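/- Let $B\subset\mathbb R^3$ be the open unit ball, $Z$ the $x_3$-axis, and $g$ a smooth Riemannian metric on $B$ that is invariant under all rotations about $Z$. Let $\mathcal R$ be an oriented, minimal foliation of $B\setminus Z$ that is rotationally invariant about $Z$, and let $\nu$ be its unit normal vector field compatible with the orientation. (Thus $B\setminus Z$ is covered by flow boxes whose plaques are smooth surfaces with vanishing $g$-mean curvature, varying continuously together with all their derivatives along the plaques; rotations about $Z$ map leaves to leaves; and $\nu$ is locally Lipschitz on $B\setminus Z$.) Let $\mathcal L'$ be the set of leaves of $\mathcal R$ that are invariant under all rotations about $Z$. Let $U\subset B$ be a regular open set, i.e. $U=\operatorname{int}(\overline U)$, let $M:=\partial U\cap B$, and suppose that $M\setminus Z$ is a union of leaves in $\mathcal L'$, at every point of which $\nu$ points out of $U$. Orient $M$ by $\nu$. By a surface we mean a two-dimensional integer multiplicity rectifiable current, and area is $g$-area counted with multiplicity. (1) $M$ has locally finite area in $B$ and is area-minimizing in $B$: if $S$ is a surface in $B$ of locally finite area such that $\partial S=\partial M$ in $B$ and $S$ coincides with $M$ outside a compact set $K\subset B$, then $\operatorname{area}(M\cap W)\le\operatorname{area}(S\cap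 W)$ for every open set $W\supset K$ with compact closure in $B$. (2) Suppose moreover that $g$ extends to a smooth Riemannian metric on $\overline B$. Then $M$ has finite area, and its area is at most that of every surface of finite area in $\overline B$ with the same oriented boundary (as currents in $\mathbb R^3$). If $M'$ is another surface of finite area in $\overline B$ with $\partial M'=\partial M$ (as currents in $\mathbb R^3$) that has least area among all surfaces of finite area in $\overline B$ with this boundary, then $M'\cap B$ is also made up of leaves of $\mathcal L'$ oriented by $\nu$: in $B$, $M'$ is the sum of a family of leaves in $\mathcal L'$, each oriented by $\nu$ and taken with a constant positive integer multiplicity, and the union of these leaves is relatively closed in $B\setminus Z$. -/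

import Mathlib

open Set Filter Topology MeasureTheory
open scoped ContDiff

noncomputable section

namespace MinimalFoliation

/-- Euclidean three-space. -/
abbrev E3 : Type := EuclideanSpace ℝ (Fin 3)

/-- The Euclidean plane. -/
abbrev E2 : Type := EuclideanSpace ℝ (Fin 2)

/-- The open unit ball. -/
def unitBall : Set E3 := Metric.ball 0 1

/-- The closed unit ball. -/
def closedUnitBall : Set E3 := Metric.closedBall 0 1

/-- The vertical coordinate axis `Z`. -/
def zAxis : Set E3 := {x | x 0 = 0 ∧ x 1 = 0}

/-- Rotation by the angle `α` about the axis `Z`. -/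
def rot (α : ℝ) (x : E3) : E3 :=
  !₂[Real.cos α * x 0 - Real.sin α * x 1, Real.sin α * x 0 + Real.cos α * x 1, x 2]

/-! ### Riemannian metrics on subsets of `ℝ³`, area density, mean curvature -/

/-- A field of bilinear forms on `ℝ³`. -/
abbrev MetricField : Type := E3 → E3 →L[ℝ] E3 →L[ℝ] ℝ

/-- `g` is a smooth Riemannian metric on the set `s`. (For the closed ball, smoothness is
smoothness up to the boundary.) -/
structure IsMetricOn (g : MetricField) (s : Set E3) : Prop where
  smooth : ContDiffOn ℝ ∞ g s
  symm : ∀ x ∈ s, ∀ v w, g x v w = g x w v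
  pos : ∀ x ∈ s, ∀ v, v ≠ 0 → 0 < g x v v

/-- All rotations about `Z` are isometries of `g` on `s`. As `rot α` is linear, it is its own
differential. -/
def IsRotInvariantMetric (g : MetricField) (s : Set E3) : Prop :=
  ∀ α : ℝ, ∀ x ∈ s, ∀ v w, g (rot α x) (rot α v) (rot α w) = g x v w

/-- The `j`-th partial derivative of a parametrized surface. -/
def partialD (F : E2 → E3) (y : E2) (j : Fin 2) : E3 :=
  fderiv ℝ F y (EuclideanSpace.single j 1)

/-- The coefficients `h i j = g(∂ᵢF, ∂ⱼF)` of the induced metric. -/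
def firstForm (g : MetricField) (F : E2 → E3) (y : E2) (i j : Fin 2) : ℝ :=
  g (F y) (partialD F y i) (partialD F y j)

/-- The area density `√(det h)` of a parametrized surface with respect to `g`. -/
def areaDensity (g : MetricField) (F : E2 → E3) (y : E2) : ℝ :=
  Real.sqrt (firstForm g F y 0 0 * firstForm g F y 1 1 - firstForm g F y 0 1 ^ 2)

/-- The coefficients `g(∇_{∂ᵢF} ∂ⱼF, N)` of the second fundamental form in the direction `N`,
where `∇` is the Levi-Civita connection of `g`; the Christoffel term is expanded by the Koszul
formula. -/
def secondForm (g : MetricField) (F : E2 → E3) (N : E3) (y : E2) (i j : Fin 2) : ℝ :=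
  g (F y) (fderiv ℝ (fderiv ℝ F) y (EuclideanSpace.single i 1) (EuclideanSpace.single j 1)) N
    + (fderiv ℝ g (F y) (partialD F y i) (partialD F y j) N
      + fderiv ℝ g (F y) (partialD F y j) (partialD F y i) N
      - fderiv ℝ g (F y) N (partialD F y i) (partialD F y j)) / 2

/-- The mean curvature of a parametrized surface with unit normal `N` at the point `F y`: the trace
of the second fundamental form with respect to the induced metric. -/
def meanCurvature (g : MetricField) (F : E2 → E3) (N : E3) (y : E2) : ℝ :=
  (firstForm g F y 1 1 * secondForm g F N y 0 0
      - 2 * firstForm g F y 0 1 * secondForm g F N y 0 1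
      + firstForm g F y 0 0 * secondForm g F N y 1 1)
    / (firstForm g F y 0 0 * firstForm g F y 1 1 - firstForm g F y 0 1 ^ 2)

/-! ### Foliations -/

/-- A two-dimensional foliation of the set `Ω ⊆ ℝ³`, given by an atlas of flow boxes
`φ : ball × (-1,1) → ℝ³`. The boxes are homeomorphisms onto open subsets of `Ω`, the plaques
`φ(ball × {t})` are smooth embedded surfaces all of whose derivatives along the plaque depend
continuously on the point of the box, and on overlaps the boxes locally have the same plaques. -/
structure Foliation (Ω : Set E3) where
  atlas : Set (OpenPartialHomeomorph (E2 × ℝ) E3)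
  source_eq : ∀ φ ∈ atlas, φ.source = Metric.ball (0 : E2) 1 ×ˢ Ioo (-1 : ℝ) 1
  cover : ⋃ φ ∈ atlas, φ.target = Ω
  smooth_plaque : ∀ φ ∈ atlas, ∀ t ∈ Ioo (-1 : ℝ) 1,
    ContDiffOn ℝ ∞ (fun x : E2 => φ (x, t)) (Metric.ball 0 1)
  continuous_derivs : ∀ φ ∈ atlas, ∀ k : ℕ,
    ContinuousOn (fun q : E2 × ℝ => iteratedFDeriv ℝ k (fun x : E2 => φ (x, q.2)) q.1) φ.source
  immersive : ∀ φ ∈ atlas, ∀ q ∈ φ.source,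
    Function.Injective (fderiv ℝ (fun x : E2 => φ (x, q.2)) q.1)
  compatible : ∀ φ ∈ atlas, ∀ ψ ∈ atlas, ∀ p ∈ φ.target ∩ ψ.target, ∃ N ∈ 𝓝 p,
    ∀ q ∈ N, ∀ q' ∈ N,
      ((φ.symm q).2 = (φ.symm q').2 ↔ (ψ.symm q).2 = (ψ.symm q').2)

namespace Foliation

variable {Ω : Set E3}

/-- Two points lie in a common plaque. -/
def SamePlaque (R : Foliation Ω) (p q : E3) : Prop :=
  ∃ φ ∈ R.atlas, p ∈ φ.target ∧ q ∈ φ.target ∧ (φ.symm p).2 = (φ.symm q).2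

/-- The leaf through `p`: all points that can be reached from `p` by a finite chain of plaques. -/
def leaf (R : Foliation Ω) (p : E3) : Set E3 :=
  {q | Relation.ReflTransGen R.SamePlaque p q}

/-- The vector field `ν` is a unit normal field of the foliation, i.e. it orients the foliation.
It is required to be locally Lipschitz. -/
structure IsUnitNormal (R : Foliation Ω) (g : MetricField) (ν : E3 → E3) : Prop where
  lipschitz : LocallyLipschitzOn Ω ν
  unit : ∀ p ∈ Ω, g p (ν p) (ν p) = 1
  normal : ∀ φ ∈ R.atlas, ∀ q ∈ φ.source, ∀ j : Fin 2,
    g (φ q) (ν (φ q)) (partialD (fun x : E2 => φ (x, q.2)) q.1 j) = 0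

/-- All leaves are minimal surfaces: their mean curvature vanishes. -/
def IsMinimal (R : Foliation Ω) (g : MetricField) (ν : E3 → E3) : Prop :=
  ∀ φ ∈ R.atlas, ∀ q ∈ φ.source,
    meanCurvature g (fun x : E2 => φ (x, q.2)) (ν (φ q)) q.1 = 0

/-- Rotations about `Z` map leaves to leaves. -/
def IsRotInvariant (R : Foliation Ω) : Prop :=
  ∀ α : ℝ, ∀ p ∈ Ω, R.leaf (rot α p) = rot α '' R.leaf p

/-- The set of leaves that are invariant under all rotations about `Z`. -/
def rotInvariantLeaves (R : Foliation Ω) : Set (Set E3) :=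
  {L | (∃ p ∈ Ω, L = R.leaf p) ∧ ∀ α : ℝ, rot α '' L = L}

end Foliation

/-- At the point `p`, the vector field `ν` points out of the open set `U`. -/
def PointsOutOf (ν : E3 → E3) (U : Set E3) (p : E3) : Prop :=
  ∀ᶠ t in 𝓝[>] (0 : ℝ), p + t • ν p ∉ closure U ∧ p - t • ν p ∈ U

/-! ### Oriented surfaces: integer multiplicity rectifiable currents -/

/-- Differential `k`-forms on `ℝ³`. -/
abbrev DForm (k : ℕ) : Type := E3 → E3 [⋀^Fin k]→L[ℝ] ℝ

/-- Smooth forms with compact support in `O`. -/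
structure IsTestForm {k : ℕ} (O : Set E3) (β : DForm k) : Prop where
  smooth : ContDiff ℝ ∞ β
  compact : HasCompactSupport β
  support : tsupport β ⊆ O

/-- A two-dimensional integer multiplicity rectifiable current in `ℝ³`: a countable family of
pairwise disjoint pieces, each the one-to-one image of a measurable subset of the plane under a
`C¹` immersion, oriented by the parametrization and carrying an integer multiplicity. (A set is
countably two-rectifiable and measurable iff, up to a set of two-dimensional Hausdorff measure zero,
it is such a union of pieces.) Local finiteness of the area is imposed separately. -/
structure RectCurrent where
  param : ℕ → E2 → E3
  dom : ℕ → Set E2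
  mult : ℕ → ℤ
  measurable_dom : ∀ i, MeasurableSet (dom i)
  contDiffAt : ∀ i, ∀ y ∈ dom i, ContDiffAt ℝ 1 (param i) y
  immersive : ∀ i, ∀ y ∈ dom i, Function.Injective (fderiv ℝ (param i) y)
  injOn : ∀ i, InjOn (param i) (dom i)
  disjoint : ∀ i j, i ≠ j → Disjoint (param i '' dom i) (param j '' dom j)

namespace RectCurrent

/-- The union of the pieces. -/
def carrier (T : RectCurrent) : Set E3 := ⋃ i, T.param i '' T.dom i

/-- The value of the current on a 2-form: the integral of the form over the oriented pieces,
counted with multiplicity. -/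
def eval (T : RectCurrent) (β : DForm 2) : ℝ :=
  ∑' i, (T.mult i : ℝ) * ∫ y in T.dom i, β (T.param i y) (partialD (T.param i) y)

/-- The `g`-area (mass), with multiplicity, of the part of the current in the set `W`. -/
def area (T : RectCurrent) (g : MetricField) (W : Set E3) : ENNReal :=
  ∑' i, ((T.mult i).natAbs : ENNReal) *
    ∫⁻ y in T.dom i ∩ T.param i ⁻¹' W, ENNReal.ofReal (areaDensity g (T.param i) y)

/-- The two currents have the same boundary in the open set `O`: `∂S = ∂T`, where
`∂T(η) = T(dη)`. -/
def SameBoundary (S T : RectCurrent) (O : Set E3) : Prop :=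
  ∀ η : DForm 1, IsTestForm O η → S.eval (extDeriv η) = T.eval (extDeriv η)

/-- The two currents coincide in the open set `O`. -/
def EqualOn (S T : RectCurrent) (O : Set E3) : Prop :=
  ∀ β : DForm 2, IsTestForm O β → S.eval β = T.eval β

/-- The current lies in the open set `O` and has locally finite area there. -/
structure IsLocallyFiniteIn (T : RectCurrent) (g : MetricField) (O : Set E3) : Prop where
  carrier_subset : T.carrier ⊆ O
  area_lt_top : ∀ K, IsCompact K → K ⊆ O → T.area g K < ⊤

/-- `T` is area-minimizing in the open set `O`: every compact portion of it has at most the area of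
any other integer multiplicity rectifiable current with the same boundary that coincides with `T`
off a compact set. -/
def IsAreaMinimizingIn (T : RectCurrent) (g : MetricField) (O : Set E3) : Prop :=
  T.IsLocallyFiniteIn g O ∧
  ∀ S : RectCurrent, S.IsLocallyFiniteIn g O →
    ∀ W K : Set E3, IsOpen W → IsCompact (closure W) → closure W ⊆ O → IsCompact K → K ⊆ W →
      S.EqualOn T (O \ K) → S.SameBoundary T O → T.area g W ≤ S.area g W

/-- `T` lies in the compact set `C`, has finite area, and has at most the area of any other integer
multiplicity rectifiable current in `C` with the same boundary, the boundary being taken in `ℝ³`. -/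
def IsAreaMinimizingInCompact (T : RectCurrent) (g : MetricField) (C : Set E3) : Prop :=
  T.carrier ⊆ C ∧ T.area g univ < ⊤ ∧
  ∀ S : RectCurrent, S.carrier ⊆ C → S.area g univ < ⊤ → S.SameBoundary T univ →
    T.area g univ ≤ S.area g univ

/-- `T` is the set `{m ≠ 0}` with multiplicity `m`, and `ν` is normal to it and compatible with the
orientation: `(ν, ∂₀F, ∂₁F)` is a positive frame for each of the parametrizations `F`. -/
structure IsOrientedBy (T : RectCurrent) (g : MetricField) (ν : E3 → E3) (m : E3 → ℕ) : Prop where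
  carrier_eq : T.carrier = {x | m x ≠ 0}
  mult_eq : ∀ i, ∀ y ∈ T.dom i, T.mult i = m (T.param i y)
  normal : ∀ i, ∀ y ∈ T.dom i, ∀ j,
    g (T.param i y) (ν (T.param i y)) (partialD (T.param i) y j) = 0
  positive : ∀ i, ∀ y ∈ T.dom i,
    0 < (EuclideanSpace.basisFun (Fin 3) ℝ).toBasis.det
      ![ν (T.param i y), partialD (T.param i) y 0, partialD (T.param i) y 1]

/-- In the open ball, `T` is made up of rotationally invariant leaves of `R`, each oriented by `ν`
and carrying a constant positive multiplicity; the union of these leaves is relatively closed off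
the axis. -/
def IsMadeOfLeaves (T : RectCurrent) (g : MetricField) (R : Foliation (unitBall \ zAxis))
    (ν : E3 → E3) : Prop :=
  ∃ (m : E3 → ℕ) (S : RectCurrent),
    (∃ 𝓢 ⊆ R.rotInvariantLeaves, {x | m x ≠ 0} = ⋃₀ 𝓢) ∧
    (∀ p q, q ∈ R.leaf p → m q = m p) ∧
    closure {x | m x ≠ 0} ∩ (unitBall \ zAxis) ⊆ {x | m x ≠ 0} ∧
    S.IsLocallyFiniteIn g unitBall ∧
    S.IsOrientedBy g ν m ∧
    T.EqualOn S unitBall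

end RectCurrent

end MinimalFoliation

end

open MinimalFoliation

open Set Filter Topology MeasureTheory
open scoped ContDiff Convolution

noncomputable section

namespace MinimalFoliation

open Metric (ball closedBall mem_ball mem_closedBall isOpen_ball ball_subset_ball ball_mem_nhds
  mem_ball_self closedBall_subset_ball eventually_nhds_iff_ball measure_ball_pos
  closedBall_mem_nhds ball_subset_closedBall sphere isClosed_closedBall)
open ENNReal (ofReal ofReal_pos ofReal_ne_top ofReal_le_ofReal ofReal_lt_top ofReal_mul ofReal_zero)

variable {g gbar : MetricField} {R : Foliation (unitBall \ zAxis)} {ν : E3 → E3} {U : Set E3}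

/-! The proof is by calibration. Contracting the volume form of `g` with the unit normal `ν` gives a
two-form whose value on a pair of vectors is at most the area they span, with equality exactly on
positively oriented planes orthogonal to `ν` (`IsInner.vol_sq`). Under the identification of
two-forms with vector fields this form is `calib`. Its exterior derivative is the divergence of
`calib`, which is the mean curvature of the leaves and hence zero wherever the Lipschitz field `ν`
is differentiable (`tr3_fderiv_calib`). The axis has codimension two, so it carries no divergence: a
cutoff at distance `1/n` has gradient of order `n` on a tube of volume of order `1/n²`
(`integral_fderiv_calib`).

Since `calib` is only Lipschitz and is undefined on the axis and on the sphere, it is replaced by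
smooth divergence free fields on a neighbourhood of the closed ball, whose values are averages of
nearby values of `calib` (`exists_mollification`). These are curls (`exists_potential`), so two
currents with the same boundary give them the same value. In the limit a calibrated current has at
most the area of its competitor. A competitor may touch the sphere, where there is no limit; there
the averaging property and the continuity of the extended metric still give the upper bound
(`toReal_area_le_integral_calibDens`). Equality forces the competitor to be calibrated as well.

The current `T` carried by `M` is assembled from plaques. Near each point of `M` off the axis, `U`
is one side of a plaque, so the divergence theorem identifies `T` with the boundary of `U` off the
axis (`BoundedByLeaves.gaussGreen`). Hence `T` has no boundary there, and the flux of `calib` bounds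
its area near the axis and, for a metric smooth up to the sphere, in the whole ball
(`BoundedByLeaves.area_bar_lt_top`).

Now let `S` be a minimizer with the boundary of `T`. It is calibrated, hence determined by its area
measure, and it has no boundary off the axis. This says that a multiple of the area measure is
transported along the plaques. Neighbouring plaques diverge at most exponentially, because `ν` is
Lipschitz; `IsTransported.integral_mono_translate` turns this into a comparison of boxes.
Consequently the multiplicity is constant along a plaque (`LeafChart.exists_theta_ae_eq`), and a
plaque through a point of positive density has positive multiplicity (`IsMultiplicity.ae_ne_zero`),
so nothing is spread over uncountably many plaques. Finite area leaves countably many plaques in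
each box, and `S` is the sum of the corresponding leaves (`IsMultiplicity.exists_equalOn`). A lower
bound for the area of nearby plaques makes their union relatively closed.

For rotational invariance, `S` and `T` are compared on exact two-forms built from functions of the
radius and the height. Such a form measures how far the rotation field is from being tangent to the
leaves. It vanishes on `T`, and it can be localized where the defect has one sign, so it vanishes on
the leaves of `S` (`IsMultiplicity.inner_ang_eq_zero`). A leaf tangent to the rotation field at a
point contains the whole circle through it (`rot_mem_leaf`). -/

/-! ### Vector algebra in three-space -/

/-- The standard basis vectors of three-space. -/
abbrev bv (i : Fin 3) : E3 := EuclideanSpace.single i 1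

/-- The determinant of three vectors. -/
def det3 (a b c : E3) : ℝ :=
  a 0 * (b 1 * c 2 - b 2 * c 1) - a 1 * (b 0 * c 2 - b 2 * c 0) + a 2 * (b 0 * c 1 - b 1 * c 0)

/-- The cross product. -/
def cross (a b : E3) : E3 :=
  !₂[a 1 * b 2 - a 2 * b 1, a 2 * b 0 - a 0 * b 2, a 0 * b 1 - a 1 * b 0]

theorem inner_cross (v a b : E3) : inner ℝ v (cross a b) = det3 v a b := by
  simp [cross, det3, PiLp.inner_apply, Fin.sum_univ_three]; ring

theorem eq_sum_bv (v : E3) : v = v 0 • bv 0 + v 1 • bv 1 + v 2 • bv 2 := by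
  ext i; fin_cases i <;> simp [bv]

theorem det3_eq_basis_det (a b c : E3) :
    (EuclideanSpace.basisFun (Fin 3) ℝ).toBasis.det ![a, b, c] = det3 a b c := by
  rw [Module.Basis.det_apply, Matrix.det_fin_three]
  simp [Module.Basis.toMatrix_apply, det3]
  ring

theorem det3_add (u v a b : E3) : det3 (u + v) a b = det3 u a b + det3 v a b := by
  simp [det3]; ring

theorem det3_smul (t : ℝ) (v a b : E3) : det3 (t • v) a b = t * det3 v a b := by
  simp [det3]; ring

theorem det3_swap (v a b : E3) : det3 v b a = -det3 v a b := by
  simp [det3]; ring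

theorem cross_eq_zero_iff {a b : E3} : cross a b = 0 ↔ ∀ v, det3 v a b = 0 := by
  constructor
  · intro h v; rw [← inner_cross, h, inner_zero_right]
  · intro h
    have := h (cross a b)
    rwa [← inner_cross, inner_self_eq_zero] at this

/-- The vector field corresponding to a two-form. -/
def vec (β : E3 [⋀^Fin 2]→L[ℝ] ℝ) : E3 :=
  !₂[β ![bv 1, bv 2], β ![bv 2, bv 0], β ![bv 0, bv 1]]

/-- In dimension three every two-form is the contraction of the determinant with a vector, by
expansion in the standard basis. From here on two-forms are handled as vector fields, and their
integrals over surfaces as fluxes. -/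
theorem alt_apply_eq (β : E3 [⋀^Fin 2]→L[ℝ] ℝ) (w : Fin 2 → E3) :
    β w = det3 (vec β) (w 0) (w 1) := by
  have hw : w = ![w 0, w 1] := by ext i : 1; fin_cases i <;> rfl
  have hs : ∀ a b, β ![a, b] = - β ![b, a] := by
    intro a b
    have := β.toAlternatingMap.map_swap ![b, a] (i := 0) (j := 1) (by decide)
    have h2 : (![b, a] ∘ Equiv.swap (0 : Fin 2) 1) = ![a, b] := by
      ext i : 1; fin_cases i <;> simp
    rw [h2] at this
    exact this
  have hz : ∀ a, β ![a, a] = 0 := fun a => by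
    have := hs a a; linarith
  have hadd : ∀ a a' b, β ![a + a', b] = β ![a, b] + β ![a', b] := fun a a' b =>
    β.toMultilinearMap.cons_add ![b] a a'
  have hsmul : ∀ (t : ℝ) a b, β ![t • a, b] = t * β ![a, b] := fun t a b =>
    β.toMultilinearMap.cons_smul ![b] t a
  have hadd' : ∀ a b b', β ![a, b + b'] = β ![a, b] + β ![a, b'] := fun a b b' => by
    rw [hs, hadd, hs b, hs b']; ring
  have hsmul' : ∀ (t : ℝ) a b, β ![a, t • b] = t * β ![a, b] := fun t a b => by
    rw [hs, hsmul, hs b]; ring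
  rw [hw]
  simp only [Matrix.cons_val_zero, Matrix.cons_val_one]
  generalize w 0 = a
  generalize w 1 = b
  conv_lhs => rw [eq_sum_bv a, eq_sum_bv b]
  simp only [hadd, hsmul, hadd', hsmul', hz, det3, vec]
  rw [hs (bv 1) (bv 0), hs (bv 2) (bv 1), hs (bv 0) (bv 2)]
  simp
  ring

/-- The trace of a linear map in coordinates. -/
def tr3 (A : E3 →L[ℝ] E3) : ℝ := A (bv 0) 0 + A (bv 1) 1 + A (bv 2) 2

theorem clm_apply_coord (A : E3 →L[ℝ] E3) (v : E3) (i : Fin 3) :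
    A v i = v 0 * A (bv 0) i + v 1 * A (bv 1) i + v 2 * A (bv 2) i := by
  conv_lhs => rw [eq_sum_bv v]
  simp only [map_add, map_smul, PiLp.add_apply, PiLp.smul_apply, smul_eq_mul]

/-- A linear map acts on volume forms as a derivation, with factor its trace. This allows the trace
to be computed in the frame formed by the normal and two tangent vectors. -/
theorem tr3_mul_det3 (A : E3 →L[ℝ] E3) (a b c : E3) :
    tr3 A * det3 a b c = det3 (A a) b c + det3 a (A b) c + det3 a b (A c) := by
  simp only [det3, tr3, clm_apply_coord A a, clm_apply_coord A b, clm_apply_coord A c]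
  ring

/-! ### Metrics -/

/-- The determinant of the coefficient matrix of a bilinear form. -/
def gdet (B : E3 →L[ℝ] E3 →L[ℝ] ℝ) : ℝ := (Matrix.of fun i j : Fin 3 => B (bv i) (bv j)).det

theorem gram_det (B : E3 →L[ℝ] E3 →L[ℝ] ℝ) (f : Fin 3 → E3) :
    (Matrix.of fun i j : Fin 3 => B (f i) (f j)).det = gdet B * det3 (f 0) (f 1) (f 2) ^ 2 := by
  have : (Matrix.of fun i j : Fin 3 => B (f i) (f j)) =
      (Matrix.of fun i k : Fin 3 => f i k) * (Matrix.of fun i j : Fin 3 => B (bv i) (bv j)) *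
        (Matrix.of fun i k : Fin 3 => f i k).transpose := by
    ext i j
    simp only [Matrix.of_apply, Matrix.mul_apply, Fin.sum_univ_three, Matrix.transpose_apply]
    conv_lhs => rw [eq_sum_bv (f i), eq_sum_bv (f j)]
    simp only [map_add, map_smul, add_apply, smul_apply,
      smul_eq_mul]
    ring
  rw [this, Matrix.det_mul, Matrix.det_mul, Matrix.det_transpose]
  have h3 : (Matrix.of fun i k : Fin 3 => f i k).det = det3 (f 0) (f 1) (f 2) := by
    rw [Matrix.det_fin_three]; simp [det3]; ring
  rw [h3, gdet]; ring

/-- A symmetric positive definite bilinear form. -/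
structure IsInner (B : E3 →L[ℝ] E3 →L[ℝ] ℝ) : Prop where
  symm : ∀ v w, B v w = B w v
  pos : ∀ v, v ≠ 0 → 0 < B v v

theorem IsMetricOn.isInner {g : MetricField} {s : Set E3} (h : IsMetricOn g s) {x : E3}
    (hx : x ∈ s) : IsInner (g x) := ⟨h.symm x hx, h.pos x hx⟩

theorem IsInner.nonneg {B : E3 →L[ℝ] E3 →L[ℝ] ℝ} (h : IsInner B) (v : E3) : 0 ≤ B v v := by
  by_cases hv : v = 0
  · simp [hv]
  · exact (h.pos v hv).le

theorem IsInner.gdet_pos {B : E3 →L[ℝ] E3 →L[ℝ] ℝ} (h : IsInner B) : 0 < gdet B := by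
  apply Matrix.PosDef.det_pos
  refine Matrix.PosDef.of_dotProduct_mulVec_pos ?_ ?_
  · ext i j; simp [h.symm (bv i) (bv j)]
  · intro x hx
    have := h.pos (x 0 • bv 0 + x 1 • bv 1 + x 2 • bv 2) (by
      intro h0; apply hx; ext i
      have := congrArg (fun v : E3 => v i) h0
      fin_cases i <;> simpa [bv] using this)
    simp only [map_add, map_smul, add_apply, smul_apply,
      smul_eq_mul] at this
    simp [dotProduct, Matrix.mulVec, Fin.sum_univ_three]
    linarith

/-- The volume density of a bilinear form. -/
def gvol (B : E3 →L[ℝ] E3 →L[ℝ] ℝ) : ℝ := √(gdet B)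

theorem IsInner.gvol_pos {B : E3 →L[ℝ] E3 →L[ℝ] ℝ} (h : IsInner B) : 0 < gvol B :=
  Real.sqrt_pos.mpr h.gdet_pos

/-- The area of the parallelogram spanned by two vectors. -/
def area2 (B : E3 →L[ℝ] E3 →L[ℝ] ℝ) (a b : E3) : ℝ := √(B a a * B b b - B a b ^ 2)

/-- The Gram determinant of `N, a, b`, expanded along the unit vector `N`. The subtracted square
measures the failure of `a` and `b` to be orthogonal to `N`, so this one identity contains both the
calibration inequality and its case of equality. -/
theorem IsInner.vol_sq {B : E3 →L[ℝ] E3 →L[ℝ] ℝ} (h : IsInner B) {N : E3} (hN : B N N = 1)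
    (a b : E3) : (gvol B * det3 N a b) ^ 2 =
      (B a a * B b b - B a b ^ 2) - B (B N a • b - B N b • a) (B N a • b - B N b • a) := by
  have := gram_det B ![N, a, b]
  rw [Matrix.det_fin_three] at this
  simp only [Matrix.of_apply, Matrix.cons_val_zero, Matrix.cons_val_one, Matrix.cons_val, hN,
    h.symm a N, h.symm b N, h.symm b a] at this
  rw [mul_pow, gvol, Real.sq_sqrt h.gdet_pos.le, ← this]
  simp only [map_sub, map_smul, sub_apply, smul_apply,
    smul_eq_mul, h.symm b a]
  ring

theorem IsInner.abs_vol_le {B : E3 →L[ℝ] E3 →L[ℝ] ℝ} (h : IsInner B) {N : E3} (hN : B N N = 1)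
    (a b : E3) : |gvol B * det3 N a b| ≤ area2 B a b := by
  apply Real.abs_le_sqrt
  rw [h.vol_sq hN]
  linarith [h.nonneg (B N a • b - B N b • a)]

theorem IsInner.vol_eq_area {B : E3 →L[ℝ] E3 →L[ℝ] ℝ} (h : IsInner B) {N : E3} (hN : B N N = 1)
    {a b : E3} (ha : B N a = 0) (hb : B N b = 0) (hp : 0 ≤ det3 N a b) :
    gvol B * det3 N a b = area2 B a b := by
  have := h.vol_sq hN a b
  rw [ha, hb] at this
  rw [zero_smul, zero_smul, sub_zero, map_zero, sub_zero] at this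
  rw [area2, ← this, Real.sqrt_sq (mul_nonneg h.gvol_pos.le hp)]

/-- A vector splits into its normal part and a part tangent to the plane `N^⊥`. -/
theorem det3_of_normal {B : E3 →L[ℝ] E3 →L[ℝ] ℝ} {N : E3} (hN : B N N = 1)
    {a b : E3} (ha : B N a = 0) (hb : B N b = 0) (v : E3) :
    det3 v a b = B N v * det3 N a b := by
  have key : det3 (v - B N v • N) a b = 0 := by
    by_contra hne
    -- Cramer's rule: if the determinant were nonzero, every `w` would be a combination of three
    -- vectors orthogonal to `N`, and `w = N` gives a contradiction.
    have hlin : ∀ w : E3, det3 (v - B N v • N) a b • w = det3 w a b • (v - B N v • N)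
        + det3 (v - B N v • N) w b • a + det3 (v - B N v • N) a w • b := by
      intro w; ext i; fin_cases i <;> simp [det3] <;> ring
    have h0 : B N (det3 (v - B N v • N) a b • N) = 0 := by
      rw [hlin]; simp [ha, hb, hN]
    rw [map_smul, hN] at h0
    simp at h0; exact hne h0
  rw [sub_eq_add_neg, ← neg_smul, det3_add, det3_smul] at key
  linarith

/-- Equality makes the square in `IsInner.vol_sq` vanish, and the independence of `a` and `b` then
kills both of its coefficients. This is how a minimizer is seen to be tangent to the leaves almost
everywhere. -/
theorem IsInner.normal_of_vol_eq {B : E3 →L[ℝ] E3 →L[ℝ] ℝ} (h : IsInner B) {N : E3}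
    (hN : B N N = 1) {a b : E3} (hab : LinearIndependent ℝ ![a, b])
    (he : |gvol B * det3 N a b| = area2 B a b) : B N a = 0 ∧ B N b = 0 := by
  have h1 := h.vol_sq hN a b
  have h2 : 0 ≤ B a a * B b b - B a b ^ 2 := by
    nlinarith [h.nonneg (B N a • b - B N b • a), sq_nonneg (gvol B * det3 N a b)]
  rw [← sq_abs, he, area2, Real.sq_sqrt h2] at h1
  have h3 : B N a • b - B N b • a = 0 := by
    by_contra hne
    linarith [h.pos _ hne]
  rw [LinearIndependent.pair_iff] at hab
  have := hab (-B N b) (B N a) (by rw [← h3]; module)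
  exact ⟨this.2, by simpa using this.1⟩

/-! ### The parameter space of a rectifiable current -/

/-- The determinant of two vectors in the plane. -/
def det2 (a b : E2) : ℝ := a 0 * b 1 - a 1 * b 0

theorem clm_det_eq (A : E2 →L[ℝ] E2) :
    A.det = det2 (A (EuclideanSpace.single 0 1)) (A (EuclideanSpace.single 1 1)) := by
  rw [ContinuousLinearMap.det, ← LinearMap.det_toMatrix (EuclideanSpace.basisFun (Fin 2) ℝ).toBasis,
    Matrix.det_fin_two]
  simp [LinearMap.toMatrix_apply, det2]
  ring

namespace RectCurrent

variable (T : RectCurrent)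

/-- The disjoint union of the parameter domains, as a measure on `ℕ × E2`. -/
def base : Measure (ℕ × E2) :=
  Measure.sum fun i => (volume.restrict (T.dom i)).map (Prod.mk i)

/-- The point with given parameters. -/
def pt (q : ℕ × E2) : E3 := (T.dom q.1).indicator (T.param q.1) q.2

/-- The first tangent vector. -/
def d0 (q : ℕ × E2) : E3 := partialD (T.param q.1) q.2 0

/-- The second tangent vector. -/
def d1 (q : ℕ × E2) : E3 := partialD (T.param q.1) q.2 1

/-- The oriented normal density, with multiplicity. -/
def nrm (q : ℕ × E2) : E3 := (T.mult q.1 : ℝ) • cross (T.d0 q) (T.d1 q)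

/-- The area density, with multiplicity. -/
def dens (g : MetricField) (q : ℕ × E2) : ℝ :=
  |(T.mult q.1 : ℝ)| * area2 (g (T.pt q)) (T.d0 q) (T.d1 q)

theorem inner_nrm (v : E3) (q : ℕ × E2) :
    inner ℝ v (T.nrm q) = T.mult q.1 * det3 v (T.d0 q) (T.d1 q) := by
  rw [nrm, inner_smul_right, inner_cross]

theorem pt_of_mem {i : ℕ} {y : E2} (h : y ∈ T.dom i) : T.pt (i, y) = T.param i y :=
  indicator_of_mem h _

theorem dens_nonneg (g : MetricField) (q : ℕ × E2) : 0 ≤ T.dens g q :=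
  mul_nonneg (abs_nonneg _) (Real.sqrt_nonneg _)

theorem continuousOn_param (i : ℕ) : ContinuousOn (T.param i) (T.dom i) := fun y hy =>
  (T.contDiffAt i y hy).continuousAt.continuousWithinAt

theorem measurable_pt : Measurable T.pt := by
  refine measurable_from_prod_countable_right fun i => ?_
  classical
  have : (fun y => T.pt (i, y)) = (T.dom i).piecewise (T.param i) 0 := by
    ext1 y; simp [pt, indicator, piecewise]
  rw [this]
  exact (T.continuousOn_param i).measurable_piecewise continuous_zero.continuousOn
    (T.measurable_dom i)

theorem measurable_d0 : Measurable T.d0 := by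
  refine measurable_from_prod_countable_right fun i => ?_
  exact (measurable_fderiv ℝ (T.param i)).apply_continuousLinearMap _

theorem measurable_d1 : Measurable T.d1 := by
  refine measurable_from_prod_countable_right fun i => ?_
  exact (measurable_fderiv ℝ (T.param i)).apply_continuousLinearMap _

theorem continuous_cross : Continuous fun p : E3 × E3 => cross p.1 p.2 := by
  unfold cross
  refine (PiLp.continuous_toLp 2 _).comp (continuous_pi fun i => ?_)
  fin_cases i <;> simp <;> fun_prop

theorem measurable_nrm : Measurable T.nrm := by
  have h : Measurable fun q : ℕ × E2 => (T.mult q.1 : ℝ) :=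
    (measurable_of_countable fun i : ℕ => (T.mult i : ℝ)).comp measurable_fst
  exact h.smul (continuous_cross.measurable.comp (T.measurable_d0.prodMk T.measurable_d1))

theorem lintegral_base (f : ℕ × E2 → ENNReal) :
    ∫⁻ q, f q ∂T.base = ∑' i, ∫⁻ y in T.dom i, f (i, y) := by
  rw [base, lintegral_sum_measure]
  congr 1; ext1 i
  exact (measurableEmbedding_prodMk_left i).lintegral_map _

theorem ae_base_iff {P : ℕ × E2 → Prop} :
    (∀ᵐ q ∂T.base, P q) ↔ ∀ i, ∀ᵐ y ∂volume.restrict (T.dom i), P (i, y) := by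
  rw [base, Measure.ae_sum_iff]
  exact forall_congr' fun i => (measurableEmbedding_prodMk_left i).ae_map_iff

theorem ae_base_mem : ∀ᵐ q ∂T.base, q.2 ∈ T.dom q.1 :=
  T.ae_base_iff.mpr fun i => ae_restrict_mem (T.measurable_dom i)

theorem ae_pt_mem_carrier : ∀ᵐ q ∂T.base, T.pt q ∈ T.carrier := by
  filter_upwards [T.ae_base_mem] with q hq
  exact mem_iUnion.mpr ⟨q.1, q.2, hq, (T.pt_of_mem hq).symm⟩

/-- All pieces are integrated over the single measure space `base`, so that limit theorems apply to
the whole current at once. Integrability over all pieces is what permits the sum and the integral to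
be exchanged. -/
theorem eval_eq {β : DForm 2}
    (h : Integrable (fun q => inner ℝ (vec (β (T.pt q))) (T.nrm q)) T.base) :
    T.eval β = ∫ q, inner ℝ (vec (β (T.pt q))) (T.nrm q) ∂T.base := by
  rw [eval]
  have key : ∀ i, (T.mult i : ℝ) * ∫ y in T.dom i, β (T.param i y) (partialD (T.param i) y) =
      ∫ q, inner ℝ (vec (β (T.pt q))) (T.nrm q) ∂(volume.restrict (T.dom i)).map (Prod.mk i) := by
    intro i
    rw [(measurableEmbedding_prodMk_left i).integral_map, ← integral_const_mul]
    refine setIntegral_congr_fun (T.measurable_dom i) fun y hy => ?_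
    simp only [inner_nrm, T.pt_of_mem hy, alt_apply_eq (β _) (partialD _ _)]
    rfl
  simp_rw [key]
  exact (hasSum_integral_measure h).tsum_eq

theorem area_eq (g : MetricField) {W : Set E3} (hW : MeasurableSet W) :
    T.area g W = ∫⁻ q in T.pt ⁻¹' W, ofReal (T.dens g q) ∂T.base := by
  rw [← lintegral_indicator (T.measurable_pt hW), lintegral_base, area]
  congr 1; ext1 i
  have h1 : T.dom i ∩ T.param i ⁻¹' W = T.dom i ∩ (fun y => T.pt (i, y)) ⁻¹' W := by
    ext y; constructor <;> rintro ⟨h, h'⟩ <;> refine ⟨h, ?_⟩ <;>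
      simpa [mem_preimage, T.pt_of_mem h] using h'
  have hm : MeasurableSet ((fun y => T.pt (i, y)) ⁻¹' W) :=
    (T.measurable_pt.comp measurable_prodMk_left) hW
  rw [h1, inter_comm, ← lintegral_const_mul' _ _ (by simp)]
  rw [← Measure.restrict_restrict hm, ← lintegral_indicator hm]
  refine setLIntegral_congr_fun (T.measurable_dom i) fun y hy => ?_
  by_cases hy' : T.pt (i, y) ∈ W
  · rw [indicator_of_mem (by exact hy'), indicator_of_mem (by exact hy')]
    simp only [dens]
    rw [ofReal_mul (abs_nonneg _), T.pt_of_mem hy]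
    have : ((T.mult i).natAbs : ENNReal) = ofReal |(T.mult i : ℝ)| := by
      rw [← ENNReal.ofReal_natCast, Nat.cast_natAbs, Int.cast_abs]
    rw [this]; rfl
  · rw [indicator_of_notMem (by exact hy'), indicator_of_notMem (by exact hy')]

theorem area_mono (g : MetricField) {W W' : Set E3} (h : W ⊆ W') : T.area g W ≤ T.area g W' := by
  unfold area
  gcongr

theorem area_univ_eq (g : MetricField) :
    T.area g univ = ∫⁻ q, ofReal (T.dens g q) ∂T.base := by
  rw [T.area_eq g MeasurableSet.univ]; simp

/-- Change of variables for the composition of a piece with a linear projection to the plane. -/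
theorem lintegral_det2_comp (L : E3 →L[ℝ] E2) {i : ℕ} {A : Set E2} (hA : MeasurableSet A)
    (hAd : A ⊆ T.dom i) (hinj : InjOn (fun y => L (T.param i y)) A) :
    ∫⁻ y in A, ofReal |det2 (L (T.d0 (i, y))) (L (T.d1 (i, y)))| =
      volume ((fun y => L (T.param i y)) '' A) := by
  rw [← lintegral_abs_det_fderiv_eq_addHaar_image volume hA
    (f' := fun y => L.comp (fderiv ℝ (T.param i) y)) ?_ hinj]
  · simp only [clm_det_eq]; rfl
  · intro y hy
    exact (L.hasFDerivAt.comp y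
      ((T.contDiffAt i y (hAd hy)).differentiableAt one_ne_zero).hasFDerivAt).hasFDerivWithinAt

theorem linearIndependent_d {i : ℕ} {y : E2} (hy : y ∈ T.dom i) :
    LinearIndependent ℝ ![T.d0 (i, y), T.d1 (i, y)] := by
  rw [LinearIndependent.pair_iff]
  intro s t h
  have h1 : fderiv ℝ (T.param i) y (s • EuclideanSpace.single 0 1 + t • EuclideanSpace.single 1 1)
      = fderiv ℝ (T.param i) y 0 := by
    rw [map_add, map_smul, map_smul, map_zero]; exact h
  have h2 := T.immersive i y hy h1
  have e0 := congrArg (fun v : E2 => v 0) h2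
  have e1 := congrArg (fun v : E2 => v 1) h2
  simp at e0 e1
  exact ⟨e0, e1⟩

theorem _root_.MinimalFoliation.cross_ne_zero {a b : E3} (h : LinearIndependent ℝ ![a, b]) :
    cross a b ≠ 0 := by
  intro h0
  rw [LinearIndependent.pair_iff] at h
  have c0 := congrArg (fun v : E3 => v 0) h0
  have c1 := congrArg (fun v : E3 => v 1) h0
  have c2 := congrArg (fun v : E3 => v 2) h0
  simp [cross] at c0 c1 c2
  have key : ∀ j : Fin 3, b j = 0 ∧ a j = 0 := by
    intro j
    have := h (b j) (-a j) (by
      ext k; fin_cases j <;> fin_cases k <;> simp <;> linarith)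
    exact ⟨this.1, by simpa using this.2⟩
  have := h 1 0 (by ext k; simp [key k])
  exact one_ne_zero this.1

/-- A rectifiable current does not charge the axis. -/
theorem ae_pt_notMem_zAxis : ∀ᵐ q ∂T.base, T.pt q ∉ zAxis := by
  rw [ae_base_iff]
  intro i
  have hZ : MeasurableSet zAxis := by
    apply IsClosed.measurableSet
    exact (isClosed_eq (by fun_prop) continuous_const).inter
      (isClosed_eq (by fun_prop) continuous_const)
  set A := T.dom i ∩ (fun y => T.pt (i, y)) ⁻¹' zAxis with hAdef
  have hA : MeasurableSet A :=
    (T.measurable_dom i).inter ((T.measurable_pt.comp measurable_prodMk_left) hZ)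
  have hmem : ∀ y ∈ A, T.param i y ∈ zAxis := fun y hy => by
    have := hy.2; rwa [mem_preimage, T.pt_of_mem hy.1] at this
  -- A projection that is injective on the axis maps the points of the piece lying on it one-to-one
  -- into a line, a null set. By change of variables its Jacobian vanishes almost everywhere on
  -- them.
  have key : ∀ L : E3 →L[ℝ] E2, (∀ x ∈ zAxis, L x 0 = x 2 ∧ L x 1 = 0) →
      ∀ᵐ y ∂volume.restrict A, det2 (L (T.d0 (i, y))) (L (T.d1 (i, y))) = 0 := by
    intro L hL
    have h1 := T.lintegral_det2_comp L hA inter_subset_left (by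
      intro y hy y' hy' h
      apply T.injOn i hy.1 hy'.1
      have m := hmem y hy
      have m' := hmem y' hy'
      have := congrArg (fun v : E2 => v 0) h
      simp only [(hL _ m).1, (hL _ m').1] at this
      ext k; fin_cases k
      · exact m.1.trans m'.1.symm
      · exact m.2.trans m'.2.symm
      · exact this)
    have h2 : volume ((fun y => L (T.param i y)) '' A) = 0 := by
      refine measure_mono_null (t := {v : E2 | v 1 = 0}) ?_ ?_
      · rintro _ ⟨y, hy, rfl⟩
        exact (hL _ (hmem y hy)).2
      · have := Measure.addHaar_submodule (volume : Measure E2)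
          (LinearMap.ker ((EuclideanSpace.proj (1 : Fin 2) : E2 →L[ℝ] ℝ) : E2 →ₗ[ℝ] ℝ)) (by
            intro h
            have : (EuclideanSpace.single 1 1 : E2) ∈
              LinearMap.ker ((EuclideanSpace.proj (1 : Fin 2) : E2 →L[ℝ] ℝ) : E2 →ₗ[ℝ] ℝ) := by
              rw [h]; trivial
            simp at this)
        convert this using 2
        ext v; simp
    rw [h2, lintegral_eq_zero_iff' ?_] at h1
    · filter_upwards [h1] with y hy
      simpa using hy
    · unfold det2
      have m0 : Measurable fun y => L (T.d0 (i, y)) :=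
        L.measurable.comp (T.measurable_d0.comp measurable_prodMk_left)
      have m1 : Measurable fun y => L (T.d1 (i, y)) :=
        L.measurable.comp (T.measurable_d1.comp measurable_prodMk_left)
      refine Measurable.aemeasurable ?_
      refine ENNReal.measurable_ofReal.comp (continuous_abs.measurable.comp ?_)
      have c : ∀ j, Measurable fun v : E2 => v j := fun j => by fun_prop
      exact (((c 0).comp m0).mul ((c 1).comp m1)).sub (((c 1).comp m0).mul ((c 0).comp m1))
  -- The minors of `(x₂, x₀)` and `(x₂, x₁)` are two components of the cross product of the tangent
  -- vectors. The third cannot be taken from `(x₀, x₁)`, which collapses the axis to a point, so it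
  -- is extracted from `(x₀ + x₂, x₁)`.
  let P (a b : E3 →L[ℝ] ℝ) : E3 →L[ℝ] E2 :=
    (PiLp.continuousLinearEquiv 2 ℝ (fun _ : Fin 2 => ℝ)).symm.toContinuousLinearMap.comp
      (ContinuousLinearMap.pi ![a, b])
  let x (j : Fin 3) : E3 →L[ℝ] ℝ := EuclideanSpace.proj j
  have k1 := key (P (x 2) (x 0)) (fun z hz => ⟨by simp [P, x], by simpa [P, x] using hz.1⟩)
  have k2 := key (P (x 2) (x 1)) (fun z hz => ⟨by simp [P, x], by simpa [P, x] using hz.2⟩)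
  have k3 := key (P (x 0 + x 2) (x 1))
    (fun z hz => ⟨by simpa [P, x] using hz.1, by simpa [P, x] using hz.2⟩)
  have hnull : ∀ᵐ y ∂volume.restrict A, False := by
    filter_upwards [k1, k2, k3, ae_restrict_mem hA] with y h1 h2 h3 hy
    apply cross_ne_zero (T.linearIndependent_d hy.1)
    simp [P, x, det2] at h1 h2 h3
    ext j; fin_cases j <;> simp [cross] <;> linarith
  rw [ae_restrict_iff' (T.measurable_dom i)]
  rw [ae_restrict_iff' hA] at hnull
  filter_upwards [hnull] with y hy hd hz
  exact hy ⟨hd, hz⟩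

end RectCurrent

/-! ### The calibrating vector field -/

theorem isOpen_unitBall : IsOpen unitBall := isOpen_ball

theorem isClosed_zAxis : IsClosed zAxis :=
  (isClosed_eq (by fun_prop) continuous_const).inter (isClosed_eq (by fun_prop) continuous_const)

theorem isOpen_offAxis : IsOpen (unitBall \ zAxis) := isOpen_unitBall.sdiff isClosed_zAxis

theorem gdet_eq (B : E3 →L[ℝ] E3 →L[ℝ] ℝ) : gdet B =
    B (bv 0) (bv 0) * B (bv 1) (bv 1) * B (bv 2) (bv 2)
      - B (bv 0) (bv 0) * B (bv 1) (bv 2) * B (bv 2) (bv 1)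
      - B (bv 0) (bv 1) * B (bv 1) (bv 0) * B (bv 2) (bv 2)
      + B (bv 0) (bv 1) * B (bv 1) (bv 2) * B (bv 2) (bv 0)
      + B (bv 0) (bv 2) * B (bv 1) (bv 0) * B (bv 2) (bv 1)
      - B (bv 0) (bv 2) * B (bv 1) (bv 1) * B (bv 2) (bv 0) := by
  rw [gdet, Matrix.det_fin_three]; rfl

theorem contDiff_gdet : ContDiff ℝ ∞ gdet := by
  have : gdet = fun B => _ := funext gdet_eq
  rw [this]
  have h : ∀ i j, ContDiff ℝ ∞ fun B : E3 →L[ℝ] E3 →L[ℝ] ℝ => B (bv i) (bv j) := fun i j =>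
    (contDiff_id.clm_apply contDiff_const).clm_apply contDiff_const
  fun_prop

/-- The vector field dual to the calibrating two-form. -/
def calib (g : MetricField) (ν : E3 → E3) (x : E3) : E3 := gvol (g x) • ν x

theorem hasDerivAt_det_fin_three {e : Fin 3 → Fin 3 → ℝ → ℝ} {k : Fin 3 → Fin 3 → ℝ} {t : ℝ}
    (h : ∀ i j, HasDerivAt (e i j) (k i j) t) :
    HasDerivAt (fun s => (Matrix.of fun i j => e i j s).det)
      (k 0 0 * (e 1 1 t * e 2 2 t - e 1 2 t * e 2 1 t)
        - k 0 1 * (e 1 0 t * e 2 2 t - e 1 2 t * e 2 0 t)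
        + k 0 2 * (e 1 0 t * e 2 1 t - e 1 1 t * e 2 0 t)
        + (k 1 0 * (e 0 2 t * e 2 1 t - e 0 1 t * e 2 2 t)
        + k 1 1 * (e 0 0 t * e 2 2 t - e 0 2 t * e 2 0 t)
        + k 1 2 * (e 0 1 t * e 2 0 t - e 0 0 t * e 2 1 t))
        + (k 2 0 * (e 0 1 t * e 1 2 t - e 0 2 t * e 1 1 t)
        + k 2 1 * (e 0 2 t * e 1 0 t - e 0 0 t * e 1 2 t)
        + k 2 2 * (e 0 0 t * e 1 1 t - e 0 1 t * e 1 0 t))) t := by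
  simp only [Matrix.det_fin_three, Matrix.of_apply]
  have := ((((((((h 0 0).mul (h 1 1)).mul (h 2 2)).sub (((h 0 0).mul (h 1 2)).mul (h 2 1))).sub
    (((h 0 1).mul (h 1 0)).mul (h 2 2))).add (((h 0 1).mul (h 1 2)).mul (h 2 0))).add
    (((h 0 2).mul (h 1 0)).mul (h 2 1))).sub (((h 0 2).mul (h 1 1)).mul (h 2 0)))
  refine this.congr_deriv ?_
  simp only [Pi.mul_apply]
  ring

theorem Foliation.contDiffAt_plaque {Ω : Set E3} (R : Foliation Ω)
    {φ : OpenPartialHomeomorph (E2 × ℝ) E3} (hφ : φ ∈ R.atlas) {q : E2 × ℝ} (hq : q ∈ φ.source) :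
    ContDiffAt ℝ ∞ (fun x : E2 => φ (x, q.2)) q.1 := by
  rw [R.source_eq φ hφ] at hq
  exact (R.smooth_plaque φ hφ q.2 hq.2).contDiffAt (isOpen_ball.mem_nhds hq.1)

theorem Foliation.eventually_mem_source {Ω : Set E3} (R : Foliation Ω)
    {φ : OpenPartialHomeomorph (E2 × ℝ) E3} (hφ : φ ∈ R.atlas) {q : E2 × ℝ} (hq : q ∈ φ.source) :
    ∀ᶠ y in 𝓝 q.1, (y, q.2) ∈ φ.source := by
  rw [R.source_eq φ hφ] at hq ⊢
  filter_upwards [isOpen_ball.mem_nhds hq.1] with y hy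
  exact ⟨hy, hq.2⟩

theorem Foliation.map_mem {Ω : Set E3} (R : Foliation Ω)
    {φ : OpenPartialHomeomorph (E2 × ℝ) E3} (hφ : φ ∈ R.atlas) {q : E2 × ℝ} (hq : q ∈ φ.source) :
    φ q ∈ Ω := by
  rw [← R.cover]; exact mem_biUnion hφ (φ.map_source hq)

theorem Foliation.target_subset {Ω : Set E3} (R : Foliation Ω)
    {φ : OpenPartialHomeomorph (E2 × ℝ) E3} (hφ : φ ∈ R.atlas) : φ.target ⊆ Ω := by
  rw [← R.cover]; exact subset_biUnion_of_mem (u := fun φ => φ.target) hφ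

theorem Foliation.exists_box {Ω : Set E3} (R : Foliation Ω) {p : E3} (hp : p ∈ Ω) :
    ∃ φ ∈ R.atlas, p ∈ φ.target := by
  rw [← R.cover] at hp
  simpa using hp

theorem gram_normal {B : E3 →L[ℝ] E3 →L[ℝ] ℝ} (h : IsInner B) {N a b : E3}
    (hN : B N N = 1) (ha : B N a = 0) (hb : B N b = 0) :
    B a a * B b b - B a b ^ 2 = gdet B * det3 N a b ^ 2 := by
  have := h.vol_sq hN a b
  rw [ha, hb, mul_pow, gvol, Real.sq_sqrt h.gdet_pos.le] at this
  simpa using this.symm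

/-- The linear map here is the derivative of `v ν` when `v` is the square root of a function with
derivative `D`; the lemma is the product rule for the divergence of `calib`. -/
theorem tr3_add_smulRight (A : E3 →L[ℝ] E3) (D : E3 →L[ℝ] ℝ) (N : E3) {v : ℝ} (hv : v ≠ 0) :
    tr3 (v • A + ((1 / (2 * v)) • D).smulRight N) = (1 / (2 * v)) * (D N + 2 * v ^ 2 * tr3 A) := by
  have hD : D N = N 0 * D (bv 0) + N 1 * D (bv 1) + N 2 * D (bv 2) := by
    conv_lhs => rw [eq_sum_bv N]
    simp only [map_add, map_smul, smul_eq_mul]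
  rw [hD]
  simp only [tr3, add_apply, smul_apply, ContinuousLinearMap.smulRight_apply, PiLp.add_apply,
    PiLp.smul_apply, smul_eq_mul]
  field_simp
  ring

/-- The trace is evaluated in the frame `N, a, b`, with `N` a unit vector orthogonal to the other
two, after clearing the denominator of the inverse of the Gram matrix of `a, b`. For the derivative
of `ν` the last bracket is, up to terms in the derivative of the metric, the numerator of the mean
curvature. -/
theorem trace_identity {B : E3 →L[ℝ] E3 →L[ℝ] ℝ} (h : IsInner B) {N a b : E3}
    (hN : B N N = 1) (ha : B N a = 0) (hb : B N b = 0) (hd : det3 N a b ≠ 0)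
    (A : E3 →L[ℝ] E3) :
    (B a a * B b b - B a b ^ 2) * tr3 A = (B a a * B b b - B a b ^ 2) * B (A N) N +
      (B b b * B (A a) a - B a b * (B (A a) b + B (A b) a) + B a a * B (A b) b) := by
  have hlin : ∀ v : E3, det3 N a b • v = det3 v a b • N + det3 N v b • a + det3 N a v • b := by
    intro v; ext i; fin_cases i <;> simp [det3] <;> ring
  have e : ∀ v w, det3 N a b * B v w =
      det3 v a b * B N w + det3 N v b * B a w + det3 N a v * B b w := by
    intro v w
    have := congrArg (fun u => B u w) (hlin v)
    simpa using this
  have t := tr3_mul_det3 A N a b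
  have e1 := e (A N) N
  have e2 := e (A a) a
  have e3 := e (A a) b
  have e4 := e (A b) a
  have e5 := e (A b) b
  rw [h.symm a N, h.symm b N] at e1
  rw [h.symm b a] at e2 e4
  simp only [hN, ha, hb] at e1 e2 e3 e4 e5
  apply mul_left_cancel₀ hd
  linear_combination (B a a * B b b - B a b ^ 2) * t - (B a a * B b b - B a b ^ 2) * e1
    - B b b * e2 + B a b * e3 + B a b * e4 - B a a * e5

theorem det3_normal_ne_zero {B : E3 →L[ℝ] E3 →L[ℝ] ℝ} {N a b : E3}
    (hN : B N N = 1) (ha : B N a = 0) (hb : B N b = 0) (hab : LinearIndependent ℝ ![a, b]) :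
    det3 N a b ≠ 0 := by
  intro h0
  apply cross_ne_zero hab
  rw [cross_eq_zero_iff]
  intro v
  rw [det3_of_normal hN ha hb, h0, mul_zero]

theorem linearIndependent_of_injective {A : E2 →L[ℝ] E3} (hA : Function.Injective A) :
    LinearIndependent ℝ ![A (EuclideanSpace.single 0 1), A (EuclideanSpace.single 1 1)] := by
  rw [LinearIndependent.pair_iff]
  intro s t h
  have h1 : A (s • EuclideanSpace.single 0 1 + t • EuclideanSpace.single 1 1) = A 0 := by
    rw [map_add, map_smul, map_smul, map_zero]; exact h
  have h2 := hA h1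
  have e0 := congrArg (fun v : E2 => v 0) h2
  have e1 := congrArg (fun v : E2 => v 1) h2
  simp at e0 e1
  exact ⟨e0, e1⟩

theorem plaque_frame (hν : R.IsUnitNormal g ν)
    {φ : OpenPartialHomeomorph (E2 × ℝ) E3} (hφ : φ ∈ R.atlas) {q : E2 × ℝ} (hq : q ∈ φ.source) :
    det3 (ν (φ q)) (partialD (fun x => φ (x, q.2)) q.1 0)
      (partialD (fun x => φ (x, q.2)) q.1 1) ≠ 0 :=
  det3_normal_ne_zero (hν.unit _ (R.map_mem hφ hq)) (hν.normal φ hφ q hq 0)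
    (hν.normal φ hφ q hq 1) (linearIndependent_of_injective (R.immersive φ hφ q hq))

theorem differentiableAt_metric (hg : IsMetricOn g unitBall) {p : E3} (hp : p ∈ unitBall) :
    DifferentiableAt ℝ g p :=
  (hg.smooth.contDiffAt (isOpen_unitBall.mem_nhds hp)).differentiableAt (by simp)

set_option maxHeartbeats 800000 in
/-- The calibrating vector field is divergence free wherever it is differentiable. -/
theorem tr3_fderiv_calib (hg : IsMetricOn g unitBall) (hν : R.IsUnitNormal g ν)
    (hmin : R.IsMinimal g ν) {p : E3} (hp : p ∈ unitBall \ zAxis) (hd : DifferentiableAt ℝ ν p) :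
    tr3 (fderiv ℝ (calib g ν) p) = 0 := by
  obtain ⟨φ, hφ, hpφ⟩ := R.exists_box hp
  obtain ⟨q, hq, rfl⟩ : ∃ q ∈ φ.source, φ q = p :=
    ⟨φ.symm p, φ.map_target hpφ, φ.right_inv hpφ⟩
  set p := φ q with hpq
  set F : E2 → E3 := fun x => φ (x, q.2) with hF
  set y := q.1 with hy
  have hFy : F y = p := rfl
  have hFs : ContDiffAt ℝ ∞ F y := R.contDiffAt_plaque hφ hq
  have hFd : HasFDerivAt F (fderiv ℝ F y) y := (hFs.differentiableAt (by simp)).hasFDerivAt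
  have hF2 : HasFDerivAt (fderiv ℝ F) (fderiv ℝ (fderiv ℝ F) y) y :=
    ((hFs.fderiv_right (m := 1) (by norm_cast)).differentiableAt (by simp)).hasFDerivAt
  have hgd : HasFDerivAt g (fderiv ℝ g p) p := (differentiableAt_metric hg hp.1).hasFDerivAt
  have hI : IsInner (g p) := hg.isInner hp.1
  set N := ν p with hN
  set A := fderiv ℝ ν p with hA
  set a := partialD F y 0 with ha
  set b := partialD F y 1 with hb
  have hNN : g p N N = 1 := hν.unit p hp
  have hn : ∀ j, g p N (partialD F y j) = 0 := hν.normal φ hφ q hq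
  have hli : LinearIndependent ℝ ![a, b] :=
    linearIndependent_of_injective (R.immersive φ hφ q hq)
  have hdet : det3 N a b ≠ 0 := plaque_frame hν hφ hq
  set H := g p a a * g p b b - g p a b ^ 2 with hH
  have hHne : H = gdet (g p) * det3 N a b ^ 2 := gram_normal hI hNN (hn 0) (hn 1)
  have hH0 : H ≠ 0 := by rw [hHne]; exact mul_ne_zero hI.gdet_pos.ne' (pow_ne_zero 2 hdet)
  -- differentiate `g(ν, ∂ⱼF) = 0` along the plaque
  have E1 : ∀ i j, fderiv ℝ g p (partialD F y i) N (partialD F y j)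
      + g p (A (partialD F y i)) (partialD F y j)
      + g p N (fderiv ℝ (fderiv ℝ F) y (EuclideanSpace.single i 1) (EuclideanSpace.single j 1))
        = 0 := by
    intro i j
    have h1 : HasFDerivAt (fun z => g (F z) (ν (F z)) (fderiv ℝ F z (EuclideanSpace.single j 1)))
        _ y := ((hgd.comp y hFd).clm_apply (hd.hasFDerivAt.comp y hFd)).clm_apply
          (hF2.clm_apply (hasFDerivAt_const _ _))
    have h2 : (fun z => g (F z) (ν (F z)) (fderiv ℝ F z (EuclideanSpace.single j 1)))
        =ᶠ[𝓝 y] fun _ => 0 := by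
      filter_upwards [R.eventually_mem_source hφ hq] with z hz
      exact hν.normal φ hφ (z, q.2) hz j
    have h3 := h1.unique ((hasFDerivAt_const (0 : ℝ) y).congr_of_eventuallyEq h2)
    have h4 := congrArg (fun L : E2 →L[ℝ] ℝ => L (EuclideanSpace.single i 1)) h3
    simp at h4
    simp only [partialD]
    linarith
  have hsymm2 : fderiv ℝ (fderiv ℝ F) y (EuclideanSpace.single 0 1) (EuclideanSpace.single 1 1)
      = fderiv ℝ (fderiv ℝ F) y (EuclideanSpace.single 1 1) (EuclideanSpace.single 0 1) :=
    (hFs.isSymmSndFDerivAt (by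
      rw [minSmoothness_of_isRCLikeNormedField]; exact WithTop.coe_le_coe.mpr le_top)) _ _
  have hball : ∀ᶠ x in 𝓝 p, x ∈ unitBall := isOpen_unitBall.mem_nhds hp.1
  have hoff : ∀ᶠ x in 𝓝 p, x ∈ unitBall \ zAxis := isOpen_offAxis.mem_nhds hp
  have E2' : fderiv ℝ g p N N N + 2 * g p (A N) N = 0 := by
    have h1 : HasFDerivAt (fun x => g x (ν x) (ν x)) _ p :=
      (hgd.clm_apply hd.hasFDerivAt).clm_apply hd.hasFDerivAt
    have h2 : (fun x => g x (ν x) (ν x)) =ᶠ[𝓝 p] fun _ => 1 := by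
      filter_upwards [hoff] with x hx
      exact hν.unit x hx
    have h3 := h1.unique ((hasFDerivAt_const (1 : ℝ) p).congr_of_eventuallyEq h2)
    have h4 := congrArg (fun L : E3 →L[ℝ] ℝ => L N) h3
    simp at h4
    rw [hI.symm N] at h4
    linarith
  have Gs : ∀ u v w, fderiv ℝ g p u v w = fderiv ℝ g p u w v := by
    intro u v w
    have h1 : HasFDerivAt (fun x => g x v w) _ p :=
      (hgd.clm_apply (hasFDerivAt_const v p)).clm_apply (hasFDerivAt_const w p)
    have h2 : HasFDerivAt (fun x => g x w v) _ p :=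
      (hgd.clm_apply (hasFDerivAt_const w p)).clm_apply (hasFDerivAt_const v p)
    have h3 : (fun x => g x v w) =ᶠ[𝓝 p] fun x => g x w v := by
      filter_upwards [hball] with x hx
      exact hg.symm x hx v w
    have h4 := congrArg (fun L : E3 →L[ℝ] ℝ => L u) (h1.unique (h2.congr_of_eventuallyEq h3))
    simpa using h4
  -- the mean curvature equation
  have hm := hmin φ hφ q hq
  have hff : ∀ i j, firstForm g F y i j = g p (partialD F y i) (partialD F y j) := fun i j => rfl
  change meanCurvature g F N y = 0 at hm
  rw [meanCurvature, div_eq_zero_iff] at hm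
  replace hm := hm.resolve_right (by simpa [hff] using hH0)
  simp only [hff, secondForm, hFy] at hm
  simp only [hI.symm _ N] at hm
  have e00 := E1 0 0
  have e01 := E1 0 1
  have e10 := E1 1 0
  have e11 := E1 1 1
  rw [← hsymm2] at e10
  simp only [← ha, ← hb] at hm e00 e01 e10 e11
  rw [Gs a a N, Gs a b N, Gs b a N, Gs b b N] at hm
  have hmean : g p b b * g p (A a) a - g p a b * (g p (A a) b + g p (A b) a) + g p a a * g p (A b) b
      = - (g p b b * fderiv ℝ g p N a a - 2 * g p a b * fderiv ℝ g p N a b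
        + g p a a * fderiv ℝ g p N b b) / 2 := by
    linear_combination -hm + g p b b * e00 - g p a b * e01 - g p a b * e10 + g p a a * e11
  -- the derivative of the volume density
  have hgl : HasDerivAt (fun t : ℝ => g (p + t • N)) (fderiv ℝ g p N) 0 :=
    show HasLineDerivAt ℝ g (fderiv ℝ g p N) p N from hgd.hasLineDerivAt N
  -- The derivative of the volume density in the direction `N` is found from the Gram determinant of
  -- the fixed frame `N, a, b` along the line `p + t N`; `gram_det` turns that determinant into
  -- `gdet` times a constant.
  have hq3 := hasDerivAt_det_fin_three (t := 0)
    (e := fun i j t => g (p + t • N) (![N, a, b] i) (![N, a, b] j))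
    (k := fun i j => fderiv ℝ g p N (![N, a, b] i) (![N, a, b] j)) (fun i j => by
      simpa using (hgl.clm_apply (hasDerivAt_const 0 (![N, a, b] i))).clm_apply
        (hasDerivAt_const 0 (![N, a, b] j)))
  simp only [gram_det, Matrix.cons_val_zero, Matrix.cons_val_one, Matrix.cons_val, zero_smul,
    add_zero, hNN, hI.symm a N, hI.symm b N, hI.symm b a] at hq3
  have hna := hn 0
  have hnb := hn 1
  rw [← ha] at hna
  rw [← hb] at hnb
  rw [hna, hnb, Gs N b a] at hq3
  have hgs : HasFDerivAt (fun x => gdet (g x)) (fderiv ℝ (fun x => gdet (g x)) p) p := by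
    have : DifferentiableAt ℝ (fun x => gdet (g x)) p :=
      (contDiff_gdet.differentiable (by simp)).differentiableAt.comp p hgd.differentiableAt
    exact this.hasFDerivAt
  set D := fderiv ℝ (fun x => gdet (g x)) p with hD
  have hgl2 : HasDerivAt (fun t : ℝ => gdet (g (p + t • N))) (D N) 0 := hgs.hasLineDerivAt N
  have hDN := (hgl2.mul_const (det3 N a b ^ 2)).unique hq3
  -- the divergence
  have hsq : HasFDerivAt (fun x => gvol (g x)) ((1 / (2 * gvol (g p))) • D) p :=
    hgs.sqrt hI.gdet_pos.ne'
  have hX : HasFDerivAt (calib g ν) _ p := hsq.smul hd.hasFDerivAt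
  rw [hX.fderiv]
  have hv := hI.gvol_pos
  have hv2 : gvol (g p) ^ 2 = gdet (g p) := Real.sq_sqrt hI.gdet_pos.le
  -- The normal derivative of the volume density has two parts: the derivative of `g(N, N)`, which
  -- cancels the normal part of the trace because `ν` has unit length, and a tangential part, which
  -- cancels the tangential trace because the leaf is minimal.
  have htr : D N + 2 * gdet (g p) * tr3 A = 0 := by
    have ht := trace_identity hI hNN hna hnb hdet A
    have hd2 : det3 N a b ^ 2 ≠ 0 := pow_ne_zero 2 hdet
    apply mul_right_cancel₀ hd2
    have hH' : g p a a * g p b b - g p a b ^ 2 = gdet (g p) * det3 N a b ^ 2 := hHne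
    linear_combination hDN + 2 * ht + 2 * hmean
      + (g p a a * g p b b - g p a b ^ 2) * E2' - 2 * tr3 A * hH'
  refine (tr3_add_smulRight A D N hv.ne').trans ?_
  rw [hv2, htr, mul_zero]

/-! ### Analytic preliminaries -/

theorem exists_cutoff {E : Type*} [NormedAddCommGroup E] [NormedSpace ℝ E] [FiniteDimensional ℝ E]
    {K U : Set E} (hK : IsCompact K) (hU : IsOpen U) (hKU : K ⊆ U) :
    ∃ χ : E → ℝ, ContDiff ℝ ∞ χ ∧ HasCompactSupport χ ∧ tsupport χ ⊆ U ∧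
      (∀ᶠ x in 𝓝ˢ K, χ x = 1) ∧ ∀ x, χ x ∈ Icc (0 : ℝ) 1 := by
  obtain ⟨K', hK', hKK', hK'U⟩ := exists_compact_between hK hU hKU
  obtain ⟨f, h1, h0, hf⟩ := exists_contMDiffMap_one_nhds_of_subset_interior (n := ⊤)
    (modelWithCornersSelf ℝ E) hK.isClosed hKK'
  have hs : tsupport f ⊆ K' := closure_minimal (fun x hx => by
    by_contra h; exact hx (h0 x h)) hK'.isClosed
  exact ⟨f, f.contMDiff.contDiff, HasCompactSupport.of_support_subset_isCompact hK'
    (subset_closure.trans hs), hs.trans hK'U, h1, hf⟩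

theorem LocallyLipschitzOn.clm_apply₂ {E V₁ V₂ V₃ : Type*} [PseudoMetricSpace E]
    [NormedAddCommGroup V₁] [NormedSpace ℝ V₁] [NormedAddCommGroup V₂] [NormedSpace ℝ V₂]
    [NormedAddCommGroup V₃] [NormedSpace ℝ V₃] (B : V₁ →L[ℝ] V₂ →L[ℝ] V₃) {s : Set E}
    {f : E → V₁} {h : E → V₂} (hf : LocallyLipschitzOn s f) (hh : LocallyLipschitzOn s h) :
    LocallyLipschitzOn s (fun x => B (f x) (h x)) := by
  intro x hx
  obtain ⟨K₁, t₁, ht₁, h₁⟩ := hf hx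
  obtain ⟨K₂, t₂, ht₂, h₂⟩ := hh hx
  have b₁ : ∀ᶠ y in 𝓝[s] x, ‖f y‖ < ‖f x‖ + 1 :=
    (hf.continuousOn x hx).norm.eventually_lt_const (lt_add_one _)
  have b₂ : ∀ᶠ y in 𝓝[s] x, ‖h y‖ < ‖h x‖ + 1 :=
    (hh.continuousOn x hx).norm.eventually_lt_const (lt_add_one _)
  refine ⟨Real.toNNReal (‖B‖ * (K₁ * (‖h x‖ + 1) + (‖f x‖ + 1) * K₂)), _,
    inter_mem (inter_mem ht₁ ht₂) (b₁.and b₂), LipschitzOnWith.of_dist_le_mul ?_⟩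
  rintro y ⟨⟨hy₁, hy₂⟩, hy₃, hy₄⟩ z ⟨⟨hz₁, hz₂⟩, hz₃, hz₄⟩
  rw [Real.coe_toNNReal _ (by positivity), dist_eq_norm]
  have e : B (f y) (h y) - B (f z) (h z) = B (f y - f z) (h y) + B (f z) (h y - h z) := by
    simp
  rw [e]
  have d₁ := h₁.dist_le_mul y hy₁ z hz₁
  have d₂ := h₂.dist_le_mul y hy₂ z hz₂
  rw [dist_eq_norm] at d₁ d₂
  calc ‖B (f y - f z) (h y) + B (f z) (h y - h z)‖
      ≤ ‖B‖ * ‖f y - f z‖ * ‖h y‖ + ‖B‖ * ‖f z‖ * ‖h y - h z‖ :=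
        (norm_add_le _ _).trans (add_le_add (B.le_opNorm₂ _ _) (B.le_opNorm₂ _ _))
    _ ≤ ‖B‖ * (K₁ * dist y z) * (‖h x‖ + 1) + ‖B‖ * (‖f x‖ + 1) * (K₂ * dist y z) := by
        gcongr
    _ = _ := by ring

theorem IsMetricOn.continuousOn {g : MetricField} {s : Set E3} (h : IsMetricOn g s) :
    ContinuousOn g s := h.smooth.continuousOn

/-- On compact sets a metric is bounded below. -/
theorem IsMetricOn.exists_lower {g : MetricField} {s K : Set E3} (h : IsMetricOn g s)
    (hK : IsCompact K) (hKs : K ⊆ s) : ∃ c > 0, ∀ x ∈ K, ∀ v, c * ‖v‖ ^ 2 ≤ g x v v := by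
  rcases K.eq_empty_or_nonempty with rfl | hne
  · exact ⟨1, one_pos, by simp⟩
  have hcomp : IsCompact (K ×ˢ sphere (0 : E3) 1) := hK.prod (isCompact_sphere 0 1)
  have hc : ContinuousOn (fun p : E3 × E3 => g p.1 p.2 p.2) (K ×ˢ sphere (0 : E3) 1) := by
    have h1 : ContinuousOn (fun p : E3 × E3 => g p.1) (K ×ˢ sphere (0 : E3) 1) :=
      h.continuousOn.comp continuousOn_fst fun p hp => hKs hp.1
    exact (h1.clm_apply continuousOn_snd).clm_apply continuousOn_snd
  obtain ⟨p, hp, hmin⟩ := hcomp.exists_isMinOn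
    (hne.prod (NormedSpace.sphere_nonempty.mpr zero_le_one)) hc
  have hp0 : p.2 ≠ 0 := by
    have : ‖p.2‖ = 1 := by simpa using hp.2
    intro h0; simp [h0] at this
  refine ⟨g p.1 p.2 p.2, h.pos _ (hKs hp.1) _ hp0, fun x hx v => ?_⟩
  by_cases hv : v = 0
  · simp [hv]
  have hv' : ‖v‖ ≠ 0 := norm_ne_zero_iff.mpr hv
  have := hmin (show (x, ‖v‖⁻¹ • v) ∈ K ×ˢ sphere (0 : E3) 1 from
    ⟨hx, by simp [norm_smul, hv']⟩)
  simp only [mem_ofPred_eq, map_smul, smul_apply, smul_eq_mul] at this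
  calc g p.1 p.2 p.2 * ‖v‖ ^ 2 ≤ (‖v‖⁻¹ * (‖v‖⁻¹ * g x v v)) * ‖v‖ ^ 2 := by gcongr
    _ = g x v v := by field_simp

theorem continuous_gvol : Continuous gvol := Real.continuous_sqrt.comp contDiff_gdet.continuous

/-- The calibrating vector field, extended by zero. -/
def calib₀ (g : MetricField) (ν : E3 → E3) : E3 → E3 := (unitBall \ zAxis).indicator (calib g ν)

/-- The calibrating field is bounded by a constant depending only on bounds for the metric. -/
theorem exists_norm_calib_le {g gb : MetricField} {ν : E3 → E3} {s K : Set E3}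
    (h : IsMetricOn gb s) (he : EqOn gb g unitBall) (hK : IsCompact K) (hKs : K ⊆ s)
    (hu : ∀ p ∈ unitBall \ zAxis, g p (ν p) (ν p) = 1) :
    ∃ C, 0 ≤ C ∧ ∀ x ∈ K, ‖calib₀ g ν x‖ ≤ C := by
  obtain ⟨c, hc, hlow⟩ := h.exists_lower hK hKs
  obtain ⟨C, hC⟩ := (hK.image_of_continuousOn
    (continuous_gvol.comp_continuousOn (h.continuousOn.mono hKs))).isBounded.exists_norm_le
  have hCn : 0 ≤ max C 0 * √(1 / c) := by positivity
  refine ⟨max C 0 * √(1 / c), hCn, fun x hx => ?_⟩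
  by_cases hxO : x ∈ unitBall \ zAxis
  · rw [calib₀, indicator_of_mem hxO, calib, norm_smul]
    have h1 : ‖gvol (g x)‖ ≤ max C 0 := by
      rw [← he hxO.1]; exact (hC _ ⟨x, hx, rfl⟩).trans (le_max_left _ _)
    have h2 : ‖ν x‖ ≤ √(1 / c) := by
      apply Real.le_sqrt_of_sq_le
      have := hlow x hx (ν x)
      rw [he hxO.1, hu x hxO] at this
      rw [le_div_iff₀ hc]; linarith
    exact mul_le_mul h1 h2 (norm_nonneg _) (le_max_right _ _)
  · rw [calib₀, indicator_of_notMem hxO, norm_zero]; exact hCn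

theorem locallyLipschitzOn_calib (hg : IsMetricOn g unitBall)
    (hν : LocallyLipschitzOn (unitBall \ zAxis) ν) :
    LocallyLipschitzOn (unitBall \ zAxis) (calib g ν) := by
  have h1 : ContDiffOn ℝ 1 (fun x => gvol (g x)) unitBall := by
    have h2 : ContDiffOn ℝ 1 (fun x => gdet (g x)) unitBall :=
      (contDiff_gdet.comp_contDiffOn hg.smooth).of_le (by norm_cast)
    exact h2.sqrt fun x hx => (hg.isInner hx).gdet_pos.ne'
  have h2 := (h1.locallyLipschitzOn (convex_ball _ _)).mono (sdiff_subset (t := zAxis))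
  exact LocallyLipschitzOn.clm_apply₂ (ContinuousLinearMap.lsmul ℝ ℝ) h2 hν

theorem measurable_calib₀ (hg : IsMetricOn g unitBall)
    (hν : LocallyLipschitzOn (unitBall \ zAxis) ν) : Measurable (calib₀ g ν) := by
  classical
  have h := (locallyLipschitzOn_calib hg hν).continuousOn.measurable_piecewise
    (continuous_zero : Continuous (0 : E3 → E3)).continuousOn isOpen_offAxis.measurableSet
  convert h using 1
  ext1 x
  simp [calib₀, indicator, piecewise]

theorem volume_zAxis : volume zAxis = 0 := by
  have := Measure.addHaar_submodule (volume : Measure E3)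
    (LinearMap.ker ((EuclideanSpace.proj (0 : Fin 3) : E3 →L[ℝ] ℝ) : E3 →ₗ[ℝ] ℝ)) (by
      intro h
      have : bv 0 ∈ LinearMap.ker ((EuclideanSpace.proj (0 : Fin 3) : E3 →L[ℝ] ℝ) : E3 →ₗ[ℝ] ℝ) := by
        rw [h]; trivial
      simp [bv] at this)
  exact measure_mono_null (fun x hx => by simpa using hx.1) this

/-! ### Cutoff functions near the axis -/

theorem exists_deriv_smoothTransition_le :
    ∃ C, 0 ≤ C ∧ ∀ x, |deriv Real.smoothTransition x| ≤ C := by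
  have hc : Continuous (deriv Real.smoothTransition) :=
    (Real.smoothTransition.contDiff (n := 1)).continuous_deriv (by simp)
  obtain ⟨C, hC⟩ := (isCompact_Icc (a := (0 : ℝ)) (b := 1)).exists_bound_of_continuousOn
    hc.continuousOn
  refine ⟨max C 0, le_max_right _ _, fun x => ?_⟩
  by_cases h : x ∈ Icc (0 : ℝ) 1
  · exact (hC x h).trans (le_max_left _ _)
  · have : deriv Real.smoothTransition x = 0 := by
      rw [mem_Icc, not_and_or, not_le, not_le] at h
      rcases h with h | h
      · have : Real.smoothTransition =ᶠ[𝓝 x] fun _ => 0 := by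
          filter_upwards [Iio_mem_nhds h] with z hz using Real.smoothTransition.zero_of_nonpos hz.le
        rw [this.deriv_eq, deriv_const]
      · have : Real.smoothTransition =ᶠ[𝓝 x] fun _ => 1 := by
          filter_upwards [Ioi_mem_nhds h] with z hz using Real.smoothTransition.one_of_one_le hz.le
        rw [this.deriv_eq, deriv_const]
    rw [this]; simp

/-- The squared distance to the axis. -/
def rsq (x : E3) : ℝ := x 0 ^ 2 + x 1 ^ 2

theorem contDiff_rsq : ContDiff ℝ ∞ rsq := by unfold rsq; fun_prop

theorem rsq_eq_zero_iff {x : E3} : rsq x = 0 ↔ x ∈ zAxis := by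
  simp only [rsq, zAxis, mem_ofPred_eq]
  constructor
  · intro h
    constructor <;> nlinarith [sq_nonneg (x 0), sq_nonneg (x 1)]
  · rintro ⟨h, h'⟩; simp [h, h']

theorem rsq_nonneg (x : E3) : 0 ≤ rsq x := by unfold rsq; positivity

/-- A function that vanishes near the axis and is one away from it. -/
def tubeCut (n : ℕ) (x : E3) : ℝ := Real.smoothTransition ((n + 1 : ℝ) ^ 2 * rsq x - 1)

theorem contDiff_tubeCut (n : ℕ) : ContDiff ℝ ∞ (tubeCut n) :=
  Real.smoothTransition.contDiff.comp ((contDiff_const.mul contDiff_rsq).sub contDiff_const)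

theorem tubeCut_mem (n : ℕ) (x : E3) : tubeCut n x ∈ Icc (0 : ℝ) 1 :=
  ⟨Real.smoothTransition.nonneg _, Real.smoothTransition.le_one _⟩

theorem tsupport_tubeCut (n : ℕ) : tsupport (tubeCut n) ⊆ zAxisᶜ := by
  have : tsupport (tubeCut n) ⊆ {x | 1 ≤ (n + 1 : ℝ) ^ 2 * rsq x} := by
    refine closure_minimal (fun x hx => ?_)
      (isClosed_le continuous_const (continuous_const.mul contDiff_rsq.continuous))
    by_contra h
    simp only [mem_ofPred_eq, not_le] at h
    exact hx (Real.smoothTransition.zero_of_nonpos (by linarith))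
  intro x hx hz
  have h1 := this hx
  simp only [mem_ofPred_eq, rsq_eq_zero_iff.mpr hz] at h1
  norm_num at h1

theorem tendsto_tubeCut {x : E3} (hx : x ∉ zAxis) :
    Tendsto (fun n => tubeCut n x) atTop (𝓝 1) := by
  have hr : 0 < rsq x := lt_of_le_of_ne (rsq_nonneg x) fun h => hx (rsq_eq_zero_iff.mp h.symm)
  obtain ⟨N, hN⟩ := exists_nat_gt (2 / rsq x)
  refine tendsto_const_nhds.congr' ?_
  filter_upwards [eventually_ge_atTop N] with n hn
  refine (Real.smoothTransition.one_of_one_le ?_).symm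
  have h1 : (N : ℝ) ≤ n := by exact_mod_cast hn
  have h2 : 2 < n * rsq x := by
    have := (div_lt_iff₀ hr).mp (hN.trans_le h1); linarith
  have h3 : (0 : ℝ) ≤ n := n.cast_nonneg
  nlinarith [mul_nonneg (mul_nonneg h3 h3) hr.le, mul_nonneg h3 hr.le]

theorem exists_fderiv_tubeCut_le : ∃ C : ℝ, 0 ≤ C ∧ ∀ (n : ℕ) x, ‖fderiv ℝ (tubeCut n) x‖ ≤
    {x | (n + 1 : ℝ) ^ 2 * rsq x ≤ 2}.indicator (fun _ => C * ((n : ℝ) + 1)) x := by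
  obtain ⟨C, hC, hb⟩ := exists_deriv_smoothTransition_le
  refine ⟨4 * C, by positivity, fun n x => ?_⟩
  by_cases hx : (n + 1 : ℝ) ^ 2 * rsq x ≤ 2
  · rw [indicator_of_mem (by exact hx)]
    refine ContinuousLinearMap.opNorm_le_bound _ (by positivity) fun v => ?_
    have hr : HasFDerivAt rsq (2 • x 0 • (EuclideanSpace.proj (0 : Fin 3) : E3 →L[ℝ] ℝ) +
        2 • x 1 • (EuclideanSpace.proj (1 : Fin 3) : E3 →L[ℝ] ℝ)) x := by
      have h0 := ((EuclideanSpace.proj (0 : Fin 3) : E3 →L[ℝ] ℝ).hasFDerivAt (x := x)).pow 2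
      have h1 := ((EuclideanSpace.proj (1 : Fin 3) : E3 →L[ℝ] ℝ).hasFDerivAt (x := x)).pow 2
      refine (h0.add h1).congr_fderiv ?_
      ext v; simp; ring
    have ht : HasDerivAt Real.smoothTransition
        (deriv Real.smoothTransition ((n + 1 : ℝ) ^ 2 * rsq x - 1)) ((n + 1 : ℝ) ^ 2 * rsq x - 1) :=
      (Real.smoothTransition.contDiffAt (n := 1)).differentiableAt (by simp) |>.hasDerivAt
    have hcomp : HasFDerivAt (tubeCut n) _ x :=
      ht.comp_hasFDerivAt x ((hr.const_mul ((n + 1 : ℝ) ^ 2)).sub_const 1)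
    rw [hcomp.fderiv]
    simp only [smul_apply, add_apply, smul_eq_mul, norm_mul, Real.norm_eq_abs,
      PiLp.proj_apply, nsmul_eq_mul]
    have hcs : |2 * (x 0 * v 0) + 2 * (x 1 * v 1)| ≤ 2 * (√(rsq x) * ‖v‖) := by
      have h1 : (x 0 * v 0 + x 1 * v 1) ^ 2 ≤ (√(rsq x) * ‖v‖) ^ 2 := by
        rw [mul_pow, Real.sq_sqrt (rsq_nonneg x), EuclideanSpace.norm_sq_eq, Fin.sum_univ_three]
        simp only [Real.norm_eq_abs, sq_abs, rsq]
        nlinarith [sq_nonneg (x 0 * v 1 - x 1 * v 0), mul_nonneg (rsq_nonneg x) (sq_nonneg (v 2)),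
          mul_nonneg (sq_nonneg (x 0)) (sq_nonneg (v 2)),
          mul_nonneg (sq_nonneg (x 1)) (sq_nonneg (v 2))]
      have := abs_le_of_sq_le_sq h1 (by positivity)
      rw [← mul_add, abs_mul, abs_two]; gcongr
    have hsq : (n + 1 : ℝ) * √(rsq x) ≤ 2 := by
      have : ((n + 1 : ℝ) * √(rsq x)) ^ 2 ≤ 2 := by
        rw [mul_pow, Real.sq_sqrt (rsq_nonneg x)]; exact hx
      nlinarith
    push_cast
    calc |deriv Real.smoothTransition ((n + 1 : ℝ) ^ 2 * rsq x - 1)| *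
          (|(n + 1 : ℝ) ^ 2| * |2 * (x 0 * v 0) + 2 * (x 1 * v 1)|)
        ≤ C * ((n + 1 : ℝ) ^ 2 * (2 * (√(rsq x) * ‖v‖))) := by
          rw [abs_of_nonneg (by positivity : (0 : ℝ) ≤ (n + 1 : ℝ) ^ 2)]
          gcongr; exact hb _
      _ = C * (2 * (n + 1) * ((n + 1 : ℝ) * √(rsq x)) * ‖v‖) := by ring
      _ ≤ C * (2 * (n + 1) * 2 * ‖v‖) := by gcongr
      _ = 4 * C * (n + 1) * ‖v‖ := by ring
  · rw [indicator_of_notMem (by exact hx)]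
    have : tubeCut n =ᶠ[𝓝 x] fun _ => 1 := by
      have ho : IsOpen {z : E3 | 2 < (n + 1 : ℝ) ^ 2 * rsq z} :=
        isOpen_lt continuous_const (continuous_const.mul contDiff_rsq.continuous)
      filter_upwards [ho.mem_nhds (not_le.mp hx)] with z hz
      exact Real.smoothTransition.one_of_one_le (by
        have : 2 < (n + 1 : ℝ) ^ 2 * rsq z := hz
        linarith)
    rw [this.fderiv_eq]; simp

/-- The tube lies in a box with two sides of order `1/(n+1)`. Its volume is therefore one order
smaller than the reciprocal of the gradient bound for `tubeCut`, which is why the axis is negligible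
for the divergence. -/
theorem volume_tube_le (n : ℕ) :
    volume ({x : E3 | (n + 1 : ℝ) ^ 2 * rsq x ≤ 2} ∩ unitBall) ≤
      ofReal (32 / (n + 1) ^ 2) := by
  set a : ℝ := 2 / (n + 1) with ha
  have ha0 : 0 < a := by positivity
  let lo : Fin 3 → ℝ := ![-a, -a, -1]
  let hi : Fin 3 → ℝ := ![a, a, 1]
  have hsub : {x : E3 | (n + 1 : ℝ) ^ 2 * rsq x ≤ 2} ∩ unitBall ⊆
      (WithLp.ofLp) ⁻¹' (Icc lo hi) := by
    rintro x ⟨hx, hb⟩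
    have hx2 : rsq x ≤ a ^ 2 := by
      have : (n + 1 : ℝ) ^ 2 * rsq x ≤ 2 := hx
      rw [ha, div_pow, le_div_iff₀ (by positivity)]; linarith
    have h0 : |x 0| ≤ a := abs_le_of_sq_le_sq (by unfold rsq at hx2; nlinarith [sq_nonneg (x 1)]) ha0.le
    have h1 : |x 1| ≤ a := abs_le_of_sq_le_sq (by unfold rsq at hx2; nlinarith [sq_nonneg (x 0)]) ha0.le
    have h2 : |x 2| ≤ 1 := by
      have : ‖x‖ < 1 := by simpa [unitBall] using hb
      exact (PiLp.norm_apply_le x 2).trans this.le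
    rw [abs_le] at h0 h1 h2
    simp only [mem_preimage, mem_Icc, Pi.le_def]
    constructor <;> intro i <;> fin_cases i <;> simp [lo, hi] <;> linarith
  refine (measure_mono hsub).trans ?_
  rw [(PiLp.volume_preserving_ofLp (Fin 3)).measure_preimage measurableSet_Icc.nullMeasurableSet,
    Real.volume_Icc_pi, Fin.prod_univ_three]
  simp only [lo, hi, Matrix.cons_val_zero, Matrix.cons_val_one, Matrix.cons_val]
  rw [← ofReal_mul (by linarith), ← ofReal_mul (by nlinarith)]
  apply ofReal_le_ofReal
  rw [ha]; field_simp; norm_num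

/-- Integrals over the ball against the gradient of the tube cutoffs tend to zero. -/
theorem tendsto_integral_fderiv_tubeCut {V : E3 → E3} {C : ℝ} {s : Set E3} (hs : s ⊆ unitBall)
    (hsm : MeasurableSet s) (hV : ∀ x ∈ s, ‖V x‖ ≤ C) :
    Tendsto (fun n => ∫ x in s, fderiv ℝ (tubeCut n) x (V x)) atTop (𝓝 0) := by
  obtain ⟨D, hD, hb⟩ := exists_fderiv_tubeCut_le
  have hC0 : 0 ≤ |C| := abs_nonneg C
  have hlim : Tendsto (fun n : ℕ => 32 * D * |C| * (1 / ((n : ℝ) + 1))) atTop (𝓝 0) := by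
    simpa using tendsto_one_div_add_atTop_nhds_zero_nat.const_mul (32 * D * |C|)
  refine squeeze_zero_norm (fun n => ?_) hlim
  set A : Set E3 := {x | (n + 1 : ℝ) ^ 2 * rsq x ≤ 2} with hA
  have hAm : MeasurableSet A := (isClosed_le (continuous_const.mul contDiff_rsq.continuous)
    continuous_const).measurableSet
  have hz : ∀ x ∈ s, x ∉ A → fderiv ℝ (tubeCut n) x (V x) = 0 := fun x _ hx => by
    have := hb n x
    rw [indicator_of_notMem hx] at this
    rw [norm_le_zero_iff.mp this]; simp
  have e : ∫ x in s, fderiv ℝ (tubeCut n) x (V x) =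
      ∫ x in A ∩ s, fderiv ℝ (tubeCut n) x (V x) := by
    rw [← Measure.restrict_restrict hAm, ← integral_indicator hAm]
    refine setIntegral_congr_fun hsm fun x hx => ?_
    by_cases hxA : x ∈ A
    · rw [indicator_of_mem hxA]
    · rw [indicator_of_notMem hxA, hz x hx hxA]
  have hvol : volume (A ∩ s) ≤ ofReal (32 / (n + 1) ^ 2) :=
    (measure_mono (inter_subset_inter_right _ hs)).trans (volume_tube_le n)
  rw [e]
  refine (norm_setIntegral_le_of_norm_le_const (C := D * (n + 1) * |C|)
    (hvol.trans_lt ofReal_lt_top) fun x hx => ?_).trans ?_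
  · have := hb n x
    rw [indicator_of_mem hx.1] at this
    exact (ContinuousLinearMap.le_opNorm _ _).trans
      (mul_le_mul this ((hV x hx.2).trans (le_abs_self C)) (norm_nonneg _) (by positivity))
  · have h1 : volume.real (A ∩ s) ≤ 32 / (n + 1) ^ 2 :=
      ENNReal.toReal_le_of_le_ofReal (by positivity) hvol
    calc D * (n + 1) * |C| * volume.real (A ∩ s) ≤ D * (n + 1) * |C| * (32 / (n + 1) ^ 2) := by
          gcongr
      _ = 32 * D * |C| * (1 / ((n : ℝ) + 1)) := by field_simp

/-! ### The calibrating field is weakly divergence free -/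

theorem calib₀_of_mem {x : E3} (hx : x ∈ unitBall \ zAxis) : calib₀ g ν x = calib g ν x :=
  indicator_of_mem hx _

theorem clm_apply_eq_sum (L : E3 →L[ℝ] ℝ) (v : E3) :
    L v = ∑ j : Fin 3, L (bv j) * v j := by
  conv_lhs => rw [eq_sum_bv v]
  simp only [map_add, map_smul, smul_eq_mul, Fin.sum_univ_three]
  ring

theorem hasCompactSupport_fderiv_apply {ψ : E3 → ℝ} (hc : HasCompactSupport ψ) (V : E3 → E3) :
    HasCompactSupport fun x => fderiv ℝ ψ x (V x) :=
  (hc.fderiv ℝ).mono fun x hx h => hx (by simp [h])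

/-- A bounded measurable field paired with the gradient of a test function is integrable. -/
theorem integrable_fderiv_apply {ψ : E3 → ℝ} (hψ : ContDiff ℝ ∞ ψ) (hc : HasCompactSupport ψ)
    {V : E3 → E3} (hV : Measurable V) {C : ℝ} (hb : ∀ x ∈ tsupport ψ, ‖V x‖ ≤ C) :
    Integrable fun x => fderiv ℝ ψ x (V x) := by
  have hcont : Continuous (fderiv ℝ ψ) := hψ.continuous_fderiv (by simp)
  have h1 : Integrable fun x => ‖fderiv ℝ ψ x‖ * |C| :=
    ((hcont.norm).mul continuous_const).integrable_of_hasCompactSupport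
      ((hc.fderiv ℝ).norm.mul_right)
  refine h1.mono' ?_ (ae_of_all _ fun x => ?_)
  · have : (fun x => fderiv ℝ ψ x (V x)) = fun x => ∑ j : Fin 3, fderiv ℝ ψ x (bv j) * V x j :=
      funext fun x => clm_apply_eq_sum _ _
    rw [this]
    refine Measurable.aestronglyMeasurable (Finset.measurable_sum _ fun j _ => ?_)
    have hVj : Measurable fun x => V x j := by fun_prop
    exact (hcont.clm_apply continuous_const).measurable.mul hVj
  · by_cases hx : x ∈ tsupport ψ
    · exact (ContinuousLinearMap.le_opNorm _ _).trans
        (mul_le_mul_of_nonneg_left ((hb x hx).trans (le_abs_self C)) (norm_nonneg _))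
    · have : fderiv ℝ ψ x = 0 := by
        by_contra h
        exact hx (tsupport_fderiv_subset ℝ (subset_closure h))
      simp [this]

/-- Near the support of `ψ` the field is Lipschitz, so its components extend to Lipschitz functions
on the whole space. These can be integrated by parts and are differentiable almost everywhere by
Rademacher's theorem, where `tr3_fderiv_calib` makes the divergence vanish. -/
theorem integral_fderiv_calib_offAxis (hg : IsMetricOn g unitBall) (hν : R.IsUnitNormal g ν)
    (hmin : R.IsMinimal g ν) {ψ : E3 → ℝ} (hψ : ContDiff ℝ ∞ ψ) (hc : HasCompactSupport ψ)
    (hs : tsupport ψ ⊆ unitBall \ zAxis) : ∫ x, fderiv ℝ ψ x (calib₀ g ν x) = 0 := by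
  obtain ⟨K', hK', hKK', hK'O⟩ := exists_compact_between hc isOpen_offAxis hs
  have hlip := locallyLipschitzOn_calib hg hν.lipschitz
  obtain ⟨L, hL⟩ := (hlip.mono hK'O).exists_lipschitzOnWith_of_compact hK'
  have hLj : ∀ j : Fin 3, ∃ K, LipschitzOnWith K (fun x => calib g ν x j) K' := fun j =>
    ⟨_, (EuclideanSpace.proj j : E3 →L[ℝ] ℝ).lipschitz.comp_lipschitzOnWith hL⟩
  choose K hK using hLj
  choose f hf hfe using fun j => (hK j).extend_real
  obtain ⟨D, hD⟩ := (hψ.of_le (by norm_cast : (1 : WithTop ℕ∞) ≤ ∞)).lipschitzWith_of_hasCompactSupport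
    hc (by simp)
  have hparts := fun j : Fin 3 => LipschitzWith.integral_lineDeriv_mul_eq (μ := volume) (hf j) hD hc (bv j)
  have hψd : Differentiable ℝ ψ := hψ.differentiable (by simp)
  have hcont : Continuous (fderiv ℝ ψ) := hψ.continuous_fderiv (by simp)
  have hline : ∀ j x, lineDeriv ℝ ψ x (-bv j) = -fderiv ℝ ψ x (bv j) := fun j x => by
    rw [(hψd x).lineDeriv_eq_fderiv, map_neg]
  have hzero : ∀ x ∉ tsupport ψ, fderiv ℝ ψ x = 0 := fun x hx => by
    by_contra h
    exact hx (tsupport_fderiv_subset ℝ (subset_closure h))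
  have hI1 : ∀ j, Integrable fun x => fderiv ℝ ψ x (bv j) * f j x := fun j =>
    ((hcont.clm_apply continuous_const).mul (hf j).continuous).integrable_of_hasCompactSupport
      ((hc.fderiv_apply ℝ (bv j)).mul_right)
  have hI2 : ∀ j, Integrable fun x => lineDeriv ℝ (f j) x (bv j) * ψ x := fun j => by
    have := (hf j).locallyIntegrable_lineDeriv (μ := volume) (bv j)
    exact this.integrable_smul_right_of_hasCompactSupport hψ.continuous hc
  have e1 : ∫ x, fderiv ℝ ψ x (calib₀ g ν x) = ∑ j, ∫ x, fderiv ℝ ψ x (bv j) * f j x := by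
    rw [← integral_finsetSum _ fun j _ => hI1 j]
    refine integral_congr_ae (ae_of_all _ fun x => ?_)
    by_cases hx : x ∈ tsupport ψ
    · have hx' : x ∈ K' := interior_subset (hKK' hx)
      simp only
      rw [clm_apply_eq_sum, calib₀_of_mem (hs hx)]
      exact Finset.sum_congr rfl fun j _ => by rw [← hfe j hx']
    · simp [hzero x hx]
  have e2 : ∀ j, ∫ x, fderiv ℝ ψ x (bv j) * f j x = -∫ x, lineDeriv ℝ (f j) x (bv j) * ψ x := by
    intro j
    rw [hparts j, ← integral_neg]
    exact integral_congr_ae (ae_of_all _ fun x => by simp only [hline]; ring)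
  rw [e1]
  simp_rw [e2]
  rw [Finset.sum_neg_distrib, ← integral_finsetSum _ fun j _ => hI2 j, neg_eq_zero]
  rw [← integral_zero E3 ℝ (μ := volume)]
  have hdiff : ∀ᵐ x, ∀ j, DifferentiableAt ℝ (f j) x :=
    ae_all_iff.mpr fun j => (hf j).ae_differentiableAt
  refine integral_congr_ae ?_
  filter_upwards [hdiff] with x hx
  by_cases hxs : x ∈ tsupport ψ
  swap
  · simp [image_eq_zero_of_notMem_tsupport hxs]
  have hxO := hs hxs
  have hnear : ∀ᶠ z in 𝓝 x, z ∈ K' := mem_interior_iff_mem_nhds.mp (hKK' hxs)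
  have hcd : ∀ j, HasFDerivAt (fun z => calib g ν z j) (fderiv ℝ (f j) x) x := fun j =>
    (hx j).hasFDerivAt.congr_of_eventuallyEq (by
      filter_upwards [hnear] with z hz using hfe j hz)
  have hXd : DifferentiableAt ℝ (calib g ν) x := by
    rw [differentiableAt_euclidean]
    exact fun j => (hcd j).differentiableAt
  have hvd : DifferentiableAt ℝ (fun z => gvol (g z)) x := by
    have : DifferentiableAt ℝ (fun z => gdet (g z)) x :=
      (contDiff_gdet.differentiable (by simp)).differentiableAt.comp x
        (differentiableAt_metric hg hxO.1)
    exact this.sqrt (hg.isInner hxO.1).gdet_pos.ne'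
  -- Rademacher's theorem is applied to `calib`; differentiability of `ν` is recovered by dividing
  -- by the positive smooth volume density.
  have hνd : DifferentiableAt ℝ ν x := by
    have h1 : DifferentiableAt ℝ (fun z => (gvol (g z))⁻¹ • calib g ν z) x :=
      (hvd.inv (hg.isInner hxO.1).gvol_pos.ne').smul hXd
    refine h1.congr_of_eventuallyEq ?_
    filter_upwards [isOpen_unitBall.mem_nhds hxO.1] with z hz
    rw [calib, smul_smul, inv_mul_cancel₀ (hg.isInner hz).gvol_pos.ne', one_smul]
  have htr := tr3_fderiv_calib hg hν hmin hxO hνd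
  have hj : ∀ j, fderiv ℝ (calib g ν) x (bv j) j = lineDeriv ℝ (f j) x (bv j) := by
    intro j
    rw [(hx j).lineDeriv_eq_fderiv]
    have h1 : HasFDerivAt (fun z => calib g ν z j) _ x :=
      (EuclideanSpace.proj j : E3 →L[ℝ] ℝ).hasFDerivAt.comp x hXd.hasFDerivAt
    rw [← h1.unique (hcd j)]
    rfl
  simp only [Fin.sum_univ_three, ← hj, ← add_mul]
  simp only [tr3] at htr
  rw [htr, zero_mul]

/-- The calibrating vector field is weakly divergence free in the ball. -/
theorem integral_fderiv_calib (hg : IsMetricOn g unitBall) (hν : R.IsUnitNormal g ν)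
    (hmin : R.IsMinimal g ν) {ψ : E3 → ℝ} (hψ : ContDiff ℝ ∞ ψ) (hc : HasCompactSupport ψ)
    (hs : tsupport ψ ⊆ unitBall) : ∫ x, fderiv ℝ ψ x (calib₀ g ν x) = 0 := by
  obtain ⟨C, hC0, hC⟩ := exists_norm_calib_le (ν := ν) hg (fun x _ => rfl) hc hs hν.unit
  have hm := measurable_calib₀ hg hν.lipschitz
  have hψd : Differentiable ℝ ψ := hψ.differentiable (by simp)
  have hzero : ∀ x ∉ tsupport ψ, fderiv ℝ ψ x = 0 := fun x hx => by
    by_contra h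
    exact hx (tsupport_fderiv_subset ℝ (subset_closure h))
  have hI := integrable_fderiv_apply hψ hc hm hC
  -- The test function is cut off near the axis. In the product rule the term with the gradient of
  -- `ψ` converges to the desired integral, and the term with the gradient of `tubeCut` tends to
  -- zero.
  have hoff : ∀ n, ∫ x, fderiv ℝ (fun z => tubeCut n z * ψ z) x (calib₀ g ν x) = 0 := fun n => by
    refine integral_fderiv_calib_offAxis hg hν hmin ((contDiff_tubeCut n).mul hψ) hc.mul_left ?_
    intro x hx
    exact ⟨hs (tsupport_mul_subset_right (f := tubeCut n) (g := ψ) hx),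
      tsupport_tubeCut n (tsupport_mul_subset_left (f := tubeCut n) (g := ψ) hx)⟩
  have hfd : ∀ n x, fderiv ℝ (fun z => tubeCut n z * ψ z) x (calib₀ g ν x) =
      tubeCut n x * fderiv ℝ ψ x (calib₀ g ν x)
        + fderiv ℝ (tubeCut n) x (ψ x • calib₀ g ν x) := by
    intro n x
    rw [fderiv_fun_mul (((contDiff_tubeCut n).differentiable (by simp)) x) (hψd x)]
    simp
  have hT1 : Tendsto (fun n => ∫ x, tubeCut n x * fderiv ℝ ψ x (calib₀ g ν x)) atTop
      (𝓝 (∫ x, fderiv ℝ ψ x (calib₀ g ν x))) := by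
    refine tendsto_integral_of_dominated_convergence (fun x => ‖fderiv ℝ ψ x (calib₀ g ν x)‖)
      (fun n => (contDiff_tubeCut n).continuous.aestronglyMeasurable.mul hI.aestronglyMeasurable)
      hI.norm (fun n => ae_of_all _ fun x => ?_) ?_
    · rw [norm_mul]
      refine mul_le_of_le_one_left (norm_nonneg _) ?_
      rw [Real.norm_of_nonneg (tubeCut_mem n x).1]; exact (tubeCut_mem n x).2
    · have : ∀ᵐ x : E3, x ∉ zAxis := measure_eq_zero_iff_ae_notMem.mp volume_zAxis
      filter_upwards [this] with x hx
      simpa using (tendsto_tubeCut hx).mul_const (fderiv ℝ ψ x (calib₀ g ν x))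
  obtain ⟨P, hP⟩ := hψ.continuous.bounded_above_of_compact_support hc
  have hPC : ∀ x, ‖ψ x • calib₀ g ν x‖ ≤ P * C := by
    intro x
    rw [norm_smul]
    by_cases hx : x ∈ tsupport ψ
    · exact mul_le_mul (hP x) (hC x hx) (norm_nonneg _) ((norm_nonneg _).trans (hP x))
    · rw [image_eq_zero_of_notMem_tsupport hx]
      simpa using mul_nonneg ((norm_nonneg _).trans (hP x)) hC0
  have hT2 := tendsto_integral_fderiv_tubeCut (V := fun x => ψ x • calib₀ g ν x) (C := P * C)
    (s := unitBall) subset_rfl isOpen_unitBall.measurableSet fun x _ => hPC x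
  have hsum : ∀ n, ∫ x, tubeCut n x * fderiv ℝ ψ x (calib₀ g ν x) =
      - ∫ x in unitBall, fderiv ℝ (tubeCut n) x (ψ x • calib₀ g ν x) := by
    intro n
    have hI1 : Integrable fun x => tubeCut n x * fderiv ℝ ψ x (calib₀ g ν x) := by
      refine hI.bdd_mul (c := 1) (contDiff_tubeCut n).continuous.aestronglyMeasurable
        (ae_of_all _ fun x => ?_)
      rw [Real.norm_of_nonneg (tubeCut_mem n x).1]; exact (tubeCut_mem n x).2
    have hI0 : Integrable fun x => fderiv ℝ (fun z => tubeCut n z * ψ z) x (calib₀ g ν x) := by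
      refine integrable_fderiv_apply ((contDiff_tubeCut n).mul hψ) hc.mul_left hm (C := C) ?_
      intro x hx
      exact hC x (tsupport_mul_subset_right (f := tubeCut n) (g := ψ) hx)
    have h0 := hoff n
    have hI2 : Integrable fun x => fderiv ℝ (tubeCut n) x (ψ x • calib₀ g ν x) := by
      refine (hI0.sub hI1).congr (ae_of_all _ fun x => ?_)
      simp only [Pi.sub_apply, hfd n x]; ring
    simp_rw [hfd n] at h0
    rw [integral_add hI1 hI2] at h0
    rw [setIntegral_eq_integral_of_forall_compl_eq_zero]
    · linarith
    · intro x hx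
      rw [image_eq_zero_of_notMem_tsupport (fun h => hx (hs h))]; simp
  simp_rw [hsum] at hT1
  have := hT2.neg
  rw [neg_zero] at this
  exact tendsto_nhds_unique hT1 this

/-! ### Smooth divergence free approximations -/

/-- The trace of the derivative of a mollified field. -/
theorem tr3_fderiv_convolution {φ : E3 → ℝ} (hφ : ContDiff ℝ ∞ φ) (hc : HasCompactSupport φ)
    {G : E3 → E3} (hG : Integrable G) (z : E3) :
    tr3 (fderiv ℝ (φ ⋆[ContinuousLinearMap.lsmul ℝ ℝ, volume] G) z) =
      - ∫ s, fderiv ℝ (fun s => φ (z - s)) s (G s) := by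
  have hd := hc.hasFDerivAt_convolution_left (ContinuousLinearMap.lsmul ℝ ℝ)
    (hφ.of_le (by norm_cast)) hG.locallyIntegrable z
  rw [hd.fderiv]
  have hcont : Continuous (fderiv ℝ φ) := hφ.continuous_fderiv (by simp)
  have hex := ((hc.fderiv ℝ).convolutionExists_left
    ((ContinuousLinearMap.lsmul ℝ ℝ : ℝ →L[ℝ] E3 →L[ℝ] E3).precompL E3)
    hcont hG.locallyIntegrable) z
  have happ : ∀ v : E3, ∀ j : Fin 3,
      ((fderiv ℝ φ ⋆[(ContinuousLinearMap.lsmul ℝ ℝ : ℝ →L[ℝ] E3 →L[ℝ] E3).precompL E3, volume] G)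
        z v) j = ∫ t, fderiv ℝ φ t v * G (z - t) j := by
    intro v j
    rw [convolution_def, ContinuousLinearMap.integral_apply hex]
    have := (EuclideanSpace.proj j : E3 →L[ℝ] ℝ).integral_comp_comm
      (φ := fun t => (((ContinuousLinearMap.lsmul ℝ ℝ : ℝ →L[ℝ] E3 →L[ℝ] E3).precompL E3)
        (fderiv ℝ φ t) (G (z - t))) v) (hex.apply_continuousLinearMap v)
    exact this.symm
  have hitg : ∀ j : Fin 3, Integrable fun t => fderiv ℝ φ t (bv j) * G (z - t) j := by
    intro j
    exact (EuclideanSpace.proj j : E3 →L[ℝ] ℝ).integrable_comp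
      (hex.apply_continuousLinearMap (bv j))
  simp only [tr3, happ]
  rw [← integral_add (hitg 0) (hitg 1), ← integral_add (by exact (hitg 0).add (hitg 1)) (hitg 2)]
  have e : ∀ t, fderiv ℝ φ t (bv 0) * G (z - t) 0 + fderiv ℝ φ t (bv 1) * G (z - t) 1
      + fderiv ℝ φ t (bv 2) * G (z - t) 2 = fderiv ℝ φ t (G (z - t)) := fun t => by
    rw [clm_apply_eq_sum _ (G (z - t)), Fin.sum_univ_three]
  simp_rw [e]
  rw [← integral_sub_left_eq_self (fun t => fderiv ℝ φ t (G (z - t))) volume z, ← integral_neg]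
  refine integral_congr_ae (ae_of_all _ fun s => ?_)
  have h1 : HasFDerivAt (fun s => φ (z - s)) (-(fderiv ℝ φ (z - s))) s := by
    have h2 : HasFDerivAt (fun s : E3 => z - s) (-ContinuousLinearMap.id ℝ E3) s :=
      (hasFDerivAt_id s).const_sub z
    refine (((hφ.differentiable (by simp)) (z - s)).hasFDerivAt.comp s h2).congr_fderiv ?_
    ext v; simp
  simp [h1.fderiv]

/-- Smooth divergence free approximations of the calibrating vector field. -/
theorem exists_mollification (hg : IsMetricOn g unitBall) (hν : R.IsUnitNormal g ν)
    (hmin : R.IsMinimal g ν) : ∃ Y : ℕ → E3 → E3, (∀ n, ContDiff ℝ ∞ (Y n)) ∧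
      (∀ n, ∃ r > 1, ∀ x ∈ ball (0 : E3) r, tr3 (fderiv ℝ (Y n) x) = 0) ∧
      ∀ (n : ℕ), ∀ x ∈ closedUnitBall, ∀ (l : E3 →L[ℝ] ℝ) (C : ℝ),
        (∀ q ∈ unitBall \ zAxis, dist q x < 3 / ((n : ℝ) + 3) → l (calib g ν q) ≤ C) →
        l (Y n x) ≤ C := by
  have key : ∀ n : ℕ, ∃ Y : E3 → E3, ContDiff ℝ ∞ Y ∧
      (∃ r > 1, ∀ x ∈ ball (0 : E3) r, tr3 (fderiv ℝ Y x) = 0) ∧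
      ∀ x ∈ closedUnitBall, ∀ (l : E3 →L[ℝ] ℝ) (C : ℝ),
        (∀ q ∈ unitBall \ zAxis, dist q x < 3 / ((n : ℝ) + 3) → l (calib g ν q) ≤ C) →
        l (Y x) ≤ C := by
    intro n
    set ε : ℝ := 1 / ((n : ℝ) + 3) with hε
    have hn3 : (0 : ℝ) < (n : ℝ) + 3 := by positivity
    have hε0 : 0 < ε := by positivity
    have hε1 : ε ≤ 1 / 3 := by
      rw [hε]; gcongr; linarith [n.cast_nonneg (α := ℝ)]
    let b : ContDiffBump (0 : E3) := ⟨ε / 2, ε, by positivity, by linarith⟩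
    set φ : E3 → ℝ := b.normed volume with hφdef
    have hφ : ContDiff ℝ ∞ φ := b.contDiff_normed
    have hφc : HasCompactSupport φ := b.hasCompactSupport_normed
    have hφt : tsupport φ = closedBall 0 ε := b.tsupport_normed_eq
    have hφs : Function.support φ = ball 0 ε := b.support_normed_eq
    -- Truncation to a compact ball makes the field bounded and integrable. The convolution does not
    -- notice the truncation at points of norm below `1 - 3ε/2`, as the kernel has radius `ε`.
    set G : E3 → E3 := (closedBall (0 : E3) (1 - ε / 2)).indicator (calib₀ g ν) with hGdef
    have hballsub : closedBall (0 : E3) (1 - ε / 2) ⊆ unitBall :=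
      closedBall_subset_ball (by linarith)
    obtain ⟨C₀, hC₀, hGb⟩ := exists_norm_calib_le (ν := ν) hg (fun x _ => rfl)
      (isCompact_closedBall (0 : E3) (1 - ε / 2)) hballsub hν.unit
    have hGm : Measurable G :=
      (measurable_calib₀ hg hν.lipschitz).indicator measurableSet_closedBall
    have hGi : Integrable G := by
      rw [hGdef, integrable_indicator_iff measurableSet_closedBall]
      exact Measure.integrableOn_of_bounded (M := C₀) measure_closedBall_lt_top.ne
        (measurable_calib₀ hg hν.lipschitz).aestronglyMeasurable
        ((ae_restrict_iff' measurableSet_closedBall).mpr (ae_of_all _ hGb))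
    set c : E3 → E3 := φ ⋆[ContinuousLinearMap.lsmul ℝ ℝ, volume] G with hcdef
    have hcs : ContDiff ℝ ∞ c := hφc.contDiff_convolution_left _ hφ hGi.locallyIntegrable
    have hdiv : ∀ z : E3, ‖z‖ < 1 - 3 * ε / 2 → tr3 (fderiv ℝ c z) = 0 := by
      intro z hz
      rw [tr3_fderiv_convolution hφ hφc hGi z, neg_eq_zero]
      have hsub : ∀ s, s ∈ tsupport (fun s => φ (z - s)) → ‖s‖ ≤ 1 - ε / 2 := by
        have h1 : tsupport (fun s => φ (z - s)) ⊆ closedBall z ε := by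
          refine closure_minimal (fun s hs => ?_) isClosed_closedBall
          have : z - s ∈ Function.support φ := hs
          rw [hφs] at this
          rw [mem_closedBall, dist_comm, dist_eq_norm]
          exact (mem_ball_zero_iff.mp this).le
        intro s hs
        have h2 := h1 hs
        rw [mem_closedBall, dist_eq_norm] at h2
        calc ‖s‖ = ‖(s - z) + z‖ := by simp
          _ ≤ ‖s - z‖ + ‖z‖ := norm_add_le _ _
          _ ≤ 1 - ε / 2 := by linarith
      have hsm : ContDiff ℝ ∞ fun s => φ (z - s) := hφ.comp (contDiff_const.sub contDiff_id)
      have hcc : HasCompactSupport fun s => φ (z - s) :=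
        HasCompactSupport.of_support_subset_isCompact (isCompact_closedBall (0 : E3) (1 - ε / 2))
          fun s hs => by simpa using hsub s (subset_closure hs)
      have h0 := integral_fderiv_calib hg hν hmin hsm hcc fun s hs => hballsub (by
        simpa using hsub s hs)
      rw [← h0]
      refine integral_congr_ae (ae_of_all _ fun s => ?_)
      by_cases hs : s ∈ tsupport fun s => φ (z - s)
      · simp only
        rw [hGdef, indicator_of_mem (by simpa using hsub s hs)]
      · have : fderiv ℝ (fun s => φ (z - s)) s = 0 := by
          by_contra h
          exact hs (tsupport_fderiv_subset ℝ (subset_closure h))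
        simp [this]
    have hlin : ContDiff ℝ ∞ fun x : E3 => (1 - 2 * ε) • x :=
      contDiff_id.const_smul _
    -- The convolution is divergence free only inside the ball. Composing with the contraction by `1
    -- - 2ε` moves this region over a neighbourhood of the closed ball, since `(1 - 2ε)(1 + ε/2) < 1
    -- - 3ε/2`; a homothety multiplies the divergence by a constant.
    refine ⟨fun x => c ((1 - 2 * ε) • x), hcs.comp hlin, ⟨1 + ε / 2, by linarith, ?_⟩, ?_⟩
    · intro x hx
      have hx' : ‖x‖ < 1 + ε / 2 := by simpa using hx
      have h1 : HasFDerivAt (fun x : E3 => (1 - 2 * ε) • x)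
          ((1 - 2 * ε) • ContinuousLinearMap.id ℝ E3) x :=
        ((1 - 2 * ε) • ContinuousLinearMap.id ℝ E3).hasFDerivAt
      have h2 : HasFDerivAt (fun x => c ((1 - 2 * ε) • x)) _ x :=
        ((hcs.differentiable (by simp)) _).hasFDerivAt.comp x h1
      rw [h2.fderiv]
      have h3 := hdiv ((1 - 2 * ε) • x) (by
        rw [norm_smul, Real.norm_of_nonneg (by linarith)]
        calc (1 - 2 * ε) * ‖x‖ ≤ (1 - 2 * ε) * (1 + ε / 2) := by gcongr; linarith
          _ < 1 - 3 * ε / 2 := by nlinarith)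
      simp only [tr3] at h3 ⊢
      simp only [ContinuousLinearMap.comp_apply, smul_apply, ContinuousLinearMap.id_apply, map_smul,
        PiLp.smul_apply, smul_eq_mul, ← mul_add, h3, mul_zero]
    -- The kernel is a probability density, so the value at `x` is an average of values of `calib`
    -- at points within `2ε + ε` of `x`, the two terms coming from the contraction and the kernel.
    -- Testing with linear functionals expresses this without reference to a value of `calib` at
    -- `x`, so it is meaningful on the sphere and on the axis.
    · intro x hx l C hl
      have hx1 : ‖x‖ ≤ 1 := by simpa [closedUnitBall] using hx
      set z := (1 - 2 * ε) • x with hz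
      have hex : Integrable fun t => φ t • G (z - t) :=
        (hφc.convolutionExists_left (ContinuousLinearMap.lsmul ℝ ℝ) hφ.continuous
          hGi.locallyIntegrable) z
      have e1 : l (c z) = ∫ t, φ t * l (G (z - t)) := by
        rw [hcdef, convolution_def]
        refine (l.integral_comp_comm hex).symm.trans ?_
        simp
      have e2 : C = ∫ t, φ t * C := by
        rw [integral_mul_const, b.integral_normed, one_mul]
      change l (c z) ≤ C
      rw [e1, e2]
      have hzs : ∀ᵐ t : E3, z - t ∉ zAxis := by
        have h1 := (Measure.measurePreserving_sub_left (volume : Measure E3) z).quasiMeasurePreserving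
        exact h1.ae (measure_eq_zero_iff_ae_notMem.mp volume_zAxis)
      refine integral_mono_ae ?_ (b.integrable_normed.mul_const C) ?_
      · simpa using l.integrable_comp hex
      · filter_upwards [hzs] with t ht
        by_cases hts : t ∈ Function.support φ
        · refine mul_le_mul_of_nonneg_left ?_ (b.nonneg_normed t)
          rw [hφs, mem_ball_zero_iff] at hts
          have hzn : ‖z‖ ≤ 1 - 2 * ε := by
            rw [hz, norm_smul, Real.norm_of_nonneg (by linarith)]
            exact mul_le_of_le_one_right (by linarith) hx1
          have hq : ‖z - t‖ ≤ 1 - ε / 2 := (norm_sub_le _ _).trans (by linarith)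
          have hqO : z - t ∈ unitBall \ zAxis := ⟨hballsub (by simpa using hq), ht⟩
          rw [hGdef, indicator_of_mem (by simpa using hq), calib₀_of_mem hqO]
          refine hl _ hqO ?_
          rw [dist_eq_norm]
          have : z - t - x = (-2 * ε) • x - t := by rw [hz]; module
          rw [this]
          refine (norm_sub_le _ _).trans_lt ?_
          rw [norm_smul, show (3 : ℝ) / ((n : ℝ) + 3) = 3 * ε by rw [hε]; ring]
          have : ‖-2 * ε‖ = 2 * ε := by rw [norm_mul, Real.norm_of_nonneg hε0.le]; norm_num
          rw [this]
          nlinarith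
        · rw [Function.notMem_support.mp hts, zero_mul, zero_mul]
  choose Y h1 h2 h3 using key
  exact ⟨Y, h1, h2, h3⟩

/-- Approximations with the averaging property converge pointwise off the axis. -/
theorem tendsto_of_average (hg : IsMetricOn g unitBall) (hν : R.IsUnitNormal g ν)
    {Y : ℕ → E3 → E3}
    (hY : ∀ (n : ℕ), ∀ x ∈ closedUnitBall, ∀ (l : E3 →L[ℝ] ℝ) (C : ℝ),
        (∀ q ∈ unitBall \ zAxis, dist q x < 3 / ((n : ℝ) + 3) → l (calib g ν q) ≤ C) →
        l (Y n x) ≤ C) {x : E3} (hx : x ∈ unitBall \ zAxis) :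
    Tendsto (fun n => Y n x) atTop (𝓝 (calib g ν x)) := by
  have hcont : ContinuousAt (calib g ν) x :=
    (locallyLipschitzOn_calib hg hν.lipschitz).continuousOn.continuousAt (isOpen_offAxis.mem_nhds hx)
  have hxc : x ∈ closedUnitBall := ball_subset_closedBall hx.1
  have hcoord : ∀ l : E3 →L[ℝ] ℝ, ∀ δ > 0, ∀ᶠ n : ℕ in atTop, l (Y n x) ≤ l (calib g ν x) + δ := by
    intro l δ hδ
    have h1 : ∀ᶠ q in 𝓝 x, l (calib g ν q) < l (calib g ν x) + δ :=
      ((l.continuous.continuousAt.comp hcont).eventually_lt_const (by simpa using hδ))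
    obtain ⟨ρ, hρ, hb⟩ := Metric.eventually_nhds_iff.mp h1
    obtain ⟨N, hN⟩ := exists_nat_gt (3 / ρ)
    filter_upwards [eventually_ge_atTop N] with n hn
    refine hY n x hxc l _ fun q _ hq => (hb (hq.trans_le ?_)).le
    have h2 : (N : ℝ) ≤ n := by exact_mod_cast hn
    rw [div_le_iff₀ (by positivity)]
    have := (div_lt_iff₀ hρ).mp (hN.trans_le h2)
    nlinarith
  have hj : ∀ j : Fin 3, Tendsto (fun n => Y n x j) atTop (𝓝 (calib g ν x j)) := by
    intro j
    rw [Metric.tendsto_atTop']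
    intro δ hδ
    have a1 := hcoord (EuclideanSpace.proj j : E3 →L[ℝ] ℝ) (δ / 2) (by positivity)
    have a2 := hcoord (-(EuclideanSpace.proj j : E3 →L[ℝ] ℝ)) (δ / 2) (by positivity)
    obtain ⟨N, hN⟩ := eventually_atTop.mp (a1.and a2)
    refine ⟨N, fun n hn => ?_⟩
    have := hN n hn.le
    simp only [neg_apply, PiLp.proj_apply] at this
    rw [Real.dist_eq, abs_lt]
    constructor <;> linarith
  have : Tendsto (fun n => WithLp.ofLp (Y n x)) atTop (𝓝 (WithLp.ofLp (calib g ν x))) :=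
    tendsto_pi_nhds.mpr hj
  exact ((PiLp.continuous_toLp 2 (fun _ : Fin 3 => ℝ)).tendsto _).comp this

/-! ### The Poincaré lemma for divergence free fields -/

theorem hasFDerivAt_integral_param {E F : Type} [NormedAddCommGroup E] [NormedSpace ℝ E]
    [FiniteDimensional ℝ E] [NormedAddCommGroup F] [NormedSpace ℝ F] [CompleteSpace F]
    {f : E × ℝ → F} (hf : ContDiff ℝ 1 f) (a b : ℝ) (x : E) :
    HasFDerivAt (fun x => ∫ t in a..b, f (x, t))
      (∫ t in a..b, (fderiv ℝ f (x, t)).comp (ContinuousLinearMap.inl ℝ E ℝ)) x := by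
  have : ProperSpace E := FiniteDimensional.proper_real E
  have hc' : Continuous fun p : E × ℝ => (fderiv ℝ f p).comp (ContinuousLinearMap.inl ℝ E ℝ) :=
    (hf.continuous_fderiv one_ne_zero).clm_comp continuous_const
  obtain ⟨C, hC⟩ := ((isCompact_closedBall x 1).prod (isCompact_uIcc (a := a) (b := b))).exists_bound_of_continuousOn
    hc'.continuousOn
  refine hasFDerivAt_integral_of_dominated_of_fderiv_le''
    (F := fun x t => f (x, t))
    (F' := fun x t => (fderiv ℝ f (x, t)).comp (ContinuousLinearMap.inl ℝ E ℝ))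
    (bound := fun _ => C) (closedBall_mem_nhds x one_pos)
    (Eventually.of_forall fun z => ?_) ?_ ?_ ?_ ?_ ?_
  · exact (hf.continuous.comp (by fun_prop)).aestronglyMeasurable
  · exact (hf.continuous.comp (by fun_prop)).intervalIntegrable _ _
  · exact (hc'.comp (by fun_prop : Continuous fun t : ℝ => (x, t))).aestronglyMeasurable
  · refine (ae_restrict_iff' measurableSet_uIoc).mpr (ae_of_all _ fun t ht z hz => ?_)
    exact hC (z, t) ⟨hz, uIoc_subset_uIcc ht⟩
  · exact intervalIntegrable_const
  · refine ae_of_all _ fun t z _ => ?_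
    exact ((hf.differentiable one_ne_zero) (z, t)).hasFDerivAt.comp z
      (hasFDerivAt_prodMk_left z t)

theorem contDiff_integral_param {E F : Type} [NormedAddCommGroup E] [NormedSpace ℝ E]
    [FiniteDimensional ℝ E] [NormedAddCommGroup F] [NormedSpace ℝ F] [CompleteSpace F]
    {f : E × ℝ → F} (hf : ContDiff ℝ ∞ f) (a b : ℝ) :
    ContDiff ℝ ∞ fun x => ∫ t in a..b, f (x, t) := by
  rw [contDiff_infty]
  intro n
  induction n generalizing F with
  | zero =>
    refine contDiff_zero.mpr ?_
    exact intervalIntegral.continuous_parametric_intervalIntegral_of_continuous'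
      (f := fun x t => f (x, t)) hf.continuous a b
  | succ n ih =>
    have hf1 : ContDiff ℝ 1 f := hf.of_le (by norm_cast)
    have hd := fun x => hasFDerivAt_integral_param hf1 a b x
    rw [show ((n + 1 : ℕ) : WithTop ℕ∞) = (n : WithTop ℕ∞) + 1 by norm_cast,
      contDiff_succ_iff_fderiv]
    refine ⟨fun x => (hd x).differentiableAt, by simp, ?_⟩
    have : fderiv ℝ (fun x => ∫ t in a..b, f (x, t)) =
        fun x => ∫ t in a..b, (fderiv ℝ f (x, t)).comp (ContinuousLinearMap.inl ℝ E ℝ) :=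
      funext fun x => (hd x).fderiv
    rw [this]
    exact ih (f := fun p => (fderiv ℝ f p).comp (ContinuousLinearMap.inl ℝ E ℝ))
      ((hf.fderiv_right (m := ∞) (by simp)).clm_comp contDiff_const)

/-- The curl of a linear map. -/
def curl (L : E3 →L[ℝ] E3) : E3 :=
  !₂[L (bv 1) 2 - L (bv 2) 1, L (bv 2) 0 - L (bv 0) 2, L (bv 0) 1 - L (bv 1) 0]

/-- The curl as a continuous linear map. -/
def curlCLM : (E3 →L[ℝ] E3) →L[ℝ] E3 := LinearMap.toContinuousLinearMap
  { toFun := curl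
    map_add' := fun L M => by ext i; fin_cases i <;> simp [curl] <;> ring
    map_smul' := fun c L => by ext i; fin_cases i <;> simp [curl] <;> ring }

theorem curlCLM_apply (L : E3 →L[ℝ] E3) : curlCLM L = curl L := rfl

theorem contDiff_cross {E : Type*} [NormedAddCommGroup E] [NormedSpace ℝ E] {f h : E → E3}
    {n : WithTop ℕ∞} (hf : ContDiff ℝ n f) (hh : ContDiff ℝ n h) :
    ContDiff ℝ n fun x => cross (f x) (h x) := by
  rw [contDiff_euclidean] at *
  intro i
  fin_cases i <;> simp [cross]
  · exact ((hf 1).mul (hh 2)).sub ((hf 2).mul (hh 1))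
  · exact ((hf 2).mul (hh 0)).sub ((hf 0).mul (hh 2))
  · exact ((hf 0).mul (hh 1)).sub ((hf 1).mul (hh 0))

/-- The cross product as a bilinear map. -/
def crossCLM : E3 →L[ℝ] E3 →L[ℝ] E3 := LinearMap.mkContinuous₂
  (LinearMap.mk₂ ℝ cross
    (fun _ _ _ => by ext i; fin_cases i <;> simp [cross] <;> ring)
    (fun _ _ _ => by ext i; fin_cases i <;> simp [cross] <;> ring)
    (fun _ _ _ => by ext i; fin_cases i <;> simp [cross] <;> ring)
    (fun _ _ _ => by ext i; fin_cases i <;> simp [cross] <;> ring)) 1 (fun a b => by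
      rw [one_mul]
      have h : ‖cross a b‖ ^ 2 ≤ (‖a‖ * ‖b‖) ^ 2 := by
        rw [mul_pow, EuclideanSpace.norm_sq_eq, EuclideanSpace.norm_sq_eq,
          EuclideanSpace.norm_sq_eq]
        simp only [Fin.sum_univ_three, Real.norm_eq_abs, sq_abs]
        simp [cross]
        nlinarith [sq_nonneg (a 0 * b 0 + a 1 * b 1 + a 2 * b 2)]
      exact abs_le_of_sq_le_sq' h (by positivity) |>.2)

theorem crossCLM_apply (a b : E3) : crossCLM a b = cross a b := rfl

/-- The potential is the usual homotopy integral of `t Y(tx) × x` over `0 ≤ t ≤ 1`. When the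
divergence of `Y` vanishes, the curl of the integrand is the derivative of `t² Y(tx)` with respect
to `t`, and its integral is `Y(x)`. -/
theorem exists_potential {Y : E3 → E3} (hY : ContDiff ℝ ∞ Y) {r : ℝ}
    (hdiv : ∀ x ∈ ball (0 : E3) r, tr3 (fderiv ℝ Y x) = 0) :
    ∃ A : E3 → E3, ContDiff ℝ ∞ A ∧ ∀ x ∈ ball (0 : E3) r, curl (fderiv ℝ A x) = Y x := by
  have hline : ContDiff ℝ ∞ fun p : E3 × ℝ => p.2 • p.1 := contDiff_snd.smul contDiff_fst
  set f : E3 × ℝ → E3 := fun p => p.2 • cross (Y (p.2 • p.1)) p.1 with hfdef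
  have hf : ContDiff ℝ ∞ f := contDiff_snd.smul (contDiff_cross (hY.comp hline) contDiff_fst)
  refine ⟨fun x => ∫ t in (0 : ℝ)..1, f (x, t), contDiff_integral_param hf 0 1, fun x hx => ?_⟩
  have hd := hasFDerivAt_integral_param (hf.of_le (by norm_cast) : ContDiff ℝ 1 f) 0 1 x
  rw [hd.fderiv]
  have hc' : Continuous fun t : ℝ => (fderiv ℝ f (x, t)).comp (ContinuousLinearMap.inl ℝ E3 ℝ) :=
    ((hf.continuous_fderiv (by simp)).comp (by fun_prop : Continuous fun t : ℝ => (x, t))).clm_comp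
      continuous_const
  rw [← curlCLM_apply, ← ContinuousLinearMap.intervalIntegral_comp_comm _
    (hc'.intervalIntegrable _ _)]
  have hYd : ∀ z, HasFDerivAt Y (fderiv ℝ Y z) z := fun z =>
    ((hY.differentiable (by simp)) z).hasFDerivAt
  have hpt : ∀ t ∈ Set.uIcc (0 : ℝ) 1, curlCLM ((fderiv ℝ f (x, t)).comp
      (ContinuousLinearMap.inl ℝ E3 ℝ)) = (2 * t) • Y (t • x) + t ^ 2 • fderiv ℝ Y (t • x) x := by
    intro t ht
    rw [uIcc_of_le zero_le_one] at ht
    have hfd : HasFDerivAt f (fderiv ℝ f (x, t)) (x, t) :=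
      ((hf.differentiable (by simp)) (x, t)).hasFDerivAt
    have hl : HasFDerivAt (fun z : E3 => (z, t)) (ContinuousLinearMap.inl ℝ E3 ℝ) x :=
      hasFDerivAt_prodMk_left x t
    have h0 : HasFDerivAt (fun z => f (z, t))
        ((fderiv ℝ f (x, t)).comp (ContinuousLinearMap.inl ℝ E3 ℝ)) x :=
      HasFDerivAt.comp (g := f) (f := fun z : E3 => (z, t)) x hfd hl
    have h1 : HasFDerivAt (fun z : E3 => t • z) (t • ContinuousLinearMap.id ℝ E3) x :=
      (t • ContinuousLinearMap.id ℝ E3).hasFDerivAt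
    have h2 : HasFDerivAt (fun z : E3 => Y (t • z))
        ((fderiv ℝ Y (t • x)).comp (t • ContinuousLinearMap.id ℝ E3)) x := (hYd (t • x)).comp x h1
    have h3 : HasFDerivAt (fun z => f (z, t)) _ x :=
      ((crossCLM.hasFDerivAt_of_bilinear h2 (hasFDerivAt_id x))).const_smul t
    rw [h0.unique h3, curlCLM_apply]
    have htr := hdiv (t • x) (by
      rw [mem_ball_zero_iff] at hx ⊢
      rw [norm_smul, Real.norm_of_nonneg ht.1]
      exact (mul_le_of_le_one_left (norm_nonneg _) ht.2).trans_lt hx)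
    generalize hB : fderiv ℝ Y (t • x) = B at htr
    generalize Y (t • x) = u
    have hB0 := clm_apply_coord B x 0
    have hB1 := clm_apply_coord B x 1
    have hB2 := clm_apply_coord B x 2
    simp only [tr3] at htr
    ext i
    fin_cases i <;> simp [curl, crossCLM_apply, cross, hB0, hB1, hB2]
    · linear_combination (-(t ^ 2) * x 0) * htr
    · linear_combination (-(t ^ 2) * x 1) * htr
    · linear_combination (-(t ^ 2) * x 2) * htr
  rw [intervalIntegral.integral_congr hpt]
  have hder : ∀ t ∈ Set.uIcc (0 : ℝ) 1, HasDerivAt (fun t : ℝ => t ^ 2 • Y (t • x))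
      ((2 * t) • Y (t • x) + t ^ 2 • fderiv ℝ Y (t • x) x) t := by
    intro t _
    have h1 : HasDerivAt (fun t : ℝ => t • x) x t := by
      simpa using (hasDerivAt_id t).smul_const x
    have h2 : HasDerivAt (fun t : ℝ => Y (t • x)) (fderiv ℝ Y (t • x) x) t :=
      (hYd (t • x)).comp_hasDerivAt t h1
    have h3 := ((hasDerivAt_id t).pow 2).smul h2
    refine h3.congr_deriv ?_
    simp [add_comm]
  rw [intervalIntegral.integral_eq_sub_of_hasDerivAt hder]
  · simp
  · apply Continuous.intervalIntegrable
    have c1 : Continuous fun t : ℝ => t • x := by fun_prop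
    have c2 : Continuous fun t : ℝ => fderiv ℝ Y (t • x) x :=
      ((hY.continuous_fderiv (by simp)).comp c1).clm_apply continuous_const
    have c3 : Continuous fun t : ℝ => Y (t • x) := hY.continuous.comp c1
    fun_prop

/-! ### One-forms -/

/-- The one-form dual to a vector field. -/
def formOf (A : E3 → E3) : DForm 1 := fun x =>
  (ContinuousAlternatingMap.ofSubsingletonLIE (0 : Fin 1) : (E3 →L[ℝ] ℝ) ≃ₗᵢ[ℝ] _)
    (innerSL ℝ (A x))

theorem formOf_apply (A : E3 → E3) (x : E3) (v : Fin 1 → E3) :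
    formOf A x v = inner ℝ (A x) (v 0) := rfl

theorem contDiff_formOf {A : E3 → E3} (hA : ContDiff ℝ ∞ A) : ContDiff ℝ ∞ (formOf A) :=
  (ContinuousAlternatingMap.ofSubsingletonLIE (0 : Fin 1) :
    (E3 →L[ℝ] ℝ) ≃ₗᵢ[ℝ] E3 [⋀^Fin 1]→L[ℝ] ℝ).contDiff.comp
    ((innerSL ℝ (E := E3)).contDiff.comp hA)

theorem tsupport_formOf_subset (A : E3 → E3) : tsupport (formOf A) ⊆ tsupport A := by
  refine closure_mono fun x hx h => hx ?_
  ext v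
  simp [formOf_apply, h]

theorem contDiff_extDeriv {k : ℕ} {η : DForm k} (hη : ContDiff ℝ ∞ η) :
    ContDiff ℝ ∞ (extDeriv η) := by
  have h : ContDiff ℝ ∞ (fderiv ℝ η) := hη.fderiv_right (by simp)
  exact ContDiff.comp (g := ContinuousAlternatingMap.alternatizeUncurryFinCLM ℝ E3 ℝ (n := k))
    (ContinuousLinearMap.contDiff _) h

theorem extDeriv_one_apply {η : DForm 1} {x : E3} (h : DifferentiableAt ℝ η x) (a b : E3) :
    extDeriv η x ![a, b] = fderiv ℝ (fun z => η z ![b]) x a - fderiv ℝ (fun z => η z ![a]) x b := by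
  rw [extDeriv_apply h, Fin.sum_univ_two]
  have h0 : (0 : Fin 2).removeNth ![a, b] = ![b] := by ext i : 1; fin_cases i; rfl
  have h1 : (1 : Fin 2).removeNth ![a, b] = ![a] := by ext i : 1; fin_cases i; rfl
  simp [h0, h1, sub_eq_add_neg]

theorem vec_extDeriv_formOf {A : E3 → E3} (hA : ContDiff ℝ ∞ A) (x : E3) :
    vec (extDeriv (formOf A) x) = curl (fderiv ℝ A x) := by
  have hd : DifferentiableAt ℝ (formOf A) x := (contDiff_formOf hA).differentiable (by simp) x
  have hAd : HasFDerivAt A (fderiv ℝ A x) x := (hA.differentiable (by simp) x).hasFDerivAt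
  have key : ∀ j v, fderiv ℝ (fun z => formOf A z ![bv j]) x v = fderiv ℝ A x v j := by
    intro j v
    have : (fun z => formOf A z ![bv j]) = fun z => A z j := by
      ext z; simp [formOf_apply, bv, EuclideanSpace.inner_single_right]
    rw [this]
    have h1 : HasFDerivAt (fun z => A z j) _ x :=
      (EuclideanSpace.proj j : E3 →L[ℝ] ℝ).hasFDerivAt.comp x hAd
    rw [h1.fderiv]; rfl
  ext i
  fin_cases i <;> simp [vec, extDeriv_one_apply hd, key, curl]

theorem continuous_vec : Continuous vec := by
  unfold vec
  refine (PiLp.continuous_toLp 2 _).comp (continuous_pi fun i => ?_)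
  fin_cases i <;> simp <;> exact continuous_eval_const _

theorem vec_sub (β γ : E3 [⋀^Fin 2]→L[ℝ] ℝ) : vec (β - γ) = vec β - vec γ := by
  ext i; fin_cases i <;> simp [vec]

theorem vec_smul (c : ℝ) (β : E3 [⋀^Fin 2]→L[ℝ] ℝ) : vec (c • β) = c • vec β := by
  ext i; fin_cases i <;> simp [vec]

theorem vec_zero : vec 0 = 0 := by
  ext i; fin_cases i <;> simp [vec]

/-! ### Comparing the Euclidean and the Riemannian area -/

/-- This is the calibration inequality `IsInner.abs_vol_le` for the unit vector in the direction of
the cross product itself. It bounds the Euclidean normal by the Riemannian area, so that bounded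
fields are integrable over currents of finite area. -/
theorem IsInner.norm_cross_le {B : E3 →L[ℝ] E3 →L[ℝ] ℝ} (h : IsInner B) (a b : E3) :
    gvol B * ‖cross a b‖ ≤ √‖B‖ * area2 B a b := by
  by_cases hc : cross a b = 0
  · rw [hc, norm_zero, mul_zero]
    exact mul_nonneg (Real.sqrt_nonneg _) (Real.sqrt_nonneg _)
  set c := cross a b with hcd
  have hBc := h.pos c hc
  have hs : 0 < √(B c c) := Real.sqrt_pos.mpr hBc
  have hN : B ((√(B c c))⁻¹ • c) ((√(B c c))⁻¹ • c) = 1 := by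
    simp only [map_smul, smul_apply, smul_eq_mul]
    rw [← mul_assoc, ← mul_inv, Real.mul_self_sqrt hBc.le, inv_mul_cancel₀ hBc.ne']
  have h1 := (le_abs_self _).trans (h.abs_vol_le hN a b)
  rw [det3_smul, ← inner_cross c a b, ← hcd, real_inner_self_eq_norm_sq] at h1
  have h2 : √(B c c) ≤ √‖B‖ * ‖c‖ := by
    rw [show √‖B‖ * ‖c‖ = √(‖B‖ * ‖c‖ ^ 2) by
      rw [Real.sqrt_mul (norm_nonneg B), Real.sqrt_sq (norm_nonneg c)]]
    refine Real.sqrt_le_sqrt ((le_abs_self _).trans ((B.le_opNorm₂ c c).trans_eq ?_))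
    ring
  have hcn : 0 < ‖c‖ := norm_pos_iff.mpr hc
  have h3 : gvol B * ‖c‖ ^ 2 ≤ √(B c c) * area2 B a b := by
    have := mul_le_mul_of_nonneg_left h1 hs.le
    rwa [show √(B c c) * (gvol B * ((√(B c c))⁻¹ * ‖c‖ ^ 2)) =
      gvol B * ‖c‖ ^ 2 * (√(B c c) * (√(B c c))⁻¹) by ring,
      mul_inv_cancel₀ hs.ne', mul_one] at this
  have h4 : gvol B * ‖c‖ ^ 2 ≤ √‖B‖ * ‖c‖ * area2 B a b :=
    h3.trans (mul_le_mul_of_nonneg_right h2 (Real.sqrt_nonneg _))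
  nlinarith

theorem IsMetricOn.exists_norm_cross_le {g : MetricField} {s K : Set E3} (h : IsMetricOn g s)
    (hK : IsCompact K) (hKs : K ⊆ s) :
    ∃ C, 0 ≤ C ∧ ∀ x ∈ K, ∀ a b, ‖cross a b‖ ≤ C * area2 (g x) a b := by
  have hc : ContinuousOn (fun x => √‖g x‖ / gvol (g x)) K := by
    refine ContinuousOn.div ?_ ?_ fun x hx => (h.isInner (hKs hx)).gvol_pos.ne'
    · have h1 : ContinuousOn (fun x => ‖g x‖) K :=
        (continuous_norm (E := E3 →L[ℝ] E3 →L[ℝ] ℝ)).comp_continuousOn (h.continuousOn.mono hKs)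
      exact Real.continuous_sqrt.comp_continuousOn h1
    · exact continuous_gvol.comp_continuousOn (h.continuousOn.mono hKs)
  obtain ⟨C, hC⟩ := hK.exists_bound_of_continuousOn hc
  refine ⟨max C 0, le_max_right _ _, fun x hx a b => ?_⟩
  have h1 := (h.isInner (hKs hx)).norm_cross_le a b
  have hp := (h.isInner (hKs hx)).gvol_pos
  have h2 : ‖cross a b‖ ≤ √‖g x‖ / gvol (g x) * area2 (g x) a b := by
    rw [div_mul_eq_mul_div, le_div_iff₀ hp]
    linarith
  refine h2.trans (mul_le_mul_of_nonneg_right ?_ (Real.sqrt_nonneg _))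
  exact ((le_abs_self _).trans (hC x hx)).trans (le_max_left _ _)

namespace RectCurrent
variable (T : RectCurrent)

theorem exists_norm_nrm_le {g : MetricField} {s K : Set E3} (h : IsMetricOn g s)
    (hK : IsCompact K) (hKs : K ⊆ s) :
    ∃ C, 0 ≤ C ∧ ∀ q, T.pt q ∈ K → ‖T.nrm q‖ ≤ C * T.dens g q := by
  obtain ⟨C, hC, h1⟩ := h.exists_norm_cross_le hK hKs
  refine ⟨C, hC, fun q hq => ?_⟩
  rw [nrm, norm_smul, dens, Real.norm_eq_abs]
  have := mul_le_mul_of_nonneg_left (h1 _ hq (T.d0 q) (T.d1 q)) (abs_nonneg (T.mult q.1 : ℝ))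
  linarith

theorem measurable_dens {g : MetricField} (hg : Measurable g) : Measurable (T.dens g) := by
  have hm : Measurable fun q : ℕ × E2 => |(T.mult q.1 : ℝ)| :=
    (measurable_from_top (f := fun i : ℕ => |(T.mult i : ℝ)|)).comp measurable_fst
  have hB : Measurable fun q => g (T.pt q) := hg.comp T.measurable_pt
  have key : ∀ {a b : ℕ × E2 → E3}, Measurable a → Measurable b →
      Measurable fun q => g (T.pt q) (a q) (b q) := by
    intro a b ha hb
    have hc : Continuous fun z : (E3 →L[ℝ] E3 →L[ℝ] ℝ) × E3 × E3 => z.1 z.2.1 z.2.2 := by fun_prop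
    exact hc.measurable.comp (hB.prodMk (ha.prodMk hb))
  unfold dens area2
  exact hm.mul ((((key T.measurable_d0 T.measurable_d0).mul (key T.measurable_d1 T.measurable_d1)).sub
    ((key T.measurable_d0 T.measurable_d1).pow_const 2)).sqrt)

theorem measurable_indicator_metric {g : MetricField} {K : Set E3} (hK : MeasurableSet K)
    (hg : ContinuousOn g K) : Measurable (K.indicator g) := by
  classical
  rw [← piecewise_eq_indicator]
  exact hg.measurable_piecewise continuousOn_const hK

theorem aemeasurable_dens {g : MetricField} {K : Set E3} (hK : MeasurableSet K)
    (hg : ContinuousOn g K) : AEMeasurable (T.dens g) (T.base.restrict (T.pt ⁻¹' K)) := by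
  refine ⟨_, T.measurable_dens (measurable_indicator_metric hK hg), ?_⟩
  refine (ae_restrict_iff' (T.measurable_pt hK)).mpr (ae_of_all _ fun q hq => ?_)
  simp only [dens]
  rw [indicator_of_mem (show T.pt q ∈ K from hq)]

theorem integrableOn_dens {g : MetricField} {K : Set E3} (hK : MeasurableSet K)
    (hg : ContinuousOn g K) (hfin : T.area g K < ⊤) :
    IntegrableOn (T.dens g) (T.pt ⁻¹' K) T.base := by
  refine ⟨(T.aemeasurable_dens hK hg).aestronglyMeasurable, ?_⟩
  rw [hasFiniteIntegral_iff_ofReal (ae_of_all _ fun q => T.dens_nonneg g q), ← T.area_eq g hK]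
  exact hfin

theorem integrableOn_form {g : MetricField} {s K : Set E3} (hg : IsMetricOn g s)
    (hK : IsCompact K) (hKs : K ⊆ s) (hfin : T.area g K < ⊤) {V : E3 → E3} (hV : Measurable V)
    {C : ℝ} (hb : ∀ x ∈ K, ‖V x‖ ≤ C) :
    IntegrableOn (fun q => inner ℝ (V (T.pt q)) (T.nrm q)) (T.pt ⁻¹' K) T.base := by
  obtain ⟨C', hC', h1⟩ := T.exists_norm_nrm_le hg hK hKs
  refine Integrable.mono' ((T.integrableOn_dens hK.measurableSet (hg.continuousOn.mono hKs)
    hfin).const_mul (C * C')) ?_ ?_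
  · exact ((hV.comp T.measurable_pt).inner T.measurable_nrm).aestronglyMeasurable
  · refine (ae_restrict_iff' (T.measurable_pt hK.measurableSet)).mpr (ae_of_all _ fun q hq => ?_)
    refine (norm_inner_le_norm _ _).trans ?_
    calc ‖V (T.pt q)‖ * ‖T.nrm q‖ ≤ C * (C' * T.dens g q) :=
          mul_le_mul (hb _ hq) (h1 q hq) (norm_nonneg _) ((norm_nonneg _).trans (hb _ hq))
      _ = _ := by ring

theorem integrable_form {g : MetricField} {s K : Set E3} (hg : IsMetricOn g s)
    (hK : IsCompact K) (hKs : K ⊆ s) (hfin : T.area g K < ⊤) {V : E3 → E3} (hV : Measurable V)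
    {C : ℝ} (hb : ∀ x ∈ K, ‖V x‖ ≤ C) (h0 : ∀ᵐ q ∂T.base, T.pt q ∉ K → V (T.pt q) = 0) :
    Integrable (fun q => inner ℝ (V (T.pt q)) (T.nrm q)) T.base := by
  have h1 := (T.integrableOn_form hg hK hKs hfin hV hb).integrable_indicator
    (T.measurable_pt hK.measurableSet)
  refine h1.congr (h0.mono fun q hq => ?_)
  by_cases hm : q ∈ T.pt ⁻¹' K
  · rw [indicator_of_mem hm]
  · simp [indicator_of_notMem hm, hq hm]

/-- The current is calibrated by `ν` off the axis. -/
def IsCalibrated (g : MetricField) (ν : E3 → E3) : Prop :=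
  ∀ᵐ q ∂T.base, T.pt q ∈ unitBall \ zAxis →
    T.dens g q = inner ℝ (calib g ν (T.pt q)) (T.nrm q)

/-- The comass of the calibrating form is at most one, with the multiplicity of the current
included. -/
theorem inner_calib_le {g : MetricField} {ν : E3 → E3} (hg : IsMetricOn g unitBall)
    (hu : ∀ p ∈ unitBall \ zAxis, g p (ν p) (ν p) = 1) {q : ℕ × E2} {x : E3}
    (hx : x ∈ unitBall \ zAxis) : inner ℝ (calib g ν x) (T.nrm q) ≤
      |(T.mult q.1 : ℝ)| * area2 (g x) (T.d0 q) (T.d1 q) := by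
  rw [inner_nrm, calib, det3_smul]
  refine (le_abs_self _).trans ?_
  rw [abs_mul]
  exact mul_le_mul_of_nonneg_left ((hg.isInner hx.1).abs_vol_le (hu x hx) _ _) (abs_nonneg _)

variable {T}

theorem IsOrientedBy.isCalibrated {g : MetricField} {ν : E3 → E3} {m : E3 → ℕ}
    (h : T.IsOrientedBy g ν m) (hg : IsMetricOn g unitBall)
    (hu : ∀ p ∈ unitBall \ zAxis, g p (ν p) (ν p) = 1) : T.IsCalibrated g ν := by
  filter_upwards [T.ae_base_mem] with q hq hx
  have hpt : T.pt q = T.param q.1 q.2 := T.pt_of_mem hq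
  rw [inner_nrm, calib, det3_smul, dens]
  have hm : (0 : ℝ) ≤ T.mult q.1 := by
    rw [h.mult_eq q.1 q.2 hq]; positivity
  rw [abs_of_nonneg hm]
  congr 1
  symm
  refine (hg.isInner hx.1).vol_eq_area (hu _ hx) ?_ ?_ ?_
  · rw [hpt]; exact h.normal q.1 q.2 hq 0
  · rw [hpt]; exact h.normal q.1 q.2 hq 1
  · have := h.positive q.1 q.2 hq
    rw [det3_eq_basis_det] at this
    rw [hpt]; exact this.le

end RectCurrent

/-! ### The calibration argument in the closed ball -/

theorem isCompact_closedUnitBall : IsCompact closedUnitBall := isCompact_closedBall _ _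

theorem unitBall_subset_closedUnitBall : unitBall ⊆ closedUnitBall := ball_subset_closedBall

/-- It suffices to test with the inner product with `V` itself. The averaging property is thereby
converted into a bound of the norm. -/
theorem norm_le_of_average {V : E3} {C : ℝ} (hC : 0 ≤ C)
    (h : ∀ l : E3 →L[ℝ] ℝ, l V ≤ C * ‖l‖) : ‖V‖ ≤ C := by
  have h1 := h (innerSL ℝ V)
  rw [innerSL_apply_norm, innerSL_apply_apply, real_inner_self_eq_norm_sq] at h1
  rcases (norm_nonneg V).eq_or_lt with h0 | h0
  · rwa [← h0]
  · nlinarith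

theorem exists_norm_le_of_average (hgb : IsMetricOn gbar closedUnitBall)
    (he : EqOn gbar g unitBall) (hu : ∀ p ∈ unitBall \ zAxis, g p (ν p) (ν p) = 1)
    {Y : ℕ → E3 → E3}
    (hY : ∀ (n : ℕ), ∀ x ∈ closedUnitBall, ∀ (l : E3 →L[ℝ] ℝ) (C : ℝ),
        (∀ q ∈ unitBall \ zAxis, dist q x < 3 / ((n : ℝ) + 3) → l (calib g ν q) ≤ C) →
        l (Y n x) ≤ C) : ∃ C, 0 ≤ C ∧ ∀ n, ∀ x ∈ closedUnitBall, ‖Y n x‖ ≤ C := by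
  obtain ⟨C, hC, hb⟩ := exists_norm_calib_le hgb he isCompact_closedUnitBall Subset.rfl hu
  refine ⟨C, hC, fun n x hx => norm_le_of_average hC fun l => hY n x hx l _ fun q hq _ => ?_⟩
  have := hb q (unitBall_subset_closedUnitBall hq.1)
  rw [calib₀_of_mem hq] at this
  exact ((le_abs_self _).trans (l.le_opNorm _)).trans (by
    rw [mul_comm]; exact mul_le_mul_of_nonneg_right this (norm_nonneg _))

namespace RectCurrent

/-- The field is the curl of a potential on a ball larger than the closed unit ball. Multiplying the
potential by a cutoff that is one near the closed unit ball gives a test one-form in `ℝ³` without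
changing the curl where the currents live, and the equality of the boundaries applies. -/
theorem integral_mollification_eq {S T : RectCurrent}
    (hgb : IsMetricOn gbar closedUnitBall)
    (hS : S.carrier ⊆ closedUnitBall) (hT : T.carrier ⊆ closedUnitBall)
    (hSf : S.area gbar univ < ⊤) (hTf : T.area gbar univ < ⊤) (hST : S.SameBoundary T univ)
    {Y : E3 → E3} (hY : ContDiff ℝ ∞ Y) {r : ℝ} (hr : 1 < r)
    (hdiv : ∀ x ∈ ball (0 : E3) r, tr3 (fderiv ℝ Y x) = 0) :
    ∫ q, inner ℝ (Y (S.pt q)) (S.nrm q) ∂S.base = ∫ q, inner ℝ (Y (T.pt q)) (T.nrm q) ∂T.base := by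
  obtain ⟨A, hA, hcurl⟩ := exists_potential hY hdiv
  obtain ⟨χ, hχ, hχc, -, hχ1, -⟩ := exists_cutoff isCompact_closedUnitBall isOpen_univ
    (subset_univ _)
  have hA' : ContDiff ℝ ∞ fun x => χ x • A x := hχ.smul hA
  have hcs : HasCompactSupport fun x => χ x • A x := hχc.smul_right
  have htest : IsTestForm univ (formOf fun x => χ x • A x) :=
    ⟨contDiff_formOf hA', hcs.of_isClosed_subset (isClosed_tsupport _) (tsupport_formOf_subset _),
      subset_univ _⟩
  have hval : ∀ x ∈ closedUnitBall, vec (extDeriv (formOf fun x => χ x • A x) x) = Y x := by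
    intro x hx
    rw [vec_extDeriv_formOf hA', ← hcurl x (closedBall_subset_ball hr hx)]
    congr 1
    refine Filter.EventuallyEq.fderiv_eq ?_
    have h1 := hχ1.filter_mono (nhds_le_nhdsSet hx)
    filter_upwards [h1] with z hz
    rw [hz, one_smul]
  have key : ∀ S : RectCurrent, S.carrier ⊆ closedUnitBall → S.area gbar univ < ⊤ →
      S.eval (extDeriv (formOf fun x => χ x • A x)) =
        ∫ q, inner ℝ (Y (S.pt q)) (S.nrm q) ∂S.base := by
    intro S hS hSf
    have hmem : ∀ᵐ q ∂S.base, S.pt q ∈ closedUnitBall :=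
      S.ae_pt_mem_carrier.mono fun q hq => hS hq
    obtain ⟨C, hC⟩ := isCompact_closedUnitBall.exists_bound_of_continuousOn hY.continuous.continuousOn
    have hitg : Integrable (fun q => inner ℝ (Y (S.pt q)) (S.nrm q)) S.base :=
      S.integrable_form hgb isCompact_closedUnitBall Subset.rfl
        ((S.area_mono gbar (subset_univ _)).trans_lt hSf) hY.continuous.measurable hC
        (hmem.mono fun q hq h => absurd hq h)
    have heq : (fun q => inner ℝ (Y (S.pt q)) (S.nrm q)) =ᵐ[S.base] fun q =>
        inner ℝ (vec (extDeriv (formOf fun x => χ x • A x) (S.pt q))) (S.nrm q) :=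
      hmem.mono fun q hq => by
        change _ = inner ℝ (vec (extDeriv (formOf fun x => χ x • A x) (S.pt q))) (S.nrm q)
        rw [hval _ hq]
    rw [S.eval_eq (hitg.congr heq)]
    exact integral_congr_ae heq.symm
  rw [← key S hS hSf, ← key T hT hTf]
  exact hST _ htest

/-- The integrand of the calibration where it is defined, and the area density elsewhere. -/
def calibDens (S : RectCurrent) (g gbar : MetricField) (ν : E3 → E3) (q : ℕ × E2) : ℝ :=
  open Classical in
  if S.pt q ∈ unitBall \ zAxis then inner ℝ (calib g ν (S.pt q)) (S.nrm q) else S.dens gbar q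

theorem calibDens_le (S : RectCurrent) (hg : IsMetricOn g unitBall) (he : EqOn gbar g unitBall)
    (hu : ∀ p ∈ unitBall \ zAxis, g p (ν p) (ν p) = 1) (q : ℕ × E2) :
    S.calibDens g gbar ν q ≤ S.dens gbar q := by
  unfold calibDens
  split_ifs with h
  · rw [dens, he h.1]
    exact S.inner_calib_le hg hu h
  · exact le_rfl

theorem integrable_dens_of_carrier {S : RectCurrent} (hgb : IsMetricOn gbar closedUnitBall)
    (hS : S.carrier ⊆ closedUnitBall) (hSf : S.area gbar univ < ⊤) :
    Integrable (S.dens gbar) S.base := by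
  have h := S.integrableOn_dens isCompact_closedUnitBall.measurableSet hgb.continuousOn
    ((S.area_mono gbar (subset_univ _)).trans_lt hSf)
  have hm : ∀ᵐ q ∂S.base, q ∈ S.pt ⁻¹' closedUnitBall :=
    S.ae_pt_mem_carrier.mono fun q hq => hS hq
  rwa [IntegrableOn, Measure.restrict_eq_self_of_ae_mem hm] at h

theorem integrable_calibDens {S : RectCurrent} (hg : IsMetricOn g unitBall)
    (hgb : IsMetricOn gbar closedUnitBall) (he : EqOn gbar g unitBall)
    (hν : R.IsUnitNormal g ν)
    (hS : S.carrier ⊆ closedUnitBall) (hSf : S.area gbar univ < ⊤) :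
    Integrable (S.calibDens g gbar ν) S.base := by
  have hd := integrable_dens_of_carrier hgb hS hSf
  obtain ⟨C, hC, hb⟩ := exists_norm_calib_le hgb he isCompact_closedUnitBall Subset.rfl hν.unit
  have hmem : ∀ᵐ q ∂S.base, S.pt q ∈ closedUnitBall :=
    S.ae_pt_mem_carrier.mono fun q hq => hS hq
  have h0 : Integrable (fun q => inner ℝ (calib₀ g ν (S.pt q)) (S.nrm q)) S.base :=
    S.integrable_form hgb isCompact_closedUnitBall Subset.rfl
      ((S.area_mono gbar (subset_univ _)).trans_lt hSf) (measurable_calib₀ hg hν.lipschitz) hb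
      (hmem.mono fun q hq h => absurd hq h)
  have hm : MeasurableSet (S.pt ⁻¹' (unitBall \ zAxis)) :=
    S.measurable_pt isOpen_offAxis.measurableSet
  refine (h0.add (hd.indicator hm.compl)).congr (ae_of_all _ fun q => ?_)
  simp only [Pi.add_apply, calibDens]
  by_cases h : S.pt q ∈ unitBall \ zAxis
  · rw [if_pos h, calib₀_of_mem h, indicator_of_notMem (by simpa using h), add_zero]
  · rw [if_neg h, calib₀, indicator_of_notMem h, inner_zero_left, zero_add, indicator_of_mem h]

/-- The approximations of `calib` have the same flux through both currents. As `T` lies in the open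
ball and does not charge the axis, its flux converges to its area. The flux through `S` is bounded
above in the limit, by the flux of `calib` off the axis in the ball and by the area density on the
sphere, where the approximations need not converge. -/
theorem toReal_area_le_integral_calibDens {S T : RectCurrent} (hg : IsMetricOn g unitBall)
    (hν : R.IsUnitNormal g ν) (hmin : R.IsMinimal g ν)
    (hgb : IsMetricOn gbar closedUnitBall) (he : EqOn gbar g unitBall)
    (hS : S.carrier ⊆ closedUnitBall) (hT : T.carrier ⊆ unitBall)
    (hSf : S.area gbar univ < ⊤) (hTf : T.area gbar univ < ⊤) (hST : S.SameBoundary T univ)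
    (hcal : T.IsCalibrated g ν) :
    (T.area gbar univ).toReal ≤ ∫ q, S.calibDens g gbar ν q ∂S.base := by
  obtain ⟨Y, hYs, hYd, hYa⟩ := exists_mollification hg hν hmin
  obtain ⟨C, hC, hYb⟩ := exists_norm_le_of_average hgb he hν.unit hYa
  have hT' := hT.trans unitBall_subset_closedUnitBall
  have hYeq : ∀ n, ∫ q, inner ℝ (Y n (S.pt q)) (S.nrm q) ∂S.base =
      ∫ q, inner ℝ (Y n (T.pt q)) (T.nrm q) ∂T.base := fun n => by
    obtain ⟨r, hr, hd⟩ := hYd n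
    exact integral_mollification_eq hgb hS hT' hSf hTf hST (hYs n) hr hd
  have hmS : ∀ᵐ q ∂S.base, S.pt q ∈ closedUnitBall :=
    S.ae_pt_mem_carrier.mono fun q hq => hS hq
  have hmT : ∀ᵐ q ∂T.base, T.pt q ∈ unitBall \ zAxis := by
    filter_upwards [T.ae_pt_mem_carrier, T.ae_pt_notMem_zAxis] with q h1 h2 using ⟨hT h1, h2⟩
  have hTlim : Tendsto (fun n => ∫ q, inner ℝ (Y n (T.pt q)) (T.nrm q) ∂T.base) atTop
      (𝓝 (T.area gbar univ).toReal) := by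
    have h1 : (T.area gbar univ).toReal = ∫ q, inner ℝ (calib g ν (T.pt q)) (T.nrm q) ∂T.base := by
      rw [T.area_univ_eq, ← integral_eq_lintegral_of_nonneg_ae
        (ae_of_all _ fun q => T.dens_nonneg gbar q)
        (integrable_dens_of_carrier hgb hT' hTf).aestronglyMeasurable]
      refine integral_congr_ae ?_
      filter_upwards [hmT, hcal] with q hq hc
      rw [← hc hq, dens, dens, he hq.1]
    rw [h1]
    obtain ⟨C', hC', hn⟩ := T.exists_norm_nrm_le hgb isCompact_closedUnitBall Subset.rfl
    refine tendsto_integral_of_dominated_convergence (fun q => C * (C' * T.dens gbar q))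
      (fun n => (((hYs n).continuous.measurable.comp T.measurable_pt).inner
        T.measurable_nrm).aestronglyMeasurable)
      (((integrable_dens_of_carrier hgb hT' hTf).const_mul C').const_mul C) ?_ ?_
    · intro n
      filter_upwards [hmT] with q hq
      have hq' := unitBall_subset_closedUnitBall hq.1
      exact (norm_inner_le_norm _ _).trans (mul_le_mul (hYb n _ hq') (hn q hq') (norm_nonneg _) hC)
    · filter_upwards [hmT] with q hq
      exact ((tendsto_of_average hg hν hYa hq).inner tendsto_const_nhds)
  have hcd := integrable_calibDens hg hgb he hν hS hSf
  have hdS := integrable_dens_of_carrier hgb hS hSf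
  obtain ⟨C', hC', hn⟩ := S.exists_norm_nrm_le hgb isCompact_closedUnitBall Subset.rfl
  have hYint : ∀ n, Integrable (fun q => inner ℝ (Y n (S.pt q)) (S.nrm q)) S.base := fun n =>
    S.integrable_form hgb isCompact_closedUnitBall Subset.rfl
      ((S.area_mono gbar (subset_univ _)).trans_lt hSf) (hYs n).continuous.measurable (hYb n)
      (hmS.mono fun q hq h => absurd hq h)
  have hexi : ∀ n, Integrable (fun q => max (inner ℝ (Y n (S.pt q)) (S.nrm q) -
      S.calibDens g gbar ν q) 0) S.base := fun n =>
    ((hYint n).sub hcd).sup (integrable_zero _ _ _)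
  -- Only the excess over `calibDens` is controlled, since on the sphere there is an upper bound but
  -- no limit. The positive part tends to zero pointwise and is dominated by a multiple of the area
  -- density plus `|calibDens|`.
  have hexc : Tendsto (fun n => ∫ q, max (inner ℝ (Y n (S.pt q)) (S.nrm q) -
      S.calibDens g gbar ν q) 0 ∂S.base) atTop (𝓝 0) := by
    rw [show (𝓝 (0 : ℝ)) = 𝓝 (∫ _, (0 : ℝ) ∂S.base) by rw [integral_zero]]
    refine tendsto_integral_of_dominated_convergence
      (fun q => C * (C' * S.dens gbar q) + |S.calibDens g gbar ν q|)
      (fun n => (hexi n).aestronglyMeasurable)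
      (((hdS.const_mul C').const_mul C).add hcd.abs) ?_ ?_
    · intro n
      filter_upwards [hmS] with q hq
      have h1 : |inner ℝ (Y n (S.pt q)) (S.nrm q)| ≤ C * (C' * S.dens gbar q) :=
        (abs_real_inner_le_norm _ _).trans
          (mul_le_mul (hYb n _ hq) (hn q hq) (norm_nonneg _) hC)
      rw [Real.norm_of_nonneg (le_max_right _ _)]
      refine max_le ?_ (add_nonneg ((abs_nonneg _).trans h1) (abs_nonneg _))
      have h2 := neg_abs_le (S.calibDens g gbar ν q)
      have h3 := le_abs_self (inner ℝ (Y n (S.pt q)) (S.nrm q))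
      linarith
    · filter_upwards [hmS] with q hq
      by_cases hx : S.pt q ∈ unitBall \ zAxis
      · simp only [calibDens, if_pos hx]
        have h1 := ((tendsto_of_average hg hν hYa hx).inner
          (tendsto_const_nhds (x := S.nrm q))).sub_const (inner ℝ (calib g ν (S.pt q)) (S.nrm q))
        rw [sub_self] at h1
        simpa using h1.max (tendsto_const_nhds (x := (0 : ℝ)))
      -- On the sphere or the axis the approximation averages values of `calib` at nearby points of
      -- the ball off the axis. Each of them has flux at most the area density computed with the
      -- metric there, and by continuity of `gbar` this is close to the area density at the point
      -- itself.
      · simp only [calibDens, if_neg hx]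
        rw [Metric.tendsto_atTop]
        intro ε hε
        have hcont : ContinuousOn (fun x => |(S.mult q.1 : ℝ)| *
            area2 (gbar x) (S.d0 q) (S.d1 q)) closedUnitBall := by
          have hc : Continuous fun B : E3 →L[ℝ] E3 →L[ℝ] ℝ => area2 B (S.d0 q) (S.d1 q) := by
            unfold area2; fun_prop
          exact continuousOn_const.mul (hc.comp_continuousOn hgb.continuousOn)
        obtain ⟨δ, hδ, hδ'⟩ := Metric.continuousOn_iff.mp hcont _ hq (ε / 2) (half_pos hε)
        obtain ⟨N, hN⟩ := exists_nat_gt (3 / δ)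
        refine ⟨N, fun n hnN => ?_⟩
        have hle : inner ℝ (Y n (S.pt q)) (S.nrm q) ≤ S.dens gbar q + ε / 2 := by
          rw [real_inner_comm]
          refine hYa n _ hq (innerSL ℝ (S.nrm q)) _ fun x hx' hd => ?_
          rw [innerSL_apply_apply, real_inner_comm]
          refine (S.inner_calib_le hg hν.unit hx').trans ?_
          rw [← he hx'.1]
          have hd' : dist x (S.pt q) < δ := by
            refine hd.trans ?_
            have : (N : ℝ) ≤ n := by exact_mod_cast hnN
            rw [div_lt_iff₀ (by positivity)]
            rw [div_lt_iff₀ hδ] at hN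
            nlinarith
          have h4 := hδ' x (unitBall_subset_closedUnitBall hx'.1) hd'
          rw [Real.dist_eq] at h4
          have := (abs_lt.mp h4).2
          simp only [dens]
          linarith
        rw [Real.dist_eq, sub_zero, abs_of_nonneg (le_max_right _ _)]
        exact max_lt (by linarith) hε
  have hlim : Tendsto (fun n => ∫ q, S.calibDens g gbar ν q ∂S.base +
      ∫ q, max (inner ℝ (Y n (S.pt q)) (S.nrm q) - S.calibDens g gbar ν q) 0 ∂S.base) atTop
      (𝓝 (∫ q, S.calibDens g gbar ν q ∂S.base)) := by
    simpa using tendsto_const_nhds.add hexc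
  refine le_of_tendsto_of_tendsto' hTlim hlim fun n => ?_
  rw [← hYeq n, ← integral_add hcd (hexi n)]
  refine integral_mono (hYint n) (hcd.add (hexi n)) fun q => ?_
  have := le_max_left (inner ℝ (Y n (S.pt q)) (S.nrm q) - S.calibDens g gbar ν q) 0
  simp only
  linarith

/-- Calibrated currents minimize area in the closed ball. -/
theorem IsCalibrated.area_le {S T : RectCurrent} (hcal : T.IsCalibrated g ν)
    (hg : IsMetricOn g unitBall)
    (hν : R.IsUnitNormal g ν) (hmin : R.IsMinimal g ν)
    (hgb : IsMetricOn gbar closedUnitBall) (he : EqOn gbar g unitBall)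
    (hS : S.carrier ⊆ closedUnitBall) (hT : T.carrier ⊆ unitBall)
    (hSf : S.area gbar univ < ⊤) (hTf : T.area gbar univ < ⊤) (hST : S.SameBoundary T univ) :
    T.area gbar univ ≤ S.area gbar univ := by
  rw [← ENNReal.toReal_le_toReal hTf.ne hSf.ne]
  refine (toReal_area_le_integral_calibDens hg hν hmin hgb he hS hT hSf hTf hST hcal).trans ?_
  have hdS := integrable_dens_of_carrier hgb hS hSf
  rw [S.area_univ_eq, ← integral_eq_lintegral_of_nonneg_ae
        (ae_of_all _ fun q => S.dens_nonneg gbar q) hdS.aestronglyMeasurable]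
  exact integral_mono (integrable_calibDens hg hgb he hν hS hSf) hdS
    fun q => S.calibDens_le hg he hν.unit q

/-- Currents with at most the area of a calibrated one are calibrated. -/
theorem IsCalibrated.of_area_le {S T : RectCurrent} (hcal : T.IsCalibrated g ν)
    (hg : IsMetricOn g unitBall)
    (hν : R.IsUnitNormal g ν) (hmin : R.IsMinimal g ν)
    (hgb : IsMetricOn gbar closedUnitBall) (he : EqOn gbar g unitBall)
    (hS : S.carrier ⊆ closedUnitBall) (hT : T.carrier ⊆ unitBall)
    (hSf : S.area gbar univ < ⊤) (hTf : T.area gbar univ < ⊤) (hST : S.SameBoundary T univ)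
    (hle : S.area gbar univ ≤ T.area gbar univ) : S.IsCalibrated g ν := by
  have h1 := toReal_area_le_integral_calibDens hg hν hmin hgb he hS hT hSf hTf hST hcal
  have hdS := integrable_dens_of_carrier hgb hS hSf
  have hcd := integrable_calibDens hg hgb he hν hS hSf
  rw [← ENNReal.toReal_le_toReal hSf.ne hTf.ne, S.area_univ_eq,
    ← integral_eq_lintegral_of_nonneg_ae
        (ae_of_all _ fun q => S.dens_nonneg gbar q) hdS.aestronglyMeasurable] at hle
  -- The area of `S` is at most that of `T`, which is at most the integral of `calibDens`, which is
  -- at most the area of `S`. A nonnegative function with zero integral vanishes almost everywhere.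
  have h2 : ∫ q, (S.dens gbar q - S.calibDens g gbar ν q) ∂S.base = 0 := by
    refine le_antisymm ?_ (integral_nonneg fun q => sub_nonneg.mpr
      (S.calibDens_le hg he hν.unit q))
    rw [integral_sub hdS hcd]
    linarith
  rw [integral_eq_zero_iff_of_nonneg (fun q => sub_nonneg.mpr
      (S.calibDens_le hg he hν.unit q)) (hdS.sub hcd)] at h2
  filter_upwards [h2] with q hq hx
  simp only [calibDens, if_pos hx, Pi.zero_apply] at hq
  rw [dens, ← he hx.1]
  rw [dens] at hq
  linarith

end RectCurrent

/-! ### The calibration argument in the open ball -/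

theorem exists_norm_le_of_average_compact (hg : IsMetricOn g unitBall)
    (hu : ∀ p ∈ unitBall \ zAxis, g p (ν p) (ν p) = 1)
    {Y : ℕ → E3 → E3}
    (hY : ∀ (n : ℕ), ∀ x ∈ closedUnitBall, ∀ (l : E3 →L[ℝ] ℝ) (C : ℝ),
        (∀ q ∈ unitBall \ zAxis, dist q x < 3 / ((n : ℝ) + 3) → l (calib g ν q) ≤ C) →
        l (Y n x) ≤ C) {K : Set E3} (hK : IsCompact K) (hKB : K ⊆ unitBall) :
    ∃ C, 0 ≤ C ∧ ∀ᶠ n in atTop, ∀ x ∈ K, ‖Y n x‖ ≤ C := by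
  obtain ⟨δ, hδ, hsub⟩ := hK.exists_cthickening_subset_open isOpen_unitBall hKB
  obtain ⟨C, hC, hb⟩ := exists_norm_calib_le hg (fun _ _ => rfl) (hK.cthickening (r := δ)) hsub hu
  refine ⟨C, hC, ?_⟩
  obtain ⟨N, hN⟩ := exists_nat_gt (3 / δ)
  filter_upwards [eventually_ge_atTop N] with n hn x hx
  refine norm_le_of_average hC fun l =>
    hY n x (unitBall_subset_closedUnitBall (hKB hx)) l _ fun q hq hd => ?_
  have hd' : dist q x < δ := by
    refine hd.trans ?_
    have : (N : ℝ) ≤ n := by exact_mod_cast hn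
    rw [div_lt_iff₀ (by positivity)]
    rw [div_lt_iff₀ hδ] at hN
    nlinarith
  have := hb q (Metric.mem_cthickening_of_dist_le q x δ K hx hd'.le)
  rw [calib₀_of_mem hq] at this
  exact ((le_abs_self _).trans (l.le_opNorm _)).trans (by
    rw [mul_comm]; exact mul_le_mul_of_nonneg_right this (norm_nonneg _))

namespace RectCurrent

theorem IsLocallyFiniteIn.integrable_test {T : RectCurrent} {O : Set E3}
    (hT : T.IsLocallyFiniteIn g O) (hg : IsMetricOn g O) {V : E3 → E3}
    (hV : Continuous V) (hc : HasCompactSupport V) (hs : tsupport V ⊆ O) :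
    Integrable (fun q => inner ℝ (V (T.pt q)) (T.nrm q)) T.base := by
  obtain ⟨C, hC⟩ := hV.bounded_above_of_compact_support hc
  exact T.integrable_form hg hc hs (hT.area_lt_top _ hc hs) hV.measurable (fun x _ => hC x)
    (ae_of_all _ fun q hq => image_eq_zero_of_notMem_tsupport hq)

theorem IsLocallyFiniteIn.eval_test {T : RectCurrent} {O : Set E3}
    (hT : T.IsLocallyFiniteIn g O) (hg : IsMetricOn g O) {β : DForm 2} (hβ : IsTestForm O β) :
    Integrable (fun q => inner ℝ (vec (β (T.pt q))) (T.nrm q)) T.base ∧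
    T.eval β = ∫ q, inner ℝ (vec (β (T.pt q))) (T.nrm q) ∂T.base := by
  have hsub : tsupport (fun x => vec (β x)) ⊆ tsupport β :=
    closure_mono fun x hx h => hx (by simp only [h, vec_zero])
  have h := hT.integrable_test hg (V := fun x => vec (β x))
    (continuous_vec.comp hβ.smooth.continuous)
    (hβ.compact.of_isClosed_subset (isClosed_tsupport _) hsub) (hsub.trans hβ.support)
  exact ⟨h, T.eval_eq h⟩

/-- If `Y = curl A`, then `χ Y` corresponds to `d(χA) - dχ ∧ A`. The first form is exact with
compact support, so equality of the boundaries applies. The second vanishes near `K`, where `χ` is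
one, so it is evaluated where the currents coincide. -/
theorem integral_cutoff_mollification_eq {S T : RectCurrent} (hg : IsMetricOn g unitBall)
    (hS : S.IsLocallyFiniteIn g unitBall) (hT : T.IsLocallyFiniteIn g unitBall)
    {K : Set E3}
    (hSTe : S.EqualOn T (unitBall \ K)) (hST : S.SameBoundary T unitBall)
    {χ : E3 → ℝ} (hχ : ContDiff ℝ ∞ χ) (hχc : HasCompactSupport χ) (hχs : tsupport χ ⊆ unitBall)
    (hχ1 : ∀ᶠ x in 𝓝ˢ K, χ x = 1)
    {Y : E3 → E3} (hY : ContDiff ℝ ∞ Y) {r : ℝ} (hr : 1 < r)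
    (hdiv : ∀ x ∈ ball (0 : E3) r, tr3 (fderiv ℝ Y x) = 0) :
    ∫ q, inner ℝ (χ (S.pt q) • Y (S.pt q)) (S.nrm q) ∂S.base =
      ∫ q, inner ℝ (χ (T.pt q) • Y (T.pt q)) (T.nrm q) ∂T.base := by
  obtain ⟨A, hA, hcurl⟩ := exists_potential hY hdiv
  have hA' : ContDiff ℝ ∞ fun x => χ x • A x := hχ.smul hA
  have hsubA : tsupport (fun x => χ x • A x) ⊆ tsupport χ :=
    closure_mono fun x hx h => hx (by simp only [h, zero_smul])
  have hcs : HasCompactSupport fun x => χ x • A x := hχc.smul_right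
  have htest : IsTestForm unitBall (formOf fun x => χ x • A x) :=
    ⟨contDiff_formOf hA', hcs.of_isClosed_subset (isClosed_tsupport _) (tsupport_formOf_subset _),
      (tsupport_formOf_subset _).trans (hsubA.trans hχs)⟩
  set β₁ : DForm 2 := extDeriv (formOf fun x => χ x • A x) with hβ₁
  set β₂ : DForm 2 := fun x => β₁ x - χ x • extDeriv (formOf A) x with hβ₂
  have hd1 : ∀ x, x ∉ tsupport χ → β₁ x = 0 := by
    intro x hx
    have h0 : formOf (fun x => χ x • A x) =ᶠ[𝓝 x] fun _ => 0 := by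
      have := (notMem_tsupport_iff_eventuallyEq.mp hx)
      filter_upwards [this] with z hz
      ext v
      simp [formOf_apply, hz]
    rw [hβ₁]
    simp only [extDeriv]
    rw [h0.fderiv_eq]
    have h1 : fderiv ℝ (fun _ : E3 => (0 : E3 [⋀^Fin 1]→L[ℝ] ℝ)) x = 0 := by simp
    rw [h1]
    exact (ContinuousAlternatingMap.alternatizeUncurryFinCLM ℝ E3 ℝ (n := 1)).map_zero
  have ht1 : IsTestForm unitBall β₁ := by
    refine ⟨contDiff_extDeriv htest.smooth, ?_, ?_⟩
    · exact HasCompactSupport.intro' hχc (isClosed_tsupport _) hd1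
    · have hsub1 : tsupport β₁ ⊆ tsupport χ :=
        closure_minimal (fun x hx => by_contra fun h => hx (hd1 x h)) (isClosed_tsupport _)
      exact hsub1.trans hχs
  have hd2 : ∀ x, x ∉ tsupport χ → β₂ x = 0 := fun x hx => by
    rw [hβ₂]; simp only; rw [hd1 x hx, image_eq_zero_of_notMem_tsupport hx]; simp
  have hsub2 : tsupport β₂ ⊆ tsupport χ :=
    closure_minimal (fun x hx => by_contra fun h => hx (hd2 x h)) (isClosed_tsupport _)
  have hK2 : ∀ x ∈ K, x ∉ tsupport β₂ := by
    intro x hx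
    rw [notMem_tsupport_iff_eventuallyEq]
    have h1 : ∀ᶠ z in 𝓝 x, χ z = 1 := hχ1.filter_mono (nhds_le_nhdsSet hx)
    filter_upwards [h1.eventually_nhds] with z hz
    have h2 : formOf (fun x => χ x • A x) =ᶠ[𝓝 z] formOf A := by
      filter_upwards [hz] with w hw
      ext v
      simp [formOf_apply, hw]
    simp only [hβ₂, hβ₁, extDeriv, h2.fderiv_eq, hz.self_of_nhds, one_smul, sub_self, Pi.zero_apply]
  have ht2 : IsTestForm (unitBall \ K) β₂ :=
    ⟨(contDiff_extDeriv htest.smooth).sub (hχ.smul (contDiff_extDeriv (contDiff_formOf hA))),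
      hχc.of_isClosed_subset (isClosed_tsupport _) hsub2,
      fun x hx => ⟨hχs (hsub2 hx), fun h => hK2 x h hx⟩⟩
  have ht2' : IsTestForm unitBall β₂ := ⟨ht2.smooth, ht2.compact, ht2.support.trans sdiff_subset⟩
  have hpt : ∀ x, χ x • Y x = vec (β₁ x) - vec (β₂ x) := by
    intro x
    by_cases hx : x ∈ tsupport χ
    · rw [← vec_sub, hβ₂]
      simp only
      rw [sub_sub_cancel, vec_smul, vec_extDeriv_formOf hA, hcurl x
        (ball_subset_ball hr.le (hχs hx))]
    · rw [hd1 x hx, hd2 x hx, sub_self, image_eq_zero_of_notMem_tsupport hx, zero_smul]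
  have key : ∀ S : RectCurrent, S.IsLocallyFiniteIn g unitBall →
      ∫ q, inner ℝ (χ (S.pt q) • Y (S.pt q)) (S.nrm q) ∂S.base = S.eval β₁ - S.eval β₂ := by
    intro S hS
    rw [(hS.eval_test hg ht1).2, (hS.eval_test hg ht2').2,
      ← integral_sub (hS.eval_test hg ht1).1 (hS.eval_test hg ht2').1]
    refine integral_congr_ae (ae_of_all _ fun q => ?_)
    simp only
    rw [hpt, inner_sub_left]
  rw [key S hS, key T hT, hSTe β₂ ht2, hβ₁, hST _ htest]

/-- Dominated convergence on the support of `χ`; the exceptional set for pointwise convergence is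
the axis, which a rectifiable current does not charge. -/
theorem tendsto_integral_cutoff_mollification {T : RectCurrent} (hg : IsMetricOn g unitBall)
    (hν : R.IsUnitNormal g ν) (hT : T.IsLocallyFiniteIn g unitBall)
    {χ : E3 → ℝ} (hχ : ContDiff ℝ ∞ χ) (hχc : HasCompactSupport χ) (hχs : tsupport χ ⊆ unitBall)
    {Y : ℕ → E3 → E3} (hYs : ∀ n, ContDiff ℝ ∞ (Y n))
    (hY : ∀ (n : ℕ), ∀ x ∈ closedUnitBall, ∀ (l : E3 →L[ℝ] ℝ) (C : ℝ),
        (∀ q ∈ unitBall \ zAxis, dist q x < 3 / ((n : ℝ) + 3) → l (calib g ν q) ≤ C) →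
        l (Y n x) ≤ C) :
    Integrable (fun q => χ (T.pt q) * inner ℝ (calib g ν (T.pt q)) (T.nrm q)) T.base ∧
    Tendsto (fun n => ∫ q, inner ℝ (χ (T.pt q) • Y n (T.pt q)) (T.nrm q) ∂T.base) atTop
      (𝓝 (∫ q, χ (T.pt q) * inner ℝ (calib g ν (T.pt q)) (T.nrm q) ∂T.base)) := by
  obtain ⟨C, hC, hb⟩ := exists_norm_le_of_average_compact hg hν.unit hY hχc hχs
  obtain ⟨C', hC'⟩ := hχ.continuous.bounded_above_of_compact_support hχc
  have hmT : ∀ᵐ q ∂T.base, T.pt q ∈ unitBall \ zAxis := by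
    filter_upwards [T.ae_pt_mem_carrier, T.ae_pt_notMem_zAxis] with q h1 h2
      using ⟨hT.carrier_subset h1, h2⟩
  have hbd : Integrable (fun q => |χ (T.pt q)| * (C * ‖T.nrm q‖)) T.base := by
    obtain ⟨C'', hC'', hn⟩ := T.exists_norm_nrm_le hg hχc hχs
    have h1 := (T.integrableOn_dens hχc.measurableSet (hg.continuousOn.mono hχs)
      (hT.area_lt_top _ hχc hχs)).integrable_indicator (T.measurable_pt hχc.measurableSet)
    refine (h1.const_mul (C' * (C * C''))).mono'
      ((hχ.continuous.measurable.comp T.measurable_pt).norm.mul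
        (T.measurable_nrm.norm.const_mul C)).aestronglyMeasurable (ae_of_all _ fun q => ?_)
    rw [Real.norm_of_nonneg (by positivity)]
    by_cases hq : T.pt q ∈ tsupport χ
    · rw [indicator_of_mem (show q ∈ T.pt ⁻¹' tsupport χ from hq)]
      calc |χ (T.pt q)| * (C * ‖T.nrm q‖) ≤ C' * (C * (C'' * T.dens g q)) := by
            refine mul_le_mul (hC' _) (mul_le_mul_of_nonneg_left (hn q hq) hC) (by positivity)
              ((norm_nonneg _).trans (hC' (T.pt q)))
        _ = _ := by ring
    · rw [indicator_of_notMem (show q ∉ T.pt ⁻¹' tsupport χ from hq),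
        image_eq_zero_of_notMem_tsupport hq]
      simp
  have hlim : ∀ᵐ q ∂T.base, Tendsto (fun n => inner ℝ (χ (T.pt q) • Y n (T.pt q)) (T.nrm q)) atTop
      (𝓝 (χ (T.pt q) * inner ℝ (calib g ν (T.pt q)) (T.nrm q))) := by
    filter_upwards [hmT] with q hq
    simp_rw [real_inner_smul_left]
    exact ((tendsto_of_average hg hν hY hq).inner tendsto_const_nhds).const_mul _
  have hmeas : ∀ n, AEStronglyMeasurable
      (fun q => inner ℝ (χ (T.pt q) • Y n (T.pt q)) (T.nrm q)) T.base := fun n =>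
    (((hχ.smul (hYs n)).continuous.measurable.comp T.measurable_pt).inner
      T.measurable_nrm).aestronglyMeasurable
  have hle : ∀ᶠ n in atTop, ∀ᵐ q ∂T.base,
      ‖inner ℝ (χ (T.pt q) • Y n (T.pt q)) (T.nrm q)‖ ≤ |χ (T.pt q)| * (C * ‖T.nrm q‖) := by
    filter_upwards [hb] with n hn
    refine ae_of_all _ fun q => ?_
    rw [real_inner_smul_left, norm_mul, Real.norm_eq_abs]
    by_cases hq : T.pt q ∈ tsupport χ
    · exact mul_le_mul_of_nonneg_left ((norm_inner_le_norm _ _).trans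
        (mul_le_mul_of_nonneg_right (hn _ hq) (norm_nonneg _))) (abs_nonneg _)
    · rw [image_eq_zero_of_notMem_tsupport hq]; simp
  refine ⟨?_, tendsto_integral_filter_of_dominated_convergence _ (Eventually.of_forall hmeas) hle
    hbd hlim⟩
  refine hbd.mono' (aestronglyMeasurable_of_tendsto_ae atTop hmeas hlim) ?_
  obtain ⟨N, hN⟩ := eventually_atTop.mp hle
  have hle' : ∀ᵐ q ∂T.base, ∀ n, N ≤ n →
      ‖inner ℝ (χ (T.pt q) • Y n (T.pt q)) (T.nrm q)‖ ≤ |χ (T.pt q)| * (C * ‖T.nrm q‖) := by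
    rw [ae_all_iff]
    intro n
    by_cases hn : N ≤ n
    · filter_upwards [hN n hn] with q hq _ using hq
    · exact ae_of_all _ fun q h => absurd h hn
  filter_upwards [hlim, hle'] with q h1 h2
  exact le_of_tendsto h1.norm (eventually_atTop.mpr ⟨N, h2⟩)

/-- Calibrated currents minimize area in the open ball. -/
theorem IsCalibrated.isAreaMinimizingIn {T : RectCurrent} (hcal : T.IsCalibrated g ν)
    (hg : IsMetricOn g unitBall) (hν : R.IsUnitNormal g ν) (hmin : R.IsMinimal g ν)
    (hT : T.IsLocallyFiniteIn g unitBall) : T.IsAreaMinimizingIn g unitBall := by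
  refine ⟨hT, fun S hS W K hW hWc hWB hK hKW hSTe hST => ?_⟩
  obtain ⟨Y, hYs, hYd, hYa⟩ := exists_mollification hg hν hmin
  -- The calibration must be multiplied by a smooth cutoff, which is one near `K'` and supported in
  -- `W`. This compares the area of `T` in `K'` with that of `S` in `W`. Exhausting `W` by such
  -- compact sets containing `K` removes the discrepancy.
  have main : ∀ K', IsCompact K' → K ⊆ K' → K' ⊆ W → T.area g K' ≤ S.area g W := by
    intro K' hK' hKK' hK'W
    obtain ⟨χ, hχ, hχc, hχs, hχ1, hχm⟩ := exists_cutoff hK' hW hK'W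
    have hχB : tsupport χ ⊆ unitBall := hχs.trans (subset_closure.trans hWB)
    have hlT := tendsto_integral_cutoff_mollification hg hν hT hχ hχc hχB hYs hYa
    have hlS := tendsto_integral_cutoff_mollification hg hν hS hχ hχc hχB hYs hYa
    have heq := tendsto_nhds_unique (hlS.2.congr fun n => by
      obtain ⟨r, hr, hd⟩ := hYd n
      exact integral_cutoff_mollification_eq hg hS hT hSTe hST hχ hχc hχB
        (hχ1.filter_mono (nhdsSet_mono hKK')) (hYs n) hr hd) hlT.2
    have hmem : ∀ S : RectCurrent, S.IsLocallyFiniteIn g unitBall →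
        ∀ᵐ q ∂S.base, S.pt q ∈ unitBall \ zAxis := fun S hS => by
      filter_upwards [S.ae_pt_mem_carrier, S.ae_pt_notMem_zAxis] with q h1 h2
        using ⟨hS.carrier_subset h1, h2⟩
    have hTd : ∀ᵐ q ∂T.base, χ (T.pt q) * inner ℝ (calib g ν (T.pt q)) (T.nrm q) =
        χ (T.pt q) * T.dens g q := by
      filter_upwards [hmem T hT, hcal] with q hq hc
      rw [hc hq]
    have hSd : ∀ᵐ q ∂S.base, χ (S.pt q) * inner ℝ (calib g ν (S.pt q)) (S.nrm q) ≤
        χ (S.pt q) * S.dens g q := by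
      filter_upwards [hmem S hS] with q hq
      exact mul_le_mul_of_nonneg_left (S.inner_calib_le hg hν.unit hq) (hχm _).1
    have hSi : Integrable (fun q => χ (S.pt q) * S.dens g q) S.base := by
      have h1 := (S.integrableOn_dens hχc.measurableSet (hg.continuousOn.mono hχB)
        (hS.area_lt_top _ hχc hχB)).integrable_indicator (S.measurable_pt hχc.measurableSet)
      refine (h1.bdd_mul (c := 1)
        (hχ.continuous.measurable.comp S.measurable_pt).aestronglyMeasurable
        (ae_of_all _ fun q => ?_)).congr (ae_of_all _ fun q => ?_)
      · have := hχm (S.pt q)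
        simp only [Function.comp_apply, Real.norm_eq_abs, abs_of_nonneg this.1, this.2]
      · simp only [Function.comp_apply]
        by_cases hq : S.pt q ∈ tsupport χ
        · rw [indicator_of_mem (show q ∈ S.pt ⁻¹' tsupport χ from hq)]
        · rw [image_eq_zero_of_notMem_tsupport hq, zero_mul, zero_mul]
    calc T.area g K' = ∫⁻ q in T.pt ⁻¹' K', ofReal (T.dens g q) ∂T.base :=
          T.area_eq g hK'.measurableSet
      _ ≤ ∫⁻ q, ofReal (χ (T.pt q) * T.dens g q) ∂T.base := by
          rw [← lintegral_indicator (T.measurable_pt hK'.measurableSet)]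
          refine lintegral_mono fun q => ?_
          by_cases hq : q ∈ T.pt ⁻¹' K'
          · rw [indicator_of_mem hq,
              (hχ1.filter_mono (nhds_le_nhdsSet (show T.pt q ∈ K' from hq))).self_of_nhds, one_mul]
          · rw [indicator_of_notMem hq]; exact zero_le
      _ = ofReal (∫ q, χ (T.pt q) * inner ℝ (calib g ν (T.pt q)) (T.nrm q) ∂T.base) := by
          rw [integral_congr_ae hTd, ofReal_integral_eq_lintegral_ofReal (hlT.1.congr hTd)
            (ae_of_all _ fun q => mul_nonneg (hχm _).1 (T.dens_nonneg g q))]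
      _ = ofReal (∫ q, χ (S.pt q) * inner ℝ (calib g ν (S.pt q)) (S.nrm q) ∂S.base) := by
          rw [heq]
      _ ≤ ofReal (∫ q, χ (S.pt q) * S.dens g q ∂S.base) :=
          ofReal_le_ofReal (integral_mono_ae hlS.1 hSi hSd)
      _ = ∫⁻ q, ofReal (χ (S.pt q) * S.dens g q) ∂S.base :=
          ofReal_integral_eq_lintegral_ofReal hSi
            (ae_of_all _ fun q => mul_nonneg (hχm _).1 (S.dens_nonneg g q))
      _ ≤ S.area g W := by
          rw [S.area_eq g hW.measurableSet,
            ← lintegral_indicator (S.measurable_pt hW.measurableSet)]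
          refine lintegral_mono fun q => ?_
          by_cases hq : q ∈ S.pt ⁻¹' W
          · rw [indicator_of_mem hq]
            exact ofReal_le_ofReal
              (mul_le_of_le_one_left (S.dens_nonneg g q) (hχm _).2)
          · rw [image_eq_zero_of_notMem_tsupport (fun h => hq (hχs h)), zero_mul,
              ofReal_zero]
            exact zero_le
  obtain ⟨F, hFc, hFW, hFU, hFm⟩ := hW.exists_iUnion_isClosed
  have hWu : T.pt ⁻¹' W = ⋃ n, T.pt ⁻¹' (F n ∪ K) := by
    rw [← preimage_iUnion, ← iUnion_union, hFU, union_eq_left.mpr hKW]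
  have hcpt : ∀ n, IsCompact (F n ∪ K) := fun n =>
    (hWc.of_isClosed_subset (hFc n) ((hFW n).trans subset_closure)).union hK
  rw [T.area_eq g hW.measurableSet, hWu, setLIntegral_iUnion_of_directed]
  · refine iSup_le fun n => ?_
    rw [← T.area_eq g (hcpt n).measurableSet]
    exact main _ (hcpt n) subset_union_right (union_subset (hFW n) hKW)
  · exact Monotone.directed_le fun i j hij => preimage_mono (union_subset_union_left _ (hFm hij))

end RectCurrent

/-! ### Charts adapted to a plaque -/

theorem locallyLipschitzOn_conormal (hg : IsMetricOn g unitBall)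
    (hν : LocallyLipschitzOn (unitBall \ zAxis) ν) :
    LocallyLipschitzOn (unitBall \ zAxis) fun x => g x (ν x) := by
  have h1 : ContDiffOn ℝ 1 g unitBall := hg.smooth.of_le (by norm_cast)
  have h2 := (h1.locallyLipschitzOn (convex_ball _ _)).mono (sdiff_subset (t := zAxis))
  exact LocallyLipschitzOn.clm_apply₂ (ContinuousLinearMap.id ℝ (E3 →L[ℝ] E3 →L[ℝ] ℝ)) h2 hν

theorem continuousOn_conormal (hg : IsMetricOn g unitBall)
    (hν : LocallyLipschitzOn (unitBall \ zAxis) ν) :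
    ContinuousOn (fun x => g x (ν x)) (unitBall \ zAxis) :=
  (locallyLipschitzOn_conormal hg hν).continuousOn

theorem eq_smul_single (v : E2) :
    v = v 0 • EuclideanSpace.single 0 1 + v 1 • EuclideanSpace.single 1 1 := by
  ext i; fin_cases i <;> simp

theorem Foliation.IsUnitNormal.fderiv_eq_zero (hν : R.IsUnitNormal g ν)
    {φ : OpenPartialHomeomorph (E2 × ℝ) E3} (hφ : φ ∈ R.atlas) {q : E2 × ℝ} (hq : q ∈ φ.source)
    (v : E2) : g (φ q) (ν (φ q)) (fderiv ℝ (fun x => φ (x, q.2)) q.1 v) = 0 := by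
  have h0 := hν.normal φ hφ q hq 0
  have h1 := hν.normal φ hφ q hq 1
  unfold partialD at h0 h1
  rw [eq_smul_single v, map_add, map_smul, map_smul, map_add, map_smul, map_smul, h0, h1]
  simp

/-- A chart around `p` in which the plaque through `p` is the graph of `f`. The coordinates are
`y`, the first component of `Λ (x - p)`, and the height `s` over the graph. -/
structure LeafChart (R : Foliation (unitBall \ zAxis)) (g : MetricField) (ν : E3 → E3)
    (p : E3) where
  φ : OpenPartialHomeomorph (E2 × ℝ) E3
  φ_mem : φ ∈ R.atlas
  Λ : E3 ≃L[ℝ] E2 × ℝ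
  f : E2 → ℝ
  r : ℝ
  C : ℝ
  Λ_normal : Λ (ν p) = (0, 1)
  smooth_f : ContDiff ℝ ∞ f
  f_zero : f 0 = 0
  r_pos : 0 < r
  C_nonneg : 0 ≤ C
  mem_target : ∀ x, ‖(Λ (x - p)).1‖ < r → |(Λ (x - p)).2 - f (Λ (x - p)).1| < r → x ∈ φ.target
  plaque_iff : ∀ x, ‖(Λ (x - p)).1‖ < r → |(Λ (x - p)).2 - f (Λ (x - p)).1| < r →
    ((φ.symm x).2 = (φ.symm p).2 ↔ (Λ (x - p)).2 - f (Λ (x - p)).1 = 0)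
  transversal : ∀ x, ‖(Λ (x - p)).1‖ < r → |(Λ (x - p)).2 - f (Λ (x - p)).1| < r →
    1 / 2 ≤ g x (ν x) (ν p)
  slope_le : ∀ x, ‖(Λ (x - p)).1‖ < r → |(Λ (x - p)).2 - f (Λ (x - p)).1| < r → ∀ v,
    |g x (ν x) (Λ.symm (v, fderiv ℝ f (Λ (x - p)).1 v))| ≤
      C * ‖v‖ * |(Λ (x - p)).2 - f (Λ (x - p)).1|

namespace LeafChart
variable {p : E3} (c : LeafChart R g ν p)

/-- The horizontal coordinate. -/
def y (x : E3) : E2 := (c.Λ (x - p)).1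

/-- The height over the plaque. -/
def s (x : E3) : ℝ := (c.Λ (x - p)).2 - c.f (c.Λ (x - p)).1

/-- The inverse of `(y, s)`. -/
def pt (q : E2 × ℝ) : E3 := p + c.Λ.symm (q.1, q.2 + c.f q.1)

/-- The coordinate neighbourhood. -/
def O : Set E3 := {x | ‖c.y x‖ < c.r ∧ |c.s x| < c.r}

@[simp] theorem y_pt (q : E2 × ℝ) : c.y (c.pt q) = q.1 := by simp [y, pt]

@[simp] theorem s_pt (q : E2 × ℝ) : c.s (c.pt q) = q.2 := by simp [s, pt]

@[simp] theorem pt_ys (x : E3) : c.pt (c.y x, c.s x) = x := by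
  simp only [y, s, pt, sub_add_cancel, Prod.mk.eta, c.Λ.symm_apply_apply, add_sub_cancel]

theorem contDiff_y : ContDiff ℝ ∞ c.y :=
  contDiff_fst.comp (c.Λ.contDiff.comp (contDiff_id.sub contDiff_const))

theorem contDiff_s : ContDiff ℝ ∞ c.s :=
  (contDiff_snd.comp (c.Λ.contDiff.comp (contDiff_id.sub contDiff_const))).sub
    (c.smooth_f.comp c.contDiff_y)

theorem contDiff_pt : ContDiff ℝ ∞ c.pt :=
  contDiff_const.add (c.Λ.symm.contDiff.comp
    (contDiff_fst.prodMk (contDiff_snd.add (c.smooth_f.comp contDiff_fst))))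

theorem isOpen_O : IsOpen c.O :=
  (isOpen_lt c.contDiff_y.continuous.norm continuous_const).inter
    (isOpen_lt c.contDiff_s.continuous.abs continuous_const)

theorem y_self : c.y p = 0 := by simp [y]

theorem s_self : c.s p = 0 := by simp [s, c.f_zero]

theorem mem_O_self : p ∈ c.O := by
  refine ⟨?_, ?_⟩ <;> simp [y_self, s_self, c.r_pos]

theorem O_mem_nhds : c.O ∈ 𝓝 p := c.isOpen_O.mem_nhds c.mem_O_self

theorem O_subset_target : c.O ⊆ c.φ.target := fun x hx => c.mem_target x hx.1 hx.2

theorem O_subset : c.O ⊆ unitBall \ zAxis :=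
  (O_subset_target c).trans (R.target_subset c.φ_mem)

theorem mem_offAxis (c : LeafChart R g ν p) : p ∈ unitBall \ zAxis := c.O_subset c.mem_O_self

theorem plaque {x : E3} (hx : x ∈ c.O) : (c.φ.symm x).2 = (c.φ.symm p).2 ↔ c.s x = 0 :=
  c.plaque_iff x hx.1 hx.2

theorem half_le {x : E3} (hx : x ∈ c.O) : 1 / 2 ≤ g x (ν x) (ν p) := c.transversal x hx.1 hx.2

theorem slope {x : E3} (hx : x ∈ c.O) (v : E2) :
    |g x (ν x) (c.Λ.symm (v, fderiv ℝ c.f (c.y x) v))| ≤ c.C * ‖v‖ * |c.s x| :=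
  c.slope_le x hx.1 hx.2 v

theorem symm_eq (v : E2) (a : ℝ) : c.Λ.symm (v, a) = c.Λ.symm (v, 0) + a • ν p := by
  apply c.Λ.injective
  rw [map_add, map_smul, c.Λ_normal]
  simp

/-- A smaller chart. -/
def shrink {r' : ℝ} (h0 : 0 < r') (h : r' ≤ c.r) : LeafChart R g ν p :=
  { c with
    r := r'
    r_pos := h0
    mem_target := fun x h1 h2 => c.mem_target x (h1.trans_le h) (h2.trans_le h)
    plaque_iff := fun x h1 h2 => c.plaque_iff x (h1.trans_le h) (h2.trans_le h)
    transversal := fun x h1 h2 => c.transversal x (h1.trans_le h) (h2.trans_le h)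
    slope_le := fun x h1 h2 => c.slope_le x (h1.trans_le h) (h2.trans_le h) }

theorem exists_r {N : Set E3} (hN : N ∈ 𝓝 p) :
    ∃ r', 0 < r' ∧ r' ≤ c.r ∧ ∀ x, ‖c.y x‖ < r' → |c.s x| < r' → x ∈ N := by
  have hc : c.pt ⁻¹' N ∈ 𝓝 ((0, 0) : E2 × ℝ) :=
    c.contDiff_pt.continuous.continuousAt.preimage_mem_nhds (by
      have h0 : c.pt (0, 0) = p := by rw [pt, c.f_zero]; simp [← Prod.zero_eq_mk]
      rwa [h0])
  obtain ⟨ε, hε, hsub⟩ := Metric.mem_nhds_iff.mp hc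
  refine ⟨min ε c.r, lt_min hε c.r_pos, min_le_right _ _, fun x h1 h2 => ?_⟩
  have : ((c.y x, c.s x) : E2 × ℝ) ∈ ball ((0, 0) : E2 × ℝ) ε := by
    rw [← ball_prod_same]
    refine ⟨?_, ?_⟩
    · simpa using h1.trans_le (min_le_left _ _)
    · simpa using h2.trans_le (min_le_left _ _)
  simpa using hsub this

end LeafChart

theorem contDiff_mul_of_tsupport_subset {E : Type*} [NormedAddCommGroup E] [NormedSpace ℝ E]
    {χ f : E → ℝ} {V : Set E} (hχ : ContDiff ℝ ∞ χ) (hs : tsupport χ ⊆ V)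
    (hf : ∀ x ∈ V, ContDiffAt ℝ ∞ f x) : ContDiff ℝ ∞ fun x => χ x * f x := by
  rw [contDiff_iff_contDiffAt]
  intro x
  by_cases hx : x ∈ tsupport χ
  · exact hχ.contDiffAt.mul (hf x (hs hx))
  · refine contDiffAt_const (c := (0 : ℝ)) |>.congr_of_eventuallyEq ?_
    filter_upwards [notMem_tsupport_iff_eventuallyEq.mp hx] with z hz
    simp [hz]

/-- The coordinates spanned by the tangent plane of the plaque and the normal. -/
theorem exists_frame (hν : R.IsUnitNormal g ν) {φ : OpenPartialHomeomorph (E2 × ℝ) E3}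
    (hφ : φ ∈ R.atlas) {q : E2 × ℝ} (hq : q ∈ φ.source) :
    ∃ Λ : E3 ≃L[ℝ] E2 × ℝ, ∀ v a, Λ.symm (v, a) =
      fderiv ℝ (fun x => φ (x, q.2)) q.1 v + a • ν (φ q) := by
  set D := fderiv ℝ (fun x => φ (x, q.2)) q.1 with hD
  let L : E2 × ℝ →ₗ[ℝ] E3 :=
    (D : E2 →ₗ[ℝ] E3).coprod (LinearMap.toSpanSingleton ℝ E3 (ν (φ q)))
  have hL : ∀ z : E2 × ℝ, L z = D z.1 + z.2 • ν (φ q) := fun z => by simp [L]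
  have hinj : Function.Injective L := by
    rw [← LinearMap.ker_eq_bot, LinearMap.ker_eq_bot']
    intro z hz
    rw [hL] at hz
    have h1 : g (φ q) (ν (φ q)) (D z.1 + z.2 • ν (φ q)) = 0 := by rw [hz]; simp
    rw [map_add, hν.fderiv_eq_zero hφ hq, map_smul, hν.unit _ (R.map_mem hφ hq)] at h1
    have hz2 : z.2 = 0 := by simpa using h1
    rw [hz2, zero_smul, add_zero] at hz
    have hz1 : z.1 = 0 := R.immersive φ hφ q hq (by rw [← hD, hz, map_zero])
    exact Prod.ext hz1 hz2
  refine ⟨(L.linearEquivOfInjective hinj (by simp [Module.finrank_prod])).symm.toContinuousLinearEquiv,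
    fun v a => ?_⟩
  exact hL (v, a)

/-- The projection of the plaque along `ν p` is a local diffeomorphism by the inverse function
theorem, so the plaque is a smooth graph near `p`. Flow boxes are only continuous transversally, so
only this one plaque is straightened. The others are controlled through the Lipschitz continuity of
the conormal: their slope relative to the graph is bounded by a multiple of the height. -/
theorem exists_leafChart (hg : IsMetricOn g unitBall) (hν : R.IsUnitNormal g ν)
    {φ : OpenPartialHomeomorph (E2 × ℝ) E3} (hφ : φ ∈ R.atlas) {p : E3} (hp : p ∈ φ.target) :
    ∃ c : LeafChart R g ν p, c.φ = φ := by
  obtain ⟨q, hq, rfl⟩ : ∃ q, q ∈ φ.source ∧ φ q = p := ⟨φ.symm p, φ.map_target hp, φ.right_inv hp⟩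
  obtain ⟨Λ, hΛ⟩ := exists_frame hν hφ hq
  set p := φ q with hpq
  have hpΩ : p ∈ unitBall \ zAxis := R.map_mem hφ hq
  set F : E2 → E3 := fun x => φ (x, q.2) with hF
  have hFs : ∀ z, (z, q.2) ∈ φ.source → ContDiffAt ℝ ∞ F z := fun z hz =>
    R.contDiffAt_plaque hφ hz
  have hFq : F q.1 = p := rfl
  have hΛD : ∀ v, Λ (fderiv ℝ F q.1 v) = (v, 0) := fun v => by
    rw [← Λ.apply_symm_apply (v, (0 : ℝ)), hΛ]; simp
  have hΛν : Λ (ν p) = (0, 1) := by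
    rw [← Λ.apply_symm_apply ((0 : E2), (1 : ℝ)), hΛ]; simp
  set P : E3 →L[ℝ] E2 := (ContinuousLinearMap.fst ℝ E2 ℝ).comp (Λ : E3 →L[ℝ] E2 × ℝ) with hP
  set G : E2 → E2 := fun z => P (F z - p) with hG
  have hGs : ∀ z, (z, q.2) ∈ φ.source → ContDiffAt ℝ ∞ G z := fun z hz =>
    P.contDiff.contDiffAt.comp z ((hFs z hz).sub contDiffAt_const)
  have hGd : ∀ z, (z, q.2) ∈ φ.source → HasFDerivAt G (P.comp (fderiv ℝ F z)) z := fun z hz =>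
    P.hasFDerivAt.comp z ((((hFs z hz).differentiableAt (by simp)).hasFDerivAt).sub_const p)
  have hGd0 : HasFDerivAt G ((ContinuousLinearEquiv.refl ℝ E2 : E2 ≃L[ℝ] E2) : E2 →L[ℝ] E2) q.1 := by
    convert hGd q.1 hq using 1
    ext1 v
    simp [hP, hΛD]
  set e := (hGs q.1 hq).toOpenPartialHomeomorph G hGd0 (by simp) with he
  have hecoe : ∀ z, e z = G z := fun z => rfl
  have hes : q.1 ∈ e.source := ContDiffAt.mem_toOpenPartialHomeomorph_source _ _ _
  have hG0 : G q.1 = 0 := by simp [hG, hFq]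
  have h0t : (0 : E2) ∈ e.target := by rw [← hG0, ← hecoe]; exact e.map_source hes
  have he0 : e.symm 0 = q.1 := by rw [← hG0, ← hecoe]; exact e.left_inv hes
  have hsymc : ContinuousAt e.symm 0 := e.continuousAt_symm h0t
  have hinv : ∀ᶠ z in 𝓝 q.1, P.comp (fderiv ℝ F z) ∈
      range (ContinuousLinearEquiv.toContinuousLinearMap : (E2 ≃L[ℝ] E2) → E2 →L[ℝ] E2) := by
    have hc : ContinuousAt (fun z => P.comp (fderiv ℝ F z)) q.1 :=
      continuousAt_const.clm_comp ((hFs q.1 hq).continuousAt_fderiv (by simp))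
    refine hc.preimage_mem_nhds ?_
    rw [(hGd q.1 hq).unique hGd0]
    exact ContinuousLinearEquiv.nhds _
  have hsrc : ∀ᶠ z in 𝓝 q.1, (z, q.2) ∈ φ.source := R.eventually_mem_source hφ hq
  have hgood : ∀ᶠ w in 𝓝 (0 : E2), w ∈ e.target ∧ (e.symm w, q.2) ∈ φ.source ∧
      P.comp (fderiv ℝ F (e.symm w)) ∈
      range (ContinuousLinearEquiv.toContinuousLinearMap : (E2 ≃L[ℝ] E2) → E2 →L[ℝ] E2) := by
    have h1 : Tendsto e.symm (𝓝 0) (𝓝 q.1) := by rw [← he0]; exact hsymc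
    have h2 : ∀ᶠ w in 𝓝 (0 : E2), w ∈ e.target := e.open_target.mem_nhds h0t
    exact h2.and ((h1.eventually hsrc).and (h1.eventually hinv))
  obtain ⟨V, hVs, hVo, h0V⟩ := eventually_nhds_iff.mp hgood
  have hsym : ∀ w ∈ V, ContDiffAt ℝ ∞ e.symm w := fun w hw => by
    obtain ⟨h1, h2, A, hA⟩ := hVs w hw
    have h3 : HasFDerivAt e (A : E2 →L[ℝ] E2) (e.symm w) := by
      rw [show (A : E2 →L[ℝ] E2) = _ from hA]; exact hGd _ h2
    exact e.contDiffAt_symm h1 h3 (hGs _ h2)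
  obtain ⟨χ, hχ, hχc, hχs, hχ1, -⟩ := exists_cutoff (isCompact_singleton (x := (0 : E2))) hVo
    (by simpa using h0V)
  -- The graph function exists only near the origin. Multiplication by a cutoff makes it globally
  -- smooth, so that the chart becomes a diffeomorphism of the whole space; it agrees with the
  -- plaque only near `p`.
  set f₀ : E2 → ℝ := fun w => (Λ (F (e.symm w) - p)).2 with hf₀
  set f : E2 → ℝ := fun w => χ w * f₀ w with hf
  have hf₀s : ∀ w ∈ V, ContDiffAt ℝ ∞ f₀ w := fun w hw =>
    contDiff_snd.contDiffAt.comp w (Λ.contDiff.contDiffAt.comp w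
      (((hFs _ (hVs w hw).2.1).comp w (hsym w hw)).sub contDiffAt_const))
  have hfs : ContDiff ℝ ∞ f := contDiff_mul_of_tsupport_subset hχ hχs hf₀s
  have hχ1' : ∀ᶠ w in 𝓝 (0 : E2), χ w = 1 := by simpa using hχ1
  have hW : ∀ᶠ w in 𝓝 (0 : E2), w ∈ V ∧ f =ᶠ[𝓝 w] f₀ := by
    filter_upwards [hVo.mem_nhds h0V, hχ1'.eventually_nhds] with w h1 h2
    exact ⟨h1, h2.mono fun z hz => by simp [hf, hz]⟩
  -- the graph of `f` is the plaque
  have hgraph : ∀ w ∈ V, f₀ w = f w → p + Λ.symm (w, f w) = F (e.symm w) := fun w hw hfw => by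
    have : Λ (F (e.symm w) - p) = (w, f w) := by
      refine Prod.ext ?_ hfw
      exact e.right_inv (hVs w hw).1
    rw [← this]; simp
  have hf0 : f 0 = 0 := by
    have := hW.self_of_nhds.2.self_of_nhds
    rw [this, hf₀]; simp [he0, hFq]
  set yy : E3 → E2 := fun x => (Λ (x - p)).1 with hyy
  set ss : E3 → ℝ := fun x => (Λ (x - p)).2 - f (yy x) with hss
  have hyc : Continuous yy := by fun_prop
  have hyp : yy p = 0 := by simp [hyy]
  have hyt : Tendsto yy (𝓝 p) (𝓝 0) := by rw [← hyp]; exact hyc.continuousAt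
  have hptar : p ∈ φ.target := φ.map_source hq
  have hsymp : φ.symm p = q := φ.left_inv hq
  have hpl : ∀ᶠ x in 𝓝 p, x ∈ φ.target ∧ ((φ.symm x).2 = (φ.symm p).2 ↔ ss x = 0) := by
    have hφs : Tendsto (fun x => (φ.symm x).1) (𝓝 p) (𝓝 q.1) := by
      have := (φ.continuousAt_symm hptar).fst
      rwa [ContinuousAt, hsymp] at this
    filter_upwards [φ.open_target.mem_nhds hptar, hyt.eventually hW,
      hφs.eventually (e.open_source.mem_nhds hes)] with x hx hw hes'
    refine ⟨hx, ?_⟩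
    rw [hsymp]
    have hfw := hw.2.self_of_nhds
    constructor
    · intro ht
      have hxF : F (φ.symm x).1 = x := by
        rw [hF]; simp only; rw [← ht]; exact φ.right_inv hx
      have hGy : e (φ.symm x).1 = yy x := by rw [hecoe, hG]; simp only; rw [hxF]; rfl
      have : e.symm (yy x) = (φ.symm x).1 := by rw [← hGy]; exact e.left_inv hes'
      rw [hss]; simp only
      rw [hfw, hf₀]; simp only
      rw [this, hxF, sub_self]
    · intro hs0
      have h1 : x = p + Λ.symm (yy x, f (yy x)) := by
        have : Λ (x - p) = (yy x, f (yy x)) := Prod.ext rfl (sub_eq_zero.mp hs0)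
        rw [← this]; simp
      rw [hgraph _ hw.1 hfw.symm] at h1
      rw [h1]
      have := φ.left_inv (hVs _ hw.1).2.1
      simp only [hF]
      rw [this]
  have htr : ∀ᶠ x in 𝓝 p, 1 / 2 ≤ g x (ν x) (ν p) := by
    have h1 : ContinuousAt (fun x => g x (ν x) (ν p)) p :=
      ((continuousOn_conormal hg hν.lipschitz).continuousAt
        (isOpen_offAxis.mem_nhds hpΩ)).clm_apply continuousAt_const
    have h2 : (1 / 2 : ℝ) < g p (ν p) (ν p) := by rw [hν.unit p hpΩ]; norm_num
    exact (h1.eventually (lt_mem_nhds h2)).mono fun x hx => hx.le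
  obtain ⟨K, t, ht, hK⟩ := locallyLipschitzOn_conormal hg hν.lipschitz hpΩ
  rw [nhdsWithin_eq_nhds.mpr (isOpen_offAxis.mem_nhds hpΩ)] at ht
  set B : ℝ := ‖fderiv ℝ f 0‖ + 1 with hB
  have hDf : ∀ᶠ w in 𝓝 (0 : E2), ‖fderiv ℝ f w‖ ≤ B :=
    (((hfs.continuous_fderiv (by simp)).norm.continuousAt (x := 0)).eventually
      (gt_mem_nhds (lt_add_one _))).mono fun w hw => hw.le
  set S : ℝ := ‖(Λ.symm : E2 × ℝ →L[ℝ] E3)‖ with hS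
  set C : ℝ := K * ‖ν p‖ * (S * (1 + B)) with hC
  have hBn : 0 ≤ B := by positivity
  have hx0 : Tendsto (fun x => p + Λ.symm (yy x, f (yy x))) (𝓝 p) (𝓝 p) := by
    have hc : Continuous fun x => p + Λ.symm (yy x, f (yy x)) :=
      continuous_const.add (Λ.symm.continuous.comp (hyc.prodMk (hfs.continuous.comp hyc)))
    have h0 : p + Λ.symm (yy p, f (yy p)) = p := by rw [hyp, hf0]; simp
    have := hc.continuousAt (x := p)
    rwa [ContinuousAt, h0] at this
  -- The point `x` is compared with the point `x₀` of the plaque on the same line parallel to `ν p`.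
  -- There the conormal annihilates the tangent vector of the graph, and between the two points it
  -- changes by at most its Lipschitz constant times the height.
  have hsl : ∀ᶠ x in 𝓝 p, ∀ v, |g x (ν x) (Λ.symm (v, fderiv ℝ f (yy x) v))| ≤
      C * ‖v‖ * |ss x| := by
    filter_upwards [ht, hx0.eventually ht, hyt.eventually hW.eventually_nhds,
      hyt.eventually hDf] with x hxt hx0t hw hD v
    set x₀ := p + Λ.symm (yy x, f (yy x)) with hx₀
    set w := Λ.symm (v, fderiv ℝ f (yy x) v) with hwd
    have hx₀F := hgraph _ hw.self_of_nhds.1 hw.self_of_nhds.2.self_of_nhds.symm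
    have hwV := hw.self_of_nhds.1
    have hzero : g x₀ (ν x₀) w = 0 := by
      have hd1 : HasFDerivAt (fun z => p + Λ.symm (z, f z))
          ((Λ.symm : E2 × ℝ →L[ℝ] E3).comp
            ((ContinuousLinearMap.id ℝ E2).prod (fderiv ℝ f (yy x)))) (yy x) := by
        have h1 : HasFDerivAt (fun z => (z, f z))
            ((ContinuousLinearMap.id ℝ E2).prod (fderiv ℝ f (yy x))) (yy x) :=
          (hasFDerivAt_id _).prodMk ((hfs.differentiable (by simp) _).hasFDerivAt)
        exact ((Λ.symm : E2 × ℝ →L[ℝ] E3).hasFDerivAt.comp (yy x) h1).const_add p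
      have hd2 : HasFDerivAt (fun z => F (e.symm z))
          ((fderiv ℝ F (e.symm (yy x))).comp (fderiv ℝ e.symm (yy x))) (yy x) :=
        HasFDerivAt.comp (g := F) (f := e.symm) (yy x)
          ((hFs _ (hVs _ hwV).2.1).differentiableAt (by simp)).hasFDerivAt
          ((hsym _ hwV).differentiableAt (by simp)).hasFDerivAt
      have heq : (fun z => p + Λ.symm (z, f z)) =ᶠ[𝓝 (yy x)] fun z => F (e.symm z) :=
        hw.mono fun z hz => hgraph z hz.1 hz.2.self_of_nhds.symm
      have hw' : w = fderiv ℝ F (e.symm (yy x)) (fderiv ℝ e.symm (yy x) v) := by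
        have := congrArg (fun A : E2 →L[ℝ] E3 => A v) ((hd2.congr_of_eventuallyEq heq).unique hd1)
        exact this.symm
      rw [hw', hx₀, hx₀F]
      exact hν.fderiv_eq_zero hφ (hVs _ hwV).2.1 _
    have hdiff : x - x₀ = ss x • ν p := by
      apply Λ.injective
      rw [map_smul, hΛν, hx₀, ← sub_sub, map_sub, Λ.apply_symm_apply]
      refine Prod.ext ?_ ?_
      · simp [hyy]
      · simp [hss]
    have h1 : |g x (ν x) w| = |(g x (ν x) - g x₀ (ν x₀)) w| := by
      rw [sub_apply, hzero, sub_zero]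
    rw [h1]
    have h2 : ‖g x (ν x) - g x₀ (ν x₀)‖ ≤ K * (|ss x| * ‖ν p‖) := by
      have := hK.dist_le_mul x hxt x₀ hx0t
      rwa [dist_eq_norm, dist_eq_norm, hdiff, norm_smul, Real.norm_eq_abs] at this
    have h3 : ‖w‖ ≤ S * ((1 + B) * ‖v‖) := by
      refine ((Λ.symm : E2 × ℝ →L[ℝ] E3).le_opNorm _).trans
        (mul_le_mul_of_nonneg_left ?_ (norm_nonneg _))
      refine max_le ?_ ?_
      · nlinarith [norm_nonneg v]
      · refine ((fderiv ℝ f (yy x)).le_opNorm v).trans ?_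
        nlinarith [norm_nonneg v]
    calc |(g x (ν x) - g x₀ (ν x₀)) w| ≤ ‖g x (ν x) - g x₀ (ν x₀)‖ * ‖w‖ :=
          (g x (ν x) - g x₀ (ν x₀)).le_opNorm w
      _ ≤ K * (|ss x| * ‖ν p‖) * (S * ((1 + B) * ‖v‖)) :=
          mul_le_mul h2 h3 (norm_nonneg _) (by positivity)
      _ = C * ‖v‖ * |ss x| := by rw [hC]; ring
  obtain ⟨r, hr, hrs⟩ : ∃ r, 0 < r ∧ ∀ x, ‖yy x‖ < r → |ss x| < r →
      (x ∈ φ.target ∧ ((φ.symm x).2 = (φ.symm p).2 ↔ ss x = 0)) ∧ 1 / 2 ≤ g x (ν x) (ν p) ∧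
      ∀ v, |g x (ν x) (Λ.symm (v, fderiv ℝ f (yy x) v))| ≤ C * ‖v‖ * |ss x| := by
    have hN := hpl.and (htr.and hsl)
    have hc : Continuous fun z : E2 × ℝ => p + Λ.symm (z.1, z.2 + f z.1) :=
      continuous_const.add (Λ.symm.continuous.comp
        (continuous_fst.prodMk (continuous_snd.add (hfs.continuous.comp continuous_fst))))
    have ht0 : Tendsto (fun z : E2 × ℝ => p + Λ.symm (z.1, z.2 + f z.1)) (𝓝 (0, 0)) (𝓝 p) := by
      have := hc.continuousAt (x := ((0, 0) : E2 × ℝ))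
      have h0 : p + Λ.symm ((0 : E2), (0 : ℝ) + f 0) = p := by
        rw [hf0]; simp [← Prod.zero_eq_mk]
      rwa [ContinuousAt, h0] at this
    obtain ⟨ε, hε, hsub⟩ := Metric.mem_nhds_iff.mp (ht0.eventually hN)
    refine ⟨ε, hε, fun x h1 h2 => ?_⟩
    have hmem : ((yy x, ss x) : E2 × ℝ) ∈ ball ((0, 0) : E2 × ℝ) ε := by
      rw [← ball_prod_same]
      exact ⟨by simpa using h1, by simpa using h2⟩
    have hx : p + Λ.symm (yy x, ss x + f (yy x)) = x := by
      simp only [hyy, hss, sub_add_cancel, Prod.mk.eta, Λ.symm_apply_apply, add_sub_cancel]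
    have := hsub hmem
    simp only [mem_ofPred_eq] at this
    rwa [hx] at this
  exact ⟨{ φ := φ, φ_mem := hφ, Λ := Λ, f := f, r := r, C := C, Λ_normal := hΛν, smooth_f := hfs
           f_zero := hf0, r_pos := hr, C_nonneg := by positivity
           mem_target := fun x h1 h2 => (hrs x h1 h2).1.1
           plaque_iff := fun x h1 h2 => (hrs x h1 h2).1.2
           transversal := fun x h1 h2 => (hrs x h1 h2).2.1
           slope_le := fun x h1 h2 => (hrs x h1 h2).2.2 }, rfl⟩

/-! ### Volume and area in a chart -/

theorem measurePreserving_split :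
    MeasurePreserving (fun x : E3 => ((!₂[x 0, x 1] : E2), x 2)) volume volume := by
  have h1 := PiLp.volume_preserving_ofLp (Fin 3)
  have h2 := volume_preserving_piFinSuccAbove (fun _ : Fin 3 => ℝ) 2
  have h3 : MeasurePreserving (Prod.swap : ℝ × (Fin 2 → ℝ) → (Fin 2 → ℝ) × ℝ) volume volume :=
    Measure.measurePreserving_swap
  have h4 : MeasurePreserving (Prod.map (WithLp.toLp 2) id : (Fin 2 → ℝ) × ℝ → E2 × ℝ)
      volume volume := (PiLp.volume_preserving_toLp (Fin 2)).prod (MeasurePreserving.id volume)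
  have h5 := h4.comp (h3.comp (h2.comp h1))
  have he : (fun x : E3 => ((!₂[x 0, x 1] : E2), x 2)) =
      (Prod.map (WithLp.toLp 2) id : (Fin 2 → ℝ) × ℝ → E2 × ℝ) ∘ (Prod.swap ∘
        (MeasurableEquiv.piFinSuccAbove (fun _ : Fin 3 => ℝ) 2 ∘ WithLp.ofLp)) := by
    ext1 x
    refine Prod.ext ?_ rfl
    ext i
    fin_cases i <;> rfl
  rw [he]
  exact h5

namespace LeafChart
variable {p : E3} (c : LeafChart R g ν p)

/-- The volume factor of the chart. -/
def D : ℝ := det3 (ν p) (c.Λ.symm (EuclideanSpace.single 0 1, 0))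
  (c.Λ.symm (EuclideanSpace.single 1 1, 0))

theorem det3_normal (a b : E3) : det3 (ν p) a b = c.D * det2 (c.Λ a).1 (c.Λ b).1 := by
  have key : ∀ a : E3, a = (c.Λ a).1 0 • c.Λ.symm (EuclideanSpace.single 0 1, 0) +
      (c.Λ a).1 1 • c.Λ.symm (EuclideanSpace.single 1 1, 0) + (c.Λ a).2 • ν p := by
    intro a
    apply c.Λ.injective
    simp only [map_add, map_smul, c.Λ_normal, c.Λ.apply_symm_apply]
    refine Prod.ext ?_ (by simp)
    ext i; fin_cases i <;> simp
  conv_lhs => rw [key a, key b]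
  unfold D det3 det2
  simp only [PiLp.add_apply, PiLp.smul_apply, smul_eq_mul]
  ring

theorem D_ne_zero : c.D ≠ 0 := by
  intro h
  have h0 : ∀ a b, det3 (ν p) a b = 0 := fun a b => by rw [c.det3_normal, h, zero_mul]
  have hν0 : ν p = 0 := by
    ext i
    fin_cases i
    · simpa [det3] using h0 (bv 1) (bv 2)
    · simpa [det3] using h0 (bv 2) (bv 0)
    · simpa [det3] using h0 (bv 0) (bv 1)
  have := c.Λ_normal
  rw [hν0, map_zero] at this
  simpa using congrArg Prod.snd this

theorem map_symm_volume :
    (volume : Measure (E2 × ℝ)).map c.Λ.symm = ofReal |c.D⁻¹| • volume := by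
  let A : E3 →ₗ[ℝ] E3 :=
    { toFun := fun x => c.Λ.symm (!₂[x 0, x 1], x 2)
      map_add' := fun x y => by
        rw [← map_add]; congr 1; refine Prod.ext ?_ rfl; ext i; fin_cases i <;> simp
      map_smul' := fun a x => by
        rw [RingHom.id_apply, ← map_smul]; congr 1; refine Prod.ext ?_ rfl
        ext i; fin_cases i <;> simp }
  have hA0 : A (bv 0) = c.Λ.symm (EuclideanSpace.single 0 1, 0) := by
    change c.Λ.symm _ = _
    congr 1; refine Prod.ext ?_ (by simp); ext i; fin_cases i <;> simp
  have hA1 : A (bv 1) = c.Λ.symm (EuclideanSpace.single 1 1, 0) := by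
    change c.Λ.symm _ = _
    congr 1; refine Prod.ext ?_ (by simp); ext i; fin_cases i <;> simp
  have hA2 : A (bv 2) = ν p := by
    apply c.Λ.injective
    rw [c.Λ_normal]
    change c.Λ (c.Λ.symm _) = _
    rw [c.Λ.apply_symm_apply]
    refine Prod.ext ?_ (by simp); ext i; fin_cases i <;> simp
  have hdet : LinearMap.det A = c.D := by
    have h1 := (EuclideanSpace.basisFun (Fin 3) ℝ).toBasis.det_comp A
      ![bv 0, bv 1, bv 2]
    have h2 : (A ∘ ![bv 0, bv 1, bv 2] : Fin 3 → E3) = ![A (bv 0), A (bv 1), A (bv 2)] := by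
      ext1 i; fin_cases i <;> rfl
    rw [h2, det3_eq_basis_det, det3_eq_basis_det, hA0, hA1, hA2] at h1
    have h3 : det3 (bv 0) (bv 1) (bv 2) = 1 := by simp [det3]
    rw [h3, mul_one] at h1
    rw [← h1]
    unfold D det3
    ring
  have h := Measure.map_linearMap_addHaar_eq_smul_addHaar (volume : Measure E3)
    (f := A) (by rw [hdet]; exact c.D_ne_zero)
  rw [hdet] at h
  rw [← h, ← measurePreserving_split.map_eq, Measure.map_map c.Λ.symm.continuous.measurable
    measurePreserving_split.measurable]
  rfl

/-- The shear `(y, s) ↦ (y, s + f y)` preserves Lebesgue measure, so only the linear part of the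
chart contributes. -/
theorem map_pt_volume :
    (volume : Measure (E2 × ℝ)).map c.pt = ofReal |c.D⁻¹| • volume := by
  have h1 : MeasurePreserving (fun q : E2 × ℝ => (q.1, c.f q.1 + q.2)) volume volume := by
    refine (MeasurePreserving.id (volume : Measure E2)).skew_product
      (g := fun y s => c.f y + s) ?_ (ae_of_all _ fun y => (measurePreserving_add_left _ _).map_eq)
    exact ((c.smooth_f.continuous.comp continuous_fst).add continuous_snd).measurable
  have h2 : c.pt = (fun x => p + x) ∘ (c.Λ.symm ∘ fun q : E2 × ℝ => (q.1, c.f q.1 + q.2)) := by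
    ext1 q; simp [pt, add_comm]
  rw [h2, ← Measure.map_map (by fun_prop) (c.Λ.symm.continuous.measurable.comp h1.measurable),
    ← Measure.map_map c.Λ.symm.continuous.measurable h1.measurable, h1.map_eq, c.map_symm_volume,
    Measure.map_smul, (measurePreserving_add_left _ _).map_eq]

theorem measurableEmbedding_pt : MeasurableEmbedding c.pt := by
  have h : Topology.IsClosedEmbedding c.pt := by
    refine (Homeomorph.mk ⟨c.pt, fun x => (c.y x, c.s x), fun q => by simp, fun x => by simp⟩
      c.contDiff_pt.continuous
      (c.contDiff_y.continuous.prodMk c.contDiff_s.continuous)).isClosedEmbedding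
  exact h.measurableEmbedding

theorem integral_eq (h : E3 → ℝ) : ∫ x, h x = |c.D| * ∫ q, h (c.pt q) := by
  rw [← c.measurableEmbedding_pt.integral_map, c.map_pt_volume, integral_smul_measure,
    ENNReal.toReal_ofReal (abs_nonneg _), smul_eq_mul, ← mul_assoc, ← abs_mul,
    mul_inv_cancel₀ c.D_ne_zero, abs_one, one_mul]

end LeafChart

namespace RectCurrent
variable (T : RectCurrent)

/-- The multiplicity of a point. -/
def theta (x : E3) : ℕ :=
  open Classical in
  if h : ∃ i, x ∈ T.param i '' T.dom i then (T.mult h.choose).natAbs else 0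

theorem theta_eq {i : ℕ} {x : E3} (hx : x ∈ T.param i '' T.dom i) :
    T.theta x = (T.mult i).natAbs := by
  have h : ∃ i, x ∈ T.param i '' T.dom i := ⟨i, hx⟩
  rw [theta, dif_pos h]
  have : h.choose = i := by
    by_contra hne
    exact Set.disjoint_left.mp (T.disjoint _ _ hne) h.choose_spec hx
  rw [this]

theorem measurableSet_piece (i : ℕ) : MeasurableSet (T.param i '' T.dom i) :=
  (T.measurable_dom i).image_of_continuousOn_injOn (T.continuousOn_param i) (T.injOn i)

theorem theta_eq_tsum (x : E3) : (T.theta x : ENNReal) =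
    ∑' i, (T.param i '' T.dom i).indicator (fun _ => ((T.mult i).natAbs : ENNReal)) x := by
  by_cases h : ∃ i, x ∈ T.param i '' T.dom i
  · obtain ⟨i, hi⟩ := h
    rw [tsum_eq_single i, indicator_of_mem hi, T.theta_eq hi]
    intro j hj
    exact indicator_of_notMem (fun h => Set.disjoint_left.mp (T.disjoint _ _ hj) h hi) _
  · rw [theta, dif_neg h]
    simp only [not_exists] at h
    rw [ENNReal.tsum_eq_zero.mpr fun i => indicator_of_notMem (h i) _]
    simp

theorem measurable_theta : Measurable fun x => (T.theta x : ENNReal) := by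
  simp_rw [T.theta_eq_tsum]
  exact Measurable.tsum fun i => measurable_const.indicator (T.measurableSet_piece i)

/-- The component of the normal along `ν p` is, up to the constant `D` and the multiplicity, the
Jacobian of the projection along `ν p` to the plane. On the zero set of the height this projection
is injective, so the area formula reduces to a change of variables on each piece. -/
theorem lintegral_inner_nrm {p : E3} (c : LeafChart R g ν p) {A : Set E3} (hA : MeasurableSet A)
    (hs : ∀ x ∈ A, c.s x = 0) :
    ∫⁻ q in T.pt ⁻¹' A, ofReal |inner ℝ (ν p) (T.nrm q)| ∂T.base =
      ofReal |c.D| * ∫⁻ w in {w | c.pt (w, 0) ∈ A}, (T.theta (c.pt (w, 0)) : ENNReal) := by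
  have hcpt : Measurable fun w : E2 => c.pt (w, 0) :=
    (c.contDiff_pt.continuous.comp (by fun_prop)).measurable
  have hAw : MeasurableSet {w | c.pt (w, 0) ∈ A} := hcpt hA
  have hr : ∫⁻ w in {w | c.pt (w, 0) ∈ A}, (T.theta (c.pt (w, 0)) : ENNReal) =
      ∑' i, ((T.mult i).natAbs : ENNReal) *
        volume {w | c.pt (w, 0) ∈ A ∧ c.pt (w, 0) ∈ T.param i '' T.dom i} := by
    simp_rw [T.theta_eq_tsum]
    have hmi : ∀ i, AEMeasurable (fun w => (T.param i '' T.dom i).indicator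
        (fun _ => ((T.mult i).natAbs : ENNReal)) (c.pt (w, 0)))
        (volume.restrict {w | c.pt (w, 0) ∈ A}) := fun i =>
      ((measurable_const.indicator (T.measurableSet_piece i)).comp hcpt).aemeasurable
    rw [lintegral_tsum hmi]
    refine tsum_congr fun i => ?_
    have h1 : (fun w => (T.param i '' T.dom i).indicator
        (fun _ => ((T.mult i).natAbs : ENNReal)) (c.pt (w, 0))) =
        ((fun w => c.pt (w, 0)) ⁻¹' (T.param i '' T.dom i)).indicator
          fun _ => ((T.mult i).natAbs : ENNReal) := rfl
    rw [h1, lintegral_indicator_const (hcpt (T.measurableSet_piece i)),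
      Measure.restrict_apply (hcpt (T.measurableSet_piece i))]
    congr 2
    ext w
    exact and_comm
  rw [hr, ← lintegral_indicator (T.measurable_pt hA), T.lintegral_base, ← ENNReal.tsum_mul_left]
  refine tsum_congr fun i => ?_
  have hBm : MeasurableSet {y | T.pt (i, y) ∈ A} :=
    (T.measurable_pt.comp measurable_prodMk_left) hA
  set B : Set E2 := {y | T.pt (i, y) ∈ A} ∩ T.dom i with hB
  have hBm' : MeasurableSet B := hBm.inter (T.measurable_dom i)
  set L : E3 →L[ℝ] E2 := (ContinuousLinearMap.fst ℝ E2 ℝ).comp (c.Λ : E3 →L[ℝ] E2 × ℝ) with hL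
  have hLy : ∀ x, L x = c.y x + L p := fun x => by
    simp [hL, LeafChart.y]
  have hinj : InjOn (fun y => L (T.param i y)) B := by
    rintro y ⟨h1, h2⟩ y' ⟨h1', h2'⟩ he
    have he : L (T.param i y) = L (T.param i y') := he
    rw [hLy (T.param i y), hLy (T.param i y'), add_left_inj] at he
    simp only [mem_ofPred_eq, T.pt_of_mem h2] at h1
    simp only [mem_ofPred_eq, T.pt_of_mem h2'] at h1'
    refine T.injOn i h2 h2' ?_
    rw [← c.pt_ys (T.param i y), ← c.pt_ys (T.param i y'), he, hs _ h1, hs _ h1']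
  have himg : (fun y => L (T.param i y)) '' B =
      (fun z => z + L p) '' {w | c.pt (w, 0) ∈ A ∧ c.pt (w, 0) ∈ T.param i '' T.dom i} := by
    ext z
    constructor
    · rintro ⟨y, ⟨h1, h2⟩, rfl⟩
      simp only [mem_ofPred_eq, T.pt_of_mem h2] at h1
      have h3 : c.pt (c.y (T.param i y), 0) = T.param i y := by
        rw [← hs _ h1, c.pt_ys]
      exact ⟨c.y (T.param i y), ⟨by rw [h3]; exact h1, by rw [h3]; exact ⟨y, h2, rfl⟩⟩,
        (hLy _).symm⟩
    · rintro ⟨w, ⟨h1, y, hy, h2⟩, rfl⟩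
      refine ⟨y, ⟨?_, hy⟩, ?_⟩
      · simp only [mem_ofPred_eq, T.pt_of_mem hy, h2]; exact h1
      · simp only
        rw [hLy, h2, c.y_pt]
  have hvol := T.lintegral_det2_comp L hBm' inter_subset_right hinj
  rw [himg, image_add_right, measure_preimage_add_right] at hvol
  rw [← hvol]
  have h2 : ∀ y, (T.pt ⁻¹' A).indicator (fun q => ofReal |inner ℝ (ν p) (T.nrm q)|) (i, y) =
      {y | T.pt (i, y) ∈ A}.indicator (fun y => ofReal |inner ℝ (ν p) (T.nrm (i, y))|) y :=
    fun y => rfl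
  simp_rw [h2]
  rw [lintegral_indicator hBm, Measure.restrict_restrict hBm, ← mul_assoc,
    ← lintegral_const_mul' _ _ (by finiteness)]
  refine lintegral_congr fun y => ?_
  rw [inner_nrm, c.det3_normal, abs_mul, abs_mul]
  rw [ofReal_mul (abs_nonneg _), ofReal_mul (abs_nonneg _), ← mul_assoc,
    mul_comm (ofReal |(T.mult i : ℝ)|)]
  congr 2
  rw [← Int.cast_abs, Int.abs_eq_natAbs, Int.cast_natCast, ENNReal.ofReal_natCast]

/-! ### The area measure off the axis -/

/-- The area measure of the current off the axis. -/
def mass (g : MetricField) : Measure E3 :=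
  (T.base.withDensity fun q =>
    ofReal (T.dens ((unitBall \ zAxis).indicator g) q)).map T.pt

theorem measurable_dens_offAxis (hg : IsMetricOn g unitBall) :
    Measurable (T.dens ((unitBall \ zAxis).indicator g)) :=
  T.measurable_dens (measurable_indicator_metric isOpen_offAxis.measurableSet
    (hg.continuousOn.mono sdiff_subset))

theorem dens_offAxis {q : ℕ × E2} (hq : T.pt q ∈ unitBall \ zAxis) :
    T.dens ((unitBall \ zAxis).indicator g) q = T.dens g q := by
  simp only [dens]
  rw [indicator_of_mem hq]

theorem dens_offAxis_of_notMem {q : ℕ × E2} (hq : T.pt q ∉ unitBall \ zAxis) :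
    T.dens ((unitBall \ zAxis).indicator g) q = 0 := by
  simp only [dens]
  rw [indicator_of_notMem hq]
  simp [area2]

theorem lintegral_mass (hg : IsMetricOn g unitBall) {h : E3 → ENNReal} (hh : Measurable h) :
    ∫⁻ x, h x ∂T.mass g = ∫⁻ q, ofReal (T.dens ((unitBall \ zAxis).indicator g) q) *
      h (T.pt q) ∂T.base := by
  rw [mass, lintegral_map hh T.measurable_pt]
  exact lintegral_withDensity_eq_lintegral_mul _
    (T.measurable_dens_offAxis hg).ennreal_ofReal (hh.comp T.measurable_pt)

theorem integral_mass (hg : IsMetricOn g unitBall) {h : E3 → ℝ} (hh : Measurable h) :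
    ∫ x, h x ∂T.mass g = ∫ q, T.dens ((unitBall \ zAxis).indicator g) q * h (T.pt q) ∂T.base := by
  rw [mass, integral_map T.measurable_pt.aemeasurable hh.aestronglyMeasurable,
    integral_withDensity_eq_integral_toReal_smul (T.measurable_dens_offAxis hg).ennreal_ofReal
      (ae_of_all _ fun _ => ofReal_lt_top)]
  refine integral_congr_ae (ae_of_all _ fun q => ?_)
  simp [ENNReal.toReal_ofReal (T.dens_nonneg _ q)]

theorem mass_apply (hg : IsMetricOn g unitBall) {W : Set E3} (hW : MeasurableSet W)
    (hWΩ : W ⊆ unitBall \ zAxis) : T.mass g W = T.area g W := by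
  rw [T.area_eq g hW, ← setLIntegral_one, ← lintegral_indicator hW, T.lintegral_mass hg
    (measurable_const.indicator hW), ← lintegral_indicator (T.measurable_pt hW)]
  refine lintegral_congr fun q => ?_
  by_cases hq : T.pt q ∈ W
  · rw [indicator_of_mem hq, indicator_of_mem (show q ∈ T.pt ⁻¹' W from hq), mul_one,
      T.dens_offAxis (hWΩ hq)]
  · rw [indicator_of_notMem hq, indicator_of_notMem (show q ∉ T.pt ⁻¹' W from hq), mul_zero]

/-- The conormal divided by the volume factor, extended by zero. -/
def _root_.MinimalFoliation.conormal (g : MetricField) (ν : E3 → E3) : E3 → E3 →L[ℝ] ℝ :=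
  (unitBall \ zAxis).indicator fun x => (gvol (g x))⁻¹ • g x (ν x)

theorem _root_.MinimalFoliation.conormal_apply {x : E3} (hx : x ∈ unitBall \ zAxis) (v : E3) :
    conormal g ν x v = (gvol (g x))⁻¹ * g x (ν x) v := by
  rw [conormal, indicator_of_mem hx]; rfl

theorem _root_.MinimalFoliation.continuousOn_conormal' (hg : IsMetricOn g unitBall)
    (hν : R.IsUnitNormal g ν) : ContinuousOn (conormal g ν) (unitBall \ zAxis) := by
  have h : ContinuousOn (fun x => (gvol (g x))⁻¹ • g x (ν x)) (unitBall \ zAxis) := by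
    refine ContinuousOn.smul (ContinuousOn.inv₀ ?_ fun x hx =>
      (hg.isInner hx.1).gvol_pos.ne') (continuousOn_conormal hg hν.lipschitz)
    exact continuous_gvol.comp_continuousOn (hg.continuousOn.mono sdiff_subset)
  exact h.congr fun x hx => indicator_of_mem hx _

theorem _root_.MinimalFoliation.measurable_conormal (hg : IsMetricOn g unitBall)
    (hν : R.IsUnitNormal g ν) : Measurable (conormal g ν) := by
  classical
  have h : conormal g ν = (unitBall \ zAxis).piecewise (conormal g ν) fun _ => 0 := by
    ext1 x
    by_cases hx : x ∈ unitBall \ zAxis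
    · rw [piecewise_eq_of_mem _ _ _ hx]
    · rw [piecewise_eq_of_notMem _ _ _ hx, conormal, indicator_of_notMem hx]
  rw [h]
  exact (continuousOn_conormal' hg hν).measurable_piecewise continuousOn_const
    isOpen_offAxis.measurableSet

theorem _root_.MinimalFoliation.measurable_conormal_apply (hg : IsMetricOn g unitBall)
    (hν : R.IsUnitNormal g ν) {V : E3 → E3} (hV : Measurable V) :
    Measurable fun x => conormal g ν x (V x) := by
  have hc : Continuous fun z : (E3 →L[ℝ] ℝ) × E3 => z.1 z.2 := by fun_prop
  exact hc.measurable.comp ((measurable_conormal hg hν).prodMk hV)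

variable {T}

/-- By the case of equality in the calibration inequality, the tangent planes are orthogonal to `ν`
almost everywhere. The vector measure of the current is then the scalar area measure times a fixed
covector field, so off the axis a calibrated current is determined by its area measure. -/
theorem IsCalibrated.inner_eq (hcal : T.IsCalibrated g ν) (hg : IsMetricOn g unitBall)
    (hu : ∀ p ∈ unitBall \ zAxis, g p (ν p) (ν p) = 1) :
    ∀ᵐ q ∂T.base, T.pt q ∈ unitBall \ zAxis → ∀ v,
      inner ℝ v (T.nrm q) = T.dens g q * conormal g ν (T.pt q) v := by
  filter_upwards [hcal, T.ae_base_mem] with q hc hq hx v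
  have hc := hc hx
  have hI := hg.isInner hx.1
  have hvol := hI.gvol_pos
  by_cases hm : T.mult q.1 = 0
  · rw [inner_nrm, dens, hm]; simp
  have hm' : (0 : ℝ) < |(T.mult q.1 : ℝ)| := abs_pos.mpr (by exact_mod_cast hm)
  have hli : LinearIndependent ℝ ![T.d0 q, T.d1 q] := T.linearIndependent_d hq
  have heq : |gvol (g (T.pt q)) * det3 (ν (T.pt q)) (T.d0 q) (T.d1 q)| =
      area2 (g (T.pt q)) (T.d0 q) (T.d1 q) := by
    have h1 := congrArg abs hc
    rw [abs_of_nonneg (T.dens_nonneg g q), inner_nrm, calib, det3_smul, abs_mul, dens] at h1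
    exact (mul_left_cancel₀ hm'.ne' h1).symm
  obtain ⟨h0, h1⟩ := hI.normal_of_vol_eq (hu _ hx) hli heq
  rw [hc, inner_nrm, inner_nrm, det3_of_normal (hu _ hx) h0 h1 v, calib, det3_smul, conormal_apply hx]
  field_simp

theorem IsCalibrated.lintegral_chart (hcal : T.IsCalibrated g ν) (hg : IsMetricOn g unitBall)
    (hν : R.IsUnitNormal g ν) {p : E3} (c : LeafChart R g ν p) {A : Set E3}
    (hA : MeasurableSet A) (hAO : A ⊆ c.O) (hs : ∀ x ∈ A, c.s x = 0) :
    ∫⁻ x in A, ofReal (conormal g ν x (ν p)) ∂T.mass g =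
      ofReal |c.D| * ∫⁻ w in {w | c.pt (w, 0) ∈ A}, (T.theta (c.pt (w, 0)) : ENNReal) := by
  rw [← T.lintegral_inner_nrm c hA hs]
  have hmeas : Measurable (A.indicator fun x => ofReal (conormal g ν x (ν p))) :=
    (measurable_conormal_apply hg hν measurable_const).ennreal_ofReal.indicator hA
  rw [← lintegral_indicator hA, T.lintegral_mass hg hmeas, ← lintegral_indicator (T.measurable_pt hA)]
  refine lintegral_congr_ae ?_
  filter_upwards [hcal.inner_eq hg hν.unit] with q hq
  by_cases hx : T.pt q ∈ A
  · have hΩ := c.O_subset (hAO hx)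
    rw [indicator_of_mem hx, indicator_of_mem (show q ∈ T.pt ⁻¹' A from hx), hq hΩ,
      T.dens_offAxis hΩ, ← ofReal_mul (T.dens_nonneg g q), abs_of_nonneg]
    refine mul_nonneg (T.dens_nonneg g q) ?_
    rw [conormal_apply hΩ]
    exact mul_nonneg (inv_nonneg.mpr (hg.isInner hΩ.1).gvol_pos.le)
      (le_trans (by norm_num) (c.half_le (hAO hx)))
  · rw [indicator_of_notMem hx, indicator_of_notMem (show q ∉ T.pt ⁻¹' A from hx), mul_zero]

end RectCurrent

/-! ### Currents made of plaques -/

/-- The exchange of the two coordinates of the plane. -/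
def swap2 : E2 →L[ℝ] E2 := LinearMap.toContinuousLinearMap
  { toFun := fun y => !₂[y 1, y 0]
    map_add' := fun x y => by ext i; fin_cases i <;> simp
    map_smul' := fun a x => by ext i; fin_cases i <;> simp }

theorem swap2_apply (y : E2) : swap2 y = !₂[y 1, y 0] := rfl

theorem swap2_swap2 (y : E2) : swap2 (swap2 y) = y := by
  ext i; fin_cases i <;> simp [swap2_apply]

theorem norm_swap2 (y : E2) : ‖swap2 y‖ = ‖y‖ := by
  simp [EuclideanSpace.norm_eq, swap2_apply, add_comm]

/-- The determinant of the normal and the tangent vectors has no zero on the connected disc, so its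
sign is constant; if it is negative, the two parameters are exchanged. The exchange preserves norms,
which the last clause records so that area bounds near the centre of the disc carry over. -/
theorem Foliation.exists_positive_param (hg : IsMetricOn g unitBall) (hν : R.IsUnitNormal g ν)
    {φ : OpenPartialHomeomorph (E2 × ℝ) E3} (hφ : φ ∈ R.atlas) {t : ℝ} (ht : t ∈ Ioo (-1 : ℝ) 1) :
    ∃ F : E2 → E3, (∀ y ∈ ball (0 : E2) 1, ContDiffAt ℝ ∞ F y) ∧
      (∀ y ∈ ball (0 : E2) 1, Function.Injective (fderiv ℝ F y)) ∧
      InjOn F (ball 0 1) ∧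
      F '' ball 0 1 = {x ∈ φ.target | (φ.symm x).2 = t} ∧
      (∀ y ∈ ball (0 : E2) 1, ∀ j, g (F y) (ν (F y)) (partialD F y j) = 0) ∧
      (∀ y ∈ ball (0 : E2) 1, 0 < det3 (ν (F y)) (partialD F y 0) (partialD F y 1)) ∧
      ∀ y ∈ ball (0 : E2) 1, ∃ z, ‖z‖ = ‖y‖ ∧
        areaDensity g F y = areaDensity g (fun x => φ (x, t)) z := by
  set G : E2 → E3 := fun y => φ (y, t) with hG
  have hsrc : ∀ y ∈ ball (0 : E2) 1, (y, t) ∈ φ.source := fun y hy => by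
    rw [R.source_eq φ hφ]; exact ⟨hy, ht⟩
  have hGs : ∀ y ∈ ball (0 : E2) 1, ContDiffAt ℝ ∞ G y := fun y hy =>
    R.contDiffAt_plaque hφ (hsrc y hy)
  have hGi : ∀ y ∈ ball (0 : E2) 1, Function.Injective (fderiv ℝ G y) := fun y hy =>
    R.immersive φ hφ (y, t) (hsrc y hy)
  have hGinj : InjOn G (ball 0 1) := fun y hy y' hy' h =>
    congrArg Prod.fst (φ.injOn (hsrc y hy) (hsrc y' hy') h)
  have hGim : G '' ball 0 1 = {x ∈ φ.target | (φ.symm x).2 = t} := by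
    ext x
    constructor
    · rintro ⟨y, hy, rfl⟩
      refine ⟨φ.map_source (hsrc y hy), ?_⟩
      rw [hG]; simp only; rw [φ.left_inv (hsrc y hy)]
    · rintro ⟨hx, hxt⟩
      have h1 := φ.map_target hx
      rw [R.source_eq φ hφ] at h1
      refine ⟨(φ.symm x).1, h1.1, ?_⟩
      rw [hG]; simp only; rw [← hxt]; exact φ.right_inv hx
  have hGn : ∀ y ∈ ball (0 : E2) 1, ∀ j, g (G y) (ν (G y)) (partialD G y j) = 0 :=
    fun y hy j => hν.normal φ hφ (y, t) (hsrc y hy) j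
  have hGd : ∀ y ∈ ball (0 : E2) 1,
      det3 (ν (G y)) (partialD G y 0) (partialD G y 1) ≠ 0 := fun y hy =>
    plaque_frame hν hφ (hsrc y hy)
  have hcont : ContinuousOn (fun y => det3 (ν (G y)) (partialD G y 0) (partialD G y 1))
      (ball 0 1) := by
    have hGc : ContinuousOn G (ball 0 1) := fun y hy =>
      (hGs y hy).continuousAt.continuousWithinAt
    have hνc : ContinuousOn (fun y => ν (G y)) (ball 0 1) :=
      hν.lipschitz.continuousOn.comp hGc fun y hy => R.map_mem hφ (hsrc y hy)
    have hpc : ∀ j, ContinuousOn (fun y => partialD G y j) (ball 0 1) := fun j y hy =>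
      (((hGs y hy).continuousAt_fderiv (by simp)).clm_apply
        continuousAt_const).continuousWithinAt
    have hco : ∀ {h : E2 → E3}, ContinuousOn h (ball 0 1) → ∀ i : Fin 3,
        ContinuousOn (fun y => h y i) (ball 0 1) := fun hh i =>
      (EuclideanSpace.proj i : E3 →L[ℝ] ℝ).continuous.comp_continuousOn hh
    unfold det3
    exact (((hco hνc 0).mul (((hco (hpc 0) 1).mul (hco (hpc 1) 2)).sub
      ((hco (hpc 0) 2).mul (hco (hpc 1) 1)))).sub
      ((hco hνc 1).mul (((hco (hpc 0) 0).mul (hco (hpc 1) 2)).sub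
      ((hco (hpc 0) 2).mul (hco (hpc 1) 0))))).add
      ((hco hνc 2).mul (((hco (hpc 0) 0).mul (hco (hpc 1) 1)).sub
      ((hco (hpc 0) 1).mul (hco (hpc 1) 0))))
  have hconn : IsPreconnected (ball (0 : E2) 1) := (convex_ball _ _).isPreconnected
  have h0 : (0 : E2) ∈ ball (0 : E2) 1 := mem_ball_self one_pos
  rcases (hGd 0 h0).lt_or_gt with hneg | hpos
  · have hall : ∀ y ∈ ball (0 : E2) 1,
        det3 (ν (G y)) (partialD G y 0) (partialD G y 1) < 0 := by
      intro y hy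
      by_contra hge
      obtain ⟨z, hz, hz0⟩ := hconn.intermediate_value h0 hy hcont ⟨hneg.le, not_lt.mp hge⟩
      exact hGd z hz hz0
    have hsw : ∀ y, y ∈ ball (0 : E2) 1 → swap2 y ∈ ball (0 : E2) 1 := fun y hy => by
      rw [mem_ball_zero_iff] at hy ⊢; rwa [norm_swap2]
    have hd : ∀ y ∈ ball (0 : E2) 1, fderiv ℝ (fun y => G (swap2 y)) y =
        (fderiv ℝ G (swap2 y)).comp swap2 := fun y hy => by
      have h1 : HasFDerivAt (fun y => G (swap2 y)) ((fderiv ℝ G (swap2 y)).comp swap2) y :=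
        HasFDerivAt.comp (g := G) (f := swap2) y
          ((hGs _ (hsw y hy)).differentiableAt (by simp)).hasFDerivAt swap2.hasFDerivAt
      exact h1.fderiv
    have hs0 : swap2 (EuclideanSpace.single 0 1) = EuclideanSpace.single 1 1 := by
      ext i; fin_cases i <;> simp [swap2_apply]
    have hs1 : swap2 (EuclideanSpace.single 1 1) = EuclideanSpace.single 0 1 := by
      ext i; fin_cases i <;> simp [swap2_apply]
    have hp0 : ∀ y ∈ ball (0 : E2) 1, partialD (fun y => G (swap2 y)) y 0 =
        partialD G (swap2 y) 1 := fun y hy => by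
      rw [partialD, hd y hy, ContinuousLinearMap.comp_apply, hs0]; rfl
    have hp1 : ∀ y ∈ ball (0 : E2) 1, partialD (fun y => G (swap2 y)) y 1 =
        partialD G (swap2 y) 0 := fun y hy => by
      rw [partialD, hd y hy, ContinuousLinearMap.comp_apply, hs1]; rfl
    refine ⟨fun y => G (swap2 y), fun y hy => (hGs _ (hsw y hy)).comp y swap2.contDiff.contDiffAt,
      fun y hy => ?_, fun y hy y' hy' h => ?_, ?_, fun y hy j => ?_, fun y hy => ?_,
      fun y hy => ⟨swap2 y, norm_swap2 y, ?_⟩⟩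
    · rw [hd y hy]
      refine (hGi _ (hsw y hy)).comp fun a b hab => ?_
      have hab : swap2 a = swap2 b := hab
      rw [← swap2_swap2 a, ← swap2_swap2 b, hab]
    · have := hGinj (hsw y hy) (hsw y' hy') h
      rw [← swap2_swap2 y, ← swap2_swap2 y', this]
    · rw [← hGim]
      ext x
      constructor
      · rintro ⟨y, hy, rfl⟩; exact ⟨_, hsw y hy, rfl⟩
      · rintro ⟨y, hy, rfl⟩
        exact ⟨swap2 y, hsw y hy, by simp only [swap2_swap2]⟩
    · fin_cases j
      · exact (congrArg _ (hp0 y hy)).trans (hGn _ (hsw y hy) 1)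
      · exact (congrArg _ (hp1 y hy)).trans (hGn _ (hsw y hy) 0)
    · rw [hp0 y hy, hp1 y hy, det3_swap]
      exact neg_pos.mpr (hall _ (hsw y hy))
    · simp only [areaDensity, firstForm]
      rw [hp0 y hy, hp1 y hy]
      have := hg.symm _ (R.map_mem hφ (hsrc _ (hsw y hy))).1 (partialD G (swap2 y) 0)
        (partialD G (swap2 y) 1)
      rw [← this, mul_comm]
  · refine ⟨G, hGs, hGi, hGinj, hGim, hGn, fun y hy => ?_, fun y _ => ⟨y, rfl, rfl⟩⟩
    by_contra hle
    obtain ⟨z, hz, hz0⟩ := hconn.intermediate_value hy h0 hcont ⟨not_lt.mp hle, hpos.le⟩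
    exact hGd z hz hz0

/-- A rectifiable current from a countable family of pieces. -/
theorem RectCurrent.exists_of_countable {ι : Type*} [Countable ι] (F : ι → E2 → E3)
    (A : ι → Set E2) (k : ι → ℤ) (hA : ∀ i, MeasurableSet (A i))
    (hF : ∀ i, ∀ y ∈ A i, ContDiffAt ℝ 1 (F i) y)
    (hi : ∀ i, ∀ y ∈ A i, Function.Injective (fderiv ℝ (F i) y))
    (hinj : ∀ i, InjOn (F i) (A i))
    (hdisj : ∀ i j, i ≠ j → Disjoint (F i '' A i) (F j '' A j)) :
    ∃ T : RectCurrent, (T.carrier = ⋃ i, F i '' A i) ∧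
      ∀ n, ∀ y ∈ T.dom n, ∃ i, y ∈ A i ∧ T.param n = F i ∧ T.mult n = k i := by
  obtain ⟨e, he⟩ := exists_injective_nat ι
  set F' : ℕ → E2 → E3 := Function.extend e F fun _ _ => 0 with hF'
  set A' : ℕ → Set E2 := Function.extend e A fun _ => ∅ with hA'
  set k' : ℕ → ℤ := Function.extend e k fun _ => 0 with hk'
  have hFe : ∀ i, F' (e i) = F i := fun i => he.extend_apply _ _ _
  have hAe : ∀ i, A' (e i) = A i := fun i => he.extend_apply _ _ _
  have hke : ∀ i, k' (e i) = k i := fun i => he.extend_apply _ _ _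
  have hcase : ∀ n, (∃ i, e i = n) ∨ A' n = ∅ := fun n => by
    by_cases h : ∃ i, e i = n
    · exact Or.inl h
    · exact Or.inr (Function.extend_apply' _ _ _ h)
  have hmem : ∀ n, ∀ y ∈ A' n, ∃ i, e i = n ∧ y ∈ A i := fun n y hy => by
    rcases hcase n with ⟨i, rfl⟩ | h
    · exact ⟨i, rfl, by rwa [hAe] at hy⟩
    · rw [h] at hy; exact hy.elim
  refine ⟨⟨F', A', k', fun n => ?_, fun n y hy => ?_, fun n y hy => ?_, fun n => ?_,
    fun n n' hn => ?_⟩, ?_, fun n y hy => ?_⟩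
  · rcases hcase n with ⟨i, rfl⟩ | h
    · rw [hAe]; exact hA i
    · rw [h]; exact MeasurableSet.empty
  · obtain ⟨i, rfl, hi'⟩ := hmem n y hy
    rw [hFe]; exact hF i y hi'
  · obtain ⟨i, rfl, hi'⟩ := hmem n y hy
    rw [hFe]; exact hi i y hi'
  · rcases hcase n with ⟨i, rfl⟩ | h
    · rw [hAe, hFe]; exact hinj i
    · rw [h]; exact injOn_empty _
  · rcases hcase n with ⟨i, rfl⟩ | h
    · rcases hcase n' with ⟨j, rfl⟩ | h'
      · rw [hAe, hFe, hAe, hFe]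
        exact hdisj i j fun h => hn (by rw [h])
      · rw [h', image_empty]; exact disjoint_empty _
    · rw [h, image_empty]; exact empty_disjoint _
  · ext x
    simp only [RectCurrent.carrier, mem_iUnion]
    constructor
    · rintro ⟨n, y, hy, rfl⟩
      obtain ⟨i, rfl, hi'⟩ := hmem n y hy
      exact ⟨i, y, hi', by rw [hFe]⟩
    · rintro ⟨i, y, hy, rfl⟩
      exact ⟨e i, y, by rw [hAe]; exact hy, by rw [hFe]⟩
  · obtain ⟨i, rfl, hi'⟩ := hmem n y hy
    exact ⟨i, hi', hFe i, hke i⟩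

theorem Foliation.exists_countable_boxes (R : Foliation (unitBall \ zAxis)) :
    ∃ 𝓐 : Set (OpenPartialHomeomorph (E2 × ℝ) E3), 𝓐 ⊆ R.atlas ∧ 𝓐.Countable ∧
      ∀ x ∈ unitBall \ zAxis, ∃ φ ∈ 𝓐, x ∈ φ.target := by
  obtain ⟨𝓐, h1, h2⟩ := TopologicalSpace.isOpen_iUnion_countable
    (fun φ : R.atlas => (φ : OpenPartialHomeomorph (E2 × ℝ) E3).target) fun φ => φ.1.open_target
  refine ⟨Subtype.val '' 𝓐, ?_, h1.image _, fun x hx => ?_⟩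
  · rintro _ ⟨φ, -, rfl⟩; exact φ.2
  · obtain ⟨φ, hφ, hxφ⟩ := R.exists_box hx
    have : x ∈ ⋃ φ : R.atlas, (φ : OpenPartialHomeomorph (E2 × ℝ) E3).target :=
      mem_iUnion.mpr ⟨⟨φ, hφ⟩, hxφ⟩
    rw [← h2] at this
    simp only [mem_iUnion] at this
    obtain ⟨ψ, hψ, hxψ⟩ := this
    exact ⟨ψ, ⟨ψ, hψ, rfl⟩, hxψ⟩

/-- Countably many plaques in every box, with multiplicities, form a current. -/
theorem Foliation.exists_isOrientedBy (hg : IsMetricOn g unitBall) (hν : R.IsUnitNormal g ν)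
    {m : E3 → ℕ} (hsupp : ∀ x, m x ≠ 0 → x ∈ unitBall \ zAxis)
    (hm : ∀ φ ∈ R.atlas, ∀ x ∈ φ.target, ∀ x' ∈ φ.target,
      (φ.symm x).2 = (φ.symm x').2 → m x = m x')
    (hcount : ∀ φ ∈ R.atlas, {t ∈ Ioo (-1 : ℝ) 1 | m (φ (0, t)) ≠ 0}.Countable) :
    ∃ T : RectCurrent, T.IsOrientedBy g ν m := by
  obtain ⟨𝓐, h𝓐, h𝓐c, hcov⟩ := R.exists_countable_boxes
  have : Countable 𝓐 := h𝓐c.to_subtype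
  obtain ⟨e, he⟩ := exists_injective_nat 𝓐
  let C : 𝓐 → Set ℝ := fun φ => {t ∈ Ioo (-1 : ℝ) 1 | m (φ.1 (0, t)) ≠ 0}
  have hC : ∀ φ, Countable (C φ) := fun φ => (hcount φ.1 (h𝓐 φ.2)).to_subtype
  have hF : ∀ i : Σ φ : 𝓐, C φ, _ := fun i =>
    Foliation.exists_positive_param hg hν (h𝓐 i.1.2) i.2.2.1
  choose F hFs hFi hFinj hFim hFn hFd _ using hF
  -- Plaques of different boxes overlap, but the pieces of a current must be disjoint. A point of a
  -- plaque is kept only in the first box containing it.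
  let V : 𝓐 → Set E3 := fun φ => ⋃ ψ : 𝓐, ⋃ (_ : e ψ < e φ), ψ.1.target
  have hV : ∀ φ, IsOpen (V φ) := fun φ =>
    isOpen_iUnion fun ψ => isOpen_iUnion fun _ => ψ.1.open_target
  let A : (Σ φ : 𝓐, C φ) → Set E2 := fun i => ball 0 1 \ (F i ⁻¹' V i.1)
  have hAB : ∀ i, A i ⊆ ball 0 1 := fun i => sdiff_subset
  have hFt : ∀ i, ∀ y ∈ ball (0 : E2) 1, F i y ∈ i.1.1.target ∧
      (i.1.1.symm (F i y)).2 = i.2.1 := fun i y hy => by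
    have : F i y ∈ F i '' ball 0 1 := ⟨y, hy, rfl⟩
    rw [hFim] at this
    exact this
  have hmF : ∀ i, ∀ y ∈ ball (0 : E2) 1, m (F i y) = m (i.1.1 (0, i.2.1)) := fun i y hy => by
    have hs : ((0 : E2), (i.2 : ℝ)) ∈ i.1.1.source := by
      rw [R.source_eq _ (h𝓐 i.1.2)]; exact ⟨mem_ball_self one_pos, i.2.2.1⟩
    refine hm i.1.1 (h𝓐 i.1.2) _ (hFt i y hy).1 _ (i.1.1.map_source hs) ?_
    rw [(hFt i y hy).2, i.1.1.left_inv hs]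
  have hAm : ∀ i, MeasurableSet (A i) := fun i => by
    have hc : ContinuousOn (F i) (ball 0 1) := fun y hy =>
      (hFs i y hy).continuousAt.continuousWithinAt
    have : A i = ball 0 1 \ (ball 0 1 ∩ F i ⁻¹' V i.1) := by
      simp only [A]; ext; simp
    rw [this]
    exact isOpen_ball.measurableSet.diff
      (hc.isOpen_inter_preimage isOpen_ball (hV _)).measurableSet
  have hAd : ∀ i j, i ≠ j → Disjoint (F i '' A i) (F j '' A j) := fun i j hij => by
    rw [Set.disjoint_left]
    rintro _ ⟨y, hy, rfl⟩ ⟨y', hy', hyy⟩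
    have h1 := hFt i y (hAB i hy)
    have h2 := hFt j y' (hAB j hy')
    rw [hyy] at h2
    rcases lt_trichotomy (e i.1) (e j.1) with hlt | heq | hgt
    · refine hy'.2 (?_ : F j y' ∈ V j.1)
      rw [hyy]
      exact mem_iUnion.mpr ⟨i.1, mem_iUnion.mpr ⟨hlt, h1.1⟩⟩
    · apply hij
      obtain ⟨φ, t⟩ := i
      obtain ⟨ψ, t'⟩ := j
      obtain rfl : φ = ψ := he heq
      have : t = t' := Subtype.ext (h1.2.symm.trans h2.2)
      rw [this]
    · refine hy.2 (?_ : F i y ∈ V i.1)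
      exact mem_iUnion.mpr ⟨j.1, mem_iUnion.mpr ⟨hgt, h2.1⟩⟩
  obtain ⟨T, hTc, hT⟩ := RectCurrent.exists_of_countable F A
    (fun i => (m (i.1.1 (0, i.2.1)) : ℤ)) hAm
    (fun i y hy => (hFs i y (hAB i hy)).of_le (by norm_cast)) (fun i y hy => hFi i y (hAB i hy))
    (fun i => (hFinj i).mono (hAB i)) hAd
  refine ⟨T, ⟨?_, fun n y hy => ?_, fun n y hy j => ?_, fun n y hy => ?_⟩⟩
  · rw [hTc]
    ext x
    simp only [mem_iUnion, mem_ofPred_eq]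
    constructor
    · rintro ⟨i, y, hy, rfl⟩
      rw [hmF i y (hAB i hy)]
      exact i.2.2.2
    · intro hx
      have hex : ∃ n, ∃ φ : 𝓐, e φ = n ∧ x ∈ φ.1.target := by
        obtain ⟨φ, hφ, hxφ⟩ := hcov x (hsupp x hx)
        exact ⟨_, ⟨φ, hφ⟩, rfl, hxφ⟩
      classical
      obtain ⟨φ, hφn, hxφ⟩ := Nat.find_spec hex
      have hmin : ∀ ψ : 𝓐, e ψ < e φ → x ∉ ψ.1.target := fun ψ hψ hxψ =>
        Nat.find_min hex (hφn ▸ hψ) ⟨ψ, rfl, hxψ⟩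
      have hsrc := φ.1.map_target hxφ
      rw [R.source_eq _ (h𝓐 φ.2)] at hsrc
      have hs : ((0 : E2), (φ.1.symm x).2) ∈ φ.1.source := by
        rw [R.source_eq _ (h𝓐 φ.2)]; exact ⟨mem_ball_self one_pos, hsrc.2⟩
      have hmx : m (φ.1 (0, (φ.1.symm x).2)) = m x := by
        refine hm φ.1 (h𝓐 φ.2) _ (φ.1.map_source hs) _ hxφ ?_
        rw [φ.1.left_inv hs]
      let i : Σ φ : 𝓐, C φ := ⟨φ, ⟨(φ.1.symm x).2, hsrc.2, by rw [hmx]; exact hx⟩⟩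
      have hxi : x ∈ F i '' ball 0 1 := by
        rw [hFim i]; exact ⟨hxφ, rfl⟩
      obtain ⟨y, hy, hyx⟩ := hxi
      refine ⟨i, y, ⟨hy, ?_⟩, hyx⟩
      intro hyV
      have hyV' : F i y ∈ V φ := hyV
      rw [hyx] at hyV'
      simp only [V, mem_iUnion] at hyV'
      obtain ⟨ψ, hψ, hxψ⟩ := hyV'
      exact hmin ψ hψ hxψ
  · obtain ⟨i, hi, hp, hk⟩ := hT n y hy
    rw [hp, hk, hmF i y (hAB i hi)]
  · obtain ⟨i, hi, hp, hk⟩ := hT n y hy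
    rw [hp]; exact hFn i y (hAB i hi) j
  · obtain ⟨i, hi, hp, hk⟩ := hT n y hy
    rw [hp, det3_eq_basis_det]; exact hFd i y (hAB i hi)

/-! ### Domains bounded by leaves -/

/-- The open set `U` is bounded by leaves along which `ν` points outwards. -/
structure BoundedByLeaves (R : Foliation (unitBall \ zAxis)) (ν : E3 → E3) (U : Set E3) :
    Prop where
  isOpen : IsOpen U
  saturated : ∀ φ ∈ R.atlas, ∀ x ∈ φ.target, ∀ x' ∈ φ.target, (φ.symm x).2 = (φ.symm x').2 →
    x ∈ frontier U → x' ∈ frontier U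
  out : ∀ p ∈ frontier U ∩ (unitBall \ zAxis), PointsOutOf ν U p

namespace LeafChart
variable {p : E3} (c : LeafChart R g ν p)

theorem pt_mem_O {q : E2 × ℝ} : c.pt q ∈ c.O ↔ ‖q.1‖ < c.r ∧ |q.2| < c.r := by
  simp [O]

theorem pt_zero (a : ℝ) : c.pt (0, a) = p + a • ν p := by
  rw [pt, c.f_zero, c.symm_eq, add_zero]
  simp [← Prod.zero_eq_mk]

theorem isPreconnected_pos : IsPreconnected {x ∈ c.O | 0 < c.s x} := by
  have h : {x ∈ c.O | 0 < c.s x} = c.pt '' (ball 0 c.r ×ˢ Ioo 0 c.r) := by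
    ext x
    constructor
    · rintro ⟨hx, hs⟩
      exact ⟨(c.y x, c.s x), ⟨by simpa using hx.1, hs, (abs_lt.mp hx.2).2⟩, c.pt_ys x⟩
    · rintro ⟨q, ⟨h1, h2⟩, rfl⟩
      refine ⟨c.pt_mem_O.mpr ⟨by simpa using h1, ?_⟩, by simpa using h2.1⟩
      rw [abs_of_pos h2.1]; exact h2.2
  rw [h]
  exact (((convex_ball _ _).prod (convex_Ioo _ _)).isPreconnected).image _
    c.contDiff_pt.continuous.continuousOn

theorem isPreconnected_neg : IsPreconnected {x ∈ c.O | c.s x < 0} := by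
  have h : {x ∈ c.O | c.s x < 0} = c.pt '' (ball 0 c.r ×ˢ Ioo (-c.r) 0) := by
    ext x
    constructor
    · rintro ⟨hx, hs⟩
      exact ⟨(c.y x, c.s x), ⟨by simpa using hx.1, (abs_lt.mp hx.2).1, hs⟩, c.pt_ys x⟩
    · rintro ⟨q, ⟨h1, h2⟩, rfl⟩
      refine ⟨c.pt_mem_O.mpr ⟨by simpa using h1, ?_⟩, by simpa using h2.2⟩
      rw [abs_of_neg h2.2]; linarith [h2.1]
  rw [h]
  exact (((convex_ball _ _).prod (convex_Ioo _ _)).isPreconnected).image _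
    c.contDiff_pt.continuous.continuousOn

theorem continuousOn_t : ContinuousOn (fun x => (c.φ.symm x).2) c.O :=
  (continuous_snd.comp_continuousOn c.φ.continuousOn_symm).mono c.O_subset_target

/-- The two sides of a plaque lie on different sides in the flow box. -/
theorem sides_opposite {x x' : E3} (hx : x ∈ c.O) (hx' : x' ∈ c.O) (hs : 0 < c.s x)
    (hs' : c.s x' < 0) : ((c.φ.symm x).2 < (c.φ.symm p).2 ∧ (c.φ.symm p).2 < (c.φ.symm x').2) ∨
      ((c.φ.symm x').2 < (c.φ.symm p).2 ∧ (c.φ.symm p).2 < (c.φ.symm x).2) := by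
  have const : ∀ {S : Set E3}, IsPreconnected S → S ⊆ c.O → (∀ z ∈ S, c.s z ≠ 0) → ∀ a ∈ S, ∀ b ∈ S,
      (c.φ.symm a).2 < (c.φ.symm p).2 → (c.φ.symm b).2 < (c.φ.symm p).2 := by
    intro S hS hSO hne a ha b hb hlt
    by_contra hge
    obtain ⟨z, hz, hz0⟩ := hS.intermediate_value ha hb (c.continuousOn_t.mono hSO)
      ⟨hlt.le, not_lt.mp hge⟩
    exact hne z hz ((c.plaque (hSO hz)).mp hz0)
  have hP := const c.isPreconnected_pos (sep_subset _ _) fun z hz => hz.2.ne'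
  have hN := const c.isPreconnected_neg (sep_subset _ _) fun z hz => hz.2.ne
  have hne : (c.φ.symm x).2 ≠ (c.φ.symm p).2 := fun h => hs.ne' ((c.plaque hx).mp h)
  have hne' : (c.φ.symm x').2 ≠ (c.φ.symm p).2 := fun h => hs'.ne ((c.plaque hx').mp h)
  have hpt := c.O_subset_target c.mem_O_self
  have hsrc := c.φ.map_target hpt
  have hev : ∀ᶠ t in 𝓝 (c.φ.symm p).2, ((c.φ.symm p).1, t) ∈ c.φ.source ∧
      c.φ ((c.φ.symm p).1, t) ∈ c.O := by
    have hc : ContinuousAt (fun t : ℝ => ((c.φ.symm p).1, t)) (c.φ.symm p).2 := by fun_prop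
    have h1 : ∀ᶠ q in 𝓝 (c.φ.symm p), q ∈ c.φ.source ∧ c.φ q ∈ c.O := by
      have h2 : ∀ᶠ q in 𝓝 (c.φ.symm p), q ∈ c.φ.source := c.φ.open_source.mem_nhds hsrc
      refine h2.and ((c.φ.continuousAt hsrc).eventually ?_)
      rw [c.φ.right_inv hpt]; exact c.O_mem_nhds
    exact hc.eventually h1
  have hside : ∀ z ∈ c.O, (c.φ.symm z).2 ≠ (c.φ.symm p).2 → 0 < c.s z ∨ c.s z < 0 := fun z hz hne =>
    (lt_or_gt_of_ne fun h => hne ((c.plaque hz).mpr h)).symm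
  -- If both sides of the plaque had heights on the same side of that of `p`, no point of the chart
  -- could have a height on the other side. But the vertical line of the flow box through `p` takes
  -- all nearby heights and stays in the chart for a short time.
  rcases hne.lt_or_gt with h | h <;> rcases hne'.lt_or_gt with h' | h'
  · exfalso
    obtain ⟨t, ⟨ht1, ht2⟩, ht3⟩ := ((hev.filter_mono nhdsWithin_le_nhds).and
      (self_mem_nhdsWithin : ∀ᶠ t in 𝓝[>] (c.φ.symm p).2, t ∈ Ioi (c.φ.symm p).2)).exists
    have ht4 : (c.φ.symm (c.φ ((c.φ.symm p).1, t))).2 = t := by rw [c.φ.left_inv ht1]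
    have ht5 : (c.φ.symm p).2 < t := ht3
    rcases hside _ ht2 (by rw [ht4]; exact ht5.ne') with h6 | h6
    · have := hP x ⟨hx, hs⟩ _ ⟨ht2, h6⟩ h
      rw [ht4] at this; linarith
    · have := hN x' ⟨hx', hs'⟩ _ ⟨ht2, h6⟩ h'
      rw [ht4] at this; linarith
  · exact Or.inl ⟨h, h'⟩
  · exact Or.inr ⟨h', h⟩
  · exfalso
    obtain ⟨t, ⟨ht1, ht2⟩, ht3⟩ := ((hev.filter_mono nhdsWithin_le_nhds).and
      (self_mem_nhdsWithin : ∀ᶠ t in 𝓝[<] (c.φ.symm p).2, t ∈ Iio (c.φ.symm p).2)).exists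
    have ht4 : (c.φ.symm (c.φ ((c.φ.symm p).1, t))).2 = t := by rw [c.φ.left_inv ht1]
    have ht5 : t < (c.φ.symm p).2 := ht3
    rcases hside _ ht2 (by rw [ht4]; exact ht5.ne) with h6 | h6
    · have := hP _ ⟨ht2, h6⟩ x ⟨hx, hs⟩ (by rw [ht4]; exact ht5)
      linarith
    · have := hN _ ⟨ht2, h6⟩ x' ⟨hx', hs'⟩ (by rw [ht4]; exact ht5)
      linarith

theorem mem_O_of_abs {a : ℝ} (ha : |a| < c.r) : c.pt (0, a) ∈ c.O :=
  c.pt_mem_O.mpr ⟨by simpa using c.r_pos, ha⟩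

/-- Every plaque close to the one through `p` crosses the normal line. -/
theorem exists_crossing {ε : ℝ} (hε : 0 < ε) (hεr : ε < c.r) :
    ∀ᶠ x in 𝓝 p, (c.φ.symm x).2 ≠ (c.φ.symm p).2 →
      ∃ a, 0 < |a| ∧ |a| ≤ ε ∧ (c.φ.symm (c.pt (0, a))).2 = (c.φ.symm x).2 := by
  have hcl : Continuous fun a : ℝ => c.pt (0, a) := c.contDiff_pt.continuous.comp (by fun_prop)
  have hmaps : ∀ a ∈ Icc (-ε) ε, c.pt (0, a) ∈ c.O := fun a ha =>
    c.mem_O_of_abs ((abs_le.mpr ha).trans_lt hεr)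
  have hcont : ContinuousOn (fun a : ℝ => (c.φ.symm (c.pt (0, a))).2) (Icc (-ε) ε) :=
    c.continuousOn_t.comp hcl.continuousOn hmaps
  have h0 : c.pt (0, 0) = p := by rw [c.pt_zero]; simp
  have hopp := c.sides_opposite (hmaps ε ⟨by linarith, le_rfl⟩) (hmaps (-ε) ⟨le_rfl, by linarith⟩)
    (by simpa using hε) (by simpa using hε)
  have htc : ContinuousAt (fun x => (c.φ.symm x).2) p := c.continuousOn_t.continuousAt c.O_mem_nhds
  have key : ∀ t ∈ uIcc (c.φ.symm (c.pt (0, -ε))).2 (c.φ.symm (c.pt (0, ε))).2,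
      t ≠ (c.φ.symm p).2 → ∃ a, 0 < |a| ∧ |a| ≤ ε ∧ (c.φ.symm (c.pt (0, a))).2 = t := by
    intro t ht hne
    have h := intermediate_value_uIcc (a := -ε) (b := ε)
      (f := fun a : ℝ => (c.φ.symm (c.pt (0, a))).2)
      (by rwa [uIcc_of_le (by linarith)])
    obtain ⟨a, ha, hat⟩ := h ht
    rw [uIcc_of_le (by linarith)] at ha
    refine ⟨a, abs_pos.mpr ?_, abs_le.mpr ha, hat⟩
    rintro rfl
    simp only at hat
    rw [h0] at hat
    exact hne hat.symm
  rcases hopp with ⟨h1, h2⟩ | ⟨h1, h2⟩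
  · filter_upwards [htc.eventually (lt_mem_nhds h1), htc.eventually (gt_mem_nhds h2)] with x hx1 hx2
    exact key _ (by rw [uIcc_of_ge (h1.trans h2).le]; exact ⟨hx1.le, hx2.le⟩)
  · filter_upwards [htc.eventually (lt_mem_nhds h1), htc.eventually (gt_mem_nhds h2)] with x hx1 hx2
    exact key _ (by rw [uIcc_of_le (h1.trans h2).le]; exact ⟨hx1.le, hx2.le⟩)

end LeafChart

namespace BoundedByLeaves

/-- Near a boundary point off the axis, `U` is the part below a plaque. -/
theorem exists_chart (hU : BoundedByLeaves R ν U) (hg : IsMetricOn g unitBall)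
    (hν : R.IsUnitNormal g ν) {φ : OpenPartialHomeomorph (E2 × ℝ) E3} (hφ : φ ∈ R.atlas) {p : E3}
    (hpφ : p ∈ φ.target) (hp : p ∈ frontier U) :
    ∃ c : LeafChart R g ν p, c.φ = φ ∧ (∀ x ∈ c.O, x ∈ frontier U ↔ c.s x = 0) ∧
      ∀ x ∈ c.O, x ∈ U ↔ c.s x < 0 := by
  obtain ⟨c, hcφ⟩ := exists_leafChart hg hν hφ hpφ
  have hout := hU.out p ⟨hp, c.mem_offAxis⟩
  obtain ⟨ε₀, hε₀, hε₀'⟩ := mem_nhdsGT_iff_exists_Ioc_subset.mp hout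
  simp only [mem_Ioi] at hε₀
  set ε := min ε₀ (c.r / 2) with hε
  have hr := c.r_pos
  have hεpos : 0 < ε := lt_min hε₀ (by linarith)
  have hεr : ε < c.r := (min_le_right _ _).trans_lt (by linarith)
  have hplus : ∀ a, 0 < a → a ≤ ε → c.pt (0, a) ∈ (closure U)ᶜ := fun a h1 h2 => by
    rw [c.pt_zero]; exact (hε₀' ⟨h1, h2.trans (min_le_left _ _)⟩).1
  have hminus : ∀ a, a < 0 → -ε ≤ a → c.pt (0, a) ∈ U := fun a h1 h2 => by
    rw [c.pt_zero]
    have := (hε₀' (show -a ∈ Ioc 0 ε₀ from ⟨by linarith,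
      by linarith [min_le_left ε₀ (c.r / 2)]⟩)).2
    simpa [sub_eq_add_neg] using this
  have hnotin : ∀ a, 0 < |a| → |a| ≤ ε → c.pt (0, a) ∉ frontier U := fun a h1 h2 h => by
    rcases lt_or_gt_of_ne (abs_pos.mp h1) with h3 | h3
    · rw [hU.isOpen.frontier_eq] at h
      exact h.2 (hminus a h3 (by rw [abs_of_neg h3] at h2; linarith))
    · exact hplus a h3 (by rwa [abs_of_pos h3] at h2) (frontier_subset_closure h)
  -- Any other plaque of the frontier near `p` would cross the normal line through `p` close to `p`.
  -- There the line lies in `U` on one side of `p` and off the closure of `U` on the other, so such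
  -- a plaque does not exist.
  have hev := c.exists_crossing hεpos hεr
  obtain ⟨r', hr', hr'r, hN⟩ := c.exists_r hev
  set c' := c.shrink hr' hr'r with hc'
  have hO : ∀ x ∈ c'.O, x ∈ c.O := fun x hx => ⟨hx.1.trans_le hr'r, hx.2.trans_le hr'r⟩
  have hM : ∀ x ∈ c'.O, x ∈ frontier U ↔ c'.s x = 0 := by
    intro x hx
    have hxO := hO x hx
    have hxt := c.O_subset_target hxO
    have hpt := c.O_subset_target c.mem_O_self
    constructor
    · intro hxU
      by_contra hne
      have hne' : (c.φ.symm x).2 ≠ (c.φ.symm p).2 := fun h => hne ((c.plaque hxO).mp h)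
      obtain ⟨a, ha, haε, hat⟩ := hN x hx.1 hx.2 hne'
      exact hnotin a ha haε (hU.saturated c.φ c.φ_mem x hxt _
        (c.O_subset_target (c.mem_O_of_abs (haε.trans_lt hεr))) hat.symm hxU)
    · intro hs
      exact hU.saturated c.φ c.φ_mem p hpt x hxt ((c.plaque hxO).mpr hs).symm hp
  have hdisj : Disjoint U (closure U)ᶜ := by
    rw [Set.disjoint_left]; exact fun x h1 h2 => h2 (subset_closure h1)
  have hcover : ∀ x, x ∉ frontier U → x ∈ U ∪ (closure U)ᶜ := fun x hx => by
    by_cases h : x ∈ closure U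
    · left
      by_contra hxU
      exact hx (by rw [hU.isOpen.frontier_eq]; exact ⟨h, hxU⟩)
    · exact Or.inr h
  set a₀ := min ε (r' / 2) with ha₀
  have ha₀pos : 0 < a₀ := lt_min hεpos (by linarith)
  have ha₀r : a₀ < r' := (min_le_right _ _).trans_lt (by linarith)
  -- Each side of the plaque is connected and misses the frontier, so a single point of the normal
  -- line decides whether it lies in `U` or outside the closure.
  have hneg : {x ∈ c'.O | c'.s x < 0} ⊆ U := by
    refine c'.isPreconnected_neg.subset_left_of_subset_union hU.isOpen isClosed_closure.isOpen_compl
      hdisj (fun x hx => hcover x fun h => hx.2.ne ((hM x hx.1).mp h))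
      ⟨c'.pt (0, -a₀), ⟨c'.mem_O_of_abs ?_, ?_⟩, ?_⟩
    · rw [abs_neg, abs_of_pos ha₀pos]; exact ha₀r
    · simpa using ha₀pos
    · exact hminus _ (by linarith) (by linarith [min_le_left ε (r' / 2)])
  have hpos : {x ∈ c'.O | 0 < c'.s x} ⊆ (closure U)ᶜ := by
    refine c'.isPreconnected_pos.subset_left_of_subset_union isClosed_closure.isOpen_compl hU.isOpen
      hdisj.symm (fun x hx => (hcover x fun h => hx.2.ne' ((hM x hx.1).mp h)).symm)
      ⟨c'.pt (0, a₀), ⟨c'.mem_O_of_abs ?_, ?_⟩, ?_⟩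
    · rw [abs_of_pos ha₀pos]; exact ha₀r
    · simpa using ha₀pos
    · exact hplus _ ha₀pos (min_le_left _ _)
  refine ⟨c', hcφ, hM, fun x hx => ⟨fun hxU => ?_, fun hs => hneg ⟨hx, hs⟩⟩⟩
  rcases lt_trichotomy (c'.s x) 0 with h | h | h
  · exact h
  · have := (hM x hx).mpr h
    rw [hU.isOpen.frontier_eq] at this
    exact absurd hxU this.2
  · exact absurd (subset_closure hxU) (hpos ⟨hx, h⟩)

/-- By `exists_chart` the heights of frontier plaques in a box are isolated, and a discrete subset
of the line is countable. -/
theorem countable_plaques (hU : BoundedByLeaves R ν U) (hg : IsMetricOn g unitBall)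
    (hν : R.IsUnitNormal g ν) {φ : OpenPartialHomeomorph (E2 × ℝ) E3} (hφ : φ ∈ R.atlas) :
    {t ∈ Ioo (-1 : ℝ) 1 | φ (0, t) ∈ frontier U}.Countable := by
  set S := {t ∈ Ioo (-1 : ℝ) 1 | φ (0, t) ∈ frontier U} with hS
  have hsrc : ∀ t ∈ Ioo (-1 : ℝ) 1, ((0 : E2), t) ∈ φ.source := fun t ht => by
    rw [R.source_eq φ hφ]; exact ⟨mem_ball_self one_pos, ht⟩
  have hd : DiscreteTopology S := by
    rw [discreteTopology_subtype_iff]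
    intro t ht
    obtain ⟨c, hcφ, hM, -⟩ := hU.exists_chart hg hν hφ (φ.map_source (hsrc t ht.1)) ht.2
    have hct : ContinuousAt (fun t : ℝ => φ ((0 : E2), t)) t :=
      (φ.continuousAt (hsrc t ht.1)).comp (f := fun t : ℝ => ((0 : E2), t))
        (by fun_prop : ContinuousAt (fun t : ℝ => ((0 : E2), t)) t)
    have hev := hct.eventually c.O_mem_nhds
    rw [inf_principal_eq_bot]
    filter_upwards [self_mem_nhdsWithin, mem_nhdsWithin_of_mem_nhds hev] with t' hne hO hS'
    have := (c.plaque hO).mpr ((hM _ hO).mp hS'.2)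
    rw [hcφ, φ.left_inv (hsrc t' hS'.1), φ.left_inv (hsrc t ht.1)] at this
    exact hne this
  have : TopologicalSpace.SeparableSpace S := inferInstance
  exact countable_coe_iff.mp (TopologicalSpace.separableSpace_iff_countable.mp this)

end BoundedByLeaves

/-! ### The boundary current of a domain bounded by leaves -/

theorem BoundedByLeaves.exists_isOrientedBy (hU : BoundedByLeaves R ν U)
    (hg : IsMetricOn g unitBall) (hν : R.IsUnitNormal g ν) : ∃ T : RectCurrent,
      T.IsOrientedBy g ν ((frontier U ∩ (unitBall \ zAxis)).indicator fun _ => 1) := by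
  classical
  refine Foliation.exists_isOrientedBy hg hν (fun x hx => ?_) (fun φ hφ x hx x' hx' h => ?_)
    fun φ hφ => ?_
  · simp only [indicator_apply, ne_eq, ite_eq_right_iff, one_ne_zero, imp_false, not_not] at hx
    exact hx.2
  · have hΩ := R.target_subset hφ
    have : x ∈ frontier U ∩ (unitBall \ zAxis) ↔ x' ∈ frontier U ∩ (unitBall \ zAxis) :=
      ⟨fun hp => ⟨hU.saturated φ hφ x hx x' hx' h hp.1, hΩ hx'⟩,
        fun hp => ⟨hU.saturated φ hφ x' hx' x hx h.symm hp.1, hΩ hx⟩⟩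
    simp only [indicator_apply, this]
  · refine (hU.countable_plaques hg hν hφ).mono ?_
    rintro t ⟨ht, h⟩
    simp only [indicator_apply, ne_eq, ite_eq_right_iff, one_ne_zero, imp_false, not_not] at h
    exact ⟨ht, h.1⟩

namespace RectCurrent
variable {T : RectCurrent}

theorem IsOrientedBy.theta_eq {m : E3 → ℕ} (h : T.IsOrientedBy g ν m) (x : E3) :
    T.theta x = m x := by
  by_cases hx : x ∈ T.carrier
  · obtain ⟨i, y, hy, rfl⟩ := mem_iUnion.mp hx
    rw [T.theta_eq ⟨y, hy, rfl⟩, h.mult_eq i y hy, Int.natAbs_natCast]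
  · have hm : m x = 0 := by
      by_contra h0
      exact hx (h.carrier_eq ▸ h0)
    rw [hm, theta, dif_neg fun hi => hx (mem_iUnion.mpr hi)]

theorem measurableSet_carrier (T : RectCurrent) : MeasurableSet T.carrier :=
  MeasurableSet.iUnion T.measurableSet_piece

theorem ae_mass {P : E3 → Prop} (hP : MeasurableSet {x | P x})
    (h : ∀ᵐ q ∂T.base, T.pt q ∈ unitBall \ zAxis → T.dens g q ≠ 0 → P (T.pt q)) (hg : IsMetricOn g unitBall) :
    ∀ᵐ x ∂T.mass g, P x := by
  rw [mass, ae_map_iff T.measurable_pt.aemeasurable hP,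
    ae_withDensity_iff (T.measurable_dens_offAxis hg).ennreal_ofReal]
  filter_upwards [h] with q hq h0
  have hx : T.pt q ∈ unitBall \ zAxis := by
    by_contra hx
    exact h0 (by rw [T.dens_offAxis_of_notMem hx, ofReal_zero])
  exact hq hx fun hd => h0 (by rw [T.dens_offAxis hx, hd, ofReal_zero])

theorem ae_mass_mem_carrier (hg : IsMetricOn g unitBall) : ∀ᵐ x ∂T.mass g, x ∈ T.carrier :=
  ae_mass T.measurableSet_carrier (T.ae_pt_mem_carrier.mono fun _ h _ _ => h) hg

theorem ae_mass_mem_offAxis (hg : IsMetricOn g unitBall) :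
    ∀ᵐ x ∂T.mass g, x ∈ unitBall \ zAxis :=
  ae_mass isOpen_offAxis.measurableSet (ae_of_all _ fun _ h _ => h) hg

/-- On a plaque, the area measure is a multiple of Lebesgue measure in the chart, up to the
multiplicity. -/
theorem IsCalibrated.withDensity_plaque (hcal : T.IsCalibrated g ν) (hg : IsMetricOn g unitBall)
    (hν : R.IsUnitNormal g ν) {p : E3} (c : LeafChart R g ν p) :
    ((T.mass g).restrict {x ∈ c.O | c.s x = 0}).withDensity
        (fun x => ofReal (conormal g ν x (ν p))) =
      ofReal |c.D| • ((volume.restrict (ball 0 c.r)).withDensity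
        fun w => (T.theta (c.pt (w, 0)) : ENNReal)).map fun w => c.pt (w, 0) := by
  have hP : MeasurableSet {x ∈ c.O | c.s x = 0} :=
    c.isOpen_O.measurableSet.inter (measurableSet_eq_fun c.contDiff_s.continuous.measurable
      measurable_const)
  have hpt : Measurable fun w : E2 => c.pt (w, 0) :=
    (c.contDiff_pt.continuous.comp (Continuous.prodMk_left 0)).measurable
  ext A hA
  rw [withDensity_apply _ hA, Measure.restrict_restrict hA, hcal.lintegral_chart hg hν c
    (hA.inter hP) (fun x hx => hx.2.1) (fun x hx => hx.2.2), Measure.smul_apply, smul_eq_mul,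
    Measure.map_apply hpt hA, withDensity_apply _ (hpt hA), Measure.restrict_restrict (hpt hA)]
  congr 3
  ext w
  simp only [mem_ofPred_eq, mem_inter_iff, mem_preimage, c.pt_mem_O, c.s_pt, mem_ball_zero_iff,
    abs_zero, c.r_pos, and_true]

end RectCurrent

/-- Additive properties of test functions are local. -/
theorem of_locally {Ω : Set E3} {P : (E3 → ℝ) → Prop} (hzero : P 0)
    (hadd : ∀ ψ₁ ψ₂, P ψ₁ → P ψ₂ → P (ψ₁ + ψ₂))
    (hloc : ∀ x ∈ Ω, ∃ O ∈ 𝓝 x, ∀ ψ : E3 → ℝ, ContDiff ℝ ∞ ψ → HasCompactSupport ψ →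
      tsupport ψ ⊆ O → P ψ)
    {ψ : E3 → ℝ} (hψ : ContDiff ℝ ∞ ψ) (hc : HasCompactSupport ψ) (hs : tsupport ψ ⊆ Ω) : P ψ := by
  classical
  choose! O hO hP using hloc
  obtain ⟨t, htΩ, ht⟩ := hc.isCompact.elim_nhds_subcover (fun x => interior (O x))
    (fun x hx => interior_mem_nhds.mpr (hO x (hs hx)))
  have key : ∀ t : Finset E3, (∀ x ∈ t, x ∈ Ω) → ∀ ψ : E3 → ℝ, ContDiff ℝ ∞ ψ →
      HasCompactSupport ψ → tsupport ψ ⊆ ⋃ x ∈ t, interior (O x) → P ψ := by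
    intro t
    induction t using Finset.induction_on with
    | empty =>
      intro _ ψ _ _ hs
      have : ψ = 0 := by
        rw [← tsupport_eq_empty_iff]
        simpa using hs
      rwa [this]
    | insert a t ha ih =>
      intro htΩ ψ hψ hc hs
      have hV : IsOpen (⋃ x ∈ t, interior (O x)) := isOpen_biUnion fun _ _ => isOpen_interior
      have hK : IsCompact (tsupport ψ \ ⋃ x ∈ t, interior (O x)) := hc.isCompact.diff hV
      have hKs : tsupport ψ \ ⋃ x ∈ t, interior (O x) ⊆ interior (O a) := fun x hx => by
        have := hs hx.1
        simp only [Finset.set_biUnion_insert] at this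
        exact this.resolve_right hx.2
      obtain ⟨χ, h1, h2, h3, h4, -⟩ := exists_cutoff hK isOpen_interior hKs
      have hP1 : P (fun x => χ x * ψ x) := by
        refine hP a (htΩ a (Finset.mem_insert_self _ _)) _ (h1.mul hψ) h2.mul_right ?_
        exact (closure_mono (Function.support_mul_subset_left χ ψ)).trans
          (h3.trans interior_subset)
      have hP2 : P (fun x => (1 - χ x) * ψ x) := by
        refine ih (fun x hx => htΩ x (Finset.mem_insert_of_mem hx)) _
          ((contDiff_const.sub h1).mul hψ) hc.mul_left fun x hx => ?_
        have hx1 : x ∈ tsupport ψ :=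
          closure_mono (Function.support_mul_subset_right (fun x => 1 - χ x) ψ) hx
        by_contra hx2
        have h6 : ∀ᶠ z in 𝓝 x, χ z = 1 := (eventually_nhdsSet_iff_forall.mp h4) x ⟨hx1, hx2⟩
        refine notMem_tsupport_iff_eventuallyEq.mpr ?_ hx
        filter_upwards [h6] with z hz
        simp [hz]
      have hsum : ψ = (fun x => χ x * ψ x) + fun x => (1 - χ x) * ψ x := by
        ext x; simp only [Pi.add_apply]; ring
      rw [hsum]
      exact hadd _ _ hP1 hP2
  exact key t (fun x hx => hs (htΩ x hx)) ψ hψ hc ht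

/-! ### The Gauss-Green formula -/

theorem integral_fderiv_eq_zero {E : Type*} [NormedAddCommGroup E] [NormedSpace ℝ E]
    [MeasurableSpace E] [BorelSpace E] [FiniteDimensional ℝ E] {μ : Measure E}
    [μ.IsAddHaarMeasure] {ψ : E → ℝ} (hψ : ContDiff ℝ ∞ ψ) (hc : HasCompactSupport ψ) (v : E) :
    ∫ x, fderiv ℝ ψ x v ∂μ = 0 := by
  have h1 : Continuous fun x => fderiv ℝ ψ x v :=
    (hψ.continuous_fderiv (by simp)).clm_apply continuous_const
  have h2 : HasCompactSupport fun x => fderiv ℝ ψ x v :=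
    (hc.fderiv (𝕜 := ℝ)).comp_left (g := fun L : E →L[ℝ] ℝ => L v) rfl
  have := integral_mul_fderiv_eq_neg_fderiv_mul_of_integrable (μ := μ) (f := fun _ => (1 : ℝ))
    (g := ψ) (v := v) (by simp) (by simpa using h1.integrable_of_hasCompactSupport h2)
    (by simpa using hψ.continuous.integrable_of_hasCompactSupport hc)
    (fun _ _ => differentiableAt_const _) (fun x _ => hψ.differentiable (by simp) x)
  simpa using this

/-- Fubini: the horizontal derivative integrates to zero on each slice, and the vertical one to the
boundary value. The vertical component `b` may depend on the horizontal variable, as needed for the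
slope of a graph. -/
theorem integral_fderiv_halfSpace {ψ : E2 × ℝ → ℝ} (hψ : ContDiff ℝ ∞ ψ)
    (hc : HasCompactSupport ψ) (v : E2) {b : E2 → ℝ} (hb : Continuous b) :
    ∫ q in univ ×ˢ Iio (0 : ℝ), fderiv ℝ ψ q (v, b q.1) = ∫ w, b w * ψ (w, 0) := by
  have hcd : Continuous (fderiv ℝ ψ) := hψ.continuous_fderiv (by simp)
  have hsd : HasCompactSupport (fderiv ℝ ψ) := hc.fderiv (𝕜 := ℝ)
  have hdiff : Differentiable ℝ ψ := hψ.differentiable (by simp)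
  have hI : ∀ V : E2 × ℝ → E2 × ℝ, Continuous V →
      Integrable (fun q => fderiv ℝ ψ q (V q)) (volume : Measure (E2 × ℝ)) := fun V hV => by
    refine (hcd.clm_apply hV).integrable_of_hasCompactSupport (hsd.mono fun q hq => ?_)
    simp only [Function.mem_support] at hq ⊢
    rintro h0
    exact hq (by rw [h0]; rfl)
  have hIr : ∀ V : E2 × ℝ → E2 × ℝ, Continuous V → Integrable (fun q => fderiv ℝ ψ q (V q))
      ((volume : Measure E2).prod (volume.restrict (Iio (0 : ℝ)))) := fun V hV => by
    have := (hI V hV).restrict (s := univ ×ˢ Iio (0 : ℝ))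
    rwa [Measure.volume_eq_prod, ← Measure.prod_restrict, Measure.restrict_univ] at this
  rw [Measure.volume_eq_prod, ← Measure.prod_restrict, Measure.restrict_univ]
  have hsplit : ∀ q : E2 × ℝ, fderiv ℝ ψ q (v, b q.1) =
      fderiv ℝ ψ q (v, 0) + fderiv ℝ ψ q (0, b q.1) := fun q => by
    rw [← map_add]; simp
  simp_rw [hsplit]
  rw [integral_add (hIr (fun _ => (v, 0)) continuous_const)
    (hIr (fun q => (0, b q.1)) (by fun_prop))]
  have h1 : ∫ q, fderiv ℝ ψ q (v, 0) ∂(volume : Measure E2).prod (volume.restrict (Iio (0 : ℝ)))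
      = 0 := by
    rw [integral_prod_symm _ (hIr (fun _ => (v, 0)) continuous_const)]
    have : ∀ t : ℝ, ∫ w : E2, fderiv ℝ ψ (w, t) (v, 0) = 0 := fun t => by
      have hs : ContDiff ℝ ∞ fun w : E2 => ψ (w, t) := hψ.comp (contDiff_prodMk_left t)
      have hcs : HasCompactSupport fun w : E2 => ψ (w, t) :=
        hc.comp_isClosedEmbedding ⟨Topology.IsEmbedding.of_leftInverse (f := Prod.fst)
          (fun _ => rfl) continuous_fst (by fun_prop), by
            have : range (fun w : E2 => (w, t)) = Prod.snd ⁻¹' {t} := by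
              ext ⟨a, b⟩; simp [eq_comm]
            rw [this]; exact isClosed_singleton.preimage continuous_snd⟩
      refine Eq.trans ?_ (integral_fderiv_eq_zero (μ := volume) hs hcs v)
      refine integral_congr_ae (ae_of_all _ fun w => ?_)
      have := (hdiff (w, t)).hasFDerivAt.comp (g := ψ) (f := fun w : E2 => (w, t)) w
        (hasFDerivAt_prodMk_left w t)
      have h' : fderiv ℝ (fun w => ψ (w, t)) w = _ := this.fderiv
      simp [h']
    simp [this]
  have h2 : ∫ q, fderiv ℝ ψ q (0, b q.1) ∂(volume : Measure E2).prod (volume.restrict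
      (Iio (0 : ℝ))) = ∫ w, b w * ψ (w, 0) := by
    rw [integral_prod _ (hIr (fun q => (0, b q.1)) (by fun_prop))]
    refine integral_congr_ae (ae_of_all _ fun w => ?_)
    have hs : ContDiff ℝ 1 fun t : ℝ => ψ (w, t) :=
      (hψ.of_le (by norm_cast)).comp (contDiff_prodMk_right w)
    have hcs : HasCompactSupport fun t : ℝ => ψ (w, t) :=
      hc.comp_isClosedEmbedding ⟨Topology.IsEmbedding.of_leftInverse (f := Prod.snd)
        (fun _ => rfl) continuous_snd (by fun_prop), by
          have : range (fun t : ℝ => (w, t)) = Prod.fst ⁻¹' {w} := by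
            ext ⟨a, b⟩; simp [eq_comm]
          rw [this]; exact isClosed_singleton.preimage continuous_fst⟩
    have := HasCompactSupport.integral_Iic_deriv_eq hs hcs 0
    simp only
    rw [← this, integral_Iic_eq_integral_Iio, ← integral_const_mul]
    refine integral_congr_ae (ae_of_all _ fun t => ?_)
    have hd := (hdiff (w, t)).hasFDerivAt.comp_hasDerivAt (f := fun t : ℝ => (w, t)) t
      ((hasDerivAt_const t w).prodMk (hasDerivAt_id t))
    have hd' : deriv (fun t => ψ (w, t)) t = fderiv ℝ ψ (w, t) (0, 1) := hd.deriv
    simp only [hd']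
    rw [← smul_eq_mul, ← map_smul]
    simp
  rw [h1, h2, zero_add]

namespace LeafChart
variable {p : E3} (c : LeafChart R g ν p)

theorem hasFDerivAt_pt (q : E2 × ℝ) : HasFDerivAt c.pt
    ((c.Λ.symm : E2 × ℝ →L[ℝ] E3).comp ((ContinuousLinearMap.fst ℝ E2 ℝ).prod
      (ContinuousLinearMap.snd ℝ E2 ℝ + (fderiv ℝ c.f q.1).comp
        (ContinuousLinearMap.fst ℝ E2 ℝ)))) q := by
  have hf := ((c.smooth_f.differentiable (by simp) q.1).hasFDerivAt).comp (g := c.f)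
    (f := Prod.fst) q hasFDerivAt_fst
  exact (c.Λ.symm.toContinuousLinearMap.hasFDerivAt.comp (g := c.Λ.symm)
    (f := fun q : E2 × ℝ => (q.1, q.2 + c.f q.1)) q
    (hasFDerivAt_fst.prodMk (hasFDerivAt_snd.add hf))).const_add p

theorem fderiv_comp_pt {ψ : E3 → ℝ} (hψ : ContDiff ℝ ∞ ψ) (q : E2 × ℝ) (e : E3) :
    fderiv ℝ ψ (c.pt q) e = fderiv ℝ (fun q => ψ (c.pt q)) q
      ((c.Λ e).1, (c.Λ e).2 - fderiv ℝ c.f q.1 (c.Λ e).1) := by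
  have h := ((hψ.differentiable (by simp) (c.pt q)).hasFDerivAt).comp (g := ψ) (f := c.pt) q
    (c.hasFDerivAt_pt q)
  rw [show (fun q => ψ (c.pt q)) = ψ ∘ c.pt from rfl, h.fderiv]
  simp

theorem hasCompactSupport_comp_pt {F : Type*} [Zero F] {ψ : E3 → F} (hc : HasCompactSupport ψ) :
    HasCompactSupport fun q => ψ (c.pt q) := by
  let e : E2 × ℝ ≃ₜ E3 :=
    { toFun := c.pt
      invFun := fun x => (c.y x, c.s x)
      left_inv := fun q => by simp
      right_inv := fun x => by simp
      continuous_toFun := c.contDiff_pt.continuous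
      continuous_invFun := c.contDiff_y.continuous.prodMk c.contDiff_s.continuous }
  exact hc.comp_homeomorph e

theorem integral_fderiv_below {ψ : E3 → ℝ} (hψ : ContDiff ℝ ∞ ψ) (hc : HasCompactSupport ψ)
    (e : E3) : ∫ x in {x | c.s x < 0}, fderiv ℝ ψ x e =
      |c.D| * ∫ w, ((c.Λ e).2 - fderiv ℝ c.f w (c.Λ e).1) * ψ (c.pt (w, 0)) := by
  have hm : MeasurableSet {x | c.s x < 0} :=
    measurableSet_lt c.contDiff_s.continuous.measurable measurable_const
  rw [← integral_indicator hm, c.integral_eq]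
  congr 1
  rw [← integral_fderiv_halfSpace (ψ := fun q => ψ (c.pt q)) (hψ.comp c.contDiff_pt)
    (c.hasCompactSupport_comp_pt hc) (c.Λ e).1
    (b := fun w => (c.Λ e).2 - fderiv ℝ c.f w (c.Λ e).1)
    (continuous_const.sub ((c.smooth_f.continuous_fderiv (by simp)).clm_apply continuous_const)),
    ← integral_indicator (MeasurableSet.univ.prod measurableSet_Iio)]
  refine integral_congr_ae (ae_of_all _ fun q => ?_)
  simp only [indicator_apply, mem_ofPred_eq, s_pt, mem_prod, mem_univ, true_and, mem_Iio]
  split_ifs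
  · exact c.fderiv_comp_pt hψ q e
  · rfl

/-- The vector `e` is split into a tangent vector of the graph and a multiple of `ν p`. On the
plaque itself the bound on the slope is zero, so the conormal annihilates the tangent part. -/
theorem conormal_eq {x : E3} (hx : x ∈ c.O) (hs : c.s x = 0) (e : E3) :
    conormal g ν x e =
      ((c.Λ e).2 - fderiv ℝ c.f (c.y x) (c.Λ e).1) * conormal g ν x (ν p) := by
  have hΩ := c.O_subset hx
  have h0 : conormal g ν x (c.Λ.symm ((c.Λ e).1, fderiv ℝ c.f (c.y x) (c.Λ e).1)) = 0 := by
    have := c.slope hx (c.Λ e).1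
    rw [hs, abs_zero, mul_zero] at this
    rw [conormal_apply hΩ, abs_nonpos_iff.mp this, mul_zero]
  have he : e = c.Λ.symm ((c.Λ e).1, fderiv ℝ c.f (c.y x) (c.Λ e).1) +
      ((c.Λ e).2 - fderiv ℝ c.f (c.y x) (c.Λ e).1) • ν p := by
    apply c.Λ.injective
    rw [map_add, map_smul, c.Λ_normal, c.Λ.apply_symm_apply]
    ext <;> simp
  conv_lhs => rw [he]
  rw [map_add, map_smul, h0, zero_add, smul_eq_mul]

theorem conormal_pos (hg : IsMetricOn g unitBall) {x : E3} (hx : x ∈ c.O) :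
    0 < conormal g ν x (ν p) := by
  rw [conormal_apply (c.O_subset hx)]
  exact mul_pos (inv_pos.mpr (hg.isInner (c.O_subset hx).1).gvol_pos)
    (lt_of_lt_of_le (by norm_num) (c.half_le hx))

end LeafChart

/-- The value of the outer boundary of `U` on a test function and a direction is given by the
Gauss-Green formula. -/
def GaussGreen (g : MetricField) (ν : E3 → E3) (U : Set E3) (μ : Measure E3) (e : E3)
    (ψ : E3 → ℝ) : Prop :=
  Integrable (fun x => ψ x * conormal g ν x e) μ ∧ Integrable (fun x => fderiv ℝ ψ x e) ∧
    Differentiable ℝ ψ ∧ ∫ x in U, fderiv ℝ ψ x e = ∫ x, ψ x * conormal g ν x e ∂μ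

/-- Integrability and differentiability are included in the predicate for the sake of this
additivity, which is what localization by `of_locally` requires. -/
theorem GaussGreen.add {μ : Measure E3} {e : E3} {ψ₁ ψ₂ : E3 → ℝ}
    (h₁ : GaussGreen g ν U μ e ψ₁) (h₂ : GaussGreen g ν U μ e ψ₂) :
    GaussGreen g ν U μ e (ψ₁ + ψ₂) := by
  have hd : ∀ x, fderiv ℝ (ψ₁ + ψ₂) x e = fderiv ℝ ψ₁ x e + fderiv ℝ ψ₂ x e := fun x => by
    rw [fderiv_add (h₁.2.2.1 x) (h₂.2.2.1 x)]; rfl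
  have hm : ∀ x, (ψ₁ + ψ₂) x * conormal g ν x e = ψ₁ x * conormal g ν x e +
    ψ₂ x * conormal g ν x e := fun x => by rw [Pi.add_apply]; ring
  unfold GaussGreen
  simp_rw [hd, hm]
  refine ⟨h₁.1.add h₂.1, h₁.2.1.add h₂.2.1, h₁.2.2.1.add h₂.2.2.1, ?_⟩
  rw [integral_add h₁.2.1.restrict h₂.2.1.restrict, integral_add h₁.1 h₂.1, h₁.2.2.2, h₂.2.2.2]

theorem integrable_fderiv_const {ψ : E3 → ℝ} (hψ : ContDiff ℝ ∞ ψ) (hc : HasCompactSupport ψ)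
    (e : E3) : Integrable fun x => fderiv ℝ ψ x e :=
  integrable_fderiv_apply hψ hc measurable_const fun _ _ => le_rfl

theorem fderiv_eq_zero_of_notMem {E : Type*} [NormedAddCommGroup E] [NormedSpace ℝ E] {ψ : E → ℝ}
    {x : E} (h : x ∉ tsupport ψ) : fderiv ℝ ψ x = 0 :=
  image_eq_zero_of_notMem_tsupport fun hx => h (tsupport_fderiv_subset ℝ hx)

theorem RectCurrent.IsCalibrated.withDensity_plaque_of_theta_eq_one {T : RectCurrent}
    (hcal : T.IsCalibrated g ν) (hg : IsMetricOn g unitBall)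
    (hν : R.IsUnitNormal g ν) {p : E3} (c : LeafChart R g ν p)
    (hθ : ∀ w ∈ ball (0 : E2) c.r, T.theta (c.pt (w, 0)) = 1) :
    ((T.mass g).restrict {x ∈ c.O | c.s x = 0}).withDensity
        (fun x => ofReal (conormal g ν x (ν p))) =
      ofReal |c.D| • (volume.restrict (ball 0 c.r)).map fun w => c.pt (w, 0) := by
  have h1 : (volume.restrict (ball 0 c.r)).withDensity
      (fun w => (T.theta (c.pt (w, 0)) : ENNReal)) = volume.restrict (ball 0 c.r) := by
    rw [withDensity_congr_ae (g := 1), withDensity_one]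
    filter_upwards [ae_restrict_mem measurableSet_ball] with w hw
    rw [hθ w hw]; simp
  rw [hcal.withDensity_plaque hg hν c, h1]

namespace BoundedByLeaves

/-- In the chart `U` is the region below the graph, so the left side is given by the divergence
theorem for a half space. The right side agrees because on a plaque of multiplicity one the area
measure, weighted by the conormal of `ν p`, is `|D|` times Lebesgue measure in the coordinate `y`.
-/
theorem gaussGreen_chart (hg : IsMetricOn g unitBall) (hν : R.IsUnitNormal g ν)
    {T : RectCurrent}
    (hT : T.IsOrientedBy g ν ((frontier U ∩ (unitBall \ zAxis)).indicator fun _ => 1))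
    {p : E3} (c : LeafChart R g ν p) (hM : ∀ x ∈ c.O, x ∈ frontier U ↔ c.s x = 0)
    (hUs : ∀ x ∈ c.O, x ∈ U ↔ c.s x < 0) (hUo : IsOpen U) {ψ : E3 → ℝ} (hψ : ContDiff ℝ ∞ ψ)
    (hc : HasCompactSupport ψ) (hs : tsupport ψ ⊆ c.O) (e : E3) :
    GaussGreen g ν U (T.mass g) e ψ := by
  classical
  set P := {x ∈ c.O | c.s x = 0} with hPdef
  have hP : MeasurableSet P :=
    c.isOpen_O.measurableSet.inter (measurableSet_eq_fun c.contDiff_s.continuous.measurable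
      measurable_const)
  set b : E2 → ℝ := fun w => (c.Λ e).2 - fderiv ℝ c.f w (c.Λ e).1 with hb
  have hbc : Continuous b :=
    continuous_const.sub ((c.smooth_f.continuous_fderiv (by simp)).clm_apply continuous_const)
  have hptc : Continuous fun w : E2 => c.pt (w, 0) :=
    c.contDiff_pt.continuous.comp (Continuous.prodMk_left 0)
  set κ : E3 → ENNReal := fun x => ofReal (conormal g ν x (ν p)) with hκ
  have hκm : Measurable κ := (measurable_conormal_apply hg hν measurable_const).ennreal_ofReal
  have hWD : ((T.mass g).restrict P).withDensity κ = ofReal |c.D| •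
      (volume.restrict (ball 0 c.r)).map fun w => c.pt (w, 0) := by
    have hθ : ∀ w ∈ ball (0 : E2) c.r, T.theta (c.pt (w, 0)) = 1 := fun w hw => by
      have hO : c.pt (w, 0) ∈ c.O := c.pt_mem_O.mpr ⟨mem_ball_zero_iff.mp hw, by simp [c.r_pos]⟩
      rw [hT.theta_eq]
      exact indicator_of_mem (s := frontier U ∩ (unitBall \ zAxis))
        ⟨(hM _ hO).mpr (by simp), c.O_subset hO⟩ _
    exact (hT.isCalibrated hg hν.unit).withDensity_plaque_of_theta_eq_one hg hν c hθ
  set h : E3 → ℝ := fun x => b (c.y x) * ψ x with hh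
  have hhc : Continuous h := (hbc.comp c.contDiff_y.continuous).mul hψ.continuous
  have hcs : HasCompactSupport fun w : E2 => h (c.pt (w, 0)) := by
    refine HasCompactSupport.of_support_subset_isCompact (hc.isCompact.image
      c.contDiff_y.continuous) fun w hw => ?_
    refine ⟨c.pt (w, 0), subset_tsupport _ ?_, by simp⟩
    simp only [hh, Function.mem_support] at hw ⊢
    exact right_ne_zero_of_mul hw
  have hi : Integrable h (((T.mass g).restrict P).withDensity κ) := by
    rw [hWD]
    refine Integrable.smul_measure ?_ ofReal_ne_top
    rw [integrable_map_measure hhc.aestronglyMeasurable hptc.aemeasurable]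
    exact ((hhc.comp hptc).integrable_of_hasCompactSupport hcs).restrict
  have hval : ∫ x, h x ∂((T.mass g).restrict P).withDensity κ =
      |c.D| * ∫ w, b w * ψ (c.pt (w, 0)) := by
    rw [hWD, integral_smul_measure, ENNReal.toReal_ofReal (abs_nonneg _), smul_eq_mul,
      integral_map hptc.aemeasurable hhc.aestronglyMeasurable]
    congr 1
    rw [setIntegral_eq_integral_of_forall_compl_eq_zero]
    · simp [hh]
    · intro w hw
      have : c.pt (w, 0) ∉ tsupport ψ := fun hx => hw (mem_ball_zero_iff.mpr
        (c.pt_mem_O.mp (hs hx)).1)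
      simp [hh, image_eq_zero_of_notMem_tsupport this]
  have hae : (fun x => ψ x * conormal g ν x e) =ᵐ[T.mass g]
      P.indicator fun x => (κ x).toReal • h x := by
    filter_upwards [RectCurrent.ae_mass_mem_carrier (T := T) hg] with x hx
    rw [hT.carrier_eq] at hx
    have hx' : x ∈ frontier U := by
      by_contra h0
      exact hx (indicator_of_notMem (fun hh => h0 hh.1) _)
    by_cases hxO : x ∈ c.O
    · have hs0 := (hM x hxO).mp hx'
      rw [indicator_of_mem (show x ∈ P from ⟨hxO, hs0⟩), c.conormal_eq hxO hs0,
        ENNReal.toReal_ofReal (c.conormal_pos hg hxO).le, smul_eq_mul]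
      simp only [hh, hb]; ring
    · rw [indicator_of_notMem (fun hP => hxO hP.1),
        image_eq_zero_of_notMem_tsupport fun h => hxO (hs h), zero_mul]
  have hlt : ∀ᵐ x ∂(T.mass g).restrict P, κ x < ⊤ := ae_of_all _ fun _ => ofReal_lt_top
  refine ⟨?_, integrable_fderiv_const hψ hc e, hψ.differentiable (by simp), ?_⟩
  · rw [integrable_congr hae, integrable_indicator_iff hP]
    exact (integrable_withDensity_iff_integrable_smul' hκm hlt).mp hi
  · rw [integral_congr_ae hae, integral_indicator hP,
      ← integral_withDensity_eq_integral_toReal_smul hκm hlt, hval,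
      ← c.integral_fderiv_below hψ hc e, ← integral_indicator hUo.measurableSet,
      ← integral_indicator (measurableSet_lt c.contDiff_s.continuous.measurable measurable_const)]
    refine integral_congr_ae (ae_of_all _ fun x => ?_)
    by_cases hx : x ∈ tsupport ψ
    · simp only [indicator_apply, hUs x (hs hx), mem_ofPred_eq]
    · simp [indicator_apply, fderiv_eq_zero_of_notMem hx]

theorem gaussGreen (hU : BoundedByLeaves R ν U) (hg : IsMetricOn g unitBall)
    (hν : R.IsUnitNormal g ν) {T : RectCurrent}
    (hT : T.IsOrientedBy g ν ((frontier U ∩ (unitBall \ zAxis)).indicator fun _ => 1))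
    {ψ : E3 → ℝ} (hψ : ContDiff ℝ ∞ ψ) (hc : HasCompactSupport ψ)
    (hs : tsupport ψ ⊆ unitBall \ zAxis) (e : E3) : GaussGreen g ν U (T.mass g) e ψ := by
  refine of_locally (P := GaussGreen g ν U (T.mass g) e) ?_ (fun _ _ => GaussGreen.add)
    (fun p hp => ?_) hψ hc hs
  · refine ⟨?_, ?_, differentiable_const 0, ?_⟩ <;> simp [fderiv_zero]
  have hoff : ∀ ψ : E3 → ℝ, ContDiff ℝ ∞ ψ → HasCompactSupport ψ →
      Disjoint (tsupport ψ) (frontier U) → ∫ x in U, fderiv ℝ ψ x e = 0 →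
      GaussGreen g ν U (T.mass g) e ψ := by
    intro ψ hψ hc hd h0
    have hae : (fun x => ψ x * conormal g ν x e) =ᵐ[T.mass g] 0 := by
      filter_upwards [RectCurrent.ae_mass_mem_carrier (T := T) hg] with x hx
      rw [hT.carrier_eq] at hx
      have hx' : x ∈ frontier U := by
        by_contra h0
        exact hx (indicator_of_notMem (fun hh => h0 hh.1) _)
      rw [image_eq_zero_of_notMem_tsupport fun h => disjoint_left.mp hd h hx', zero_mul]
      rfl
    refine ⟨(integrable_congr hae).mpr (integrable_zero _ _ _), integrable_fderiv_const hψ hc e,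
      hψ.differentiable (by simp), ?_⟩
    rw [h0, integral_congr_ae hae]
    simp
  by_cases hpF : p ∈ frontier U
  · obtain ⟨φ, hφ, hpφ⟩ := R.exists_box hp
    obtain ⟨c, -, hM, hUs⟩ := hU.exists_chart hg hν hφ hpφ hpF
    exact ⟨c.O, c.O_mem_nhds, fun ψ hψ hc hs =>
      gaussGreen_chart hg hν hT c hM hUs hU.isOpen hψ hc hs e⟩
  by_cases hpU : p ∈ U
  · refine ⟨U, hU.isOpen.mem_nhds hpU, fun ψ hψ hc hs => hoff ψ hψ hc ?_ ?_⟩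
    · rw [hU.isOpen.frontier_eq]
      exact disjoint_left.mpr fun x h1 h2 => h2.2 (hs h1)
    · rw [setIntegral_eq_integral_of_forall_compl_eq_zero, integral_fderiv_eq_zero hψ hc]
      exact fun x hx => by rw [fderiv_eq_zero_of_notMem fun h => hx (hs h)]; rfl
  · have hp' : p ∈ (closure U)ᶜ := fun h => hpF (by rw [hU.isOpen.frontier_eq]; exact ⟨h, hpU⟩)
    refine ⟨(closure U)ᶜ, isClosed_closure.isOpen_compl.mem_nhds hp',
      fun ψ hψ hc hs => hoff ψ hψ hc ?_ ?_⟩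
    · exact disjoint_left.mpr fun x h1 h2 => hs h1 (frontier_subset_closure h2)
    · refine setIntegral_eq_zero_of_forall_eq_zero fun x hx => ?_
      rw [fderiv_eq_zero_of_notMem fun h => hs h (subset_closure hx)]; rfl

/-- The area measure is finite on compact subsets off the axis. -/
theorem mass_lt_top (hU : BoundedByLeaves R ν U) (hg : IsMetricOn g unitBall)
    (hν : R.IsUnitNormal g ν) {T : RectCurrent}
    (hT : T.IsOrientedBy g ν ((frontier U ∩ (unitBall \ zAxis)).indicator fun _ => 1))
    {K : Set E3} (hK : IsCompact K) (hKΩ : K ⊆ unitBall \ zAxis) : T.mass g K < ⊤ := by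
  refine hK.measure_lt_top_of_nhdsWithin fun p hp => ?_
  have hpΩ := hKΩ hp
  obtain ⟨χ, h1, h2, h3, h4, h5⟩ := exists_cutoff (isCompact_singleton (x := p)) isOpen_offAxis
    (singleton_subset_iff.mpr hpΩ)
  -- The formula contains the integrability of the conormal against a cutoff. Near `p` the conormal
  -- of `ν p` is bounded below by a positive constant, so Markov's inequality gives finite measure
  -- to a neighbourhood.
  have hi := (hU.gaussGreen hg hν hT h1 h2 h3 (ν p)).1
  have hcont : ContinuousAt (fun x => conormal g ν x (ν p)) p :=
    ((continuousOn_conormal' hg hν).continuousAt (isOpen_offAxis.mem_nhds hpΩ)).clm_apply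
      continuousAt_const
  have hpos : 0 < conormal g ν p (ν p) := by
    rw [conormal_apply hpΩ, hν.unit p hpΩ, mul_one]
    exact inv_pos.mpr (hg.isInner hpΩ.1).gvol_pos
  set a := conormal g ν p (ν p) / 2
  have ha : 0 < a := half_pos hpos
  refine ⟨{x | a ≤ ‖χ x * conormal g ν x (ν p)‖}, mem_nhdsWithin_of_mem_nhds ?_, ?_⟩
  · have h4' : ∀ᶠ x in 𝓝 p, χ x = 1 := by simpa [nhdsSet_singleton] using h4
    filter_upwards [h4', hcont.eventually (lt_mem_nhds (half_lt_self hpos))] with x hx hx'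
    rw [hx, one_mul]
    exact hx'.le.trans (le_abs_self _)
  · exact hi.measure_norm_ge_lt_top ha

end BoundedByLeaves

/-! ### The area of the boundary of a domain bounded by leaves -/

theorem integrable_of_tsupport_finite {μ : Measure E3} {φ : E3 → ℝ} (hφ : Continuous φ)
    (hc : HasCompactSupport φ) (hK : μ (tsupport φ) < ⊤) : Integrable φ μ := by
  obtain ⟨C, hC⟩ := hφ.bounded_above_of_compact_support hc
  rw [← integrableOn_iff_integrable_of_support_subset (subset_tsupport φ)]
  exact Measure.integrableOn_of_bounded hK.ne hφ.aestronglyMeasurable (ae_of_all _ hC)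

theorem conormal_calib (hg : IsMetricOn g unitBall) (hν : R.IsUnitNormal g ν) {x : E3}
    (hx : x ∈ unitBall \ zAxis) : conormal g ν x (calib g ν x) = 1 := by
  rw [conormal_apply hx, calib, map_smul, smul_eq_mul, hν.unit x hx, mul_one,
    inv_mul_cancel₀ (hg.isInner hx.1).gvol_pos.ne']

namespace BoundedByLeaves

/-- The Gauss-Green formula for `φ Y_j` in the direction of the `j`-th basis vector, summed over
`j`; the term with the divergence of `Y` drops out. -/
theorem integral_field (hU : BoundedByLeaves R ν U) (hg : IsMetricOn g unitBall)
    (hν : R.IsUnitNormal g ν) {T : RectCurrent}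
    (hT : T.IsOrientedBy g ν ((frontier U ∩ (unitBall \ zAxis)).indicator fun _ => 1))
    {φ : E3 → ℝ} (hφ : ContDiff ℝ ∞ φ) (hc : HasCompactSupport φ)
    (hs : tsupport φ ⊆ unitBall \ zAxis) {Y : E3 → E3} (hY : ContDiff ℝ ∞ Y)
    (hdiv : ∀ x ∈ unitBall, tr3 (fderiv ℝ Y x) = 0) :
    ∫ x in U, fderiv ℝ φ x (Y x) = ∫ x, φ x * conormal g ν x (Y x) ∂T.mass g := by
  have hYj : ∀ j, ContDiff ℝ ∞ fun x => Y x j := fun j => by fun_prop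
  have hgg : ∀ j, GaussGreen g ν U (T.mass g) (bv j) fun x => φ x * Y x j := fun j =>
    hU.gaussGreen hg hν hT (hφ.mul (hYj j)) hc.mul_right
      ((closure_mono (Function.support_mul_subset_left _ _)).trans hs) _
  have h1 : ∀ x, fderiv ℝ φ x (Y x) = ∑ j, fderiv ℝ (fun x => φ x * Y x j) x (bv j) := by
    intro x
    have hφd := hφ.differentiable (by simp) x
    have hYd : DifferentiableAt ℝ Y x := hY.differentiable (by simp) x
    have hd : ∀ j, fderiv ℝ (fun x => φ x * Y x j) x (bv j) =
        φ x * fderiv ℝ Y x (bv j) j + Y x j * fderiv ℝ φ x (bv j) := fun j => by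
      have hj : fderiv ℝ (fun x => Y x j) x (bv j) = fderiv ℝ Y x (bv j) j := by
        have := ((EuclideanSpace.proj (𝕜 := ℝ) j).hasFDerivAt (x := Y x)).comp
          (g := EuclideanSpace.proj (𝕜 := ℝ) j) (f := Y) x hYd.hasFDerivAt
        have h' : fderiv ℝ (fun x => Y x j) x = _ := this.fderiv
        rw [h']; rfl
      rw [fderiv_fun_mul hφd ((hYj j).differentiable (by simp) x)]
      simp [hj]
    simp_rw [hd]
    rw [Finset.sum_add_distrib, ← Finset.mul_sum]
    have h0 : φ x * ∑ j, fderiv ℝ Y x (bv j) j = 0 := by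
      by_cases hx : x ∈ tsupport φ
      · have := hdiv x (hs hx).1
        rw [tr3] at this
        rw [Fin.sum_univ_three, this, mul_zero]
      · rw [image_eq_zero_of_notMem_tsupport hx, zero_mul]
    rw [h0, zero_add, clm_apply_eq_sum]
    exact Finset.sum_congr rfl fun j _ => mul_comm _ _
  have h2 : ∀ x, φ x * conormal g ν x (Y x) = ∑ j, φ x * Y x j * conormal g ν x (bv j) := fun x => by
    rw [clm_apply_eq_sum, Finset.mul_sum]
    exact Finset.sum_congr rfl fun j _ => by ring
  simp_rw [h1, h2]
  rw [integral_finsetSum _ fun j _ => (hgg j).2.1.restrict,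
    integral_finsetSum _ fun j _ => (hgg j).1]
  exact Finset.sum_congr rfl fun j _ => (hgg j).2.2.2

/-- The conormal of `calib` is one, so the flux of `calib` is the area measure. The formula for
smooth divergence free fields is applied to the approximations, and dominated convergence on both
sides gives it for `calib`. -/
theorem integral_mass_eq (hU : BoundedByLeaves R ν U) (hg : IsMetricOn g unitBall)
    (hν : R.IsUnitNormal g ν) (hmin : R.IsMinimal g ν) {T : RectCurrent}
    (hT : T.IsOrientedBy g ν ((frontier U ∩ (unitBall \ zAxis)).indicator fun _ => 1))
    {φ : E3 → ℝ} (hφ : ContDiff ℝ ∞ φ) (hc : HasCompactSupport φ)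
    (hs : tsupport φ ⊆ unitBall \ zAxis) :
    ∫ x, φ x ∂T.mass g = ∫ x in U, fderiv ℝ φ x (calib₀ g ν x) := by
  obtain ⟨Y, hYs, hYd, hY⟩ := exists_mollification hg hν hmin
  set K := tsupport φ with hKdef
  have hK : IsCompact K := hc
  obtain ⟨C, hC0, hC⟩ := exists_norm_le_of_average_compact hg hν.unit hY hK fun x hx => (hs hx).1
  obtain ⟨C₂, hC₂⟩ := hK.exists_bound_of_continuousOn ((continuousOn_conormal' hg hν).mono hs)
  have hfin := hU.mass_lt_top hg hν hT hK hs
  have hitg := integrable_of_tsupport_finite (μ := T.mass g) hφ.continuous hc hfin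
  have hfc : Continuous (fderiv ℝ φ) := hφ.continuous_fderiv (by simp)
  have h1 : Tendsto (fun n => ∫ x in U, fderiv ℝ φ x (Y n x)) atTop
      (𝓝 (∫ x in U, fderiv ℝ φ x (calib₀ g ν x))) := by
    refine tendsto_integral_filter_of_dominated_convergence (fun x => ‖fderiv ℝ φ x‖ * C)
      (Eventually.of_forall fun n => (hfc.clm_apply (hYs n).continuous).aestronglyMeasurable)
      (hC.mono fun n hn => ae_of_all _ fun x => ?_)
      (((hfc.norm.integrable_of_hasCompactSupport (hc.fderiv (𝕜 := ℝ)).norm).mul_const C).restrict)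
      (ae_of_all _ fun x => ?_)
    · by_cases hx : x ∈ K
      · exact (ContinuousLinearMap.le_opNorm _ _).trans
          (mul_le_mul_of_nonneg_left (hn x hx) (norm_nonneg _))
      · simp [fderiv_eq_zero_of_notMem hx]
    · by_cases hx : x ∈ K
      · rw [calib₀_of_mem (hs hx)]
        exact ((fderiv ℝ φ x).continuous.tendsto _).comp (tendsto_of_average hg hν hY (hs hx))
      · simp [fderiv_eq_zero_of_notMem hx]
  have h2 : Tendsto (fun n => ∫ x, φ x * conormal g ν x (Y n x) ∂T.mass g) atTop
      (𝓝 (∫ x, φ x ∂T.mass g)) := by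
    refine tendsto_integral_filter_of_dominated_convergence (fun x => ‖φ x‖ * (C₂ * C))
      (Eventually.of_forall fun n => (hφ.continuous.measurable.mul (measurable_conormal_apply hg hν
        (hYs n).continuous.measurable)).aestronglyMeasurable)
      (hC.mono fun n hn => ae_of_all _ fun x => ?_) (hitg.norm.mul_const _)
      (ae_of_all _ fun x => ?_)
    · rw [norm_mul]
      by_cases hx : x ∈ K
      · refine mul_le_mul_of_nonneg_left ?_ (norm_nonneg _)
        exact (ContinuousLinearMap.le_opNorm _ _).trans (mul_le_mul (hC₂ x hx) (hn x hx)
          (norm_nonneg _) ((norm_nonneg _).trans (hC₂ x hx)))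
      · simp [image_eq_zero_of_notMem_tsupport hx]
    · by_cases hx : x ∈ K
      · have := ((conormal g ν x).continuous.tendsto _).comp
          (tendsto_of_average hg hν hY (hs hx))
        rw [conormal_calib hg hν (hs hx)] at this
        simpa using this.const_mul (φ x)
      · simp [image_eq_zero_of_notMem_tsupport hx]
  refine tendsto_nhds_unique h2 (h1.congr fun n => ?_)
  obtain ⟨r, hr, hd⟩ := hYd n
  exact hU.integral_field hg hν hT hφ hc hs (hYs n) fun x hx =>
    hd x (ball_subset_ball hr.le hx)

/-- The cutoff `χ` may be nonzero on the axis, where finiteness of the area is not yet known. The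
tube cutoffs remove the axis at a cost that tends to zero, and Fatou's lemma recovers the full
integral. -/
theorem lintegral_cutoff_le (hU : BoundedByLeaves R ν U) (hUB : U ⊆ unitBall)
    (hg : IsMetricOn g unitBall)
    (hν : R.IsUnitNormal g ν) (hmin : R.IsMinimal g ν) {T : RectCurrent}
    (hT : T.IsOrientedBy g ν ((frontier U ∩ (unitBall \ zAxis)).indicator fun _ => 1))
    {χ : E3 → ℝ} (hχ : ContDiff ℝ ∞ χ) (hc : HasCompactSupport χ) (hs : tsupport χ ⊆ unitBall)
    (h01 : ∀ x, χ x ∈ Icc (0 : ℝ) 1) :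
    ∫⁻ x, ofReal (χ x) ∂T.mass g ≤
      ofReal (∫ x in U, |fderiv ℝ χ x (calib₀ g ν x)|) := by
  set φ : ℕ → E3 → ℝ := fun n x => tubeCut n x * χ x with hφdef
  have hφ : ∀ n, ContDiff ℝ ∞ (φ n) := fun n => (contDiff_tubeCut n).mul hχ
  have hφc : ∀ n, HasCompactSupport (φ n) := fun n => hc.mul_left
  have hφs : ∀ n, tsupport (φ n) ⊆ unitBall \ zAxis := fun n x hx =>
    ⟨hs (closure_mono (Function.support_mul_subset_right _ _) hx),
      tsupport_tubeCut n (closure_mono (Function.support_mul_subset_left _ _) hx)⟩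
  obtain ⟨C, hC0, hC⟩ := exists_norm_calib_le hg (fun x _ => rfl) hc.isCompact hs hν.unit
  have hcm := measurable_calib₀ hg hν.lipschitz
  have hi1 : Integrable (fun x => fderiv ℝ χ x (calib₀ g ν x)) :=
    integrable_fderiv_apply hχ hc hcm hC
  have h0 : ∀ n x, 0 ≤ φ n x := fun n x => mul_nonneg (tubeCut_mem n x).1 (h01 x).1
  set a := ∫ x in U, |fderiv ℝ χ x (calib₀ g ν x)|
  set ε : ℕ → ℝ := fun n => ∫ x in U, fderiv ℝ (tubeCut n) x (χ x • calib₀ g ν x)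
  have hε : Tendsto ε atTop (𝓝 0) := by
    refine tendsto_integral_fderiv_tubeCut hUB hU.isOpen.measurableSet (C := C) fun x _ => ?_
    rw [norm_smul, Real.norm_of_nonneg (h01 x).1]
    by_cases hx : x ∈ tsupport χ
    · exact (mul_le_mul (h01 x).2 (hC x hx) (norm_nonneg _) zero_le_one).trans (by simp)
    · rw [image_eq_zero_of_notMem_tsupport hx, zero_mul]; exact hC0
  have hle : ∀ n, ∫⁻ x, ofReal (φ n x) ∂T.mass g ≤ ofReal (a + ε n) := by
    intro n
    have hfin := hU.mass_lt_top hg hν hT (hφc n).isCompact (hφs n)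
    have hitg := integrable_of_tsupport_finite (hφ n).continuous (hφc n) hfin
    rw [← ofReal_integral_eq_lintegral_ofReal hitg (ae_of_all _ (h0 n))]
    refine ofReal_le_ofReal ?_
    rw [hU.integral_mass_eq hg hν hmin hT (hφ n) (hφc n) (hφs n)]
    have hd : ∀ x, fderiv ℝ (φ n) x (calib₀ g ν x) = tubeCut n x * fderiv ℝ χ x (calib₀ g ν x) +
        fderiv ℝ (tubeCut n) x (χ x • calib₀ g ν x) := fun x => by
      rw [hφdef, fderiv_fun_mul ((contDiff_tubeCut n).differentiable (by simp) x)
        (hχ.differentiable (by simp) x)]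
      simp
    have hi2 : Integrable fun x => tubeCut n x * fderiv ℝ χ x (calib₀ g ν x) :=
      hi1.bdd_mul (c := 1) (contDiff_tubeCut n).continuous.aestronglyMeasurable
        (ae_of_all _ fun x => by
          rw [Real.norm_of_nonneg (tubeCut_mem n x).1]; exact (tubeCut_mem n x).2)
    have hi3 : Integrable fun x => fderiv ℝ (tubeCut n) x (χ x • calib₀ g ν x) := by
      have := integrable_fderiv_apply (hφ n) (hφc n) hcm
        (C := C) fun x hx => hC x (closure_mono (Function.support_mul_subset_right _ _) hx)
      refine (this.sub hi2).congr (ae_of_all _ fun x => ?_)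
      simp only [Pi.sub_apply]
      rw [hd x]; ring
    simp_rw [hd]
    rw [integral_add hi2.restrict hi3.restrict]
    refine add_le_add (integral_mono hi2.restrict hi1.abs.restrict fun x => ?_) le_rfl
    refine (le_abs_self _).trans ?_
    rw [abs_mul, abs_of_nonneg (tubeCut_mem n x).1]
    exact mul_le_of_le_one_left (abs_nonneg _) (tubeCut_mem n x).2
  have hlim : ∀ᵐ x ∂T.mass g, ofReal (χ x) =
      liminf (fun n => ofReal (φ n x)) atTop := by
    filter_upwards [RectCurrent.ae_mass_mem_offAxis (T := T) hg] with x hx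
    have : Tendsto (fun n => φ n x) atTop (𝓝 (χ x)) := by
      simpa using (tendsto_tubeCut hx.2).mul_const (χ x)
    exact ((ENNReal.continuous_ofReal.tendsto _).comp this).liminf_eq.symm
  rw [lintegral_congr_ae hlim]
  refine (lintegral_liminf_le fun n => (hφ n).continuous.measurable.ennreal_ofReal).trans ?_
  refine (liminf_le_liminf (Eventually.of_forall hle)).trans (le_of_eq ?_)
  have : Tendsto (fun n => ofReal (a + ε n)) atTop (𝓝 (ofReal a)) := by
    have h := hε.const_add a
    rw [add_zero] at h
    exact (ENNReal.continuous_ofReal.tendsto _).comp h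
  exact this.liminf_eq

end BoundedByLeaves

namespace RectCurrent

theorem mass_eq_area (T : RectCurrent) (hg : IsMetricOn g unitBall) {W : Set E3}
    (hW : MeasurableSet W) (hWB : W ⊆ unitBall) : T.mass g W = T.area g W := by
  have h1 : T.area g W = T.area g (W \ zAxis) := by
    rw [T.area_eq g hW, T.area_eq g (hW.diff isClosed_zAxis.measurableSet)]
    refine setLIntegral_congr ?_
    filter_upwards [T.ae_pt_notMem_zAxis] with q hq
    exact propext ⟨fun h => ⟨h, hq⟩, fun h => h.1⟩
  rw [h1, ← T.mass_apply hg (hW.diff isClosed_zAxis.measurableSet)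
    fun x hx => ⟨hWB hx.1, hx.2⟩]
  refine measure_congr ?_
  filter_upwards [T.ae_mass_mem_offAxis hg] with x hx
  exact propext ⟨fun h => ⟨h, hx.2⟩, fun h => h.1⟩

theorem area_bar_eq {T : RectCurrent} (hT : T.carrier ⊆ unitBall) (he : EqOn gbar g unitBall) :
    T.area gbar univ = T.area g unitBall := by
  rw [T.area_univ_eq, T.area_eq g isOpen_unitBall.measurableSet, setLIntegral_congr
    (t := univ), setLIntegral_univ]
  · refine lintegral_congr_ae ?_
    filter_upwards [T.ae_pt_mem_carrier] with q hq
    rw [dens, dens, he (hT hq)]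
  · filter_upwards [T.ae_pt_mem_carrier] with q hq
    exact propext ⟨fun _ => trivial, fun _ => hT hq⟩

end RectCurrent

namespace BoundedByLeaves

theorem isLocallyFiniteIn (hU : BoundedByLeaves R ν U) (hUB : U ⊆ unitBall)
    (hg : IsMetricOn g unitBall)
    (hν : R.IsUnitNormal g ν) (hmin : R.IsMinimal g ν) {T : RectCurrent}
    (hT : T.IsOrientedBy g ν ((frontier U ∩ (unitBall \ zAxis)).indicator fun _ => 1)) :
    T.IsLocallyFiniteIn g unitBall := by
  refine ⟨fun x hx => ?_, fun K hK hKB => ?_⟩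
  · rw [hT.carrier_eq] at hx
    by_contra h
    exact hx (indicator_of_notMem (fun h' => h h'.2.1) _)
  · obtain ⟨χ, h1, h2, h3, h4, h5⟩ := exists_cutoff hK isOpen_unitBall hKB
    rw [← T.mass_eq_area hg hK.measurableSet hKB]
    refine lt_of_le_of_lt ?_ ((hU.lintegral_cutoff_le hUB hg hν hmin hT h1 h2 h3 h5).trans_lt
      ofReal_lt_top)
    rw [← setLIntegral_one, ← lintegral_indicator hK.measurableSet]
    refine lintegral_mono fun x => ?_
    by_cases hx : x ∈ K
    · rw [indicator_of_mem hx, h4.self_of_nhdsSet x hx, ENNReal.ofReal_one]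
    · rw [indicator_of_notMem hx]; exact zero_le

end BoundedByLeaves

/-! ### Area up to the sphere -/

/-- Radial cutoff functions of the unit ball. -/
def shellCut (k : ℕ) (x : E3) : ℝ := Real.smoothTransition ((k + 4 : ℝ) * (1 - ‖x‖ ^ 2) - 1)

theorem contDiff_shellCut (k : ℕ) : ContDiff ℝ ∞ (shellCut k) :=
  Real.smoothTransition.contDiff.comp ((contDiff_const.mul
    (contDiff_const.sub (contDiff_norm_sq ℝ))).sub contDiff_const)

theorem shellCut_mem (k : ℕ) (x : E3) : shellCut k x ∈ Icc (0 : ℝ) 1 :=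
  ⟨Real.smoothTransition.nonneg _, Real.smoothTransition.le_one _⟩

theorem tsupport_shellCut (k : ℕ) : tsupport (shellCut k) ⊆ unitBall := by
  have hk : (0 : ℝ) < k + 4 := by positivity
  have h : tsupport (shellCut k) ⊆ {x | 1 ≤ (k + 4 : ℝ) * (1 - ‖x‖ ^ 2)} := by
    refine closure_minimal (fun x hx => ?_) (isClosed_le continuous_const (by fun_prop))
    by_contra h
    exact hx (Real.smoothTransition.zero_of_nonpos (by simp at h; linarith))
  intro x hx
  have h1 : 1 ≤ (k + 4 : ℝ) * (1 - ‖x‖ ^ 2) := h hx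
  rw [unitBall, mem_ball_zero_iff]
  by_contra h2
  have : (k + 4 : ℝ) * (1 - ‖x‖ ^ 2) ≤ 0 :=
    mul_nonpos_of_nonneg_of_nonpos hk.le (by nlinarith [not_lt.mp h2])
  linarith

theorem hasCompactSupport_shellCut (k : ℕ) : HasCompactSupport (shellCut k) :=
  isCompact_closedUnitBall.of_isClosed_subset (isClosed_tsupport _)
    ((tsupport_shellCut k).trans unitBall_subset_closedUnitBall)

theorem tendsto_shellCut {x : E3} (hx : x ∈ unitBall) :
    Tendsto (fun k => shellCut k x) atTop (𝓝 1) := by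
  rw [unitBall, mem_ball_zero_iff] at hx
  have h1 : 0 < 1 - ‖x‖ ^ 2 := by nlinarith [norm_nonneg x]
  have h2 : Tendsto (fun k : ℕ => (k + 4 : ℝ) * (1 - ‖x‖ ^ 2) - 1) atTop atTop :=
    tendsto_atTop_add_const_right _ _ ((tendsto_atTop_add_const_right _ _
      tendsto_natCast_atTop_atTop).atTop_mul_const h1)
  refine tendsto_const_nhds.congr' ?_
  filter_upwards [h2.eventually_ge_atTop 1] with k hk
  exact (Real.smoothTransition.one_of_one_le hk).symm

theorem fderiv_shellCut (k : ℕ) (x v : E3) : fderiv ℝ (shellCut k) x v =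
    -(deriv Real.smoothTransition ((k + 4 : ℝ) * (1 - ‖x‖ ^ 2) - 1) * (k + 4) * 2) *
      inner ℝ x v := by
  have h1 : HasFDerivAt (fun x : E3 => (k + 4 : ℝ) * (1 - ‖x‖ ^ 2) - 1)
      (-((k + 4 : ℝ) • (2 : ℝ) • innerSL ℝ x)) x := by
    have := ((((hasStrictFDerivAt_norm_sq x).hasFDerivAt).const_sub 1).const_mul
      (k + 4 : ℝ)).sub_const 1
    refine this.congr_fderiv ?_
    ext v; simp
  have h2 := (Real.smoothTransition.contDiff (n := 1)).differentiable (by simp)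
    ((k + 4 : ℝ) * (1 - ‖x‖ ^ 2) - 1)
  have h3 := h2.hasDerivAt.comp_hasFDerivAt x h1
  have h4 : fderiv ℝ (shellCut k) x = _ := h3.fderiv
  rw [h4]
  simp
  ring

/-- The gradient is radial and points inwards, and it vanishes for `|x| < 1/2`; the `4` in
`shellCut` ensures this. Elsewhere `|⟨x, v⟩| ≤ 2C|x|²`, so the derivative in an arbitrary bounded
direction is controlled by the radial one. -/
theorem abs_fderiv_shellCut_le (k : ℕ) {x v : E3} {C : ℝ} (hv : ‖v‖ ≤ C) :
    |fderiv ℝ (shellCut k) x v| ≤ 2 * C * (-fderiv ℝ (shellCut k) x x) := by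
  have hC : 0 ≤ C := (norm_nonneg v).trans hv
  have hd : 0 ≤ deriv Real.smoothTransition ((k + 4 : ℝ) * (1 - ‖x‖ ^ 2) - 1) :=
    Real.smoothTransition.monotone.deriv_nonneg
  rw [fderiv_shellCut, fderiv_shellCut, real_inner_self_eq_norm_sq]
  set d := deriv Real.smoothTransition ((k + 4 : ℝ) * (1 - ‖x‖ ^ 2) - 1) with hd'
  set A := d * (k + 4) * 2 with hA
  have hA0 : 0 ≤ A := by positivity
  by_cases hx : 1 / 2 ≤ ‖x‖
  · have h1 := abs_real_inner_le_norm x v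
    rw [abs_mul, abs_neg, abs_of_nonneg hA0]
    have h2 : ‖x‖ * ‖v‖ ≤ 2 * C * ‖x‖ ^ 2 := by
      have := mul_le_mul_of_nonneg_left hv (norm_nonneg x)
      nlinarith [mul_nonneg hC (norm_nonneg x)]
    calc A * |inner ℝ x v| ≤ A * (2 * C * ‖x‖ ^ 2) :=
          mul_le_mul_of_nonneg_left (h1.trans h2) hA0
      _ = _ := by ring
  · have h1 : 1 < (k + 4 : ℝ) * (1 - ‖x‖ ^ 2) - 1 := by
      have h3 : (3 : ℝ) / 4 ≤ 1 - ‖x‖ ^ 2 := by nlinarith [norm_nonneg x, not_le.mp hx]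
      have h4 : (4 : ℝ) ≤ k + 4 := by linarith [Nat.cast_nonneg (α := ℝ) k]
      nlinarith
    have h2 : d = 0 := by
      have : Real.smoothTransition =ᶠ[𝓝 ((k + 4 : ℝ) * (1 - ‖x‖ ^ 2) - 1)] fun _ => 1 := by
        filter_upwards [lt_mem_nhds h1] with t ht
        exact Real.smoothTransition.one_of_one_le ht.le
      rw [hd', this.deriv_eq]; simp
    simp [hA, h2]

/-- The radial field has divergence three. -/
theorem integral_fderiv_self {ψ : E3 → ℝ} (hψ : ContDiff ℝ ∞ ψ) (hc : HasCompactSupport ψ) :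
    Integrable (fun x => fderiv ℝ ψ x x) ∧ ∫ x, fderiv ℝ ψ x x = -3 * ∫ x, ψ x := by
  have hfc : Continuous (fderiv ℝ ψ) := hψ.continuous_fderiv (by simp)
  have hI : ∀ j, Integrable fun x : E3 => x j * fderiv ℝ ψ x (bv j) := fun j =>
    Continuous.integrable_of_hasCompactSupport (by fun_prop)
      (hasCompactSupport_fderiv_apply hc fun _ => bv j).mul_left
  have hψi : Integrable ψ := hψ.continuous.integrable_of_hasCompactSupport hc
  have h1 : ∀ j, ∫ x : E3, x j * fderiv ℝ ψ x (bv j) = -∫ x, ψ x := fun j => by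
    have hd : ∀ x : E3, fderiv ℝ (fun x : E3 => x j) x (bv j) = 1 := fun x => by
      have : fderiv ℝ (fun x : E3 => x j) x = _ :=
        (EuclideanSpace.proj (𝕜 := ℝ) j).hasFDerivAt (x := x) |>.fderiv
      rw [this]; simp [bv]
    have := integral_mul_fderiv_eq_neg_fderiv_mul_of_integrable (μ := (volume : Measure E3))
      (f := fun x : E3 => x j) (g := ψ) (v := bv j) (by simpa [hd] using hψi) (hI j)
      (Continuous.integrable_of_hasCompactSupport (by fun_prop) hc.mul_left)
      (fun x _ => by fun_prop) (fun x _ => hψ.differentiable (by simp) x)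
    simpa [hd] using this
  have h2 : ∀ x : E3, fderiv ℝ ψ x x = ∑ j, x j * fderiv ℝ ψ x (bv j) := fun x => by
    rw [clm_apply_eq_sum]; exact Finset.sum_congr rfl fun j _ => mul_comm _ _
  simp_rw [h2]
  refine ⟨integrable_finsetSum _ fun j _ => hI j, ?_⟩
  rw [integral_finsetSum _ fun j _ => hI j, Finset.sum_congr rfl fun j _ => h1 j]
  simp

/-- The extension of the metric to the closed ball bounds `calib` uniformly by some `C`. With the
radial cutoffs the flux bound is at most `2C` times the integral of minus the radial derivative,
that is, `6C` times the integral of the cutoff, independently of its width. Fatou's lemma concludes.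
-/
theorem BoundedByLeaves.area_bar_lt_top (hU : BoundedByLeaves R ν U) (hUB : U ⊆ unitBall)
    (hg : IsMetricOn g unitBall)
    (hν : R.IsUnitNormal g ν) (hmin : R.IsMinimal g ν) {T : RectCurrent}
    (hT : T.IsOrientedBy g ν ((frontier U ∩ (unitBall \ zAxis)).indicator fun _ => 1))
    (hgb : IsMetricOn gbar closedUnitBall) (he : EqOn gbar g unitBall) :
    T.area gbar univ < ⊤ := by
  have hTl := hU.isLocallyFiniteIn hUB hg hν hmin hT
  rw [RectCurrent.area_bar_eq hTl.carrier_subset he,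
    ← T.mass_eq_area hg isOpen_unitBall.measurableSet Subset.rfl]
  obtain ⟨C, hC0, hC⟩ := exists_norm_calib_le hgb he isCompact_closedUnitBall Subset.rfl hν.unit
  have hC' : ∀ x, ‖calib₀ g ν x‖ ≤ C := fun x => by
    by_cases hx : x ∈ closedUnitBall
    · exact hC x hx
    · rw [calib₀, indicator_of_notMem fun h => hx (unitBall_subset_closedUnitBall h.1), norm_zero]
      exact hC0
  have hb : ∀ k, ∫⁻ x, ofReal (shellCut k x) ∂T.mass g ≤
      ofReal (6 * C * (volume closedUnitBall).toReal) := by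
    intro k
    refine (hU.lintegral_cutoff_le hUB hg hν hmin hT (contDiff_shellCut k)
      (hasCompactSupport_shellCut k) (tsupport_shellCut k) (shellCut_mem k)).trans
      (ofReal_le_ofReal ?_)
    obtain ⟨hi, hv⟩ := integral_fderiv_self (contDiff_shellCut k) (hasCompactSupport_shellCut k)
    have hi' : Integrable fun x => |fderiv ℝ (shellCut k) x (calib₀ g ν x)| :=
      (integrable_fderiv_apply (contDiff_shellCut k) (hasCompactSupport_shellCut k)
        (measurable_calib₀ hg hν.lipschitz) fun x _ => hC' x).abs
    calc ∫ x in U, |fderiv ℝ (shellCut k) x (calib₀ g ν x)|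
        ≤ ∫ x, |fderiv ℝ (shellCut k) x (calib₀ g ν x)| :=
          setIntegral_le_integral hi' (ae_of_all _ fun _ => abs_nonneg _)
      _ ≤ ∫ x, 2 * C * (-fderiv ℝ (shellCut k) x x) :=
          integral_mono hi' (hi.neg.const_mul _) fun x => abs_fderiv_shellCut_le k (hC' x)
      _ = 6 * C * ∫ x, shellCut k x := by
          rw [integral_const_mul, integral_neg, hv]; ring
      _ ≤ 6 * C * (volume closedUnitBall).toReal := by
          refine mul_le_mul_of_nonneg_left ?_ (by positivity)
          have h1 : ∫ x, closedUnitBall.indicator (fun _ => (1 : ℝ)) x =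
              (volume closedUnitBall).toReal := by
            rw [integral_indicator_const _ isCompact_closedUnitBall.measurableSet]
            simp [Measure.real]
          rw [← h1]
          refine integral_mono ((contDiff_shellCut k).continuous.integrable_of_hasCompactSupport
            (hasCompactSupport_shellCut k)) ?_ fun x => ?_
          · exact (integrable_indicator_iff isCompact_closedUnitBall.measurableSet).mpr
              (integrableOn_const isCompact_closedUnitBall.measure_lt_top.ne)
          · by_cases hx : x ∈ closedUnitBall
            · rw [indicator_of_mem hx]; exact (shellCut_mem k x).2
            · rw [indicator_of_notMem hx, image_eq_zero_of_notMem_tsupport fun h =>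
                hx (unitBall_subset_closedUnitBall (tsupport_shellCut k h))]
  have hlim : ∀ x, unitBall.indicator 1 x ≤
      liminf (fun k => ofReal (shellCut k x)) atTop := by
    intro x
    by_cases hx : x ∈ unitBall
    · rw [indicator_of_mem hx]
      have := (ENNReal.continuous_ofReal.tendsto _).comp (tendsto_shellCut hx)
      rw [ENNReal.ofReal_one] at this
      exact this.liminf_eq.symm.le
    · rw [indicator_of_notMem hx]; exact zero_le
  rw [← lintegral_indicator_one isOpen_unitBall.measurableSet]
  refine lt_of_le_of_lt ((lintegral_mono hlim).trans (lintegral_liminf_le fun k =>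
    (contDiff_shellCut k).continuous.measurable.ennreal_ofReal)) ?_
  refine lt_of_le_of_lt ?_ (ofReal_lt_top (r := 6 * C * (volume closedUnitBall).toReal))
  exact (liminf_le_liminf (Eventually.of_forall hb)).trans (liminf_const _).le

/-! ### Stationarity of calibrated currents -/

theorem RectCurrent.IsCalibrated.eval_eq {S : RectCurrent} (hcal : S.IsCalibrated g ν)
    (hg : IsMetricOn g unitBall) (hν : R.IsUnitNormal g ν) {β : DForm 2} (hβ : Continuous β)
    (hc : HasCompactSupport β) (hs : tsupport β ⊆ unitBall) (hfin : S.area g (tsupport β) < ⊤) :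
    S.eval β = ∫ x, conormal g ν x (vec (β x)) ∂S.mass g := by
  have hV : Continuous fun x => vec (β x) := continuous_vec.comp hβ
  obtain ⟨C, hC⟩ := hc.isCompact.exists_bound_of_continuousOn hV.continuousOn
  have h0 : ∀ x ∉ tsupport β, vec (β x) = 0 := fun x hx => by
    rw [image_eq_zero_of_notMem_tsupport hx, vec_zero]
  have hitg := S.integrable_form hg hc.isCompact hs hfin hV.measurable hC
    (ae_of_all _ fun q => h0 _)
  rw [S.eval_eq hitg, S.integral_mass hg (measurable_conormal_apply hg hν hV.measurable)]
  refine integral_congr_ae ?_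
  filter_upwards [hcal.inner_eq hg hν.unit, S.ae_pt_notMem_zAxis] with q h1 h2
  by_cases hx : S.pt q ∈ unitBall
  · rw [S.dens_offAxis ⟨hx, h2⟩, h1 ⟨hx, h2⟩]
  · rw [h0 _ fun h => hx (hs h)]; simp

/-- Evaluated by the conormal, the right side is the derivative of `α` along a combination of `A`
and `B` tangent to the leaves. These one-forms therefore express the absence of boundary as a
transport equation for the area measure. -/
theorem curl_fderiv_smul {α : E3 → ℝ} {x : E3} (hα : DifferentiableAt ℝ α x) (A B : E3) :
    curl (fderiv ℝ (fun x => α x • cross A B) x) =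
      fderiv ℝ α x B • A - fderiv ℝ α x A • B := by
  rw [fderiv_smul_const hα, clm_apply_eq_sum _ A, clm_apply_eq_sum _ B]
  ext i
  fin_cases i <;> simp [curl, cross, Fin.sum_univ_three] <;> ring

theorem tsupport_smul_const_subset {α : E3 → ℝ} (a : E3) :
    tsupport (fun x => α x • a) ⊆ tsupport α := by
  refine closure_mono fun x hx => ?_
  simp only [Function.mem_support] at hx ⊢
  rintro h; exact hx (by rw [h, zero_smul])

theorem tsupport_extDeriv_subset {η : DForm 1} : tsupport (extDeriv η) ⊆ tsupport η := by
  refine closure_minimal (fun x hx => ?_) (isClosed_tsupport _)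
  by_contra h
  refine hx ?_
  have h0 : fderiv ℝ η x = 0 := image_eq_zero_of_notMem_tsupport fun hx => h
    (tsupport_fderiv_subset ℝ hx)
  rw [extDeriv, h0]
  exact map_zero (ContinuousAlternatingMap.alternatizeUncurryFinCLM ℝ E3 ℝ)

theorem isTestForm_formOf {α : E3 → ℝ} (hα : ContDiff ℝ ∞ α) (hc : HasCompactSupport α)
    (a : E3) {O : Set E3} (hs : tsupport α ⊆ O) :
    IsTestForm O (formOf fun x => α x • a) := by
  have h1 : tsupport (formOf fun x => α x • a) ⊆ tsupport α :=
    (tsupport_formOf_subset _).trans (tsupport_smul_const_subset a)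
  exact ⟨contDiff_formOf (hα.smul contDiff_const),
    hc.isCompact.of_isClosed_subset (isClosed_tsupport _) h1, h1.trans hs⟩

theorem RectCurrent.IsCalibrated.eval_extDeriv {S : RectCurrent} (hcal : S.IsCalibrated g ν)
    (hg : IsMetricOn g unitBall) (hν : R.IsUnitNormal g ν) {α : E3 → ℝ} (hα : ContDiff ℝ ∞ α)
    (hc : HasCompactSupport α) (hs : tsupport α ⊆ unitBall) (hfin : S.area g (tsupport α) < ⊤)
    (A B : E3) : S.eval (extDeriv (formOf fun x => α x • cross A B)) =
      ∫ x, (fderiv ℝ α x B * conormal g ν x A - fderiv ℝ α x A * conormal g ν x B) ∂S.mass g := by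
  have hη : ContDiff ℝ ∞ fun x => α x • cross A B := hα.smul contDiff_const
  have h1 : tsupport (extDeriv (formOf fun x => α x • cross A B)) ⊆ tsupport α :=
    tsupport_extDeriv_subset.trans
      ((tsupport_formOf_subset _).trans (tsupport_smul_const_subset _))
  rw [hcal.eval_eq hg hν (contDiff_extDeriv (contDiff_formOf hη)).continuous
    (hc.isCompact.of_isClosed_subset (isClosed_tsupport _) h1) (h1.trans hs)
    ((S.area_mono g h1).trans_lt hfin)]
  refine integral_congr_ae (ae_of_all _ fun x => ?_)
  simp only
  rw [vec_extDeriv_formOf hη, curl_fderiv_smul (hα.differentiable (by simp) x)]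
  simp

/-- Off the axis `T` is the boundary of `U` and so has no boundary itself. Concretely, two
applications of the Gauss-Green formula give integrals over `U` of the mixed second derivatives of
`α` in either order. -/
theorem BoundedByLeaves.eval_extDeriv (hU : BoundedByLeaves R ν U) (hg : IsMetricOn g unitBall)
    (hν : R.IsUnitNormal g ν) {T : RectCurrent}
    (hT : T.IsOrientedBy g ν ((frontier U ∩ (unitBall \ zAxis)).indicator fun _ => 1))
    {α : E3 → ℝ} (hα : ContDiff ℝ ∞ α) (hc : HasCompactSupport α)
    (hs : tsupport α ⊆ unitBall \ zAxis) (A B : E3) :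
    T.eval (extDeriv (formOf fun x => α x • cross A B)) = 0 := by
  have hfin : T.area g (tsupport α) < ⊤ := by
    rw [← T.mass_apply hg (isClosed_tsupport _).measurableSet hs]
    exact hU.mass_lt_top hg hν hT hc hs
  rw [(hT.isCalibrated hg hν.unit).eval_extDeriv hg hν hα hc (hs.trans sdiff_subset) hfin]
  have hgg : ∀ A B : E3, GaussGreen g ν U (T.mass g) A fun x => fderiv ℝ α x B := fun A B => by
    have hsup : Function.support (fun x => fderiv ℝ α x B) ⊆ tsupport α := fun x hx => by
      by_contra h
      exact hx (by simp only [fderiv_eq_zero_of_notMem h]; rfl)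
    refine hU.gaussGreen hg hν hT ((hα.fderiv_right (by simp)).clm_apply contDiff_const)
      (hasCompactSupport_fderiv_apply hc _) ((closure_minimal hsup (isClosed_tsupport _)).trans hs) A
  rw [integral_sub (hgg A B).1 (hgg B A).1, ← (hgg A B).2.2.2, ← (hgg B A).2.2.2, sub_eq_zero]
  refine integral_congr_ae (ae_of_all _ fun x => ?_)
  have hd : DifferentiableAt ℝ (fderiv ℝ α) x :=
    (hα.fderiv_right (m := 1) (by norm_cast)).differentiable (by simp) x
  have h2 : ∀ A B : E3, fderiv ℝ (fun x => fderiv ℝ α x B) x A = fderiv ℝ (fderiv ℝ α) x A B :=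
    fun A B => by
      rw [fderiv_clm_apply hd (differentiableAt_const _)]
      simp
  simp only [h2]
  exact (hα.contDiffAt.isSymmSndFDerivAt (by simp; norm_cast)) A B

/-- A calibrated current without boundary off the axis, of finite area. -/
structure IsStationary (S : RectCurrent) (g : MetricField) (ν : E3 → E3) : Prop where
  calibrated : S.IsCalibrated g ν
  finite : S.mass g univ < ⊤
  integral_eq_zero : ∀ α : E3 → ℝ, ContDiff ℝ ∞ α → HasCompactSupport α →
    tsupport α ⊆ unitBall \ zAxis → ∀ A B : E3,
    ∫ x, (fderiv ℝ α x B * conormal g ν x A - fderiv ℝ α x A * conormal g ν x B) ∂S.mass g = 0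

theorem RectCurrent.area_bar_apply {S : RectCurrent} (he : EqOn gbar g unitBall) {W : Set E3}
    (hW : MeasurableSet W) (hWB : W ⊆ unitBall) : S.area g W = S.area gbar W := by
  rw [S.area_eq g hW, S.area_eq gbar hW]
  refine setLIntegral_congr_fun (S.measurable_pt hW) fun q hq => ?_
  simp only [RectCurrent.dens]
  rw [he (hWB hq)]

theorem BoundedByLeaves.isStationary (hU : BoundedByLeaves R ν U) (hg : IsMetricOn g unitBall)
    (hν : R.IsUnitNormal g ν) {T : RectCurrent}
    (hT : T.IsOrientedBy g ν ((frontier U ∩ (unitBall \ zAxis)).indicator fun _ => 1))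
    (he : EqOn gbar g unitBall) {S : RectCurrent} (hcal : S.IsCalibrated g ν)
    (hSf : S.area gbar univ < ⊤) (hST : S.SameBoundary T univ) : IsStationary S g ν := by
  have hb : ∀ W ⊆ unitBall, MeasurableSet W → S.area g W < ⊤ := fun W h1 h2 => by
    rw [RectCurrent.area_bar_apply he h2 h1]
    exact (S.area_mono gbar (subset_univ _)).trans_lt hSf
  refine ⟨hcal, ?_, fun α hα hc hs A B => ?_⟩
  · have : S.mass g univ = S.mass g unitBall := by
      refine measure_congr ?_
      filter_upwards [RectCurrent.ae_mass_mem_offAxis (T := S) hg] with x hx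
      exact propext ⟨fun _ => hx.1, fun _ => trivial⟩
    rw [this, S.mass_eq_area hg isOpen_unitBall.measurableSet Subset.rfl]
    exact hb _ Subset.rfl isOpen_unitBall.measurableSet
  · rw [← hcal.eval_extDeriv hg hν hα hc (hs.trans sdiff_subset)
      (hb _ (hs.trans sdiff_subset) (isClosed_tsupport _).measurableSet),
      hST _ (isTestForm_formOf hα hc _ (subset_univ _)), hU.eval_extDeriv hg hν hT hα hc hs]

/-! ### Almost invariant measures -/

/-- A smooth decreasing function that is one on `(-∞, 1]` and zero on `[2, ∞)`. -/
def fall (t : ℝ) : ℝ := Real.smoothTransition (2 - t)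

/-- The derivative of `fall`. -/
def fall' (t : ℝ) : ℝ := -deriv Real.smoothTransition (2 - t)

theorem contDiff_fall : ContDiff ℝ ∞ fall :=
  Real.smoothTransition.contDiff.comp (contDiff_const.sub contDiff_id)

theorem hasDerivAt_fall (t : ℝ) : HasDerivAt fall (fall' t) t := by
  have h := ((Real.smoothTransition.contDiff (n := 1)).differentiable (by simp) (2 - t)).hasDerivAt
  exact (h.comp t ((hasDerivAt_id t).const_sub 2)).congr_deriv (by simp [fall'])

theorem fall_mem (t : ℝ) : fall t ∈ Icc (0 : ℝ) 1 :=
  ⟨Real.smoothTransition.nonneg _, Real.smoothTransition.le_one _⟩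

theorem fall_of_le {t : ℝ} (h : t ≤ 1) : fall t = 1 :=
  Real.smoothTransition.one_of_one_le (by linarith)

theorem fall_of_ge {t : ℝ} (h : 2 ≤ t) : fall t = 0 :=
  Real.smoothTransition.zero_of_nonpos (by linarith)

theorem fall'_nonpos (t : ℝ) : fall' t ≤ 0 :=
  neg_nonpos.mpr Real.smoothTransition.monotone.deriv_nonneg

theorem fall'_of_gt {t : ℝ} (h : 2 < t) : fall' t = 0 := by
  have h1 : fall =ᶠ[𝓝 t] fun _ => 0 := by
    filter_upwards [lt_mem_nhds h] with s hs using fall_of_ge hs.le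
  rw [← (hasDerivAt_fall t).deriv, h1.deriv_eq, deriv_const]

theorem continuous_fall' : Continuous fall' :=
  (((Real.smoothTransition.contDiff (n := 1)).continuous_deriv le_rfl).comp (by fun_prop)).neg

theorem exists_mul_fall'_le : ∃ K, 0 ≤ K ∧ ∀ t, 0 ≤ t → |t * fall' t| ≤ K := by
  obtain ⟨C, hC0, hC⟩ := exists_deriv_smoothTransition_le
  refine ⟨2 * C, by positivity, fun t ht => ?_⟩
  by_cases h : t ≤ 2
  · rw [abs_mul, abs_of_nonneg ht, fall', abs_neg]
    exact mul_le_mul h (hC _) (abs_nonneg _) (by norm_num)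
  · rw [fall'_of_gt (not_le.mp h), mul_zero, abs_zero]; positivity

/-- A measure on the coordinate box that is transported along the directions `(v, P)`, where the
slope `P` is controlled by the height. -/
structure IsTransported (lam : Measure (E2 × ℝ)) (r C : ℝ) (v : E2) (P : E2 × ℝ → ℝ) :
    Prop where
  slope_le : ∀ q, ‖q.1‖ < r → |q.2| < r → |P q| ≤ C * |q.2|
  integral_eq_zero : ∀ β : E2 × ℝ → ℝ, ContDiff ℝ ∞ β → HasCompactSupport β →
    tsupport β ⊆ {q | ‖q.1‖ < r ∧ |q.2| < r} → ∫ q, fderiv ℝ β q (v, P q) ∂lam = 0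
  integrable : ∀ β : E2 × ℝ → ℝ, ContDiff ℝ ∞ β → HasCompactSupport β →
    tsupport β ⊆ {q | ‖q.1‖ < r ∧ |q.2| < r} → Integrable (fun q => fderiv ℝ β q (v, P q)) lam

namespace IsTransported
variable {lam : Measure (E2 × ℝ)} {r C : ℝ} {v : E2} {P : E2 × ℝ → ℝ}

/-- The test function follows the translation by `τ v` while its height widens like `exp (C τ)`, the
fastest rate at which the slope can push mass away from the plaque. Its integral is therefore
nondecreasing in `τ`. No flow of the transport field is needed, so no regularity of the slope enters
beyond its bound. -/
theorem integral_mono_translate [IsFiniteMeasure lam] (H : IsTransported lam r C v P) (hC : 0 ≤ C)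
    {h : E2 → ℝ} (hh : ContDiff ℝ ∞ h) (hc : HasCompactSupport h) (h0 : ∀ y, 0 ≤ h y)
    (hsupp : ∀ τ ∈ Icc (0 : ℝ) 1, ∀ y ∈ tsupport h, ‖y + τ • v‖ < r)
    {δ : ℝ} (hδ : 0 < δ) (hδr : 2 * δ * Real.exp C < r) :
    ∫ q, h q.1 * fall (q.2 ^ 2 / δ ^ 2) ∂lam ≤
      ∫ q, h (q.1 - v) * fall (q.2 ^ 2 * Real.exp (-2 * C) / δ ^ 2) ∂lam := by
  set arg : ℝ → ℝ → ℝ := fun τ s => s ^ 2 * Real.exp (-2 * C * τ) / δ ^ 2 with harg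
  have harg0 : ∀ τ s, 0 ≤ arg τ s := fun τ s => by positivity
  set G : ℝ → E2 × ℝ → ℝ := fun τ q => h (q.1 - τ • v) * fall (arg τ q.2) with hG
  set G' : ℝ → E2 × ℝ → ℝ := fun τ q => -fderiv ℝ h (q.1 - τ • v) v * fall (arg τ q.2) +
    h (q.1 - τ • v) * (fall' (arg τ q.2) * (arg τ q.2 * (-2 * C))) with hG'
  have hGs : ∀ τ, ContDiff ℝ ∞ (G τ) := fun τ => by
    refine (hh.comp (contDiff_fst.sub contDiff_const)).mul (contDiff_fall.comp ?_)
    simp only [harg]; fun_prop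
  have hargd : ∀ τ s, HasDerivAt (fun τ => arg τ s) (arg τ s * (-2 * C)) τ := fun τ s => by
    have := (((hasDerivAt_id τ).const_mul (-2 * C)).exp.const_mul (s ^ 2)).div_const (δ ^ 2)
    exact this.congr_deriv (by simp only [harg, id]; ring)
  have hhd : ∀ y, HasFDerivAt h (fderiv ℝ h y) y := fun y =>
    (hh.differentiable (by simp) y).hasFDerivAt
  have hGd : ∀ τ q, HasDerivAt (fun τ => G τ q) (G' τ q) τ := fun τ q => by
    have h1 : HasDerivAt (fun τ : ℝ => q.1 - τ • v) (-v) τ := by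
      simpa using ((hasDerivAt_id τ).smul_const v).const_sub q.1
    have h2 := (hhd (q.1 - τ • v)).comp_hasDerivAt τ h1
    have h3 := (hasDerivAt_fall (arg τ q.2)).comp τ (hargd τ q.2)
    have h4 := h2.mul h3
    rw [map_neg] at h4
    exact h4
  obtain ⟨Ch, hCh⟩ := hh.continuous.bounded_above_of_compact_support hc
  obtain ⟨Cd, hCd⟩ := (hh.continuous_fderiv (by simp)).bounded_above_of_compact_support
    (hc.fderiv (𝕜 := ℝ))
  obtain ⟨K, hK0, hK⟩ := exists_mul_fall'_le
  have hbound : ∀ τ q, ‖G' τ q‖ ≤ Cd * ‖v‖ + Ch * (K * (2 * C)) := fun τ q => by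
    refine (norm_add_le _ _).trans (add_le_add ?_ ?_)
    · rw [norm_mul, norm_neg, Real.norm_of_nonneg (fall_mem _).1]
      refine (mul_le_of_le_one_right (norm_nonneg _) (fall_mem _).2).trans ?_
      exact (ContinuousLinearMap.le_opNorm _ _).trans
        (mul_le_mul_of_nonneg_right (hCd _) (norm_nonneg _))
    · rw [norm_mul]
      refine mul_le_mul (hCh _) ?_ (norm_nonneg _) ((norm_nonneg _).trans (hCh 0))
      rw [← mul_assoc, mul_comm (fall' _), norm_mul]
      refine mul_le_mul (hK _ (harg0 _ _)) ?_ (norm_nonneg _) hK0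
      rw [Real.norm_eq_abs, abs_mul, abs_of_nonneg hC]; norm_num
  have hG'c : ∀ τ, Continuous (G' τ) := fun τ => by
    have h1 : Continuous fun q : E2 × ℝ => arg τ q.2 := by simp only [harg]; fun_prop
    have h2 : Continuous fun q : E2 × ℝ => q.1 - τ • v := by fun_prop
    exact ((((hh.continuous_fderiv (by simp)).comp h2).clm_apply continuous_const).neg.mul
      (contDiff_fall.continuous.comp h1)).add ((hh.continuous.comp h2).mul
        ((continuous_fall'.comp h1).mul (h1.mul continuous_const)))
  have hGi : ∀ τ, Integrable (G τ) lam := fun τ =>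
    Integrable.of_bound (hGs τ).continuous.aestronglyMeasurable Ch (ae_of_all _ fun q => by
      rw [norm_mul, Real.norm_of_nonneg (fall_mem _).1]
      exact (mul_le_of_le_one_right (norm_nonneg _) (fall_mem _).2).trans (hCh _))
  have hG'i : ∀ τ, Integrable (G' τ) lam := fun τ =>
    Integrable.of_bound (hG'c τ).aestronglyMeasurable _ (ae_of_all _ (hbound τ))
  have hF : ∀ τ, HasDerivAt (fun τ => ∫ q, G τ q ∂lam) (∫ q, G' τ q ∂lam) τ := fun τ =>
    (hasDerivAt_integral_of_dominated_loc_of_deriv_le (F := G) (F' := G') univ_mem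
      (Eventually.of_forall fun τ => (hGs τ).continuous.aestronglyMeasurable) (hGi τ)
      (hG'c τ).aestronglyMeasurable (ae_of_all _ fun q τ _ => hbound τ q) (integrable_const _)
      (ae_of_all _ fun q τ _ => hGd τ q)).2
  -- outside the box the functions vanish
  have hsq : ∀ τ ∈ Icc (0 : ℝ) 1, ∀ s : ℝ, arg τ s ≤ 2 → |s| ≤ 2 * δ * Real.exp C := by
    intro τ hτ s hs
    have h1 : s ^ 2 * Real.exp (-2 * C * τ) ≤ 2 * δ ^ 2 := by
      rwa [harg, div_le_iff₀ (by positivity)] at hs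
    have h2 : Real.exp (-2 * C) ≤ Real.exp (-2 * C * τ) :=
      Real.exp_le_exp.mpr (by nlinarith [hτ.2, mul_nonneg hC (sub_nonneg.mpr hτ.2)])
    have h3 : Real.exp (-2 * C) * Real.exp C ^ 2 = 1 := by
      rw [← Real.exp_nat_mul, ← Real.exp_add]
      simp
    have h4 : s ^ 2 ≤ (2 * δ * Real.exp C) ^ 2 := by
      calc s ^ 2 = s ^ 2 * Real.exp (-2 * C) * Real.exp C ^ 2 := by rw [mul_assoc, h3, mul_one]
        _ ≤ 2 * δ ^ 2 * Real.exp C ^ 2 := by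
            refine mul_le_mul_of_nonneg_right ((mul_le_mul_of_nonneg_left h2 (sq_nonneg s)).trans h1)
              (sq_nonneg _)
        _ ≤ (2 * δ * Real.exp C) ^ 2 := by nlinarith [sq_nonneg (δ * Real.exp C)]
    exact abs_le_of_sq_le_sq h4 (by positivity)
  have hGsupp : ∀ τ ∈ Icc (0 : ℝ) 1, tsupport (G τ) ⊆
      {q | q.1 - τ • v ∈ tsupport h ∧ |q.2| ≤ 2 * δ * Real.exp C} := by
    intro τ hτ
    refine closure_minimal (fun q hq => ⟨?_, ?_⟩) ?_
    · by_contra hx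
      exact hq (by simp only [hG, image_eq_zero_of_notMem_tsupport hx, zero_mul])
    · by_contra hx
      have : 2 ≤ arg τ q.2 := by
        by_contra h
        exact hx (hsq τ hτ q.2 (not_le.mp h).le)
      exact hq (by simp only [hG, fall_of_ge this, mul_zero])
    · have h1 : Continuous fun q : E2 × ℝ => q.1 - τ • v := by fun_prop
      have h2 : Continuous fun q : E2 × ℝ => |q.2| := by fun_prop
      exact ((isClosed_tsupport h).preimage h1).inter (isClosed_le h2 continuous_const)
  have hin : ∀ τ ∈ Icc (0 : ℝ) 1, ∀ y, y - τ • v ∈ tsupport h → ‖y‖ < r := fun τ hτ y hy => by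
    simpa using hsupp τ hτ _ hy
  have hGin : ∀ τ ∈ Icc (0 : ℝ) 1, tsupport (G τ) ⊆ {q | ‖q.1‖ < r ∧ |q.2| < r} :=
    fun τ hτ q hq => ⟨hin τ hτ _ (hGsupp τ hτ hq).1, (hGsupp τ hτ hq).2.trans_lt hδr⟩
  have hGc : ∀ τ ∈ Icc (0 : ℝ) 1, HasCompactSupport (G τ) := fun τ hτ => by
    refine IsCompact.of_isClosed_subset ((isCompact_closedBall (0 : E2) r).prod
      (isCompact_Icc (a := -r) (b := r))) (isClosed_tsupport _) fun q hq => ?_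
    exact ⟨mem_closedBall_zero_iff.mpr (hGin τ hτ hq).1.le, abs_le.mp (hGin τ hτ hq).2.le⟩
  have hdq : ∀ τ q, fderiv ℝ (G τ) q (v, P q) = fderiv ℝ h (q.1 - τ • v) v * fall (arg τ q.2) +
      h (q.1 - τ • v) * (fall' (arg τ q.2) *
        (2 * q.2 * P q * Real.exp (-2 * C * τ) / δ ^ 2)) := fun τ q => by
    have h1 : HasFDerivAt (fun q : E2 × ℝ => q.1 - τ • v) (ContinuousLinearMap.fst ℝ E2 ℝ) q :=
      hasFDerivAt_fst.sub_const _
    have h2 := (hhd (q.1 - τ • v)).comp (g := h) (f := fun q : E2 × ℝ => q.1 - τ • v) q h1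
    have h3 : HasFDerivAt (fun q : E2 × ℝ => arg τ q.2)
        ((2 * q.2 * Real.exp (-2 * C * τ) / δ ^ 2) • ContinuousLinearMap.snd ℝ E2 ℝ) q := by
      have h4 : HasDerivAt (fun s => arg τ s) (2 * q.2 * Real.exp (-2 * C * τ) / δ ^ 2) q.2 := by
        have := (((hasDerivAt_id q.2).pow 2).mul_const (Real.exp (-2 * C * τ))).div_const (δ ^ 2)
        simpa [harg] using this
      exact h4.comp_hasFDerivAt q hasFDerivAt_snd
    have h5 := h2.mul ((hasDerivAt_fall (arg τ q.2)).comp_hasFDerivAt q h3)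
    have h6 : fderiv ℝ (G τ) q = _ := h5.fderiv
    rw [h6]
    simp
    ring
  -- The vanishing integral of the derivative along the transport direction is added. The horizontal
  -- terms cancel, and what remains is `-fall'` times `C s² - s P` with nonnegative factors, hence
  -- nonnegative by the bound on the slope.
  have hderiv : ∀ τ ∈ Icc (0 : ℝ) 1, 0 ≤ ∫ q, G' τ q ∂lam := by
    intro τ hτ
    have h1 := H.integral_eq_zero (G τ) (hGs τ) (hGc τ hτ) (hGin τ hτ)
    have h2 := H.integrable (G τ) (hGs τ) (hGc τ hτ) (hGin τ hτ)
    have h12 := integral_add (hG'i τ) h2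
    rw [h1, add_zero] at h12
    rw [← h12]
    refine integral_nonneg fun q => ?_
    simp only [Pi.zero_apply]
    rw [hdq τ q]
    have h3 : G' τ q + (fderiv ℝ h (q.1 - τ • v) v * fall (arg τ q.2) + h (q.1 - τ • v) *
        (fall' (arg τ q.2) * (2 * q.2 * P q * Real.exp (-2 * C * τ) / δ ^ 2))) =
        h (q.1 - τ • v) * (-fall' (arg τ q.2)) * (2 * Real.exp (-2 * C * τ) / δ ^ 2) *
          (C * q.2 ^ 2 - q.2 * P q) := by
      simp only [hG', harg]; ring
    rw [h3]
    by_cases hy : q.1 - τ • v ∈ tsupport h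
    · by_cases hs : arg τ q.2 ≤ 2
      · refine mul_nonneg (mul_nonneg (mul_nonneg (h0 _) (neg_nonneg.mpr (fall'_nonpos _)))
          (by positivity)) ?_
        have h4 := H.slope_le q (hin τ hτ _ hy) ((hsq τ hτ _ hs).trans_lt hδr)
        have h5 : q.2 * P q ≤ |q.2| * (C * |q.2|) := (le_abs_self _).trans
          (by rw [abs_mul]; exact mul_le_mul_of_nonneg_left h4 (abs_nonneg _))
        nlinarith [sq_abs q.2]
      · rw [fall'_of_gt (not_le.mp hs)]; simp
    · rw [image_eq_zero_of_notMem_tsupport hy]; simp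
  have hmono : MonotoneOn (fun τ => ∫ q, G τ q ∂lam) (Icc 0 1) := by
    refine monotoneOn_of_deriv_nonneg (convex_Icc 0 1)
      (fun τ _ => (hF τ).continuousAt.continuousWithinAt)
      (fun τ _ => (hF τ).differentiableAt.differentiableWithinAt) fun τ hτ => ?_
    rw [(hF τ).deriv]
    exact hderiv τ (interior_subset hτ)
  have := hmono (left_mem_Icc.mpr zero_le_one) (right_mem_Icc.mpr zero_le_one) zero_le_one
  simpa [hG, harg] using this

/-- Boxes are transported into slightly larger boxes. -/
theorem measure_box_le [IsFiniteMeasure lam] (H : IsTransported lam r C v P) (hC : 0 ≤ C)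
    {a : E2} {ρ ρ' : ℝ} (hρ : ρ < ρ') (h1 : ‖a‖ + ρ' ≤ r) (h2 : ‖a + v‖ + ρ' ≤ r)
    {δ : ℝ} (hδ : 0 < δ) (hδr : 2 * δ * Real.exp C < r) :
    lam (closedBall a ρ ×ˢ Icc (-δ) δ) ≤
      lam (ball (a + v) ρ' ×ˢ Icc (-(2 * δ * Real.exp C)) (2 * δ * Real.exp C)) := by
  obtain ⟨h, hh, hc, hs, hone, h01⟩ := exists_cutoff (isCompact_closedBall a ρ)
    (isOpen_ball (x := a) (ε := ρ')) (closedBall_subset_ball hρ)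
  have hm1 : MeasurableSet (closedBall a ρ ×ˢ Icc (-δ) δ) :=
    measurableSet_closedBall.prod measurableSet_Icc
  have hm2 : MeasurableSet (ball (a + v) ρ' ×ˢ
      Icc (-(2 * δ * Real.exp C)) (2 * δ * Real.exp C)) := measurableSet_ball.prod measurableSet_Icc
  have hsupp : ∀ τ ∈ Icc (0 : ℝ) 1, ∀ y ∈ tsupport h, ‖y + τ • v‖ < r := by
    intro τ hτ y hy
    have h3 : ‖y - a‖ < ρ' := by simpa [dist_eq_norm] using hs hy
    have h4 : y + τ • v = (y - a) + ((1 - τ) • a + τ • (a + v)) := by module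
    calc ‖y + τ • v‖ ≤ ‖y - a‖ + ‖(1 - τ) • a + τ • (a + v)‖ := by rw [h4]; exact norm_add_le _ _
      _ ≤ ‖y - a‖ + ((1 - τ) * ‖a‖ + τ * ‖a + v‖) := by
          gcongr
          refine (norm_add_le _ _).trans (le_of_eq ?_)
          rw [norm_smul, norm_smul, Real.norm_of_nonneg (sub_nonneg.mpr hτ.2),
            Real.norm_of_nonneg hτ.1]
      _ < r := by nlinarith [hτ.1, hτ.2]
  have key := H.integral_mono_translate hC hh hc (fun y => (h01 y).1) hsupp hδ hδr
  have hi : ∀ (b : E2) (k : ℝ), Integrable (fun q : E2 × ℝ => h (q.1 - b) *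
      fall (q.2 ^ 2 * k / δ ^ 2)) lam := fun b k => by
    refine Integrable.of_bound (Continuous.aestronglyMeasurable ?_) 1 (ae_of_all _ fun q => ?_)
    · exact (hh.continuous.comp (by fun_prop)).mul (contDiff_fall.continuous.comp (by fun_prop))
    · rw [norm_mul, Real.norm_of_nonneg (fall_mem _).1, Real.norm_of_nonneg (h01 _).1]
      exact mul_le_one₀ (h01 _).2 (fall_mem _).1 (fall_mem _).2
  have hn : ∀ (b : E2) (k : ℝ) (q : E2 × ℝ), 0 ≤ h (q.1 - b) * fall (q.2 ^ 2 * k / δ ^ 2) :=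
    fun b k q => mul_nonneg (h01 _).1 (fall_mem _).1
  have hi0 := hi 0 1
  have hn0 := hn 0 1
  simp only [sub_zero, mul_one] at hi0 hn0
  rw [← lintegral_indicator_one hm1, ← lintegral_indicator_one hm2]
  calc ∫⁻ q, (closedBall a ρ ×ˢ Icc (-δ) δ).indicator 1 q ∂lam
      ≤ ∫⁻ q, ofReal (h q.1 * fall (q.2 ^ 2 / δ ^ 2)) ∂lam := by
        refine lintegral_mono fun q => ?_
        by_cases hq : q ∈ closedBall a ρ ×ˢ Icc (-δ) δ
        · rw [indicator_of_mem hq, hone.self_of_nhdsSet _ hq.1, fall_of_le, mul_one,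
            ENNReal.ofReal_one]
          · rfl
          · rw [div_le_one (by positivity)]
            exact sq_le_sq' hq.2.1 hq.2.2
        · rw [indicator_of_notMem hq]; exact zero_le
    _ = ofReal (∫ q, h q.1 * fall (q.2 ^ 2 / δ ^ 2) ∂lam) :=
        (ofReal_integral_eq_lintegral_ofReal hi0 (ae_of_all _ hn0)).symm
    _ ≤ ofReal (∫ q, h (q.1 - v) * fall (q.2 ^ 2 * Real.exp (-2 * C) / δ ^ 2) ∂lam) :=
        ofReal_le_ofReal key
    _ = ∫⁻ q, ofReal (h (q.1 - v) * fall (q.2 ^ 2 * Real.exp (-2 * C) / δ ^ 2)) ∂lam :=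
        ofReal_integral_eq_lintegral_ofReal (hi v _) (ae_of_all _ (hn v _))
    _ ≤ _ := by
        refine lintegral_mono fun q => ?_
        by_cases hq : q ∈ ball (a + v) ρ' ×ˢ
            Icc (-(2 * δ * Real.exp C)) (2 * δ * Real.exp C)
        · rw [indicator_of_mem hq, Pi.one_apply, ← ENNReal.ofReal_one]
          exact ofReal_le_ofReal (mul_le_one₀ (h01 _).2 (fall_mem _).1 (fall_mem _).2)
        · rw [indicator_of_notMem hq, nonpos_iff_eq_zero, ENNReal.ofReal_eq_zero]
          refine le_of_eq ?_
          rw [mem_prod, not_and_or] at hq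
          rcases hq with hq | hq
          · have hx : q.1 - v ∉ tsupport h := fun hx => by
              have := hs hx
              rw [mem_ball, dist_eq_norm] at this hq
              exact hq (by rwa [sub_sub, add_comm v a] at this)
            rw [image_eq_zero_of_notMem_tsupport hx, zero_mul]
          · rw [fall_of_ge, mul_zero]
            rw [le_div_iff₀ (by positivity)]
            by_contra hlt
            refine hq (abs_le.mp (abs_le_of_sq_le_sq ?_ (by positivity)))
            have h3 : Real.exp (-2 * C) * Real.exp C ^ 2 = 1 := by
              rw [← Real.exp_nat_mul, ← Real.exp_add]; simp
            nlinarith [Real.exp_pos C, sq_nonneg (δ * Real.exp C),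
              mul_le_mul_of_nonneg_right (not_le.mp hlt).le (sq_nonneg (Real.exp C))]

end IsTransported

theorem measure_prod_zero_eq_iInter {A : ℕ → Set E2} {A₀ : Set E2} {η : ℕ → ℝ}
    (hA : Antitone A) (hA₀ : ⋂ n, A n = A₀) (hη : Antitone η) (hη0 : Tendsto η atTop (𝓝 0))
    (hm : ∀ n, MeasurableSet (A n)) (lam : Measure (E2 × ℝ)) [IsFiniteMeasure lam] :
    Tendsto (fun n => lam (A n ×ˢ Icc (-η n) (η n))) atTop (𝓝 (lam (A₀ ×ˢ {0}))) := by
  have h0 : ∀ n, 0 ≤ η n := fun n => hη.le_of_tendsto hη0 n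
  have hset : A₀ ×ˢ {(0 : ℝ)} = ⋂ n, A n ×ˢ Icc (-η n) (η n) := by
    ext ⟨y, s⟩
    simp only [mem_prod, mem_singleton_iff, mem_iInter, ← hA₀]
    refine ⟨fun h n => ⟨h.1 n, ?_⟩, fun h => ⟨fun n => (h n).1, ?_⟩⟩
    · rw [h.2]; exact ⟨neg_nonpos.mpr (h0 n), h0 n⟩
    · refine abs_nonpos_iff.mp (ge_of_tendsto' hη0 fun n => abs_le.mpr (h n).2)
  rw [hset]
  refine tendsto_measure_iInter_atTop (fun n => ((hm n).prod measurableSet_Icc).nullMeasurableSet)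
    (fun m n hmn => prod_mono (hA hmn) (Icc_subset_Icc (neg_le_neg (hη hmn)) (hη hmn)))
    ⟨0, measure_ne_top _ _⟩

namespace IsTransported
variable {lam : Measure (E2 × ℝ)} {r C : ℝ}

/-- The comparison of boxes as the height tends to zero: the factor `2 exp C` in the height becomes
irrelevant, and on the plaque itself the measure is exactly translation invariant. -/
theorem measure_zero_le [IsFiniteMeasure lam] {v : E2} {P : E2 × ℝ → ℝ}
    (H : IsTransported lam r C v P) (hC : 0 ≤ C) {a : E2} {ρ : ℝ}
    (h1 : ‖a‖ + ρ < r) (h2 : ‖a + v‖ + ρ < r) (hr : 0 < r) :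
    lam (closedBall a ρ ×ˢ {0}) ≤ lam (closedBall (a + v) ρ ×ˢ {0}) := by
  set ε : ℕ → ℝ := fun n => 1 / ((n : ℝ) + 1) with hε
  have hεa : Antitone ε := fun m n h => one_div_le_one_div_of_le (by positivity) (by gcongr)
  have hε0 : Tendsto ε atTop (𝓝 0) := tendsto_one_div_add_atTop_nhds_zero_nat
  have hlim := measure_prod_zero_eq_iInter (A := fun n => closedBall (a + v) (ρ + ε n))
    (A₀ := closedBall (a + v) ρ) (η := fun n => ε n * (2 * Real.exp C))
    (fun m n h => Metric.closedBall_subset_closedBall (by gcongr; exact hεa h)) ?_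
    (fun m n h => mul_le_mul_of_nonneg_right (hεa h) (by positivity))
    (by simpa using hε0.mul_const (2 * Real.exp C)) (fun n => measurableSet_closedBall) lam
  · refine ge_of_tendsto hlim ?_
    have h3 : ∀ᶠ n in atTop, ε n < min (r - ρ - ‖a‖) (r - ρ - ‖a + v‖) :=
      hε0.eventually_lt_const (lt_min (by linarith) (by linarith))
    have h4 : ∀ᶠ n in atTop, ε n * (2 * Real.exp C) < r := by
      have := hε0.mul_const (2 * Real.exp C)
      rw [zero_mul] at this
      exact this.eventually_lt_const hr
    filter_upwards [h3, h4] with n h3 h4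
    have hpos : 0 < ε n := by positivity
    have h5 := h3.trans_le (min_le_left _ _)
    have h6 := h3.trans_le (min_le_right _ _)
    have h7 : 2 * ε n * Real.exp C = ε n * (2 * Real.exp C) := by ring
    refine (measure_mono ?_).trans ((H.measure_box_le hC (a := a) (ρ := ρ) (ρ' := ρ + ε n)
      (by linarith) (by linarith) (by linarith) hpos (by rw [h7]; exact h4)).trans ?_)
    · exact prod_mono Subset.rfl (singleton_subset_iff.mpr ⟨by linarith, hpos.le⟩)
    · rw [h7]
      exact measure_mono (prod_mono ball_subset_closedBall Subset.rfl)
  · ext y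
    simp only [mem_iInter, mem_closedBall]
    refine ⟨fun h => ?_, fun h n => h.trans (by linarith [show 0 < ε n by positivity])⟩
    exact ge_of_tendsto' (by simpa using hε0.const_add ρ) h

/-- The small box at the origin, of mass at least `c ρ²`, is transported to every `v` in a disc of
radius `r/2`. Integrating over `v` by Tonelli's theorem counts each point at most with the area of a
disc of radius `2ρ`. The powers of `ρ` cancel, so a strip of height of order `ρ` has mass at least
`c (r/2)²/4`, and this survives as `ρ` tends to zero. -/
theorem measure_zero_pos [IsFiniteMeasure lam] {P : E2 → E2 × ℝ → ℝ} (hC : 0 ≤ C) (hr : 0 < r)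
    (H : ∀ v : E2, ‖v‖ < r / 2 → IsTransported lam r C v (P v)) {c : ℝ} (hc : 0 < c)
    (hlow : ∀ᶠ ρ in 𝓝[>] (0 : ℝ), ofReal (c * ρ ^ 2) ≤
      lam (closedBall 0 ρ ×ˢ Icc (-ρ) ρ)) :
    0 < lam (ball 0 r ×ˢ {0}) := by
  set ε : ℕ → ℝ := fun n => 1 / ((n : ℝ) + 1) with hε
  have hεa : Antitone ε := fun m n h => one_div_le_one_div_of_le (by positivity) (by gcongr)
  have hε0 : Tendsto ε atTop (𝓝 0) := tendsto_one_div_add_atTop_nhds_zero_nat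
  have hεpos : ∀ n, 0 < ε n := fun n => by positivity
  have hlim := measure_prod_zero_eq_iInter (A := fun _ => ball (0 : E2) r)
    (A₀ := ball 0 r) (η := fun n => ε n * (2 * Real.exp C)) antitone_const
    (iInter_const _) (fun m n h => mul_le_mul_of_nonneg_right (hεa h) (by positivity))
    (by simpa using hε0.mul_const (2 * Real.exp C)) (fun n => measurableSet_ball) lam
  set V₁ := volume (ball (0 : E2) 1) with hV₁
  have hV₁pos : V₁ ≠ 0 := (measure_ball_pos volume _ one_pos).ne'
  have hV₁fin : V₁ ≠ ⊤ := measure_ball_lt_top.ne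
  have hVol : ∀ (x : E2) (ρ : ℝ), 0 ≤ ρ → volume (ball x ρ) = ofReal (ρ ^ 2) * V₁ :=
    fun x ρ hρ => by
      rw [Measure.addHaar_ball _ _ hρ]; simp [hV₁]
  have hgoal : ofReal (c * (r / 2) ^ 2 / 4) ≤ lam (ball 0 r ×ˢ {0}) := by
    refine ge_of_tendsto hlim ?_
    have hε0' : Tendsto ε atTop (𝓝[>] 0) := tendsto_nhdsWithin_iff.mpr
      ⟨hε0, Eventually.of_forall hεpos⟩
    have h4 : ∀ᶠ n in atTop, ε n * (2 * Real.exp C) < r := by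
      have := hε0.mul_const (2 * Real.exp C)
      rw [zero_mul] at this
      exact this.eventually_lt_const hr
    filter_upwards [hε0'.eventually hlow, h4, hε0.eventually_lt_const (show 0 < r / 4 by linarith)]
      with n h1 h2 h3
    set ρ := ε n
    have hρ : 0 < ρ := hεpos n
    set η := ρ * (2 * Real.exp C)
    have hbox : ∀ v ∈ ball (0 : E2) (r / 2), ofReal (c * ρ ^ 2) ≤
        lam (ball v (2 * ρ) ×ˢ Icc (-η) η) := fun v hv => by
      rw [mem_ball_zero_iff] at hv
      have := (H v hv).measure_box_le hC (a := 0) (ρ := ρ) (ρ' := 2 * ρ) (by linarith)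
        (by rw [norm_zero]; linarith) (by rw [zero_add]; linarith) hρ
        (by linarith [show 2 * ρ * Real.exp C = η by ring])
      rw [zero_add, show 2 * ρ * Real.exp C = η by ring] at this
      exact h1.trans this
    set B := {z : E2 × (E2 × ℝ) | z.1 ∈ ball (0 : E2) (r / 2) ∧
      z.2 ∈ ball z.1 (2 * ρ) ×ˢ Icc (-η) η} with hB
    have hBm : MeasurableSet B := by
      refine ((measurableSet_ball (x := (0 : E2))).preimage measurable_fst).inter ?_
      refine MeasurableSet.inter (s₁ := {z : E2 × (E2 × ℝ) | dist z.2.1 z.1 < 2 * ρ})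
        (s₂ := {z : E2 × (E2 × ℝ) | z.2.2 ∈ Icc (-η) η}) ?_ ?_
      · exact measurableSet_lt (by fun_prop) measurable_const
      · exact measurableSet_Icc.preimage (by fun_prop)
    have hL : ofReal (c * ρ ^ 2) * volume (ball (0 : E2) (r / 2)) ≤
        ∫⁻ v, ∫⁻ q, B.indicator 1 (v, q) ∂lam := by
      rw [← setLIntegral_const, ← lintegral_indicator measurableSet_ball]
      refine lintegral_mono fun v => ?_
      by_cases hv : v ∈ ball (0 : E2) (r / 2)
      · rw [indicator_of_mem hv]
        refine (hbox v hv).trans (le_of_eq ?_)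
        rw [← lintegral_indicator_one (measurableSet_ball.prod measurableSet_Icc)]
        refine lintegral_congr fun q => ?_
        by_cases hq : q ∈ ball v (2 * ρ) ×ˢ Icc (-η) η
        · rw [indicator_of_mem hq, indicator_of_mem (show (v, q) ∈ B from ⟨hv, hq⟩)]; rfl
        · rw [indicator_of_notMem hq, indicator_of_notMem fun h : (v, q) ∈ B => hq h.2]
      · rw [indicator_of_notMem hv]; exact zero_le
    have hR : ∫⁻ v, ∫⁻ q, B.indicator 1 (v, q) ∂lam ≤
        ofReal ((2 * ρ) ^ 2) * V₁ * lam (ball 0 r ×ˢ Icc (-η) η) := by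
      rw [lintegral_lintegral_swap (f := fun v q => B.indicator 1 (v, q))
        (measurable_one.indicator hBm).aemeasurable, ← setLIntegral_const,
        ← lintegral_indicator (measurableSet_ball.prod measurableSet_Icc)]
      refine lintegral_mono fun q => ?_
      by_cases hq : q ∈ ball (0 : E2) r ×ˢ Icc (-η) η
      · rw [indicator_of_mem hq, ← hVol q.1 (2 * ρ) (by positivity),
          ← lintegral_indicator_one measurableSet_ball]
        refine lintegral_mono fun v => ?_
        by_cases hv : (v, q) ∈ B
        · rw [indicator_of_mem hv, indicator_of_mem (show v ∈ ball q.1 (2 * ρ) by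
            rw [Metric.mem_ball_comm]; exact hv.2.1)]; rfl
        · rw [indicator_of_notMem hv]; exact zero_le
      · rw [indicator_of_notMem hq, nonpos_iff_eq_zero, ← lintegral_zero]
        refine lintegral_congr fun v => indicator_of_notMem ?_ _
        rintro ⟨h5, h6, h7⟩
        refine hq ⟨?_, h7⟩
        rw [mem_ball] at h5 h6 ⊢
        linarith [dist_triangle q.1 v 0]
    have hLR := hL.trans hR
    rw [hVol 0 (r / 2) (by linarith)] at hLR
    refine (ENNReal.mul_le_mul_iff_right (a := ofReal ((2 * ρ) ^ 2) * V₁)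
      (mul_ne_zero (ofReal_pos.mpr (by positivity)).ne' hV₁pos)
      (ENNReal.mul_ne_top ofReal_ne_top hV₁fin)).mp (le_trans (le_of_eq ?_) hLR)
    rw [mul_right_comm, ← mul_assoc, ← ofReal_mul (by positivity),
      ← ofReal_mul (by positivity)]
    congr 2
    ring
  refine lt_of_lt_of_le ?_ hgoal
  exact ofReal_pos.mpr (by positivity)

end IsTransported

/-! ### The area measure of a stationary current in a chart -/

variable {S : RectCurrent}

namespace LeafChart
variable {p : E3} (c : LeafChart R g ν p)

/-- The conormal is bounded in the direction of the normal at the centre. -/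
def Tame : Prop := ∃ B, ∀ x ∈ c.O, conormal g ν x (ν p) ≤ B

theorem exists_tame (hg : IsMetricOn g unitBall) (hν : R.IsUnitNormal g ν)
    {φ : OpenPartialHomeomorph (E2 × ℝ) E3} (hφ : φ ∈ R.atlas) {p : E3} (hp : p ∈ φ.target)
    {N : Set E3} (hN : N ∈ 𝓝 p) : ∃ c : LeafChart R g ν p, c.φ = φ ∧ c.Tame ∧ c.O ⊆ N := by
  obtain ⟨c, hc⟩ := exists_leafChart hg hν hφ hp
  have hpΩ := R.target_subset hφ hp
  have hcont : ContinuousAt (fun x => conormal g ν x (ν p)) p :=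
    ((continuousOn_conormal' hg hν).continuousAt (isOpen_offAxis.mem_nhds hpΩ)).clm_apply
      continuousAt_const
  obtain ⟨r', h0, hr', hsub⟩ := c.exists_r (inter_mem hN (hcont.eventually
    (gt_mem_nhds (lt_add_one (conormal g ν p (ν p))))))
  exact ⟨c.shrink h0 hr', hc, ⟨_, fun x hx => (hsub x hx.1 hx.2).2.le⟩,
    fun x hx => (hsub x hx.1 hx.2).1⟩

/-- The area measure in the coordinates of the chart. -/
def boxMeasure (S : RectCurrent) : Measure (E2 × ℝ) :=
  (((S.mass g).restrict c.O).withDensity fun x => ofReal (conormal g ν x (ν p))).map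
    fun x => (c.y x, c.s x)

theorem continuous_ys : Continuous fun x => (c.y x, c.s x) :=
  c.contDiff_y.continuous.prodMk c.contDiff_s.continuous

theorem boxMeasure_apply (S : RectCurrent) {A : Set (E2 × ℝ)} (hA : MeasurableSet A) :
    c.boxMeasure S A = ∫⁻ x in {x ∈ c.O | (c.y x, c.s x) ∈ A},
      ofReal (conormal g ν x (ν p)) ∂S.mass g := by
  have hm := c.continuous_ys.measurable hA
  rw [boxMeasure, Measure.map_apply c.continuous_ys.measurable hA, withDensity_apply _ hm,
    Measure.restrict_restrict hm, inter_comm]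
  rfl

theorem boxMeasure_le {c : LeafChart R g ν p} {B : ℝ}
    (hB : ∀ x ∈ c.O, conormal g ν x (ν p) ≤ B)
    {A : Set (E2 × ℝ)} (hA : MeasurableSet A) :
    c.boxMeasure S A ≤ ofReal B * S.mass g {x ∈ c.O | (c.y x, c.s x) ∈ A} := by
  rw [c.boxMeasure_apply S hA, ← setLIntegral_const]
  exact setLIntegral_mono measurable_const fun x hx => ofReal_le_ofReal (hB x hx.1)

theorem isFiniteMeasure_boxMeasure {c : LeafChart R g ν p} (hc : c.Tame)
    (hS : IsStationary S g ν) : IsFiniteMeasure (c.boxMeasure S) := by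
  obtain ⟨B, hB⟩ := hc
  refine ⟨(boxMeasure_le hB MeasurableSet.univ).trans_lt ?_⟩
  exact ENNReal.mul_lt_top ofReal_lt_top
    ((measure_mono (subset_univ _)).trans_lt hS.finite)

theorem boxMeasure_prod_zero (hS : S.IsCalibrated g ν) (hg : IsMetricOn g unitBall)
    (hν : R.IsUnitNormal g ν) {A : Set E2} (hA : MeasurableSet A) :
    c.boxMeasure S (A ×ˢ {0}) = ofReal |c.D| * ∫⁻ w in A ∩ ball 0 c.r,
      (S.theta (c.pt (w, 0)) : ENNReal) := by
  have hm : MeasurableSet (A ×ˢ {(0 : ℝ)}) := hA.prod (measurableSet_singleton 0)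
  rw [c.boxMeasure_apply S hm, hS.lintegral_chart hg hν c
    (A := {x ∈ c.O | (c.y x, c.s x) ∈ A ×ˢ {(0 : ℝ)}}) (c.isOpen_O.measurableSet.inter (c.continuous_ys.measurable hm)) (fun x hx => hx.1)
    fun x hx => hx.2.2]
  congr 3
  ext w
  simp [c.pt_mem_O, c.r_pos, and_comm]

/-- The slope of the foliation in the direction `v`. -/
def slopeAt (v : E2) (q : E2 × ℝ) : ℝ :=
  -conormal g ν (c.pt q) (c.Λ.symm (v, fderiv ℝ c.f q.1 v)) / conormal g ν (c.pt q) (ν p)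

theorem abs_slopeAt_le (hg : IsMetricOn g unitBall) (v : E2) {q : E2 × ℝ} (h1 : ‖q.1‖ < c.r)
    (h2 : |q.2| < c.r) : |c.slopeAt v q| ≤ 2 * c.C * ‖v‖ * |q.2| := by
  have hO : c.pt q ∈ c.O := c.pt_mem_O.mpr ⟨h1, h2⟩
  have hΩ := c.O_subset hO
  have hv := (hg.isInner hΩ.1).gvol_pos
  have hs := c.slope hO v
  have hh := c.half_le hO
  rw [c.y_pt, c.s_pt] at hs
  rw [slopeAt, conormal_apply hΩ, conormal_apply hΩ, neg_div,
    mul_div_mul_left _ _ (inv_pos.mpr hv).ne', abs_neg, abs_div,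
    abs_of_pos (lt_of_lt_of_le (by norm_num) hh), div_le_iff₀ (lt_of_lt_of_le (by norm_num) hh)]
  have h0 : 0 ≤ c.C * ‖v‖ * |q.2| := by have := c.C_nonneg; positivity
  nlinarith

theorem measurable_slopeAt (hg : IsMetricOn g unitBall) (hν : R.IsUnitNormal g ν) (v : E2) :
    Measurable (c.slopeAt v) := by
  have hc : Continuous fun z : (E3 →L[ℝ] ℝ) × E3 => z.1 z.2 := by fun_prop
  have h1 : Measurable fun q => conormal g ν (c.pt q) :=
    (measurable_conormal hg hν).comp c.contDiff_pt.continuous.measurable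
  have h2 : Continuous fun q : E2 × ℝ => c.Λ.symm (v, fderiv ℝ c.f q.1 v) :=
    c.Λ.symm.continuous.comp (continuous_const.prodMk
      (((c.smooth_f.continuous_fderiv (by simp)).comp continuous_fst).clm_apply continuous_const))
  exact ((hc.measurable.comp (h1.prodMk h2.measurable)).neg).div
    (hc.measurable.comp (h1.prodMk measurable_const))

/-- Stationarity is applied to the pair consisting of `ν p` and the horizontal lift of `v`. After
the conormal of `ν p` is factored out, it becomes the derivative in the direction `(v, slopeAt v)`.
For `‖v‖ ≤ 2r` the bound `2C‖v‖` on the slope gives the constant `4Cr`. -/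
theorem isTransported (hS : IsStationary S g ν) (hg : IsMetricOn g unitBall)
    (hν : R.IsUnitNormal g ν) (hc : c.Tame) {v : E2} (hv : ‖v‖ ≤ 2 * c.r) :
    IsTransported (c.boxMeasure S) c.r (4 * c.C * c.r) v (c.slopeAt v) := by
  have := isFiniteMeasure_boxMeasure hc hS
  have hC := c.C_nonneg
  have hslope : ∀ q : E2 × ℝ, ‖q.1‖ < c.r → |q.2| < c.r →
      |c.slopeAt v q| ≤ 4 * c.C * c.r * |q.2| := fun q h1 h2 => by
    refine (c.abs_slopeAt_le hg v h1 h2).trans (mul_le_mul_of_nonneg_right ?_ (abs_nonneg _))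
    nlinarith [mul_le_mul_of_nonneg_left hv hC]
  have hmeas : ∀ β : E2 × ℝ → ℝ, ContDiff ℝ ∞ β →
      Measurable fun q => fderiv ℝ β q (v, c.slopeAt v q) := fun β hβ => by
    have hc : Continuous fun z : (E2 × ℝ →L[ℝ] ℝ) × (E2 × ℝ) => z.1 z.2 := by fun_prop
    exact hc.measurable.comp ((hβ.continuous_fderiv (by simp)).measurable.prodMk
      (measurable_const.prodMk (c.measurable_slopeAt hg hν v)))
  refine ⟨hslope, fun β hβ hβc hβs => ?_, fun β hβ hβc hβs => ?_⟩
  · set α : E3 → ℝ := fun x => β (c.y x, c.s x) with hα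
    have hαs : ContDiff ℝ ∞ α := hβ.comp (c.contDiff_y.prodMk c.contDiff_s)
    have hαt : tsupport α ⊆ (fun x => (c.y x, c.s x)) ⁻¹' tsupport β :=
      closure_minimal (fun x hx => subset_tsupport _ hx)
        ((isClosed_tsupport _).preimage c.continuous_ys)
    have hαO : tsupport α ⊆ c.O := fun x hx => hβs (hαt hx)
    have hαc : HasCompactSupport α := by
      refine IsCompact.of_isClosed_subset (hβc.isCompact.image c.contDiff_pt.continuous)
        (isClosed_tsupport _) fun x hx => ⟨_, hαt hx, by simp⟩
    have key := hS.integral_eq_zero α hαs hαc (hαO.trans c.O_subset) (ν p) (c.Λ.symm (v, 0))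
    have hβα : (fun q => α (c.pt q)) = β := by ext q; simp [hα]
    rw [boxMeasure, integral_map c.continuous_ys.measurable.aemeasurable
      (hmeas β hβ).aestronglyMeasurable, integral_withDensity_eq_integral_toReal_smul
      (measurable_conormal_apply hg hν measurable_const).ennreal_ofReal
      (ae_of_all _ fun _ => ofReal_lt_top), ← key,
      ← integral_indicator c.isOpen_O.measurableSet]
    refine integral_congr_ae (ae_of_all _ fun x => ?_)
    by_cases hx : x ∈ c.O
    · have hpos := c.conormal_pos hg hx
      have hd := c.fderiv_comp_pt hαs (c.y x, c.s x)
      simp only [c.pt_ys, hβα] at hd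
      simp only
      rw [indicator_of_mem hx, ENNReal.toReal_ofReal hpos.le, hd, hd, c.Λ.apply_symm_apply,
        c.Λ_normal, smul_eq_mul]
      simp only [map_zero, sub_zero, zero_sub, slopeAt, c.pt_ys]
      rw [c.symm_eq v (fderiv ℝ c.f (c.y x) v), map_add, map_smul, smul_eq_mul]
      have e1 : ∀ b : ℝ, fderiv ℝ β (c.y x, c.s x) (v, b) = fderiv ℝ β (c.y x, c.s x) (v, 0) +
          b * fderiv ℝ β (c.y x, c.s x) (0, 1) := fun b => by
        rw [← smul_eq_mul, ← map_smul, ← map_add]; simp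
      rw [e1, e1 (-(fderiv ℝ c.f (c.y x)) v)]
      field_simp
      ring
    · have hx' : x ∉ tsupport α := fun h => hx (hαO h)
      simp [indicator_of_notMem hx, fderiv_eq_zero_of_notMem hx']
  · obtain ⟨K, hK⟩ := (hβ.continuous_fderiv (by simp)).bounded_above_of_compact_support
      (hβc.fderiv (𝕜 := ℝ))
    refine Integrable.of_bound (hmeas β hβ).aestronglyMeasurable
      (K * max ‖v‖ (4 * c.C * c.r * c.r)) (ae_of_all _ fun q => ?_)
    have hK0 : 0 ≤ K := (norm_nonneg _).trans (hK 0)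
    by_cases hq : q ∈ tsupport β
    · refine (ContinuousLinearMap.le_opNorm _ _).trans (mul_le_mul (hK q) ?_ (norm_nonneg _) hK0)
      rw [Prod.norm_mk]
      refine max_le_max le_rfl ((hslope q (hβs hq).1 (hβs hq).2).trans ?_)
      exact mul_le_mul_of_nonneg_left (hβs hq).2.le (by have := c.r_pos; positivity)
    · rw [fderiv_eq_zero_of_notMem hq]
      simp only [zero_apply, norm_zero]
      exact mul_nonneg hK0 (le_max_of_le_left (norm_nonneg _))

/-- Discs of equal radius in the plaque carry equal mass, since each can be transported to the
other. By Lebesgue's differentiation theorem the density, which is the multiplicity, is almost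
everywhere the same. -/
theorem exists_theta_ae_eq (hS : IsStationary S g ν) (hg : IsMetricOn g unitBall)
    (hν : R.IsUnitNormal g ν) (hc : c.Tame) :
    ∃ n : ℕ, ∀ᵐ w ∂volume.restrict (ball 0 c.r), S.theta (c.pt (w, 0)) = n := by
  have := isFiniteMeasure_boxMeasure hc hS
  have hptc : Continuous fun w : E2 => c.pt (w, 0) :=
    c.contDiff_pt.continuous.comp (Continuous.prodMk_left 0)
  set f : E2 → ENNReal := (ball 0 c.r).indicator fun w => (S.theta (c.pt (w, 0)) : ENNReal)
    with hf
  have hfm : Measurable f := (S.measurable_theta.comp hptc.measurable).indicator measurableSet_ball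
  have hbox : ∀ A : Set E2, MeasurableSet A →
      c.boxMeasure S (A ×ˢ {0}) = ofReal |c.D| * ∫⁻ w in A, f w := fun A hA => by
    rw [c.boxMeasure_prod_zero hS.calibrated hg hν hA, hf, lintegral_indicator measurableSet_ball,
      Measure.restrict_restrict measurableSet_ball, inter_comm]
  have hD : ofReal |c.D| ≠ 0 := (ofReal_pos.mpr (abs_pos.mpr c.D_ne_zero)).ne'
  have hfin : ∫⁻ w, f w ≠ ⊤ := fun h => by
    have := hbox univ MeasurableSet.univ
    rw [setLIntegral_univ, h, ENNReal.mul_top hD] at this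
    exact measure_ne_top _ _ this
  have hmove : ∀ a b : E2, ∀ ρ : ℝ, ‖a‖ + ρ < c.r → ‖b‖ + ρ < c.r → 0 < ρ →
      ∫⁻ w in closedBall a ρ, f w ≤ ∫⁻ w in closedBall b ρ, f w := by
    intro a b ρ ha hb hρ
    have hv : ‖b - a‖ ≤ 2 * c.r := (norm_sub_le _ _).trans (by linarith)
    have h1 := (c.isTransported hS hg hν hc hv).measure_zero_le
      (by have := c.C_nonneg; have := c.r_pos; positivity) ha (by simpa using hb) c.r_pos
    rw [hbox _ measurableSet_closedBall, hbox _ measurableSet_closedBall, add_sub_cancel] at h1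
    exact (ENNReal.mul_le_mul_iff_right hD ofReal_ne_top).mp h1
  have hleb := (Besicovitch.vitaliFamily (volume : Measure E2)).ae_tendsto_lintegral_div
    hfm.aemeasurable hfin
  have hleb' : ∀ᵐ w ∂volume.restrict (ball (0 : E2) c.r), w ∈ ball (0 : E2) c.r ∧
      Tendsto (fun ρ => (∫⁻ y in closedBall w ρ, f y) / volume (closedBall w ρ))
        (𝓝[>] 0) (𝓝 (f w)) := by
    filter_upwards [ae_restrict_mem measurableSet_ball, ae_restrict_of_ae hleb] with w hw h
    exact ⟨hw, h.comp (Besicovitch.tendsto_filterAt _ _)⟩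
  have hne : (volume.restrict (ball (0 : E2) c.r)) ≠ 0 := by
    rw [Ne, Measure.restrict_eq_zero]
    exact (measure_ball_pos volume _ c.r_pos).ne'
  have : NeBot (ae (volume.restrict (ball (0 : E2) c.r))) := ae_neBot.mpr hne
  obtain ⟨w₀, hw₀, ht₀⟩ := hleb'.exists
  refine ⟨S.theta (c.pt (w₀, 0)), ?_⟩
  filter_upwards [hleb'] with w hw
  have heq : f w = f w₀ := by
    refine tendsto_nhds_unique hw.2 (ht₀.congr' ?_)
    have h1 := mem_ball_zero_iff.mp hw.1
    have h2 := mem_ball_zero_iff.mp hw₀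
    have hpos : 0 < min (c.r - ‖w‖) (c.r - ‖w₀‖) := lt_min (by linarith) (by linarith)
    filter_upwards [self_mem_nhdsWithin, mem_nhdsWithin_of_mem_nhds (gt_mem_nhds hpos)]
      with ρ hρ0 hρ
    have h3 := hρ.trans_le (min_le_left _ _)
    have h4 := hρ.trans_le (min_le_right _ _)
    rw [le_antisymm (hmove w₀ w ρ (by linarith) (by linarith) hρ0)
      (hmove w w₀ ρ (by linarith) (by linarith) hρ0), Measure.addHaar_closedBall_center,
      Measure.addHaar_closedBall_center volume w]
  rw [hf, indicator_of_mem hw.1, indicator_of_mem hw₀] at heq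
  exact_mod_cast heq

end LeafChart

/-! ### The multiplicity of a stationary current along the leaves -/

namespace LeafChart
variable {p : E3} (c : LeafChart R g ν p)

theorem measurableSet_plaque : MeasurableSet {x ∈ c.O | c.s x = 0} :=
  c.isOpen_O.measurableSet.inter (measurableSet_eq_fun c.contDiff_s.continuous.measurable
    measurable_const)

theorem continuous_pt_zero : Continuous fun w : E2 => c.pt (w, 0) :=
  c.contDiff_pt.continuous.comp (Continuous.prodMk_left 0)

theorem pt_y_zero {x : E3} (hs : c.s x = 0) : c.pt (c.y x, 0) = x := by
  rw [← hs]; exact c.pt_ys x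

theorem setLIntegral_conormal_pos_iff (hg : IsMetricOn g unitBall) (hν : R.IsUnitNormal g ν)
    {μ : Measure E3} {A : Set E3} (hAm : MeasurableSet A) (hA : A ⊆ c.O) :
    ∫⁻ x in A, ofReal (conormal g ν x (ν p)) ∂μ = 0 ↔ μ A = 0 := by
  rw [lintegral_eq_zero_iff (measurable_conormal_apply hg hν measurable_const).ennreal_ofReal]
  constructor
  · intro h
    by_contra hne
    have hne' : μ.restrict A ≠ 0 := by rwa [Ne, Measure.restrict_eq_zero]
    have : NeBot (ae (μ.restrict A)) := ae_neBot.mpr hne'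
    obtain ⟨x, h1, h2⟩ := (h.and (ae_restrict_mem hAm)).exists
    exact (ofReal_pos.mpr (c.conormal_pos hg (hA h2))).ne' h1
  · intro h
    rw [Measure.restrict_eq_zero.mpr h]
    rfl

theorem mass_theta_ne (hS : S.IsCalibrated g ν) (hg : IsMetricOn g unitBall)
    (hν : R.IsUnitNormal g ν) {n : ℕ}
    (hn : ∀ᵐ w ∂volume.restrict (ball 0 c.r), S.theta (c.pt (w, 0)) = n) :
    S.mass g {x ∈ c.O | c.s x = 0 ∧ S.theta x ≠ n} = 0 := by
  have hm : MeasurableSet {x ∈ c.O | c.s x = 0 ∧ S.theta x ≠ n} := by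
    have h1 : MeasurableSet {x | (S.theta x : ENNReal) = n}ᶜ :=
      (measurableSet_eq_fun S.measurable_theta measurable_const).compl
    have h2 : {x ∈ c.O | c.s x = 0 ∧ S.theta x ≠ n} =
        {x ∈ c.O | c.s x = 0} ∩ {x | (S.theta x : ENNReal) = n}ᶜ := by
      ext x
      exact ⟨fun h => ⟨⟨h.1, h.2.1⟩, fun h' => h.2.2 (by exact_mod_cast h')⟩,
        fun h => ⟨h.1.1, h.1.2, fun h' => h.2 (by rw [mem_ofPred_eq, h'])⟩⟩
    rw [h2]; exact c.measurableSet_plaque.inter h1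
  rw [← c.setLIntegral_conormal_pos_iff hg hν hm fun x hx => hx.1,
    hS.lintegral_chart hg hν c hm (fun x hx => hx.1) fun x hx => hx.2.1]
  have h0 : volume {w | c.pt (w, 0) ∈ {x ∈ c.O | c.s x = 0 ∧ S.theta x ≠ n}} = 0 := by
    rw [ae_restrict_iff' measurableSet_ball] at hn
    refine measure_mono_null (fun w hw => ?_) (ae_iff.mp hn)
    exact fun h => hw.2.2 (h (mem_ball_zero_iff.mpr (c.pt_mem_O.mp hw.1).1))
  rw [Measure.restrict_eq_zero.mpr h0, lintegral_zero_measure, mul_zero]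

theorem mass_plaque_pos (hS : S.IsCalibrated g ν) (hg : IsMetricOn g unitBall)
    (hν : R.IsUnitNormal g ν) {n : ℕ} (h0 : n ≠ 0)
    (hn : ∀ᵐ w ∂volume.restrict (ball 0 c.r), S.theta (c.pt (w, 0)) = n)
    {N : Set E3} (hN : IsOpen N) (hNO : N ⊆ c.O) {x : E3} (hx : x ∈ N) (hs : c.s x = 0) :
    0 < S.mass g {x ∈ N | c.s x = 0} := by
  have hm : MeasurableSet {x ∈ N | c.s x = 0} := by
    have : {x ∈ N | c.s x = 0} = N ∩ {x ∈ c.O | c.s x = 0} := by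
      ext z; exact ⟨fun h => ⟨h.1, hNO h.1, h.2⟩, fun h => ⟨h.1, h.2.2⟩⟩
    rw [this]; exact hN.measurableSet.inter c.measurableSet_plaque
  rw [pos_iff_ne_zero, Ne, ← c.setLIntegral_conormal_pos_iff hg hν hm fun x hx => hNO hx.1,
    hS.lintegral_chart hg hν c hm (fun x hx => hNO hx.1) fun x hx => hx.2]
  set A := {w : E2 | c.pt (w, 0) ∈ {x ∈ N | c.s x = 0}} with hA
  have hAeq : A = {w | c.pt (w, 0) ∈ N} := by ext w; simp [hA]
  have hAo : IsOpen A := by rw [hAeq]; exact hN.preimage c.continuous_pt_zero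
  have hApos : 0 < volume A := hAo.measure_pos _ ⟨c.y x, by
    rw [hAeq]; change c.pt (c.y x, 0) ∈ N; rwa [c.pt_y_zero hs]⟩
  have hAb : A ⊆ ball 0 c.r := fun w hw =>
    mem_ball_zero_iff.mpr (c.pt_mem_O.mp (hNO hw.1)).1
  have hval : ∫⁻ w in A, (S.theta (c.pt (w, 0)) : ENNReal) = n * volume A := by
    rw [← setLIntegral_const]
    refine lintegral_congr_ae ?_
    filter_upwards [ae_restrict_of_ae_restrict_of_subset hAb hn] with w hw
    rw [hw]
  rw [hval]
  simp [h0, hApos.ne', c.D_ne_zero]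

/-- The charts share an open piece of plaque. If one of the constants is nonzero, that piece has
positive area, while the set where the multiplicity differs from either constant is null; so the
constants agree. -/
theorem theta_eq_of_common (hS : S.IsCalibrated g ν) (hg : IsMetricOn g unitBall)
    (hν : R.IsUnitNormal g ν) {p' : E3} (c' : LeafChart R g ν p') {n n' : ℕ}
    (hn : ∀ᵐ w ∂volume.restrict (ball 0 c.r), S.theta (c.pt (w, 0)) = n)
    (hn' : ∀ᵐ w ∂volume.restrict (ball 0 c'.r), S.theta (c'.pt (w, 0)) = n')
    {x : E3} (hx : x ∈ c.O) (hx' : x ∈ c'.O) (hs : c.s x = 0)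
    (hiff : ∀ᶠ z in 𝓝 x, (c.s z = 0 ↔ c'.s z = 0)) : n = n' := by
  obtain ⟨N, hNsub, hNo, hxN⟩ := mem_nhds_iff.mp
    (inter_mem (inter_mem (c.isOpen_O.mem_nhds hx) (c'.isOpen_O.mem_nhds hx')) hiff)
  have hpos : n ≠ 0 ∨ n' ≠ 0 → 0 < S.mass g {x ∈ N | c.s x = 0} := by
    rintro (h | h)
    · exact c.mass_plaque_pos hS hg hν h hn hNo (fun z hz => (hNsub hz).1.1) hxN hs
    · have := c'.mass_plaque_pos hS hg hν h hn' hNo (fun z hz => (hNsub hz).1.2) hxN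
        ((hNsub hxN).2.mp hs)
      refine this.trans_le (measure_mono fun z hz => ⟨hz.1, (hNsub hz.1).2.mpr hz.2⟩)
  by_contra hne
  refine (hpos (by omega)).ne' (measure_mono_null (fun z hz => ?_) (measure_union_null
    (c.mass_theta_ne hS hg hν hn) (c'.mass_theta_ne hS hg hν hn')))
  have hz' := hNsub hz.1
  by_cases h : S.theta z = n
  · exact Or.inr ⟨hz'.1.2, hz'.2.mp hz.2, fun h' => hne (h.symm.trans h')⟩
  · exact Or.inl ⟨hz'.1.1, hz.2, h⟩

end LeafChart

/-- The multiplicity function of a stationary current. -/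
structure IsMultiplicity (R : Foliation (unitBall \ zAxis)) (S : RectCurrent) (g : MetricField)
    (ν : E3 → E3) (m : E3 → ℕ) : Prop where
  offAxis : ∀ x, m x ≠ 0 → x ∈ unitBall \ zAxis
  theta_eq : ∀ (p : E3) (c : LeafChart R g ν p), c.Tame →
    ∀ᵐ w ∂volume.restrict (ball 0 c.r), S.theta (c.pt (w, 0)) = m p
  plaque : ∀ φ ∈ R.atlas, ∀ x ∈ φ.target, ∀ x' ∈ φ.target,
    (φ.symm x).2 = (φ.symm x').2 → m x = m x'

/-- The constants from different charts at one point agree by compatibility of the flow boxes. Along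
a plaque the resulting function is locally constant on a connected disc, hence constant. -/
theorem IsStationary.exists_multiplicity (hS : IsStationary S g ν) (hg : IsMetricOn g unitBall)
    (hν : R.IsUnitNormal g ν) : ∃ m, IsMultiplicity R S g ν m := by
  classical
  have hex := fun (p : E3) (c : LeafChart R g ν p) (hc : c.Tame) =>
    c.exists_theta_ae_eq hS hg hν hc
  set m : E3 → ℕ := fun p => if h : ∃ c : LeafChart R g ν p, c.Tame then
    (hex p h.choose h.choose_spec).choose else 0 with hm
  have hθ : ∀ (p : E3) (c : LeafChart R g ν p), c.Tame →
      ∀ᵐ w ∂volume.restrict (ball 0 c.r), S.theta (c.pt (w, 0)) = m p := by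
    intro p c hc
    have h : ∃ c : LeafChart R g ν p, c.Tame := ⟨c, hc⟩
    have hmp : m p = (hex p h.choose h.choose_spec).choose := dif_pos h
    obtain ⟨n, hn⟩ := hex p c hc
    have : n = m p := by
      rw [hmp]
      refine c.theta_eq_of_common hS.calibrated hg hν h.choose hn
        (hex p h.choose h.choose_spec).choose_spec c.mem_O_self h.choose.mem_O_self c.s_self ?_
      set c' := h.choose
      obtain ⟨N, hN, hNiff⟩ := R.compatible c.φ c.φ_mem c'.φ c'.φ_mem p
        ⟨c.O_subset_target c.mem_O_self, c'.O_subset_target c'.mem_O_self⟩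
      filter_upwards [hN, c.O_mem_nhds, c'.O_mem_nhds] with z h1 h2 h3
      rw [← c.plaque h2, ← c'.plaque h3]
      exact hNiff z h1 p (mem_of_mem_nhds hN)
    rwa [← this]
  refine ⟨m, fun x hx => ?_, hθ, fun φ hφ x hx x' hx' ht => ?_⟩
  · by_contra h
    refine hx (dif_neg ?_)
    rintro ⟨c, -⟩
    exact h c.mem_offAxis
  · have hsrc : ∀ z : E3, z ∈ φ.target → (φ.symm z).1 ∈ ball (0 : E2) 1 ∧
        (φ.symm z).2 ∈ Ioo (-1 : ℝ) 1 := fun z hz => by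
      have := φ.map_target hz
      rwa [R.source_eq φ hφ] at this
    set t := (φ.symm x).2 with htdef
    have ht1 := (hsrc x hx).2
    have hw : ∀ w ∈ ball (0 : E2) 1, (w, t) ∈ φ.source := fun w hw => by
      rw [R.source_eq φ hφ]; exact ⟨hw, ht1⟩
    have key : ∀ w ∈ ball (0 : E2) 1, ∀ w' ∈ ball (0 : E2) 1,
        m (φ (w, t)) = m (φ (w', t)) := by
      refine fun w hw1 w' hw2 => (convex_ball (0 : E2) 1).isPreconnected.induction₂
        (fun w w' => m (φ (w, t)) = m (φ (w', t))) (fun w₀ hw₀ => ?_)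
        (fun _ _ _ _ _ _ h1 h2 => h1.trans h2) (fun _ _ _ _ h => h.symm) hw1 hw2
      obtain ⟨c, hcφ, hct, -⟩ := LeafChart.exists_tame hg hν hφ (φ.map_source (hw w₀ hw₀)) univ_mem
      have hcont : ContinuousAt (fun w : E2 => φ (w, t)) w₀ :=
        (φ.continuousAt (hw w₀ hw₀)).comp (f := fun w : E2 => (w, t)) (by fun_prop)
      filter_upwards [mem_nhdsWithin_of_mem_nhds (hcont.eventually c.O_mem_nhds),
        self_mem_nhdsWithin] with w hwO hwb
      obtain ⟨c', hcφ', hct', -⟩ := LeafChart.exists_tame hg hν hφ (φ.map_source (hw w hwb)) univ_mem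
      have hteq : ∀ w ∈ ball (0 : E2) 1, (φ.symm (φ (w, t))).2 = t := fun w h => by
        rw [φ.left_inv (hw w h)]
      refine c.theta_eq_of_common hS.calibrated hg hν c' (hθ _ c hct) (hθ _ c' hct') hwO
        c'.mem_O_self ((c.plaque hwO).mp (by rw [hcφ, hteq w hwb, hteq w₀ hw₀])) ?_
      filter_upwards [c.isOpen_O.mem_nhds hwO, c'.O_mem_nhds] with z h1 h2
      rw [← c.plaque h1, ← c'.plaque h2, hcφ, hcφ', hteq w hwb, hteq w₀ hw₀]
    have e1 : φ ((φ.symm x).1, t) = x := φ.right_inv hx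
    have e2 : φ ((φ.symm x').1, t) = x' := by rw [ht]; exact φ.right_inv hx'
    have := key _ (hsrc x hx).1 _ (hsrc x' hx').1
    rwa [e1, e2] at this

theorem RectCurrent.IsCalibrated.setLIntegral_conormal (hcal : S.IsCalibrated g ν)
    (hg : IsMetricOn g unitBall) (hν : R.IsUnitNormal g ν) {A : Set E3} (hA : MeasurableSet A)
    (hAΩ : A ⊆ unitBall \ zAxis) (e : E3) :
    ∫⁻ x in A, ofReal (conormal g ν x e) ∂S.mass g =
      ∫⁻ q in S.pt ⁻¹' A, ofReal (inner ℝ e (S.nrm q)) ∂S.base := by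
  have hmeas : Measurable (A.indicator fun x => ofReal (conormal g ν x e)) :=
    (measurable_conormal_apply hg hν measurable_const).ennreal_ofReal.indicator hA
  rw [← lintegral_indicator hA, S.lintegral_mass hg hmeas, ← lintegral_indicator (S.measurable_pt hA)]
  refine lintegral_congr_ae ?_
  filter_upwards [hcal.inner_eq hg hν.unit] with q hq
  by_cases hx : S.pt q ∈ A
  · rw [indicator_of_mem hx, indicator_of_mem (show q ∈ S.pt ⁻¹' A from hx), hq (hAΩ hx),
      S.dens_offAxis (hAΩ hx), ← ofReal_mul (S.dens_nonneg g q)]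
  · rw [indicator_of_notMem hx, indicator_of_notMem (show q ∉ S.pt ⁻¹' A from hx), mul_zero]

/-! ### No area outside the plaques of positive multiplicity -/

/-- At a point of density of a piece, the area measure has positive lower density. -/
theorem LeafChart.lower_density {i : ℕ} {y : E2} (hy : y ∈ S.dom i)
    {p : E3} (hp : S.param i y = p) (c : LeafChart R g ν p) (hcal : S.IsCalibrated g ν)
    (hg : IsMetricOn g unitBall) (hν : R.IsUnitNormal g ν)
    (hpos : 0 < inner ℝ (ν p) (S.nrm (i, y)))
    (hdens : Tendsto (fun r => volume (S.dom i ∩ closedBall y r) /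
      volume (closedBall y r)) (𝓝[>] 0) (𝓝 1)) :
    ∃ a > 0, ∀ᶠ ρ in 𝓝[>] (0 : ℝ), ofReal (a * ρ ^ 2) ≤
      c.boxMeasure S (closedBall 0 ρ ×ˢ Icc (-ρ) ρ) := by
  set F := S.param i with hF
  have hFC : ContDiffAt ℝ 1 F y := S.contDiffAt i y hy
  -- the coordinates of the piece are Lipschitz at `y`
  have hΞ : ContDiffAt ℝ 1 (fun z => (c.y (F z), c.s (F z))) y :=
    ((c.contDiff_y.of_le (by norm_cast)).contDiffAt.comp y hFC).prodMk
      ((c.contDiff_s.of_le (by norm_cast)).contDiffAt.comp y hFC)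
  obtain ⟨K, t, ht, hKt⟩ := hΞ.exists_lipschitzOnWith
  set L : ℝ := K + 1 with hL
  have hLpos : 0 < L := by positivity
  have hlip : ∀ᶠ z in 𝓝 y, ‖c.y (F z)‖ ≤ L * dist z y ∧ |c.s (F z)| ≤ L * dist z y := by
    filter_upwards [ht] with z hz
    have h1 := hKt.dist_le_mul z hz y (mem_of_mem_nhds ht)
    rw [Prod.dist_eq] at h1
    simp only [hp, c.y_self, c.s_self, dist_zero_right, Real.norm_eq_abs] at h1
    have h2 : (K : ℝ) * dist z y ≤ L * dist z y :=
      mul_le_mul_of_nonneg_right (by linarith) dist_nonneg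
    exact ⟨((le_max_left _ _).trans h1).trans h2, ((le_max_right _ _).trans h1).trans h2⟩
  set v₀ := inner ℝ (ν p) (S.nrm (i, y)) with hv₀
  have hd : ContinuousAt (fderiv ℝ F) y :=
    (hFC.fderiv_right (m := 0) (by norm_num)).continuousAt
  have hcont : ContinuousAt (fun z => inner ℝ (ν p) (S.nrm (i, z))) y := by
    have h1 : ∀ j, ContinuousAt (fun z => partialD F z j) y := fun j =>
      hd.clm_apply continuousAt_const
    have h2 := (RectCurrent.continuous_cross.continuousAt).comp (f := fun z => (partialD F z 0, partialD F z 1))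
      (x := y) ((h1 0).prodMk (h1 1))
    exact continuousAt_const.inner ((continuousAt_const (y := (S.mult i : ℝ))).smul h2)
  have hev : ∀ᶠ z in 𝓝 y, v₀ / 2 ≤ inner ℝ (ν p) (S.nrm (i, z)) :=
    (hcont.eventually (lt_mem_nhds (half_lt_self hpos))).mono fun _ h => h.le
  have hO : ∀ᶠ z in 𝓝 y, F z ∈ c.O := hFC.continuousAt.eventually (by rw [hp]; exact c.O_mem_nhds)
  obtain ⟨ε, hε, hsub⟩ := eventually_nhds_iff_ball.mp (hlip.and (hev.and hO))
  set V₁ := (volume (ball (0 : E2) 1)).toReal with hV₁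
  have hV₁fin : volume (ball (0 : E2) 1) ≠ ⊤ := measure_ball_lt_top.ne
  have hV₁pos : 0 < V₁ := ENNReal.toReal_pos (measure_ball_pos volume _ one_pos).ne' hV₁fin
  refine ⟨v₀ / 2 * (1 / 2 * (V₁ / L ^ 2)), by positivity, ?_⟩
  have hdiv : Tendsto (fun ρ : ℝ => ρ / L) (𝓝[>] 0) (𝓝[>] 0) := by
    refine tendsto_nhdsWithin_iff.mpr ⟨?_, ?_⟩
    · have : Tendsto (fun ρ : ℝ => ρ / L) (𝓝 0) (𝓝 (0 / L)) := tendsto_id.div_const L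
      rw [zero_div] at this
      exact this.mono_left nhdsWithin_le_nhds
    · filter_upwards [self_mem_nhdsWithin] with ρ hρ using div_pos hρ hLpos
  -- A disc of radius `ρ/L` around `y` is mapped into the box of size `ρ` by the Lipschitz bound,
  -- and at a point of density at least half of it belongs to the domain of the piece.
  have hhalf : ∀ᶠ r in 𝓝[>] (0 : ℝ), (1 / 2 : ENNReal) < volume (S.dom i ∩ closedBall y r) /
      volume (closedBall y r) :=
    hdens.eventually (lt_mem_nhds (by rw [one_div]; exact ENNReal.one_half_lt_one))
  filter_upwards [hdiv.eventually hhalf, hdiv.eventually (mem_nhdsWithin_of_mem_nhds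
    (gt_mem_nhds hε)), self_mem_nhdsWithin] with ρ h1 h2 hρ
  have hρ0 : 0 < ρ := hρ
  have hρL : 0 < ρ / L := div_pos hρ0 hLpos
  have hm : MeasurableSet (closedBall (0 : E2) ρ ×ˢ Icc (-ρ) ρ) :=
    measurableSet_closedBall.prod measurableSet_Icc
  set A := {x ∈ c.O | (c.y x, c.s x) ∈ closedBall (0 : E2) ρ ×ˢ Icc (-ρ) ρ} with hAdef
  have hA : MeasurableSet A := c.isOpen_O.measurableSet.inter (c.continuous_ys.measurable hm)
  rw [c.boxMeasure_apply S hm, hcal.setLIntegral_conormal hg hν hA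
    fun x hx => c.O_subset hx.1]
  set B := S.dom i ∩ closedBall y (ρ / L) with hB
  have hBm : MeasurableSet B := (S.measurable_dom i).inter measurableSet_closedBall
  have hBin : ∀ z ∈ B, z ∈ ball y ε := fun z hz =>
    closedBall_subset_ball h2 hz.2
  have hBA : ∀ z ∈ B, S.pt (i, z) ∈ A := fun z hz => by
    have h3 := hsub z (hBin z hz)
    have h4 : L * dist z y ≤ ρ := by
      have := mem_closedBall.mp hz.2
      rwa [le_div_iff₀ hLpos, mul_comm] at this
    rw [S.pt_of_mem hz.1]
    exact ⟨h3.2.2, mem_closedBall_zero_iff.mpr (h3.1.1.trans h4), abs_le.mp (h3.1.2.trans h4)⟩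
  have hvol : ofReal (1 / 2 * (V₁ / L ^ 2) * ρ ^ 2) ≤ volume B := by
    have h5 : volume (closedBall y (ρ / L)) = ofReal (V₁ / L ^ 2 * ρ ^ 2) := by
      rw [Measure.addHaar_closedBall _ _ hρL.le, ← ENNReal.ofReal_toReal hV₁fin,
        ← ofReal_mul (by positivity)]
      congr 1
      simp only [finrank_euclideanSpace, Fintype.card_fin, ← hV₁]
      field_simp
    have h6 := h1.le
    rw [ENNReal.le_div_iff_mul_le (Or.inl (by rw [h5]; exact (ofReal_pos.mpr
      (by positivity)).ne')) (Or.inl (by rw [h5]; exact ofReal_ne_top)), h5] at h6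
    refine le_trans (le_of_eq ?_) h6
    rw [mul_assoc, ofReal_mul (by norm_num)]
    congr 1
    rw [ENNReal.ofReal_div_of_pos (by norm_num)]; simp
  calc ofReal (v₀ / 2 * (1 / 2 * (V₁ / L ^ 2)) * ρ ^ 2)
      = ofReal (v₀ / 2) * ofReal (1 / 2 * (V₁ / L ^ 2) * ρ ^ 2) := by
        rw [← ofReal_mul (by positivity)]; congr 1; ring
    _ ≤ ofReal (v₀ / 2) * volume B := mul_le_mul_right hvol _
    _ = ∫⁻ _ in B, ofReal (v₀ / 2) := (setLIntegral_const _ _).symm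
    _ ≤ ∫⁻ z in B, (S.pt ⁻¹' A).indicator
          (fun q => ofReal (inner ℝ (ν p) (S.nrm q))) (i, z) := by
        refine setLIntegral_mono' hBm fun z hz => ?_
        rw [indicator_of_mem (show (i, z) ∈ S.pt ⁻¹' A from hBA z hz)]
        exact ofReal_le_ofReal (hsub z (hBin z hz)).2.1
    _ ≤ ∫⁻ z in S.dom i, (S.pt ⁻¹' A).indicator
          (fun q => ofReal (inner ℝ (ν p) (S.nrm q))) (i, z) :=
        lintegral_mono_set inter_subset_left
    _ ≤ _ := by
        rw [← lintegral_indicator (S.measurable_pt hA), S.lintegral_base]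
        exact ENNReal.le_tsum (f := fun i => ∫⁻ z in S.dom i, (S.pt ⁻¹' A).indicator
          (fun q => ofReal (inner ℝ (ν p) (S.nrm q))) (i, z)) i

/-- Almost every parameter is a point of density of its piece. There the area measure has positive
lower density, so by `IsTransported.measure_zero_pos` the plaque through the point has positive
mass. This excludes a part of the current spread over uncountably many plaques, each of zero area.
-/
theorem IsMultiplicity.ae_ne_zero {m : E3 → ℕ} (hm : IsMultiplicity R S g ν m)
    (hS : IsStationary S g ν) (hg : IsMetricOn g unitBall) (hν : R.IsUnitNormal g ν) :
    ∀ᵐ q ∂S.base, S.pt q ∈ unitBall \ zAxis → S.dens g q ≠ 0 → m (S.pt q) ≠ 0 := by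
  rw [S.ae_base_iff]
  intro i
  filter_upwards [Besicovitch.ae_tendsto_measure_inter_div volume (S.dom i),
    (S.ae_base_iff.mp (hS.calibrated.inner_eq hg hν.unit)) i,
    ae_restrict_mem (S.measurable_dom i)] with y hdens hinner hy hΩ hne h0
  have hpt := S.pt_of_mem hy
  rw [hpt] at hΩ h0
  obtain ⟨φ, hφ, hpφ⟩ := R.exists_box hΩ
  obtain ⟨c, -, hct, -⟩ := LeafChart.exists_tame hg hν hφ hpφ univ_mem
  have := LeafChart.isFiniteMeasure_boxMeasure hct hS
  have hpos : 0 < inner ℝ (ν (S.param i y)) (S.nrm (i, y)) := by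
    rw [hinner (by rw [hpt]; exact hΩ), hpt]
    exact mul_pos ((S.dens_nonneg g _).lt_of_ne hne.symm) (c.conormal_pos hg c.mem_O_self)
  obtain ⟨a, ha, hlow⟩ := c.lower_density hy rfl hS.calibrated hg hν hpos hdens
  have hr := c.r_pos
  have := IsTransported.measure_zero_pos (lam := c.boxMeasure S) (P := c.slopeAt)
    (by have := c.C_nonneg; positivity) hr
    (fun v hv => c.isTransported hS hg hν hct (by linarith)) ha hlow
  rw [c.boxMeasure_prod_zero hS.calibrated hg hν measurableSet_ball, inter_self,
    lintegral_congr_ae (g := 0), Pi.zero_def, lintegral_zero, mul_zero] at this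
  · exact this.ne rfl
  · filter_upwards [hm.theta_eq _ c hct] with w hw
    rw [hw, h0]; simp

/-! ### Comparison with the current formed by the leaves -/

variable {Q : RectCurrent}
  {φ : OpenPartialHomeomorph (E2 × ℝ) E3} {t : ℝ}

/-- The plaque of the box `φ` at height `t`. -/
def plaqueAt (φ : OpenPartialHomeomorph (E2 × ℝ) E3) (t : ℝ) : Set E3 :=
  {x ∈ φ.target | (φ.symm x).2 = t}

theorem continuousOn_height (φ : OpenPartialHomeomorph (E2 × ℝ) E3) :
    ContinuousOn (fun x => (φ.symm x).2) φ.target :=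
  continuous_snd.comp_continuousOn φ.continuousOn_symm

theorem measurableSet_plaqueAt : MeasurableSet (plaqueAt φ t) := by
  have h := (continuousOn_height φ).isOpen_inter_preimage φ.open_target
    (isClosed_singleton (x := t)).isOpen_compl
  have : plaqueAt φ t = φ.target \ (φ.target ∩ (fun x => (φ.symm x).2) ⁻¹' {t}ᶜ) := by
    ext x
    exact ⟨fun h => ⟨h.1, fun h' => h'.2 h.2⟩, fun h => ⟨h.1, not_not.mp fun h' => h.2 ⟨h.1, h'⟩⟩⟩
  rw [this]
  exact φ.open_target.measurableSet.diff h.measurableSet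

theorem pairwise_disjoint_plaqueAt : Pairwise (Function.onFun Disjoint (plaqueAt φ)) :=
  fun _ _ h => Set.disjoint_left.mpr fun _ h1 h2 => h (h1.2.symm.trans h2.2)

theorem LeafChart.plaque_subset {p : E3} (c : LeafChart R g ν p) :
    {x ∈ c.O | c.s x = 0} ⊆ plaqueAt c.φ (c.φ.symm p).2 := fun _ hx =>
  ⟨c.O_subset_target hx.1, (c.plaque hx.1).mpr hx.2⟩

theorem LeafChart.pt_mem_plaqueAt {p : E3} (c : LeafChart R g ν p) {w : E2}
    (hw : w ∈ ball 0 c.r) : c.pt (w, 0) ∈ plaqueAt c.φ (c.φ.symm p).2 :=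
  c.plaque_subset ⟨c.pt_mem_O.mpr ⟨mem_ball_zero_iff.mp hw, by simpa using c.r_pos⟩, c.s_pt _⟩

/-- Along a plaque the area measure is determined by the multiplicity. -/
theorem mass_restrict_plaqueAt (hS : S.IsCalibrated g ν) (hQ : Q.IsCalibrated g ν)
    (hg : IsMetricOn g unitBall) (hν : R.IsUnitNormal g ν) (hφ : φ ∈ R.atlas) {a : ℕ}
    (h : ∀ (p : E3) (c : LeafChart R g ν p), c.φ = φ → (φ.symm p).2 = t → c.Tame →
      ∀ᵐ w ∂volume.restrict (ball 0 c.r),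
        S.theta (c.pt (w, 0)) = a * Q.theta (c.pt (w, 0))) :
    (S.mass g).restrict (plaqueAt φ t) = (a : ENNReal) • (Q.mass g).restrict (plaqueAt φ t) := by
  have hloc : ∀ p ∈ plaqueAt φ t, ∃ P ∈ 𝓝[plaqueAt φ t] p, P ⊆ plaqueAt φ t ∧
      (S.mass g).restrict P = ((a : ENNReal) • Q.mass g).restrict P := fun p hp => by
    obtain ⟨c, hcφ, hct, -⟩ := LeafChart.exists_tame hg hν hφ hp.1 univ_mem
    refine ⟨{x ∈ c.O | c.s x = 0}, ?_, ?_, ?_⟩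
    · filter_upwards [mem_nhdsWithin_of_mem_nhds c.O_mem_nhds, self_mem_nhdsWithin] with x h1 h2
      exact ⟨h1, (c.plaque h1).mp (by rw [hcφ, h2.2, hp.2])⟩
    · have := c.plaque_subset
      rwa [hcφ, hp.2] at this
    -- On a plaque the conormal of `ν p` is positive, so it can be divided out. The area measure is
    -- thus a universal measure weighted by the multiplicity, and only the multiplicities of the two
    -- currents have to be compared.
    have key : ∀ {T : RectCurrent}, T.IsCalibrated g ν →
        (T.mass g).restrict {x ∈ c.O | c.s x = 0} =
        (ofReal |c.D| • ((volume.restrict (ball 0 c.r)).withDensity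
          fun w => (T.theta (c.pt (w, 0)) : ENNReal)).map fun w => c.pt (w, 0)).withDensity
          (fun x => (ofReal (conormal g ν x (ν p)))⁻¹) := fun {T} hT => by
      rw [← hT.withDensity_plaque hg hν c]
      refine (withDensity_inv_same
        (measurable_conormal_apply hg hν measurable_const).ennreal_ofReal
        ?_ (ae_of_all _ fun _ => ofReal_ne_top)).symm
      filter_upwards [ae_restrict_mem c.measurableSet_plaque] with x hx
      exact (ofReal_pos.mpr (c.conormal_pos hg hx.1)).ne'
    have hwd : (volume.restrict (ball 0 c.r)).withDensity
        (fun w => (S.theta (c.pt (w, 0)) : ENNReal)) =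
        (a : ENNReal) • (volume.restrict (ball 0 c.r)).withDensity
        (fun w => (Q.theta (c.pt (w, 0)) : ENNReal)) := by
      rw [← withDensity_smul (μ := volume.restrict (ball 0 c.r)) (a : ENNReal)
        (f := fun w => (Q.theta (c.pt (w, 0)) : ENNReal))
        (Q.measurable_theta.comp c.continuous_pt_zero.measurable)]
      refine withDensity_congr_ae ?_
      filter_upwards [h p c hcφ hp.2 hct] with w hw
      simp [hw]
    rw [Measure.restrict_smul, key hS, key hQ, ← withDensity_smul_measure, smul_comm,
      hwd, Measure.map_smul]
  choose! P hPn hPs hPeq using hloc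
  obtain ⟨D, hD, hDc, hcov⟩ := TopologicalSpace.countable_cover_nhdsWithin hPn
  have hunion : plaqueAt φ t = ⋃ p ∈ D, P p :=
    Subset.antisymm hcov (iUnion₂_subset fun p hp => hPs p (hD hp))
  have : Countable D := hDc.to_subtype
  rw [hunion, biUnion_eq_iUnion, ← Measure.restrict_smul, Measure.restrict_iUnion_congr]
  exact fun p => hPeq p (hD p.2)

/-- Plaques of a box have areas bounded below, locally uniformly. -/
theorem Foliation.exists_le_mass_plaqueAt (hg : IsMetricOn g unitBall) (hν : R.IsUnitNormal g ν)
    (hφ : φ ∈ R.atlas) {t₀ : ℝ} (ht₀ : t₀ ∈ Ioo (-1 : ℝ) 1) :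
    ∃ a > 0, ∀ᶠ t in 𝓝 t₀, ∃ Q : RectCurrent,
      Q.IsOrientedBy g ν ((plaqueAt φ t).indicator fun _ => 1) ∧ a ≤ Q.mass g (plaqueAt φ t) := by
  have hs0 : ((0 : E2), t₀) ∈ φ.source := by
    rw [R.source_eq φ hφ]; exact ⟨mem_ball_self one_pos, ht₀⟩
  have hcd : ∀ j, ContinuousAt (fun q : E2 × ℝ => partialD (fun x => φ (x, q.2)) q.1 j) (0, t₀) := by
    intro j
    have h1 := (R.continuous_derivs φ hφ 1).continuousAt (φ.open_source.mem_nhds hs0)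
    have h2 := ((ContinuousMultilinearMap.apply ℝ (fun _ : Fin 1 => E2) E3
      (fun _ => EuclideanSpace.single j 1)).continuous.continuousAt).comp h1
    refine h2.congr (Eventually.of_forall fun q => ?_)
    simp [partialD, iteratedFDeriv_one_apply]
  have hgc : ContinuousAt (fun q : E2 × ℝ => g (φ q)) (0, t₀) :=
    ((hg.smooth.continuousOn.continuousAt (isOpen_unitBall.mem_nhds (R.map_mem hφ hs0).1)).comp
      (f := φ) (φ.continuousAt hs0))
  have hff : ∀ i j, ContinuousAt
      (fun q : E2 × ℝ => firstForm g (fun x => φ (x, q.2)) q.1 i j) (0, t₀) := fun i j =>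
    (hgc.clm_apply (hcd i)).clm_apply (hcd j)
  have hcont : ContinuousAt (fun q : E2 × ℝ => areaDensity g (fun x => φ (x, q.2)) q.1) (0, t₀) :=
    (((hff 0 0).mul (hff 1 1)).sub ((hff 0 1).pow 2)).sqrt
  set A₀ := areaDensity g (fun x => φ (x, t₀)) 0 with hA₀
  have hpos : 0 < A₀ := by
    have hI := hg.isInner (R.map_mem hφ hs0).1
    refine (abs_pos.mpr (mul_ne_zero hI.gvol_pos.ne' (plaque_frame hν hφ hs0))).trans_le
      (hI.abs_vol_le (hν.unit _ (R.map_mem hφ hs0)) _ _)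
  obtain ⟨ε, hε, hball⟩ := eventually_nhds_iff_ball.mp
    (hcont.eventually (lt_mem_nhds (half_lt_self hpos)))
  set δ := min ε 1
  have hδ : 0 < δ := lt_min hε one_pos
  refine ⟨ofReal (A₀ / 2) * volume (ball (0 : E2) δ), ENNReal.mul_pos
    (ofReal_pos.mpr (by positivity)).ne' (measure_ball_pos _ _ hδ).ne', ?_⟩
  filter_upwards [isOpen_Ioo.mem_nhds ht₀, ball_mem_nhds t₀ hε] with t ht htε
  obtain ⟨F, h1, h2, h3, h4, h5, h6, h7⟩ := Foliation.exists_positive_param hg hν hφ ht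
  have him : ∀ y ∈ ball (0 : E2) 1, F y ∈ plaqueAt φ t := fun y hy =>
    (h4.subset ⟨y, hy, rfl⟩ : _)
  let Q : RectCurrent :=
    { param := fun _ => F
      dom := fun i => if i = 0 then ball 0 1 else ∅
      mult := fun _ => 1
      measurable_dom := fun i => by split_ifs; exacts [measurableSet_ball, MeasurableSet.empty]
      contDiffAt := fun i y hy => by
        split_ifs at hy
        exacts [(h1 y hy).of_le (by norm_cast), hy.elim]
      immersive := fun i y hy => by split_ifs at hy; exacts [h2 y hy, hy.elim]
      injOn := fun i => by split_ifs; exacts [h3, injOn_empty _]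
      disjoint := fun i j hij => by
        split_ifs with hi hj
        · exact absurd (hi.trans hj.symm) hij
        all_goals simp }
  have hdom : ∀ i, ∀ y ∈ Q.dom i, y ∈ ball (0 : E2) 1 := fun i y hy => by
    simp only [Q] at hy; split_ifs at hy; exacts [hy, hy.elim]
  refine ⟨Q, ⟨?_, fun i y hy => ?_, fun i y hy => h5 y (hdom i y hy), fun i y hy => ?_⟩, ?_⟩
  · ext x
    simp only [RectCurrent.carrier, mem_iUnion, mem_ofPred_eq, ne_eq, indicator_apply_eq_zero,
      one_ne_zero, imp_false, not_not]
    constructor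
    · rintro ⟨i, y, hy, rfl⟩; exact him y (hdom i y hy)
    · intro hx; exact ⟨0, (h4.superset hx : _)⟩
  · simp [Q, indicator_of_mem (him y (hdom i y hy))]
  · rw [det3_eq_basis_det]; exact h6 y (hdom i y hy)
  · rw [Q.mass_eq_area hg measurableSet_plaqueAt fun x hx => (R.target_subset hφ hx.1).1]
    refine le_trans ?_ (ENNReal.le_tsum 0)
    simp only [Q, if_true, Int.natAbs_one, Nat.cast_one, one_mul]
    rw [← setLIntegral_const]
    refine (setLIntegral_mono' measurableSet_ball fun y hy => ?_).trans (lintegral_mono_set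
      fun y hy => ⟨ball_subset_ball (min_le_right _ _) hy,
        him y (ball_subset_ball (min_le_right _ _) hy)⟩)
    obtain ⟨z, hz, hzA⟩ := h7 y (ball_subset_ball (min_le_right _ _) hy)
    rw [hzA]
    refine ofReal_le_ofReal (hball (z, t) ?_).le
    rw [mem_ball, Prod.dist_eq, dist_zero_right, hz]
    exact max_lt ((mem_ball_zero_iff.mp hy).trans_le (min_le_left _ _)) htε

namespace IsMultiplicity
variable {m : E3 → ℕ}

theorem eq_of_mem_plaqueAt (hm : IsMultiplicity R S g ν m) (hφ : φ ∈ R.atlas) {x x' : E3}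
    (h : x ∈ plaqueAt φ t) (h' : x' ∈ plaqueAt φ t) : m x = m x' :=
  hm.plaque φ hφ x h.1 x' h'.1 (h.2.trans h'.2.symm)

theorem mass_pos (hm : IsMultiplicity R S g ν m) (hS : IsStationary S g ν)
    (hg : IsMetricOn g unitBall) (hν : R.IsUnitNormal g ν) {p : E3} (hp : m p ≠ 0) {N : Set E3}
    (hN : N ∈ 𝓝 p) (hφ : φ ∈ R.atlas) (hpφ : p ∈ φ.target) :
    0 < S.mass g (N ∩ plaqueAt φ (φ.symm p).2) := by
  obtain ⟨c, rfl, hct, hcN⟩ := LeafChart.exists_tame hg hν hφ hpφ hN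
  exact (c.mass_plaque_pos hS.calibrated hg hν hp (hm.theta_eq p c hct) c.isOpen_O Subset.rfl
    c.mem_O_self c.s_self).trans_le (measure_mono fun x hx => ⟨hcN hx.1, c.plaque_subset hx⟩)

/-- Distinct plaques of a box are disjoint, and those of positive multiplicity have positive mass
for a finite measure. -/
theorem countable_plaques (hm : IsMultiplicity R S g ν m) (hS : IsStationary S g ν)
    (hg : IsMetricOn g unitBall) (hν : R.IsUnitNormal g ν) (hφ : φ ∈ R.atlas) :
    {t ∈ Ioo (-1 : ℝ) 1 | m (φ (0, t)) ≠ 0}.Countable := by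
  have : IsFiniteMeasure (S.mass g) := ⟨hS.finite⟩
  refine (Measure.countable_meas_pos_of_disjoint_iUnion (μ := S.mass g)
    (fun _ => measurableSet_plaqueAt) (pairwise_disjoint_plaqueAt (φ := φ))).mono
    fun t ht => ?_
  have hs : ((0 : E2), t) ∈ φ.source := by
    rw [R.source_eq φ hφ]; exact ⟨mem_ball_self one_pos, ht.1⟩
  have := hm.mass_pos hS hg hν ht.2 univ_mem hφ (φ.map_source hs)
  rwa [φ.left_inv hs, univ_inter] at this

/-- The leaves of positive multiplicity form a relatively closed set. -/
theorem closure_inter_subset (hm : IsMultiplicity R S g ν m) (hS : IsStationary S g ν)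
    (hg : IsMetricOn g unitBall) (hν : R.IsUnitNormal g ν) :
    closure {x | m x ≠ 0} ∩ (unitBall \ zAxis) ⊆ {x | m x ≠ 0} := by
  rintro p ⟨hp, hpΩ⟩ h0
  obtain ⟨φ, hφ, hpφ⟩ := R.exists_box hpΩ
  have : IsFiniteMeasure (S.mass g) := ⟨hS.finite⟩
  have hp1 := φ.map_target hpφ
  rw [R.source_eq φ hφ] at hp1
  obtain ⟨a, ha, hev⟩ := Foliation.exists_le_mass_plaqueAt hg hν hφ hp1.2
  -- Only finitely many plaques of the box can have mass at least `a`. So near the height of `p`,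
  -- the only such plaque possible is the one through `p`.
  have hfin := Measure.finite_const_le_meas_of_disjoint_iUnion (S.mass g) ha
    (fun _ => measurableSet_plaqueAt) (pairwise_disjoint_plaqueAt (φ := φ)) (measure_ne_top _ _)
  set t₀ := (φ.symm p).2
  have hev2 : ∀ᶠ t in 𝓝 t₀, t ∉ {t | a ≤ S.mass g (plaqueAt φ t)} \ {t₀} :=
    ((hfin.subset sdiff_subset).isClosed).isOpen_compl.mem_nhds fun h => h.2 rfl
  have hct : ContinuousAt (fun x => (φ.symm x).2) p :=
    (continuousOn_height φ).continuousAt (φ.open_target.mem_nhds hpφ)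
  obtain ⟨x, ⟨⟨⟨Q, hQ, hQa⟩, hx2⟩, hxφ⟩, hx0⟩ := mem_closure_iff_nhds.mp hp _
    (inter_mem (hct.eventually (hev.and hev2)) (φ.open_target.mem_nhds hpφ))
  set t := (φ.symm x).2
  -- The mass of `S` on the plaque through `x` is `m x` times its area, hence at least `a`, because
  -- the integer `m x` is not zero. That plaque must be the one through `p`.
  have hcompare := mass_restrict_plaqueAt hS.calibrated (hQ.isCalibrated hg hν.unit) hg hν hφ
    (a := m x) (t := t) fun q c hcφ hqt hcT => by
      filter_upwards [hm.theta_eq q c hcT, ae_restrict_mem measurableSet_ball] with w hw hwb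
      have hmem := c.pt_mem_plaqueAt hwb
      rw [hcφ, hqt] at hmem
      rw [hw, hQ.theta_eq, indicator_of_mem hmem, mul_one]
      refine hm.eq_of_mem_plaqueAt hφ (t := t) ⟨?_, hqt⟩ ⟨hxφ, rfl⟩
      rw [← hcφ]; exact c.O_subset_target c.mem_O_self
  have hle : a ≤ S.mass g (plaqueAt φ t) := by
    have := congrArg (fun μ : Measure E3 => μ univ) hcompare
    simp only [Measure.restrict_apply_univ, Measure.smul_apply, smul_eq_mul] at this
    rw [this]
    exact hQa.trans (le_mul_of_one_le_left' (by exact_mod_cast Nat.one_le_iff_ne_zero.mpr hx0))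
  refine hx0 ((hm.plaque φ hφ x hxφ p hpφ ?_).trans h0)
  by_contra hne
  exact hx2 ⟨hle, hne⟩

/-- The current formed by the leaves with their multiplicities. -/
theorem exists_equalOn (hm : IsMultiplicity R S g ν m) (hS : IsStationary S g ν)
    (hg : IsMetricOn g unitBall) (hν : R.IsUnitNormal g ν) :
    ∃ T : RectCurrent, T.IsLocallyFiniteIn g unitBall ∧ T.IsOrientedBy g ν m ∧
      S.EqualOn T unitBall := by
  obtain ⟨T, hT⟩ := Foliation.exists_isOrientedBy hg hν hm.offAxis hm.plaque
    fun φ hφ => hm.countable_plaques hS hg hν hφ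
  have hTc := hT.isCalibrated hg hν.unit
  obtain ⟨𝓐, h𝓐, h𝓐c, hcov⟩ := R.exists_countable_boxes
  set I : Set (OpenPartialHomeomorph (E2 × ℝ) E3 × ℝ) :=
    ⋃ φ ∈ 𝓐, Prod.mk φ '' {t ∈ Ioo (-1 : ℝ) 1 | m (φ (0, t)) ≠ 0} with hI
  have hIc : I.Countable := h𝓐c.biUnion fun φ hφ =>
    (hm.countable_plaques hS hg hν (h𝓐 hφ)).image _
  have : Countable I := hIc.to_subtype
  have hunion : {x | m x ≠ 0} ⊆ ⋃ i : I, plaqueAt i.1.1 i.1.2 := fun x hx => by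
    obtain ⟨φ, hφ, hxφ⟩ := hcov x (hm.offAxis x hx)
    have h1 := φ.map_target hxφ
    rw [R.source_eq φ (h𝓐 hφ)] at h1
    have hs : ((0 : E2), (φ.symm x).2) ∈ φ.source := by
      rw [R.source_eq φ (h𝓐 hφ)]; exact ⟨mem_ball_self one_pos, h1.2⟩
    refine mem_iUnion.mpr ⟨⟨(φ, (φ.symm x).2), mem_biUnion hφ ⟨_, ⟨h1.2, ?_⟩, rfl⟩⟩, hxφ, rfl⟩
    rwa [hm.plaque φ (h𝓐 hφ) _ (φ.map_source hs) x hxφ (by rw [φ.left_inv hs])]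
  -- Both measures are carried by countably many plaques, on each of which they agree by
  -- `mass_restrict_plaqueAt`. For calibrated currents equal area measures give equal currents.
  have hmass : S.mass g = T.mass g := by
    have hSr : ∀ᵐ x ∂S.mass g, x ∈ ⋃ i : I, plaqueAt i.1.1 i.1.2 :=
      (RectCurrent.ae_mass (P := fun x => x ∈ {x | m x ≠ 0})
        (by rw [← hT.carrier_eq]; exact T.measurableSet_carrier) (hm.ae_ne_zero hS hg hν) hg).mono
        fun x hx => hunion hx
    have hTr : ∀ᵐ x ∂T.mass g, x ∈ ⋃ i : I, plaqueAt i.1.1 i.1.2 :=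
      (RectCurrent.ae_mass_mem_carrier hg).mono fun x hx => hunion (hT.carrier_eq.subset hx)
    rw [← Measure.restrict_eq_self_of_ae_mem hSr, ← Measure.restrict_eq_self_of_ae_mem hTr,
      Measure.restrict_iUnion_congr]
    rintro ⟨⟨φ, t⟩, hi⟩
    obtain ⟨φ, hφ, t, -, h⟩ := mem_iUnion₂.mp hi
    obtain ⟨rfl, rfl⟩ := Prod.mk.inj h
    have := mass_restrict_plaqueAt (t := t) hS.calibrated hTc hg hν (h𝓐 hφ) (a := 1)
      fun q c hcφ hqt hcT => by
        filter_upwards [hm.theta_eq q c hcT, ae_restrict_mem measurableSet_ball] with w hw hwb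
        rw [hw, hT.theta_eq, one_mul]
        exact hm.eq_of_mem_plaqueAt c.φ_mem ⟨c.O_subset_target c.mem_O_self, rfl⟩
          (c.pt_mem_plaqueAt hwb)
    rwa [Nat.cast_one, one_smul] at this
  have hfin : ∀ (T' : RectCurrent), T'.mass g = S.mass g → ∀ K, IsCompact K → K ⊆ unitBall →
      T'.area g K < ⊤ := fun T' h K hK hKB => by
    rw [← T'.mass_eq_area hg hK.measurableSet hKB, h]
    exact (measure_mono (subset_univ _)).trans_lt hS.finite
  refine ⟨T, ⟨fun x hx => (hm.offAxis x (hT.carrier_eq.subset hx)).1, hfin T hmass.symm⟩, hT,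
    fun β hβ => ?_⟩
  rw [hS.calibrated.eval_eq hg hν hβ.smooth.continuous hβ.compact hβ.support
    (hfin S rfl _ hβ.compact.isCompact hβ.support), hTc.eval_eq hg hν hβ.smooth.continuous
    hβ.compact hβ.support (hfin T hmass.symm _ hβ.compact.isCompact hβ.support), hmass]

end IsMultiplicity

/-! ### Leaves meet flow boxes in countably many plaques -/

variable {φ : OpenPartialHomeomorph (E2 × ℝ) E3} {t : ℝ} {p : E3}

instance : Std.Symm R.SamePlaque :=
  ⟨fun _ _ ⟨φ, hφ, h1, h2, h3⟩ => ⟨φ, hφ, h2, h1, h3.symm⟩⟩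

theorem Foliation.leaf_eq {q : E3} (h : q ∈ R.leaf p) : R.leaf q = R.leaf p :=
  ext fun _ => ⟨fun h' => h.trans h', fun h' => (Std.Symm.symm _ _ h).trans h'⟩

/-- The set meets every flow box in countably many plaques. -/
def Thin (R : Foliation (unitBall \ zAxis)) (Y : Set E3) : Prop :=
  ∀ ψ ∈ R.atlas, ((fun x => (ψ.symm x).2) '' (Y ∩ ψ.target)).Countable

theorem Thin.iUnion {ι : Type*} [Countable ι] {Y : ι → Set E3} (h : ∀ i, Thin R (Y i)) :
    Thin R (⋃ i, Y i) := fun ψ hψ => by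
  rw [iUnion_inter, image_iUnion]
  exact countable_iUnion fun i => h i ψ hψ

/-- By compatibility the height in the second box is locally constant along the plaque of the first,
and countably many of the neighbourhoods cover. -/
theorem thin_plaqueAt (hφ : φ ∈ R.atlas) : Thin R (plaqueAt φ t) := fun ψ hψ => by
  have hloc : ∀ p ∈ plaqueAt φ t ∩ ψ.target, {x | (ψ.symm x).2 = (ψ.symm p).2} ∈
      𝓝[plaqueAt φ t ∩ ψ.target] p := fun p hp => by
    obtain ⟨N, hN, h⟩ := R.compatible φ hφ ψ hψ p ⟨hp.1.1, hp.2⟩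
    filter_upwards [mem_nhdsWithin_of_mem_nhds hN, self_mem_nhdsWithin] with x hx hx'
    exact (h x hx p (mem_of_mem_nhds hN)).mp (hx'.1.2.trans hp.1.2.symm)
  obtain ⟨D, -, hDc, hcov⟩ := TopologicalSpace.countable_cover_nhdsWithin hloc
  refine (hDc.image fun x => (ψ.symm x).2).mono ?_
  rintro _ ⟨x, hx, rfl⟩
  obtain ⟨q, hq, hxq⟩ := mem_iUnion₂.mp (hcov hx)
  exact ⟨q, hq, hxq.symm⟩

/-- A set that is saturated for a subatlas is a union of leaves. -/
theorem Foliation.leaf_subset {𝓐 : Set (OpenPartialHomeomorph (E2 × ℝ) E3)} (h𝓐 : 𝓐 ⊆ R.atlas)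
    (hcov : ∀ x ∈ unitBall \ zAxis, ∃ φ ∈ 𝓐, x ∈ φ.target) {Y : Set E3}
    (hY : ∀ φ ∈ 𝓐, ∀ x ∈ φ.target, ∀ x' ∈ φ.target, (φ.symm x).2 = (φ.symm x').2 →
      x ∈ Y → x' ∈ Y) (hp : p ∈ Y) : R.leaf p ⊆ Y := by
  intro q hq
  induction hq with
  | refl => exact hp
  | @tail x x' _ hxx' ih =>
    obtain ⟨ψ, hψ, hx, hx', ht⟩ := hxx'
    have hb : ∀ z ∈ ψ.target, (ψ.symm z).1 ∈ ball (0 : E2) 1 ∧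
        (ψ.symm z).2 ∈ Ioo (-1 : ℝ) 1 := fun z hz => by
      have := ψ.map_target hz
      rwa [R.source_eq ψ hψ] at this
    set t := (ψ.symm x).2 with htx
    have hs : ∀ w ∈ ball (0 : E2) 1, (w, t) ∈ ψ.source := fun w hw => by
      rw [R.source_eq ψ hψ]; exact ⟨hw, (hb x hx).2⟩
    have key := (convex_ball (0 : E2) 1).isPreconnected.induction₂
      (fun w w' => ψ (w, t) ∈ Y ↔ ψ (w', t) ∈ Y) (fun w hw => ?_)
      (fun _ _ _ _ _ _ h1 h2 => h1.trans h2) (fun _ _ _ _ h => h.symm) (hb x hx).1 (hb x' hx').1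
    · have e1 : ψ ((ψ.symm x).1, t) = x := ψ.right_inv hx
      have e2 : ψ ((ψ.symm x').1, t) = x' := by rw [ht]; exact ψ.right_inv hx'
      rw [e1, e2] at key
      exact key.mp ih
    · have hwt := ψ.map_source (hs w hw)
      obtain ⟨φ, hφ, hwφ⟩ := hcov _ (R.target_subset hψ hwt)
      obtain ⟨N, hN, h⟩ := R.compatible ψ hψ φ (h𝓐 hφ) _ ⟨hwt, hwφ⟩
      have hcont : ContinuousAt (fun w : E2 => ψ (w, t)) w :=
        (ψ.continuousAt (hs w hw)).comp (f := fun w : E2 => (w, t)) (by fun_prop)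
      filter_upwards [mem_nhdsWithin_of_mem_nhds (hcont.eventually hN), self_mem_nhdsWithin,
        mem_nhdsWithin_of_mem_nhds (hcont.eventually (φ.open_target.mem_nhds hwφ))] with w' h1 h2 h3
      have := (h _ (mem_of_mem_nhds hN) _ h1).mp (by rw [ψ.left_inv (hs w hw), ψ.left_inv (hs w' h2)])
      exact ⟨hY φ hφ _ hwφ _ h3 this, hY φ hφ _ h3 _ hwφ this.symm⟩

/-- Starting from a point, all plaques of a countable subatlas that meet the set are added
repeatedly. Each step keeps the set thin, and the union of the steps is saturated for the subatlas,
hence contains the leaf. -/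
theorem thin_leaf (R : Foliation (unitBall \ zAxis)) (p : E3) : Thin R (R.leaf p) := by
  obtain ⟨𝓐, h𝓐, h𝓐c, hcov⟩ := R.exists_countable_boxes
  have : Countable 𝓐 := h𝓐c.to_subtype
  let step : Set E3 → Set E3 := fun Y => ⋃ φ : 𝓐,
    ⋃ t : (fun x => (φ.1.symm x).2) '' (Y ∩ φ.1.target), plaqueAt φ.1 t
  have hstep : ∀ n, Thin R (step^[n] {p}) := fun n => by
    induction n with
    | zero => exact fun ψ _ => ((countable_singleton p).mono inter_subset_left).image _
    | succ n ih =>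
      rw [Function.iterate_succ_apply']
      refine Thin.iUnion fun φ => ?_
      have := (ih φ.1 (h𝓐 φ.2)).to_subtype
      exact Thin.iUnion fun t => thin_plaqueAt (h𝓐 φ.2)
  refine fun ψ hψ => (Thin.iUnion hstep ψ hψ).mono (image_mono (inter_subset_inter_left _
    (R.leaf_subset h𝓐 hcov (fun φ hφ x hx x' hx' h hxY => ?_) (mem_iUnion.mpr ⟨0, rfl⟩))))
  obtain ⟨n, hn⟩ := mem_iUnion.mp hxY
  refine mem_iUnion.mpr ⟨n + 1, ?_⟩
  rw [Function.iterate_succ_apply']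
  exact mem_iUnion.mpr ⟨⟨φ, hφ⟩, mem_iUnion.mpr ⟨⟨_, x, ⟨hn, hx⟩, rfl⟩, hx', h.symm⟩⟩

namespace LeafChart
variable (c : LeafChart R g ν p)

theorem hasFDerivAt_s (x : E3) : HasFDerivAt c.s
    (((ContinuousLinearMap.snd ℝ E2 ℝ) - (fderiv ℝ c.f (c.y x)).comp
      (ContinuousLinearMap.fst ℝ E2 ℝ)).comp (c.Λ : E3 →L[ℝ] E2 × ℝ)) x := by
  have h1 : HasFDerivAt (fun x => c.Λ (x - p)) (c.Λ : E3 →L[ℝ] E2 × ℝ) x :=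
    c.Λ.hasFDerivAt.comp x ((hasFDerivAt_id x).sub_const p)
  exact h1.snd.sub ((c.smooth_f.differentiable (by simp) (c.y x)).hasFDerivAt.comp x h1.fst)

end LeafChart

/-- A curve in a leaf is tangent to it. -/
theorem inner_normal_eq_zero_of_leaf (hg : IsMetricOn g unitBall) (hν : R.IsUnitNormal g ν)
    (hp : p ∈ unitBall \ zAxis) {γ : ℝ → E3} {v : E3} (h0 : γ 0 = p) (hγ : Continuous γ)
    (hd : HasDerivAt γ v 0) (hleaf : ∀ᶠ σ in 𝓝 0, γ σ ∈ R.leaf p) : g p (ν p) v = 0 := by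
  obtain ⟨φ, hφ, hpφ⟩ := R.exists_box hp
  obtain ⟨c, hc⟩ := exists_leafChart hg hν hφ hpφ
  obtain ⟨δ, hδ, hball⟩ := eventually_nhds_iff_ball.mp
    (hleaf.and (hγ.continuousAt.eventually (by rw [h0]; exact c.O_mem_nhds)))
  have hcont : ContinuousOn (fun σ => (c.φ.symm (γ σ)).2) (ball 0 δ) :=
    c.continuousOn_t.comp hγ.continuousOn fun σ hσ => (hball σ hσ).2
  have hpre := (convex_ball (0 : ℝ) δ).isPreconnected.image _ hcont
  have hcount : ((fun σ => (c.φ.symm (γ σ)).2) '' ball 0 δ).Countable := by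
    refine (thin_leaf R p c.φ c.φ_mem).mono ?_
    rintro _ ⟨σ, hσ, rfl⟩
    exact ⟨γ σ, ⟨(hball σ hσ).1, c.O_subset_target (hball σ hσ).2⟩, rfl⟩
  -- The curve takes only countably many heights in the box, and they form a connected set. So its
  -- height is constant and it remains in the plaque of `p`, rather than in some other plaque of the
  -- same leaf.
  have hsub := hcount.isTotallyDisconnected _ Subset.rfl hpre
  have hz : (fun σ => c.s (γ σ)) =ᶠ[𝓝 0] fun _ => 0 := by
    filter_upwards [ball_mem_nhds 0 hδ] with σ hσ
    refine (c.plaque (hball σ hσ).2).mp ?_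
    have := hsub ⟨σ, hσ, rfl⟩ ⟨0, mem_ball_self hδ, rfl⟩
    simpa only [h0] using this
  have h1 := (c.hasFDerivAt_s (γ 0)).comp_hasDerivAt (0 : ℝ) hd
  have h2 := h1.unique ((hasDerivAt_const (0 : ℝ) (0 : ℝ)).congr_of_eventuallyEq hz)
  have h3 := c.conormal_eq c.mem_O_self c.s_self v
  rw [h0] at h2
  have h4 : conormal g ν p v = 0 := by
    rw [h3]; refine mul_eq_zero_of_left ?_ _; simpa using h2
  rw [conormal_apply hp] at h4
  exact (mul_eq_zero.mp h4).resolve_left (inv_pos.mpr (hg.isInner hp.1).gvol_pos).ne'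

/-- A curve that is tangent to the foliation stays in a leaf. -/
theorem eventually_mem_leaf (hg : IsMetricOn g unitBall) (hν : R.IsUnitNormal g ν)
    (hp : p ∈ unitBall \ zAxis) {γ γ' : ℝ → E3} {B : ℝ} (h0 : γ 0 = p)
    (hd : ∀ σ, HasDerivAt γ (γ' σ) σ) (hB : ∀ σ, ‖γ' σ‖ ≤ B)
    (ht : ∀ σ, g (γ σ) (ν (γ σ)) (γ' σ) = 0) : ∀ᶠ σ in 𝓝[≥] 0, γ σ ∈ R.leaf p := by
  obtain ⟨φ, hφ, hpφ⟩ := R.exists_box hp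
  obtain ⟨c, hc⟩ := exists_leafChart hg hν hφ hpφ
  have hγ : Continuous γ := continuous_iff_continuousAt.mpr fun σ => (hd σ).continuousAt
  obtain ⟨δ, hδ, hball⟩ := eventually_nhds_iff_ball.mp
    (hγ.continuousAt.eventually (by rw [h0]; exact c.O_mem_nhds))
  have hB0 : 0 ≤ B := (norm_nonneg _).trans (hB 0)
  set K := 2 * (c.C * (‖(c.Λ : E3 →L[ℝ] E2 × ℝ)‖ * B)) with hK
  have hsd := fun σ => (c.hasFDerivAt_s (γ σ)).comp_hasDerivAt σ (hd σ)
  -- A velocity tangent to the foliation changes the height over the plaque at a rate at most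
  -- proportional to the height. Grönwall's inequality with zero initial height then keeps the curve
  -- in the plaque, for times to the right of zero.
  have hbound : ∀ σ ∈ ball (0 : ℝ) δ, ‖(c.Λ (γ' σ)).2 -
      fderiv ℝ c.f (c.y (γ σ)) (c.Λ (γ' σ)).1‖ ≤ K * ‖c.s (γ σ)‖ + 0 := fun σ hσ => by
    have hO := hball σ hσ
    set v := (c.Λ (γ' σ)).1
    set a := (c.Λ (γ' σ)).2 - fderiv ℝ c.f (c.y (γ σ)) v with ha
    have hdec : γ' σ = c.Λ.symm (v, fderiv ℝ c.f (c.y (γ σ)) v) + a • ν p := by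
      rw [c.symm_eq v (fderiv ℝ c.f (c.y (γ σ)) v), add_assoc, ← add_smul, ha, add_sub_cancel,
        ← c.symm_eq]
      exact (c.Λ.symm_apply_apply _).symm
    have h1 := ht σ
    rw [hdec, map_add, map_smul, smul_eq_mul] at h1
    have h2 := c.slope hO v
    have h3 := c.half_le hO
    have h4 : ‖v‖ ≤ ‖(c.Λ : E3 →L[ℝ] E2 × ℝ)‖ * B := (norm_fst_le _).trans
      (((c.Λ : E3 →L[ℝ] E2 × ℝ).le_opNorm _).trans (by gcongr; exact hB σ))
    have h5 : |a| * (1 / 2) ≤ c.C * ‖v‖ * |c.s (γ σ)| := by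
      refine le_trans ?_ h2
      rw [eq_neg_of_add_eq_zero_left h1, abs_neg, abs_mul]
      gcongr
      exact h3.trans (le_abs_self _)
    have h6 : c.C * ‖v‖ * |c.s (γ σ)| ≤ c.C * (‖(c.Λ : E3 →L[ℝ] E2 × ℝ)‖ * B) * |c.s (γ σ)| := by
      have := c.C_nonneg
      gcongr
    rw [Real.norm_eq_abs, Real.norm_eq_abs, hK]
    linarith
  filter_upwards [Ico_mem_nhdsGE hδ] with σ hσ
  have hin : ∀ τ ∈ Icc 0 σ, τ ∈ ball (0 : ℝ) δ := fun τ hτ => by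
    rw [mem_ball_zero_iff, Real.norm_eq_abs, abs_of_nonneg hτ.1]; exact hτ.2.trans_lt hσ.2
  have := norm_le_gronwallBound_of_norm_deriv_right_le (δ := 0) (K := K) (ε := 0)
    (f := fun τ => c.s (γ τ)) (a := 0) (b := σ)
    (c.contDiff_s.continuous.comp hγ).continuousOn (fun τ _ => (hsd τ).hasDerivWithinAt)
    (by simp [h0, c.s_self]) (fun τ hτ => by
      simpa using hbound τ (hin τ (Ico_subset_Icc_self hτ))) σ (right_mem_Icc.mpr hσ.1)
  rw [gronwallBound_ε0_δ0, norm_le_zero_iff] at this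
  have hO := hball σ (hin σ (right_mem_Icc.mpr hσ.1))
  exact .single ⟨c.φ, c.φ_mem, c.O_subset_target c.mem_O_self, c.O_subset_target hO,
    ((c.plaque hO).mpr this).symm⟩

/-! ### Rotations -/

/-- The infinitesimal rotation. -/
def ang (x : E3) : E3 := !₂[-x 1, x 0, 0]

theorem rot_add_smul (α a : ℝ) (x y : E3) : rot α (x + a • y) = rot α x + a • rot α y := by
  ext i; fin_cases i <;> simp [rot] <;> ring

theorem rot_rot (α β : ℝ) (x : E3) : rot α (rot β x) = rot (α + β) x := by
  ext i; fin_cases i <;> simp [rot, Real.cos_add, Real.sin_add] <;> ring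

theorem rot_zero (x : E3) : rot 0 x = x := by
  ext i; fin_cases i <;> simp [rot]

theorem rot_ang (α : ℝ) (x : E3) : rot α (ang x) = ang (rot α x) := by
  ext i; fin_cases i <;> simp [rot, ang] <;> ring

theorem rsq_rot (α : ℝ) (x : E3) : rsq (rot α x) = rsq x := by
  simp only [rsq, rot]
  simp
  linear_combination (x 0 ^ 2 + x 1 ^ 2) * Real.sin_sq_add_cos_sq α

theorem norm_sq_eq_rsq (x : E3) : ‖x‖ ^ 2 = rsq x + x 2 ^ 2 := by
  simp [EuclideanSpace.norm_sq_eq, Fin.sum_univ_three, rsq]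

theorem mem_unitBall_iff {x : E3} : x ∈ unitBall ↔ rsq x + x 2 ^ 2 < 1 := by
  rw [unitBall, mem_ball_zero_iff, ← norm_sq_eq_rsq, sq_lt_one_iff₀ (norm_nonneg x)]

theorem mem_offAxis_iff {x : E3} : x ∈ unitBall \ zAxis ↔ rsq x + x 2 ^ 2 < 1 ∧ 0 < rsq x := by
  rw [Set.mem_sdiff, mem_unitBall_iff, ← rsq_eq_zero_iff, (rsq_nonneg x).lt_iff_ne', Ne]

theorem rot_mem_offAxis (α : ℝ) (hp : p ∈ unitBall \ zAxis) : rot α p ∈ unitBall \ zAxis := by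
  rw [mem_offAxis_iff, rsq_rot]; exact mem_offAxis_iff.mp hp

theorem hasDerivAt_rot (x : E3) (σ : ℝ) : HasDerivAt (fun σ => rot σ x) (ang (rot σ x)) σ := by
  have e : (fun σ => rot σ x) = fun σ => Real.cos σ • (!₂[x 0, x 1, 0] : E3) + Real.sin σ • ang x +
      (!₂[0, 0, x 2] : E3) := by
    ext σ i; fin_cases i <;> simp [rot, ang] <;> ring
  rw [e]
  refine ((((Real.hasDerivAt_cos σ).smul_const _).add
    ((Real.hasDerivAt_sin σ).smul_const _)).add_const _).congr_deriv ?_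
  ext i; fin_cases i <;> simp [rot, ang] <;> ring

theorem continuous_rot_apply (x : E3) : Continuous fun σ => rot σ x :=
  continuous_iff_continuousAt.mpr fun σ => (hasDerivAt_rot x σ).continuousAt

/-- The rotation as a linear map. -/
def rotL (α : ℝ) : E3 →L[ℝ] E3 := LinearMap.toContinuousLinearMap
  { toFun := rot α
    map_add' := fun x y => by simpa using rot_add_smul α 1 x y
    map_smul' := fun a x => by
      have h0 : rot α 0 = 0 := by ext i; fin_cases i <;> simp [rot]
      simpa [h0] using rot_add_smul α a 0 x }

/-- The conormal is invariant under rotations. -/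
theorem inner_normal_rot (hg : IsMetricOn g unitBall) (hgrot : IsRotInvariantMetric g unitBall)
    (hν : R.IsUnitNormal g ν) (hrot : R.IsRotInvariant) (hp : p ∈ unitBall \ zAxis) (α : ℝ)
    (v : E3) : g (rot α p) (ν (rot α p)) (rot α v) = g p (ν p) v := by
  -- A tangent vector at `p` is the velocity of a curve in the plaque. Its rotated image lies in a
  -- leaf, so it is tangent there; hence rotations preserve the kernel of the conormal.
  have hker : ∀ α v, g p (ν p) v = 0 → g (rot α p) (ν (rot α p)) (rot α v) = 0 := by
    intro α v hv
    obtain ⟨φ, hφ, hpφ⟩ := R.exists_box hp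
    obtain ⟨c, -⟩ := exists_leafChart hg hν hφ hpφ
    set w := (c.Λ v).1
    have h1 : (c.Λ v).2 = fderiv ℝ c.f 0 w := by
      have h2 := c.conormal_eq c.mem_O_self c.s_self v
      rw [conormal_apply hp, hv, mul_zero, c.y_self] at h2
      exact sub_eq_zero.mp ((mul_eq_zero.mp h2.symm).resolve_right
        (c.conormal_pos hg c.mem_O_self).ne')
    have hd0 : HasDerivAt (fun σ : ℝ => c.pt (σ • w, 0)) v 0 := by
      have h3 : HasDerivAt (fun σ : ℝ => (σ • w, (0 : ℝ))) (w, 0) 0 :=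
        (by simpa using (hasDerivAt_id (0 : ℝ)).smul_const w : HasDerivAt (fun σ : ℝ => σ • w) w 0).prodMk
          (hasDerivAt_const _ _)
      refine (HasFDerivAt.comp_hasDerivAt (f := fun σ : ℝ => (σ • w, (0 : ℝ))) (0 : ℝ)
        (c.hasFDerivAt_pt ((0 : ℝ) • w, 0)) h3).congr_deriv ?_
      simp only [zero_smul, ContinuousLinearMap.comp_apply, ContinuousLinearMap.prod_apply,
        ContinuousLinearMap.coe_fst', add_apply, ContinuousLinearMap.coe_snd', zero_add, ← h1]
      exact c.Λ.symm_apply_apply v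
    have hc0 : Continuous fun σ : ℝ => c.pt (σ • w, 0) :=
      c.continuous_pt_zero.comp (continuous_id.smul continuous_const)
    have hp0 : c.pt ((0 : ℝ) • w, 0) = p := by rw [zero_smul, c.pt_zero, zero_smul, add_zero]
    refine inner_normal_eq_zero_of_leaf hg hν (rot_mem_offAxis α hp)
      (γ := fun σ => rot α (c.pt (σ • w, 0))) (by simp only [hp0])
      ((rotL α).continuous.comp hc0) ((rotL α).hasFDerivAt.comp_hasDerivAt (0 : ℝ) hd0) ?_
    have hev : ∀ᶠ σ : ℝ in 𝓝 0, c.pt (σ • w, 0) ∈ c.O :=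
      hc0.continuousAt.eventually (by simp only [hp0]; exact c.O_mem_nhds)
    filter_upwards [hev] with σ hσ
    rw [hrot α p hp]
    exact ⟨_, .single ⟨c.φ, c.φ_mem, c.O_subset_target c.mem_O_self, c.O_subset_target hσ,
      ((c.plaque hσ).mpr (c.s_pt _)).symm⟩, rfl⟩
  set l : ℝ → ℝ := fun α => g (rot α p) (ν (rot α p)) (rot α (ν p)) with hl
  have hunit := hν.unit p hp
  have hmul : ∀ α v, g (rot α p) (ν (rot α p)) (rot α v) = g p (ν p) v * l α := by
    intro α v
    have h1 := hker α (v + (-g p (ν p) v) • ν p) (by rw [map_add, map_smul, hunit]; simp)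
    rw [rot_add_smul, map_add, map_smul, smul_eq_mul] at h1
    linarith
  -- Rotations are isometries and `ν` has unit length, so the proportionality factor is a sign. It
  -- is continuous in the angle and equal to one at angle zero.
  have hsq : ∀ α, l α ^ 2 = 1 := by
    intro α
    set w := rot (-α) (ν (rot α p))
    have hw : rot α w = ν (rot α p) := by rw [rot_rot, add_neg_cancel, rot_zero]
    have h1 := hmul α w
    rw [hw, hν.unit _ (rot_mem_offAxis α hp), hg.symm p hp.1, ← hgrot α p hp.1, hw] at h1
    rw [sq]; exact h1.symm
  have hcr := continuous_rot_apply p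
  have hcont : Continuous l := by
    have h1 : Continuous fun α => g (rot α p) := hg.smooth.continuousOn.comp_continuous hcr
      fun α => (rot_mem_offAxis α hp).1
    have h2 : Continuous fun α => ν (rot α p) := hν.lipschitz.continuousOn.comp_continuous hcr
      fun α => rot_mem_offAxis α hp
    exact (h1.clm_apply h2).clm_apply (continuous_rot_apply _)
  have hone : l α = 1 := by
    rcases isPreconnected_univ.eq_one_or_eq_neg_one_of_sq_eq hcont.continuousOn
      fun α _ => hsq α with h | h
    · exact h (mem_univ α)
    · have h0 := h (mem_univ 0)
      simp only [hl, rot_zero, hunit, Pi.neg_apply, Pi.one_apply] at h0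
      norm_num at h0
  rw [hmul, hone, mul_one]

theorem inner_ang_rot (hg : IsMetricOn g unitBall) (hgrot : IsRotInvariantMetric g unitBall)
    (hν : R.IsUnitNormal g ν) (hrot : R.IsRotInvariant) (hp : p ∈ unitBall \ zAxis) (α : ℝ) :
    g (rot α p) (ν (rot α p)) (ang (rot α p)) = g p (ν p) (ang p) := by
  rw [← rot_ang, inner_normal_rot hg hgrot hν hrot hp]

/-- A rotationally invariant leaf is tangent to the infinitesimal rotation. -/
theorem inner_ang_eq_zero (hg : IsMetricOn g unitBall) (hν : R.IsUnitNormal g ν)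
    (hp : p ∈ unitBall \ zAxis) (h : ∀ α, rot α p ∈ R.leaf p) : g p (ν p) (ang p) = 0 := by
  refine inner_normal_eq_zero_of_leaf hg hν hp (rot_zero p) (continuous_rot_apply p) ?_
    (Eventually.of_forall h)
  simpa only [rot_zero] using hasDerivAt_rot p 0

/-- A leaf containing a point at which it is tangent to the infinitesimal rotation is
rotationally invariant. -/
theorem rot_mem_leaf (hg : IsMetricOn g unitBall) (hgrot : IsRotInvariantMetric g unitBall)
    (hν : R.IsUnitNormal g ν) (hrot : R.IsRotInvariant) (hp : p ∈ unitBall \ zAxis)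
    (h0 : g p (ν p) (ang p) = 0) (α : ℝ) : rot α p ∈ R.leaf p := by
  have ht : ∀ σ, g (rot σ p) (ν (rot σ p)) (ang (rot σ p)) = 0 := fun σ =>
    (inner_ang_rot hg hgrot hν hrot hp σ).trans h0
  have hnorm : ∀ σ, ‖ang (rot σ p)‖ ≤ ‖ang p‖ := fun σ => by
    refine (sq_le_sq₀ (norm_nonneg _) (norm_nonneg _)).mp ?_
    rw [← rot_ang, norm_sq_eq_rsq, rsq_rot, norm_sq_eq_rsq]
    simp [rot]
  have hloc : ∀ σ₀, ∀ᶠ σ in 𝓝 σ₀, rot σ p ∈ R.leaf (rot σ₀ p) := by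
    intro σ₀
    -- The statement `eventually_mem_leaf` runs forward in time only, so the circle is traversed in
    -- both senses to obtain a full neighbourhood of the angle.
    have hside : ∀ ε : ℝ, |ε| = 1 → ∀ᶠ τ in 𝓝[≥] (0 : ℝ), rot (σ₀ + ε * τ) p ∈ R.leaf (rot σ₀ p) := by
      intro ε hε
      refine eventually_mem_leaf hg hν (rot_mem_offAxis σ₀ hp) (γ := fun τ => rot (σ₀ + ε * τ) p)
        (γ' := fun τ => ε • ang (rot (σ₀ + ε * τ) p)) (B := ‖ang p‖) (by simp) (fun τ => ?_)
        (fun τ => by rw [norm_smul, Real.norm_eq_abs, hε, one_mul]; exact hnorm _)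
        (fun τ => by rw [map_smul, ht, smul_zero])
      have h1 : HasDerivAt (fun τ : ℝ => σ₀ + ε * τ) ε τ := by
        simpa using ((hasDerivAt_id τ).const_mul ε).const_add σ₀
      exact (hasDerivAt_rot p _).scomp τ h1
    have h1 := hside 1 (by simp)
    have h2 := hside (-1) (by simp)
    obtain ⟨a, ha, ha'⟩ := mem_nhdsGE_iff_exists_Ico_subset.mp (h1.and h2)
    filter_upwards [ball_mem_nhds σ₀ ha] with σ hσ
    rw [mem_ball, Real.dist_eq] at hσ
    rcases le_total σ₀ σ with h | h
    · have := (ha' ⟨sub_nonneg.mpr h, (le_abs_self _).trans_lt hσ⟩).1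
      simpa using this
    · have := (ha' (a := σ₀ - σ) ⟨sub_nonneg.mpr h, by rw [abs_sub_comm] at hσ; exact (le_abs_self _).trans_lt hσ⟩).2
      simpa using this
  have := isPreconnected_univ.induction₂ (fun a b : ℝ => R.leaf (rot a p) = R.leaf (rot b p))
    (fun σ₀ _ => (nhdsWithin_univ σ₀).symm ▸ (hloc σ₀).mono fun σ h => (Foliation.leaf_eq h).symm)
    (fun _ _ _ _ _ _ h1 h2 => h1.trans h2) (fun _ _ _ _ h => h.symm) (mem_univ 0) (mem_univ α)
  rw [rot_zero] at this
  rw [this]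
  exact .refl

/-! ### The leaves of a stationary current are rotationally invariant -/

/-- The point of the half plane `{x₁ = 0, x₀ ≥ 0}` with given radius squared and height. -/
def meridian (q : ℝ × ℝ) : E3 := !₂[√q.1, 0, q.2]

theorem exists_rot_meridian (x : E3) : ∃ α, rot α (meridian (rsq x, x 2)) = x := by
  set z : ℂ := ⟨x 0, x 1⟩ with hz
  have hn : √(rsq x) = ‖z‖ := by
    rw [Complex.norm_def, Complex.normSq_mk]; congr 1; simp only [rsq]; ring
  refine ⟨z.arg, ?_⟩
  have h1 : Real.cos z.arg * √(rsq x) = x 0 := by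
    rw [hn, mul_comm, Complex.norm_mul_cos_arg]
  have h2 : Real.sin z.arg * √(rsq x) = x 1 := by
    rw [hn, mul_comm, Complex.norm_mul_sin_arg]
  ext i; fin_cases i <;> simp [rot, meridian, h1, h2]

theorem continuous_meridian : Continuous meridian := by
  have : meridian = fun q : ℝ × ℝ => √q.1 • bv 0 + q.2 • bv 2 := by
    ext q i; fin_cases i <;> simp [meridian, bv]
  rw [this]; fun_prop

theorem hasFDerivAt_meridional {A h : ℝ → ℝ} {A' h' : ℝ} (x : E3) (hA : HasDerivAt A A' (rsq x))
    (hh : HasDerivAt h h' (x 2)) : HasFDerivAt (fun x : E3 => A (rsq x) * h (x 2))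
      (A (rsq x) • h' • EuclideanSpace.proj (𝕜 := ℝ) (2 : Fin 3) + h (x 2) • A' •
        ((2 * x 0) • EuclideanSpace.proj (𝕜 := ℝ) (0 : Fin 3) +
          (2 * x 1) • EuclideanSpace.proj (𝕜 := ℝ) (1 : Fin 3))) x := by
  have hp : ∀ i, HasFDerivAt (fun x : E3 => x i) (EuclideanSpace.proj (𝕜 := ℝ) i) x := fun i =>
    (EuclideanSpace.proj (𝕜 := ℝ) i).hasFDerivAt
  have hr : HasFDerivAt rsq ((2 * x 0) • EuclideanSpace.proj (𝕜 := ℝ) (0 : Fin 3) +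
      (2 * x 1) • EuclideanSpace.proj (𝕜 := ℝ) (1 : Fin 3)) x := by
    refine (((hp 0).pow 2).add ((hp 1).pow 2)).congr_fderiv ?_
    simp
  exact (hA.comp_hasFDerivAt x hr).mul (hh.comp_hasFDerivAt x (hp 2))

/-- For a function `α` of the squared radius and the height, the integrand in the first two basis
directions is a density times the conormal of the rotation field. By invariance this pairing is
constant on circles, so near the circle through `p` it keeps its sign. If it were nonzero at `p`,
the integral over `S` would be nonzero because the leaf through `p` has positive mass there, whereas
the integral over `T` vanishes. -/
theorem IsMultiplicity.inner_ang_eq_zero {S T : RectCurrent} {m : E3 → ℕ}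
    (hm : IsMultiplicity R S g ν m) (hS : IsStationary S g ν)
    (hg : IsMetricOn g unitBall) (hgrot : IsRotInvariantMetric g unitBall)
    (hν : R.IsUnitNormal g ν) (hrot : R.IsRotInvariant)
    (hST : ∀ α : E3 → ℝ, ContDiff ℝ ∞ α → HasCompactSupport α → tsupport α ⊆ unitBall →
      ∀ A B : E3,
      ∫ x, (fderiv ℝ α x B * conormal g ν x A - fderiv ℝ α x A * conormal g ν x B) ∂S.mass g =
      ∫ x, (fderiv ℝ α x B * conormal g ν x A - fderiv ℝ α x A * conormal g ν x B) ∂T.mass g)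
    (hT : ∀ᵐ x ∂T.mass g, conormal g ν x (ang x) = 0) (hp : m p ≠ 0) :
    g p (ν p) (ang p) = 0 := by
  by_contra hu
  have hpΩ := hm.offAxis p hp
  set u : E3 → ℝ := fun x => g x (ν x) (ang x) with hudef
  have hang : Continuous ang := by
    have : ang = fun x => (-x 1) • bv 0 + x 0 • bv 1 := by
      ext x i; fin_cases i <;> simp [ang, bv]
    rw [this]; fun_prop
  have hucont : ContinuousOn u (unitBall \ zAxis) :=
    (((hg.smooth.continuousOn.mono sdiff_subset).clm_apply hν.lipschitz.continuousOn).clm_apply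
      hang.continuousOn)
  -- `u` depends on the radius and the height only
  have hmer : ∀ x ∈ unitBall \ zAxis, meridian (rsq x, x 2) ∈ unitBall \ zAxis ∧
      u (meridian (rsq x, x 2)) = u x := fun x hx => by
    obtain ⟨α, hα⟩ := exists_rot_meridian x
    have h1 : meridian (rsq x, x 2) ∈ unitBall \ zAxis := by
      have := rot_mem_offAxis (-α) hx
      rwa [← hα, rot_rot, neg_add_cancel, rot_zero] at this
    refine ⟨h1, ?_⟩
    have := inner_ang_rot hg hgrot hν hrot h1 α
    rw [hα] at this
    exact this.symm
  set ρ₀ := rsq p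
  set z₀ := p 2
  have hp1 := mem_offAxis_iff.mp hpΩ
  have hev : ∀ᶠ q : ℝ × ℝ in 𝓝 (ρ₀, z₀), 0 < u p * u (meridian q) ∧ 0 < q.1 ∧
      q.1 + q.2 ^ 2 < 1 := by
    have h1 : ContinuousAt (fun q => u p * u (meridian q)) (ρ₀, z₀) :=
      continuousAt_const.mul ((hucont.continuousAt (isOpen_offAxis.mem_nhds (hmer p hpΩ).1)).comp
        continuous_meridian.continuousAt)
    refine (h1.eventually (lt_mem_nhds ?_)).and ((continuousAt_fst.eventually
      (lt_mem_nhds hp1.2)).and ((continuousAt_fst.add (continuousAt_snd.pow 2)).eventually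
        (gt_mem_nhds hp1.1)))
    exact (mul_self_pos.mpr hu).trans_eq (congrArg _ (hmer p hpΩ).2.symm)
  obtain ⟨ε, hε, hball⟩ := eventually_nhds_iff_ball.mp hev
  set δ := ε / 2 with hδ
  have hδ0 : 0 < δ := half_pos hε
  have hbox : ∀ ρ z : ℝ, |ρ - ρ₀| ≤ δ → |z - z₀| ≤ δ → 0 < u p * u (meridian (ρ, z)) ∧ 0 < ρ ∧
      ρ + z ^ 2 < 1 := fun ρ z h1 h2 => hball (ρ, z) (by
    rw [mem_ball, Prod.dist_eq, Real.dist_eq, Real.dist_eq]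
    exact max_lt (by linarith) (by linarith))
  let f : ContDiffBump ρ₀ := ⟨δ / 2, δ, half_pos hδ0, half_lt_self hδ0⟩
  let h : ContDiffBump z₀ := ⟨δ / 2, δ, half_pos hδ0, half_lt_self hδ0⟩
  have hfd : ∀ {ρ : ℝ}, f ρ ≠ 0 → |ρ - ρ₀| < δ := fun {ρ} hρ => by
    have : ρ ∈ Function.support f := hρ
    rwa [f.support_eq, mem_ball, Real.dist_eq] at this
  have hhd : ∀ {z : ℝ}, h z ≠ 0 → |z - z₀| < δ := fun {z} hz => by
    have : z ∈ Function.support h := hz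
    rwa [h.support_eq, mem_ball, Real.dist_eq] at this
  -- The primitive of the bump is normalized to vanish for large radius and is constant for small
  -- radius. Thus `α` has compact support in the ball but is in general nonzero on the axis, which
  -- is why the comparison `hST` is needed for test functions meeting the axis.
  set A : ℝ → ℝ := fun ρ => ∫ s in (ρ₀ + δ)..ρ, f s with hA
  have hAd : ∀ ρ, HasDerivAt A (f ρ) ρ := fun ρ =>
    (f.continuous.integral_hasStrictDerivAt (ρ₀ + δ) ρ).hasDerivAt
  have hAs : ContDiff ℝ ∞ A := contDiff_infty_iff_deriv.mpr
    ⟨fun ρ => (hAd ρ).differentiableAt, by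
      rw [show deriv A = f from funext fun ρ => (hAd ρ).deriv]; exact f.contDiff⟩
  have hA0 : ∀ ρ, ρ₀ + δ ≤ ρ → A ρ = 0 := fun ρ hρ => by
    refine intervalIntegral.integral_zero_ae (ae_of_all _ fun s hs => ?_)
    by_contra hne
    rw [uIoc_of_le hρ] at hs
    linarith [le_abs_self (s - ρ₀), hfd hne, hs.1]
  set α : E3 → ℝ := fun x => A (rsq x) * h (x 2) with hα
  have hαs : ContDiff ℝ ∞ α := (hAs.comp contDiff_rsq).mul (h.contDiff.comp (by fun_prop))
  have hcr := contDiff_rsq.continuous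
  have hc1 : Continuous fun x : E3 => |rsq x - ρ₀| := (hcr.sub continuous_const).abs
  have hc2 : Continuous fun x : E3 => |x 2 - z₀| := by fun_prop
  have hch : Continuous fun x : E3 => h (x 2) := h.continuous.comp (by fun_prop)
  set K : Set E3 := {x | rsq x ≤ ρ₀ + δ ∧ |x 2 - z₀| ≤ δ} with hK
  have hKc : IsClosed K := (isClosed_le hcr continuous_const).inter
    (isClosed_le hc2 continuous_const)
  have hKB : K ⊆ unitBall := fun x hx => mem_unitBall_iff.mpr (by
    have := (hbox (ρ₀ + δ) (x 2) (by rw [add_sub_cancel_left, abs_of_pos hδ0]) hx.2).2.2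
    linarith [hx.1])
  have hKcpt : IsCompact K :=
    isCompact_closedUnitBall.of_isClosed_subset hKc (hKB.trans unitBall_subset_closedUnitBall)
  have hsupp : tsupport α ⊆ K := closure_minimal (fun x hx => by
    obtain ⟨h1, h2⟩ := mul_ne_zero_iff.mp hx
    exact ⟨not_lt.mp fun hlt => h1 (hA0 _ hlt.le), (hhd h2).le⟩) hKc
  have hitg := hST α hαs (hKcpt.of_isClosed_subset (isClosed_tsupport _) hsupp)
    (hsupp.trans hKB) (bv 0) (bv 1)
  -- The derivative of `α` in the height does not appear, as both directions are horizontal. The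
  -- radial derivative contributes `2 x₀` and `2 x₁`, which combine with the conormal into its value
  -- on the rotation field.
  have hval : ∀ x, fderiv ℝ α x (bv 1) * conormal g ν x (bv 0) -
      fderiv ℝ α x (bv 0) * conormal g ν x (bv 1) =
      -2 * (f (rsq x) * h (x 2) * conormal g ν x (ang x)) := fun x => by
    have h1 : ang x = (-x 1) • bv 0 + x 0 • bv 1 := by
      ext i; fin_cases i <;> simp [ang, bv]
    rw [(hasFDerivAt_meridional x (hAd _)
      ((h.contDiff (n := 1)).differentiable (by simp) (x 2)).hasDerivAt).fderiv, h1]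
    simp only [map_add, map_smul, smul_eq_mul]
    simp [bv]
    ring
  simp only [hval, integral_const_mul] at hitg
  rw [show ∫ x, f (rsq x) * h (x 2) * conormal g ν x (ang x) ∂T.mass g = 0 from
    integral_eq_zero_of_ae (hT.mono fun x hx => by simp [hx]), mul_zero, mul_eq_zero] at hitg
  replace hitg := hitg.resolve_left (by norm_num)
  set G : E3 → ℝ := fun x => u p * (f (rsq x) * h (x 2) * conormal g ν x (ang x)) with hG
  have hpos : ∀ x ∈ unitBall \ zAxis, |rsq x - ρ₀| ≤ δ → |x 2 - z₀| ≤ δ →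
      0 < u p * conormal g ν x (ang x) := fun x hx h1 h2 => by
    rw [conormal_apply hx, mul_left_comm]
    refine mul_pos (inv_pos.mpr (hg.isInner hx.1).gvol_pos) ?_
    rw [← show u (meridian (rsq x, x 2)) = g x (ν x) (ang x) from (hmer x hx).2]
    exact (hbox _ _ h1 h2).1
  have hG0 : 0 ≤ᵐ[S.mass g] G := by
    filter_upwards [RectCurrent.ae_mass_mem_offAxis (T := S) hg] with x hx
    by_cases hf : f (rsq x) * h (x 2) = 0
    · simp [hG, hf]
    · obtain ⟨h1, h2⟩ := mul_ne_zero_iff.mp hf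
      simp only [hG, Pi.zero_apply]
      rw [mul_left_comm]
      exact mul_nonneg (mul_nonneg f.nonneg h.nonneg) (hpos x hx (hfd h1).le (hhd h2).le).le
  have : IsFiniteMeasure (S.mass g) := ⟨hS.finite⟩
  set K' := K ∩ {x | |rsq x - ρ₀| ≤ δ} with hK'
  have hK'Ω : K' ⊆ unitBall \ zAxis := fun x hx =>
    ⟨hKB hx.1, fun hz => (hbox _ _ hx.2 hx.1.2).2.1.ne' (rsq_eq_zero_iff.mpr hz)⟩
  have hK'c : IsCompact K' := hKcpt.inter_right (isClosed_le hc1 continuous_const)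
  have hGc : ContinuousOn G K' := by
    refine continuousOn_const.mul (ContinuousOn.mul (Continuous.continuousOn
      ((f.continuous.comp hcr).mul hch)) ?_)
    exact ((continuousOn_conormal' hg hν).mono hK'Ω).clm_apply hang.continuousOn
  obtain ⟨C, hC⟩ := hK'c.exists_bound_of_continuousOn hGc
  have hC0 : 0 ≤ C := (norm_nonneg _).trans (hC p ⟨⟨by linarith, by simp [z₀, hδ0.le]⟩, by
    simp [ρ₀, hδ0.le]⟩)
  have hGm : Measurable G := measurable_const.mul ((((f.continuous.comp hcr).mul
    hch).measurable).mul (measurable_conormal_apply hg hν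
      hang.measurable))
  have hGi : Integrable G (S.mass g) := by
    refine Integrable.of_bound hGm.aestronglyMeasurable C (ae_of_all _ fun x => ?_)
    by_cases hf : f (rsq x) * h (x 2) = 0
    · simp [hG, hf, hC0]
    · obtain ⟨h1, h2⟩ := mul_ne_zero_iff.mp hf
      have h3 := hfd h1
      exact hC x ⟨⟨by linarith [le_abs_self (rsq x - ρ₀)], (hhd h2).le⟩, h3.le⟩
  have hzero := (integral_eq_zero_iff_of_nonneg_ae hG0 hGi).mp (by
    simp only [hG, integral_const_mul, hitg, mul_zero])
  obtain ⟨φ, hφ, hpφ⟩ := R.exists_box hpΩ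
  have hN : {x : E3 | |rsq x - ρ₀| < δ ∧ |x 2 - z₀| < δ} ∩ (unitBall \ zAxis) ∈ 𝓝 p :=
    inter_mem (((isOpen_lt hc1 continuous_const).inter
      (isOpen_lt hc2 continuous_const)).mem_nhds
      ⟨by simp [ρ₀, hδ0], by simp [z₀, hδ0]⟩) (isOpen_offAxis.mem_nhds hpΩ)
  refine (hm.mass_pos hS hg hν hp hN hφ hpφ).ne' (measure_mono_null (fun x hx => ?_)
    (ae_iff.mp hzero))
  obtain ⟨⟨⟨h1, h2⟩, hxΩ⟩, -⟩ := hx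
  have hf0 : 0 < f (rsq x) := f.pos_of_mem_ball (by rwa [mem_ball, Real.dist_eq])
  have hh0 : 0 < h (x 2) := h.pos_of_mem_ball (by rwa [mem_ball, Real.dist_eq])
  simp only [mem_ofPred_eq, hG, Pi.zero_apply]
  rw [mul_left_comm]
  exact (mul_pos (mul_pos hf0 hh0) (hpos x hxΩ h1.le h2.le)).ne'

theorem IsMultiplicity.eq_of_mem_leaf {S : RectCurrent} {m : E3 → ℕ}
    (hm : IsMultiplicity R S g ν m) {p q : E3} (h : q ∈ R.leaf p) : m q = m p := by
  induction h with
  | refl => rfl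
  | tail _ h ih =>
    obtain ⟨φ, hφ, h1, h2, h3⟩ := h
    exact (hm.plaque φ hφ _ h2 _ h1 h3.symm).trans ih

/-- Calibrated currents bounded by `∂U` consist of rotationally invariant leaves. -/
theorem BoundedByLeaves.isMadeOfLeaves (hU : BoundedByLeaves R ν U) (hg : IsMetricOn g unitBall)
    (hgrot : IsRotInvariantMetric g unitBall) (hν : R.IsUnitNormal g ν) (hrot : R.IsRotInvariant)
    (hUrot : ∀ p ∈ frontier U ∩ (unitBall \ zAxis), ∀ α, rot α p ∈ R.leaf p) {T : RectCurrent}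
    (hT : T.IsOrientedBy g ν ((frontier U ∩ (unitBall \ zAxis)).indicator fun _ => 1))
    (hTl : T.IsLocallyFiniteIn g unitBall) (he : EqOn gbar g unitBall) {S : RectCurrent}
    (hcal : S.IsCalibrated g ν) (hSf : S.area gbar univ < ⊤) (hST : S.SameBoundary T univ) :
    S.IsMadeOfLeaves g R ν := by
  have hS := hU.isStationary hg hν hT he hcal hSf hST
  obtain ⟨m, hm⟩ := hS.exists_multiplicity hg hν
  have hTc : ∀ᵐ x ∂T.mass g, conormal g ν x (ang x) = 0 := by
    filter_upwards [RectCurrent.ae_mass_mem_carrier (T := T) hg] with x hx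
    have hxU : x ∈ frontier U ∩ (unitBall \ zAxis) := by
      have := hT.carrier_eq.subset hx
      by_contra h
      exact this (indicator_of_notMem h _)
    rw [conormal_apply hxU.2, inner_ang_eq_zero hg hν hxU.2 (hUrot x hxU), mul_zero]
  have hang : ∀ p, m p ≠ 0 → g p (ν p) (ang p) = 0 := fun p hp => by
    refine hm.inner_ang_eq_zero hS hg hgrot hν hrot (fun α hα hc hs A B => ?_) hTc hp
    rw [← hcal.eval_extDeriv hg hν hα hc hs ?_, ← (hT.isCalibrated hg hν.unit).eval_extDeriv hg hν
      hα hc hs (hTl.area_lt_top _ hc.isCompact hs)]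
    · exact hST _ (isTestForm_formOf hα hc _ (subset_univ _))
    · rw [← S.mass_eq_area hg (isClosed_tsupport _).measurableSet hs]
      exact (measure_mono (subset_univ _)).trans_lt hS.finite
  obtain ⟨T', h1, h2, h3⟩ := hm.exists_equalOn hS hg hν
  refine ⟨m, T', ⟨{L | ∃ p, m p ≠ 0 ∧ L = R.leaf p}, ?_, ?_⟩, fun p q h => hm.eq_of_mem_leaf h,
    hm.closure_inter_subset hS hg hν, h1, h2, h3⟩
  · rintro _ ⟨p, hp, rfl⟩
    have hpΩ := hm.offAxis p hp
    refine ⟨⟨p, hpΩ, rfl⟩, fun α => ?_⟩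
    rw [← hrot α p hpΩ]
    exact Foliation.leaf_eq (rot_mem_leaf hg hgrot hν hrot hpΩ (hang p hp) α)
  · ext x
    refine ⟨fun hx => ⟨R.leaf x, ⟨x, hx, rfl⟩, .refl⟩, ?_⟩
    rintro ⟨_, ⟨p, hp, rfl⟩, hxp⟩
    exact (hm.eq_of_mem_leaf hxp).trans_ne hp

end MinimalFoliation

end

theorem mainTheorem8
    (g : MetricField) (hg : IsMetricOn g unitBall) (hgrot : IsRotInvariantMetric g unitBall)
    (R : Foliation (unitBall \ zAxis)) (ν : E3 → E3)
    (hν : R.IsUnitNormal g ν) (hmin : R.IsMinimal g ν) (hrot : R.IsRotInvariant)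
    (U : Set E3) (hUopen : IsOpen U) (hUball : U ⊆ unitBall) (hUreg : interior (closure U) = U)
    (M : Set E3) (hM : M = frontier U ∩ unitBall)
    (hleaves : ∃ 𝓢 ⊆ R.rotInvariantLeaves, M \ zAxis = ⋃₀ 𝓢)
    (hout : ∀ p ∈ M \ zAxis, PointsOutOf ν U p) :
    ∃ T : RectCurrent,
      T.IsOrientedBy g ν ((M \ zAxis).indicator (fun _ => 1)) ∧
      T.IsAreaMinimizingIn g unitBall ∧
      ∀ gbar : MetricField, IsMetricOn gbar closedUnitBall → EqOn gbar g unitBall →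
        T.IsAreaMinimizingInCompact gbar closedUnitBall ∧
        ∀ M' : RectCurrent, M'.IsAreaMinimizingInCompact gbar closedUnitBall →
          M'.SameBoundary T univ → M'.IsMadeOfLeaves g R ν := by
  obtain ⟨𝓢, h𝓢, hM𝓢⟩ := hleaves
  have hMU : M \ zAxis = frontier U ∩ (unitBall \ zAxis) := by rw [hM, inter_sdiff_assoc]
  have hleaf : ∀ p ∈ M \ zAxis, ∀ q ∈ R.leaf p, q ∈ M \ zAxis ∧ ∀ α, rot α q ∈ R.leaf p := by
    intro p hp q hq
    rw [hM𝓢] at hp ⊢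
    obtain ⟨L, hL, hpL⟩ := hp
    obtain ⟨⟨p₀, -, rfl⟩, hinv⟩ := h𝓢 hL
    rw [Foliation.leaf_eq hpL] at hq ⊢
    exact ⟨⟨_, hL, hq⟩, fun α => (hinv α).subset ⟨q, hq, rfl⟩⟩
  have hU : BoundedByLeaves R ν U :=
    { isOpen := hUopen
      saturated := fun φ hφ x hx x' hx' h hxU => by
        have hxM : x ∈ M \ zAxis := hMU ▸ ⟨hxU, R.target_subset hφ hx⟩
        exact (hMU.subset (hleaf x hxM x' (.single ⟨φ, hφ, hx, hx', h⟩)).1).1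
      out := fun p hp => hout p (hMU ▸ hp) }
  obtain ⟨T, hT⟩ := hU.exists_isOrientedBy hg hν
  have hTcal := hT.isCalibrated hg hν.unit
  have hTl := hU.isLocallyFiniteIn hUball hg hν hmin hT
  refine ⟨T, hMU ▸ hT, hTcal.isAreaMinimizingIn hg hν hmin hTl, fun gbar hgb he => ?_⟩
  have hTf := hU.area_bar_lt_top hUball hg hν hmin hT hgb he
  have hTB := hTl.carrier_subset
  refine ⟨⟨hTB.trans unitBall_subset_closedUnitBall, hTf, fun S hS hSf hST =>
    hTcal.area_le hg hν hmin hgb he hS hTB hSf hTf hST⟩, fun M' hM' hM'T => ?_⟩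
  obtain ⟨hM'c, hM'f, hM'min⟩ := hM'
  refine hU.isMadeOfLeaves hg hgrot hν hrot (fun p hp α => (hleaf p (hMU ▸ hp) p .refl).2 α) hT hTl
    he (hTcal.of_area_le hg hν hmin hgb he hM'c hTB hM'f hTf hM'T ?_) hM'f hM'T
  -- The current `T` is itself an admissible competitor for `M'`, so `M'` has at most the area of
  -- `T`. This is the inequality that forces `M'` to be calibrated.
  exact hM'min T (hTB.trans unitBall_subset_closedUnitBall) hTf fun η hη => (hM'T η hη).symm
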